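/- Let $W$ be a complex vector space of finite dimension $n>3$. A pencil of quadratic forms on $W$ is a two-dimensional subspace $\Phi\subset \mathrm{Sym}^2W^*$; it is nonsingular if its general element is nondegenerate and exactly $n$ points of the line $\mathbb P(\Phi)$ are degenerate forms. Let $\mathcal M_n$ be the moduli space of nonsingular pencils $\Phi$ modulo $\Phi\sim T^*\Phi$ ($T\in GL(W)$), and let $\widetilde{\mathcal M}_n$ be the moduli space of pairs $(\Phi,P)$, with $\Phi$ a nonsingular pencil and $P\subset W$ a three-dimensional subspace, modulo $(\Phi,P)\sim(T^*\Phi,T^{-1}P)$. These are orbit spaces with their quotient structures: a set is open, and a function on it is regular (holomorphic), if its pullback to the space of frames $(\varphi_1,\varphi_2)$ of $\Phi$ (respectively $(\varphi_1,\varphi_2;u_1,u_2,u_3)$ of $(\Phi,P)$) is so; the same applies to the product $\mathcal M_n\times\widetilde{\mathcal M}_n$. A subspace $P$ is *poised by* $\Phi$ if, for some basis $\varphi_1,\varphi_2$ of $\Phi$ consisting of nondegenerate forms and some basis $w_1,\dots,w_n$ of $W$ with $\varphi_1(\sum z_iw_i)=\sum\alpha_iz_i^2$ and $\varphi_2(\sum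 z_iw_i)=\sum z_i^2$ ($\alpha_i$ distinct), $P$ is spanned by $u,\ \alpha(u),\ \alpha^2(u)$, where $\alpha(\sum z_iw_i)=\sum\alpha_iz_iw_i$ and $u=\sum u_iw_i$ with all $u_i\ne0$. Consider the correspondence $$S=\{([\Phi],[(\Phi,P)]) : \Phi \text{ a nonsingular pencil},\ P \text{ poised by } \Phi\}\subset \mathcal M_n\times\widetilde{\mathcal M}_n$$ with the induced structure, and its projections $p_1:S\to\mathcal M_n$, $p_2:S\to\widetilde{\mathcal M}_n$. Then: 1. $p_2$ is an embedding: it is an isomorphism of $S$ onto a locally closed subvariety of $\widetilde{\mathcal M}_n$. 2. $p_1$ is a morphism and a submersion of orbit spaces (in the orbifold sense): the set of frames of pairs $(\Phi,P)$ with $P$ poised by $\Phi$ is a complex submanifold of the ambient vector space $(\mathrm{Sym}^2W^*)^2\times W^3$, and its projection to the manifold of frames of nonsingular pencils, which lifts $p_1$, is a holomorphic submersion at every point. Moreover, at every point of $S$ lying over a general $[\Phi]$, the spaces $S$ and $\mathcal M_n$ are themselves complex manifolds and $p_1$ is a holomorphic submersion; here $\Phi$ is general if the identity is the only projective automorphism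 of the line $\mathbb P(\Phi)$ preserving its set of degenerate elements. 3. For every $[\Phi]\in\mathcal M_n$ the fiber $p_1^{-1}([\Phi])$, as a subvariety of $S$, is birational to $\mathbb P^{n-1}$. -/

import Mathlib

open scoped Topology

noncomputable section

namespace PencilModuli

/-! ### Spaces with functions

Classical varieties over `ℂ` and complex spaces are handled as topological spaces with a sheaf of
`ℂ`-valued functions. The sheaf is recorded through the predicate `RegAt f x`, read as
"`f` is regular (holomorphic) on a neighbourhood of `x`"; a function is regular on an open set `U`
when it is so at every point of `U`. -/

/-- A topological space together with a notion of regular function at a point. -/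
structure FunSpace (X : Type*) where
  top : TopologicalSpace X
  RegAt : (X → ℂ) → X → Prop

namespace FunSpace

variable {X Y A Q : Type*}

/-- The structure pulled back along `i : A → X`: the induced topology, and the functions that are
locally pullbacks of regular functions. For an inclusion this is the induced (reduced) structure
of a subset. -/
def induced (𝒳 : FunSpace X) (i : A → X) : FunSpace A where
  top := TopologicalSpace.induced i 𝒳.top
  RegAt g a := ∃ F : X → ℂ, 𝒳.RegAt F (i a) ∧
    ∃ U : Set X, IsOpen[𝒳.top] U ∧ i a ∈ U ∧ ∀ b : A, i b ∈ U → g b = F (i b)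

/-- The induced structure on a subset. -/
def restrict (𝒳 : FunSpace X) (s : Set X) : FunSpace s :=
  𝒳.induced (Subtype.val : s → X)

/-- The quotient structure along a surjection `q : A → Q`: the quotient topology, and the functions
whose pullbacks along `q` are regular. -/
def quot (𝒜 : FunSpace A) (q : A → Q) : FunSpace Q where
  top := TopologicalSpace.coinduced q 𝒜.top
  RegAt g x := ∃ U : Set Q, IsOpen[TopologicalSpace.coinduced q 𝒜.top] U ∧ x ∈ U ∧
    ∀ a : A, q a ∈ U → 𝒜.RegAt (g ∘ q) a

/-- Morphisms: continuous maps that pull regular functions back to regular functions. -/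
def IsMorphism (𝒳 : FunSpace X) (𝒴 : FunSpace Y) (f : X → Y) : Prop :=
  @Continuous X Y 𝒳.top 𝒴.top f ∧
    ∀ (x : X) (g : Y → ℂ), 𝒴.RegAt g (f x) → 𝒳.RegAt (g ∘ f) x

/-- (Locally closed) embeddings: isomorphisms onto a locally closed subset with its induced
structure. -/
def IsEmbedding (𝒳 : FunSpace X) (𝒴 : FunSpace Y) (f : X → Y) : Prop :=
  Function.Injective f ∧ @IsLocallyClosed Y 𝒴.top (Set.range f) ∧ 𝒳 = 𝒴.induced f

/-- Two spaces with functions are isomorphic. -/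
def Isomorphic (𝒳 : FunSpace X) (𝒴 : FunSpace Y) : Prop :=
  ∃ e : X ≃ Y, 𝒳 = 𝒴.induced e

/-- Two spaces with functions are birational: they have isomorphic dense open subsets. -/
def Birational (𝒳 : FunSpace X) (𝒴 : FunSpace Y) : Prop :=
  ∃ (U : Set X) (V : Set Y), IsOpen[𝒳.top] U ∧ @Dense X 𝒳.top U ∧
    IsOpen[𝒴.top] V ∧ @Dense Y 𝒴.top V ∧ Isomorphic (𝒳.restrict U) (𝒴.restrict V)

end FunSpace

/-! ### Vector spaces as varieties and as complex manifolds -/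

/-- The polynomial functions on a complex vector space. -/
def polyFun (E : Type*) [AddCommGroup E] [Module ℂ E] : Subalgebra ℂ (E → ℂ) :=
  Algebra.adjoin ℂ {f : E → ℂ | ∃ l : Module.Dual ℂ E, f = fun x => l x}

/-- A complex vector space as a variety: the Zariski topology, generated by the non-vanishing loci
of polynomial functions, and the functions that are locally quotients of polynomial functions. -/
def zariski (E : Type*) [AddCommGroup E] [Module ℂ E] : FunSpace E where
  top := TopologicalSpace.generateFrom {U | ∃ p ∈ polyFun E, U = {x | p x ≠ 0}}
  RegAt f x := ∃ p ∈ polyFun E, ∃ q ∈ polyFun E, q x ≠ 0 ∧ ∀ y, q y ≠ 0 → f y = p y / q y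

/-- A finite-dimensional complex vector space as a complex manifold: the Euclidean topology and
the holomorphic functions, both read in linear coordinates. -/
def analytic (E : Type*) [AddCommGroup E] [Module ℂ E] [Module.Finite ℂ E] : FunSpace E where
  top := TopologicalSpace.induced (Module.finBasis ℂ E).equivFun inferInstance
  RegAt f x := AnalyticAt ℂ (fun z => f ((Module.finBasis ℂ E).equivFun.symm z))
    ((Module.finBasis ℂ E).equivFun x)

/-- `ψ` restricts to a holomorphic chart on the open set `U`: an isomorphism of `U` onto an open
subset of the vector space `E`. -/
def IsChartOn {X E : Type*} [AddCommGroup E] [Module ℂ E] [Module.Finite ℂ E]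
    (𝒳 : FunSpace X) (ψ : X → E) (U : Set X) : Prop :=
  IsOpen[𝒳.top] U ∧ Set.InjOn ψ U ∧ IsOpen[(analytic E).top] (ψ '' U) ∧
    𝒳.restrict U = (analytic E).induced (fun u : U => ψ u)

/-- `f` is a holomorphic submersion at `x`: source and target are complex manifolds near `x` and
`f x`, and `f` is a linear projection in suitable holomorphic charts. -/
def IsSubmersionAt {X Y : Type*} (𝒳 : FunSpace X) (𝒴 : FunSpace Y) (f : X → Y) (x : X) : Prop :=
  ∃ (k l : ℕ) (ψ : X → (Fin k → ℂ) × (Fin l → ℂ)) (χ : Y → (Fin k → ℂ)) (U : Set X) (V : Set Y),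
    x ∈ U ∧ IsChartOn 𝒳 ψ U ∧ IsChartOn 𝒴 χ V ∧ Set.MapsTo f U V ∧ ∀ u ∈ U, χ (f u) = (ψ u).1

/-- A map `f : X → Y` of orbit spaces `qX : A → X`, `qY : C → Y` is a submersion of orbit spaces
(in the orbifold sense) through the lift `F : A → C` if `F` is a holomorphic submersion of complex
manifolds at every point of `A`. -/
def IsOrbitSubmersion {A C X Y : Type*} (𝒜 : FunSpace A) (𝒞 : FunSpace C)
    (qX : A → X) (qY : C → Y) (F : A → C) (f : X → Y) : Prop :=
  Function.Surjective qX ∧ Function.Surjective qY ∧ (∀ a, f (qX a) = qY (F a)) ∧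
    ∀ a, IsSubmersionAt 𝒜 𝒞 F a

/-- The projective space `ℙ^{d-1}` of lines in `ℂ^d` as a variety. -/
def projVariety (d : ℕ) : FunSpace (Projectivization ℂ (Fin d → ℂ)) :=
  ((zariski (Fin d → ℂ)).induced (Subtype.val : {v : Fin d → ℂ // v ≠ 0} → _)).quot
    (fun v => Projectivization.mk ℂ v.1 v.2)

/-! ### Pencils of quadratic forms -/

section Pencils

variable (W : Type*) [AddCommGroup W] [Module ℂ W]

instance finite_quadraticForm [Module.Finite ℂ W] : Module.Finite ℂ (QuadraticForm ℂ W) := by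
  refine Module.Finite.of_injective (QuadraticMap.associatedHom (R := ℂ) (M := W) (N := ℂ) ℂ) ?_
  intro φ ψ h
  have h1 := congrArg LinearMap.BilinMap.toQuadraticMap h
  simpa [QuadraticMap.toQuadraticMap_associated] using h1

variable {W}

/-- A quadratic form is degenerate if its polar form (twice the associated symmetric bilinear form)
has a nonzero radical. -/
def IsDegenerate (φ : QuadraticForm ℂ W) : Prop :=
  ∃ u : W, u ≠ 0 ∧ ∀ v : W, QuadraticMap.polar φ u v = 0

/-- A pencil (two-dimensional space of quadratic forms) is nonsingular if its general element is
nondegenerate and exactly `dim W` of its points are degenerate. Nondegeneracy is a Zariski-open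
condition, so it holds for the general element when it holds for one. -/
def IsNonsingular (Φ : Submodule ℂ (QuadraticForm ℂ W)) : Prop :=
  Module.finrank ℂ Φ = 2 ∧ (∃ φ ∈ Φ, ¬ IsDegenerate φ) ∧
    {ℓ : Projectivization ℂ (QuadraticForm ℂ W) | ℓ.rep ∈ Φ ∧ IsDegenerate ℓ.rep}.ncard =
      Module.finrank ℂ W

variable (W)

/-- The nonsingular pencils of quadratic forms on `W`. -/
abbrev NSPencil : Type _ := {Φ : Submodule ℂ (QuadraticForm ℂ W) // IsNonsingular Φ}

/-- The three-dimensional subspaces of `W`. -/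
abbrev Gr3 : Type _ := {P : Submodule ℂ W // Module.finrank ℂ P = 3}

variable {W}

/-- `T^* φ = φ ∘ T`. -/
def pullback (T : W ≃ₗ[ℂ] W) : QuadraticForm ℂ W →ₗ[ℂ] QuadraticForm ℂ W where
  toFun φ := φ.comp (T : W →ₗ[ℂ] W)
  map_add' _ _ := rfl
  map_smul' _ _ := rfl

lemma pullback_trans (T T' : W ≃ₗ[ℂ] W) :
    pullback (T'.trans T) = (pullback T').comp (pullback T) := rfl

lemma pullback_refl : pullback (LinearEquiv.refl ℂ W) = LinearMap.id := rfl

lemma pullback_symm_comp (T : W ≃ₗ[ℂ] W) :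
    (pullback T.symm).comp (pullback T) = LinearMap.id := by
  rw [← pullback_trans, LinearEquiv.symm_trans_self, pullback_refl]

variable (W)

/-- Projective equivalence of nonsingular pencils: `Φ' = T^* Φ` for some `T ∈ GL(W)`. -/
instance pencilSetoid : Setoid (NSPencil W) where
  r Φ Φ' := ∃ T : W ≃ₗ[ℂ] W, Φ'.1 = Φ.1.map (pullback T)
  iseqv :=
    { refl := fun Φ => ⟨LinearEquiv.refl ℂ W, by rw [pullback_refl, Submodule.map_id]⟩
      symm := by
        rintro Φ Φ' ⟨T, h⟩
        exact ⟨T.symm, by rw [h, ← Submodule.map_comp, pullback_symm_comp, Submodule.map_id]⟩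
      trans := by
        rintro Φ Φ' Φ'' ⟨T, h⟩ ⟨T', h'⟩
        exact ⟨T'.trans T, by rw [h', h, ← Submodule.map_comp, pullback_trans]⟩ }

/-- Projective equivalence of pairs: `(Φ', P') = (T^* Φ, T⁻¹ P)` for some `T ∈ GL(W)`. -/
instance pairSetoid : Setoid (NSPencil W × Gr3 W) where
  r x y := ∃ T : W ≃ₗ[ℂ] W, y.1.1 = x.1.1.map (pullback T) ∧
    y.2.1 = x.2.1.map (T.symm : W →ₗ[ℂ] W)
  iseqv :=
    { refl := fun x => ⟨LinearEquiv.refl ℂ W, by rw [pullback_refl, Submodule.map_id],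
        (Submodule.map_id x.2.1).symm⟩
      symm := by
        rintro x y ⟨T, h, k⟩
        refine ⟨T.symm, by rw [h, ← Submodule.map_comp, pullback_symm_comp, Submodule.map_id], ?_⟩
        rw [k, ← Submodule.map_comp]
        simp
      trans := by
        rintro x y z ⟨T, h, k⟩ ⟨T', h', k'⟩
        refine ⟨T'.trans T, by rw [h', h, ← Submodule.map_comp, pullback_trans], ?_⟩
        rw [k', k, ← Submodule.map_comp]
        rfl }

/-- The moduli space of nonsingular pencils of quadratic forms on `W`. -/
abbrev Moduli : Type _ := Quotient (pencilSetoid W)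

/-- The refined moduli space of pairs of a nonsingular pencil on `W` and a three-dimensional
subspace of `W`. -/
abbrev RefinedModuli : Type _ := Quotient (pairSetoid W)

variable {W}

/-- The class `[Φ]`. -/
def moduliMk (Φ : NSPencil W) : Moduli W := Quotient.mk (pencilSetoid W) Φ

/-- The class `[(Φ, P)]`. -/
def refinedMk (Φ : NSPencil W) (P : Gr3 W) : RefinedModuli W :=
  Quotient.mk (pairSetoid W) (Φ, P)

/-! ### Poised subspaces -/

/-- `(φ₁, φ₂)` is a good pair of `Φ`: two linearly independent nondegenerate forms spanning `Φ`. -/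
def IsGoodPair (Φ : Submodule ℂ (QuadraticForm ℂ W)) (φ₁ φ₂ : QuadraticForm ℂ W) : Prop :=
  LinearIndependent ℂ ![φ₁, φ₂] ∧ ¬ IsDegenerate φ₁ ∧ ¬ IsDegenerate φ₂ ∧
    Submodule.span ℂ {φ₁, φ₂} = Φ

/-- `w` is a standard basis for `(φ₁, φ₂)` with distinct roots `α`:
`φ₁ (∑ zᵢ wᵢ) = ∑ αᵢ zᵢ²` and `φ₂ (∑ zᵢ wᵢ) = ∑ zᵢ²`. -/
def IsStandardBasis {n : ℕ} (φ₁ φ₂ : QuadraticForm ℂ W) (w : Module.Basis (Fin n) ℂ W)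
    (α : Fin n → ℂ) : Prop :=
  Function.Injective α ∧ ∀ z : Fin n → ℂ,
    φ₁ (∑ i, z i • w i) = ∑ i, α i * z i ^ 2 ∧ φ₂ (∑ i, z i • w i) = ∑ i, z i ^ 2

/-- The linear map `∑ zᵢ wᵢ ↦ ∑ αᵢ zᵢ wᵢ`. -/
def alphaMap {n : ℕ} (w : Module.Basis (Fin n) ℂ W) (α : Fin n → ℂ) : W →ₗ[ℂ] W :=
  w.constr ℂ (fun i => α i • w i)

/-- `P` is poised by the pair `(φ₁, φ₂)`: it is spanned by `u, α(u), α²(u)` for a vector `u` all of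
whose coordinates in a standard basis are nonzero. -/
def IsPoisedByPair (φ₁ φ₂ : QuadraticForm ℂ W) (P : Submodule ℂ W) : Prop :=
  ∃ (w : Module.Basis (Fin (Module.finrank ℂ W)) ℂ W) (α : Fin (Module.finrank ℂ W) → ℂ) (u : W),
    IsStandardBasis φ₁ φ₂ w α ∧ (∀ i, w.repr u i ≠ 0) ∧
      P = Submodule.span ℂ {u, alphaMap w α u, alphaMap w α (alphaMap w α u)}

/-- `P` is poised by the pencil `Φ`: it is poised by a good pair of `Φ`. -/
def IsPoised (Φ : Submodule ℂ (QuadraticForm ℂ W)) (P : Submodule ℂ W) : Prop :=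
  ∃ φ₁ φ₂ : QuadraticForm ℂ W, IsGoodPair Φ φ₁ φ₂ ∧ IsPoisedByPair φ₁ φ₂ P

/-- A pencil is general if the identity is the only projective automorphism of the projective line
`Φ` that preserves its set of degenerate elements. -/
def IsGeneral (Φ : Submodule ℂ (QuadraticForm ℂ W)) : Prop :=
  ∀ g : Φ ≃ₗ[ℂ] Φ,
    (∀ φ : Φ, IsDegenerate (φ : QuadraticForm ℂ W) ↔ IsDegenerate (g φ : QuadraticForm ℂ W)) →
      ∃ c : ℂ, ∀ φ : Φ, g φ = c • φ

variable (W)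

/-- The correspondence `S ⊆ M × M̃`: the pairs `([Φ], [(Φ, P)])` with `P` poised by `Φ`. -/
def corr : Set (Moduli W × RefinedModuli W) :=
  {x | ∃ (Φ : NSPencil W) (P : Gr3 W), IsPoised Φ.1 P.1 ∧ x = (moduliMk Φ, refinedMk Φ P)}

variable {W}

/-- The projection `p₁ : S → M`. -/
def p₁ (s : corr W) : Moduli W := s.1.1

/-- The projection `p₂ : S → M̃`. -/
def p₂ (s : corr W) : RefinedModuli W := s.1.2

/-! ### The geometric structures

A pencil is given by a frame `(φ₁, φ₂)` and a three-dimensional subspace by a frame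
`(u₁, u₂, u₃)`. Frames lie in a vector space, and Grassmannians, moduli spaces and products of them
are orbit spaces of spaces of frames; they carry the quotient structures. -/

variable (W)

/-- The ambient vector space of the frames of pencils. -/
abbrev PencilAmb : Type _ := Fin 2 → QuadraticForm ℂ W

/-- The ambient vector space of the frames of pairs `(Φ, P)`. -/
abbrev PairAmb : Type _ := (Fin 2 → QuadraticForm ℂ W) × (Fin 3 → W)

/-- Frames of nonsingular pencils. -/
abbrev PencilFrame : Type _ :=
  {a : PencilAmb W // IsNonsingular (Submodule.span ℂ (Set.range a))}

/-- Frames of pairs of a nonsingular pencil and a three-dimensional subspace. -/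
abbrev PairFrame : Type _ :=
  {a : PairAmb W // IsNonsingular (Submodule.span ℂ (Set.range a.1)) ∧
    Module.finrank ℂ (Submodule.span ℂ (Set.range a.2)) = 3}

/-- Frames of pairs `(Φ, P)` with `P` poised by `Φ`. -/
abbrev PoisedFrame : Type _ :=
  {a : PairFrame W //
    IsPoised (Submodule.span ℂ (Set.range a.1.1)) (Submodule.span ℂ (Set.range a.1.2))}

variable {W}

/-- The class `[Φ]` of the pencil `Φ` with a given frame. -/
def frameToModuli (a : PencilFrame W) : Moduli W :=
  moduliMk ⟨Submodule.span ℂ (Set.range a.1), a.2⟩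

/-- The class `[(Φ, P)]` of the pair `(Φ, P)` with a given frame. -/
def frameToRefined (a : PairFrame W) : RefinedModuli W :=
  refinedMk ⟨Submodule.span ℂ (Set.range a.1.1), a.2.1⟩
    ⟨Submodule.span ℂ (Set.range a.1.2), a.2.2⟩

/-- The point `([Φ], [(Φ, P)])` of the correspondence given by a frame of `(Φ, P)`. -/
def frameToCorr (a : PoisedFrame W) : corr W :=
  ⟨(moduliMk ⟨Submodule.span ℂ (Set.range a.1.1.1), a.1.2.1⟩, frameToRefined a.1),
    ⟨⟨Submodule.span ℂ (Set.range a.1.1.1), a.1.2.1⟩,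
      ⟨Submodule.span ℂ (Set.range a.1.1.2), a.1.2.2⟩, a.2, rfl⟩⟩

/-- The lift `(Φ, P) ↦ Φ` of `p₁` to frames. -/
def poisedFrameProj (a : PoisedFrame W) : PencilFrame W := ⟨a.1.1.1, a.1.2.1⟩

/-- The structure on the moduli space `M` coming from a structure on the space of frames. -/
def moduliOf (𝒜 : FunSpace (PencilAmb W)) : FunSpace (Moduli W) :=
  (𝒜.induced (Subtype.val : PencilFrame W → _)).quot frameToModuli

/-- The structure on the refined moduli space `M̃`. -/
def refinedOf (𝒜 : FunSpace (PairAmb W)) : FunSpace (RefinedModuli W) :=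
  (𝒜.induced (Subtype.val : PairFrame W → _)).quot frameToRefined

/-- The structure on the product `M × M̃`. -/
def prodOf (𝒜 : FunSpace (PencilAmb W × PairAmb W)) : FunSpace (Moduli W × RefinedModuli W) :=
  (𝒜.induced (fun a : PencilFrame W × PairFrame W => (a.1.1, a.2.1))).quot
    (fun a => (frameToModuli a.1, frameToRefined a.2))

variable (W)

/-- `M` as a variety. -/
def moduliVar : FunSpace (Moduli W) := moduliOf (zariski _)

/-- `M̃` as a variety. -/
def refinedVar : FunSpace (RefinedModuli W) := refinedOf (zariski _)

/-- `S` as a subvariety of the product variety `M × M̃`. -/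
def corrVar : FunSpace (corr W) := (prodOf (zariski _)).restrict (corr W)

variable [Module.Finite ℂ W]

/-- `M` as a complex space. -/
def moduliAn : FunSpace (Moduli W) := moduliOf (analytic _)

/-- `S` as a subspace of the complex space `M × M̃`. -/
def corrAn : FunSpace (corr W) := (prodOf (analytic _)).restrict (corr W)

/-- The complex manifold of frames of nonsingular pencils. -/
def pencilFrameAn : FunSpace (PencilFrame W) :=
  (analytic (PencilAmb W)).induced Subtype.val

/-- The complex manifold of frames of pairs `(Φ, P)` with `P` poised by `Φ`, with the structure
induced from the ambient vector space. -/
def poisedFrameAn : FunSpace (PoisedFrame W) :=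
  (analytic (PairAmb W)).induced (fun a => a.1.1)

end Pencils

end PencilModuli

end

open PencilModuli

namespace PencilModuli

open Module (finBasis Basis Dual)
open Submodule (span)
open Set (range)
open Function (Injective)
open QuadraticMap (polar)
open Equiv (Perm)
open Finset (sum_congr mem_univ mul_sum prod_ne_zero_iff sum_comm sum_add_distrib sum_eq_single sum_sub_distrib
  prod_congr prod_eq_zero mem_erase sum_filter exists_ne_zero_of_sum_ne_zero)
open IntermediateField (adjoin subset_adjoin adjoin_le_iff fixedField)
open FunSpace

local notation "dim" W:max => Module.finrank ℂ W
local notation "Mat₂" => Matrix (Fin 2) (Fin 2) ℂ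
local notation "Mat₃" => Matrix (Fin 3) (Fin 3) ℂ
local notation "Span" x:max => Submodule.span ℂ (Set.range x)

namespace FunSpace

section Refinement

variable {X Y A B C Q : Type*}

lemma isOpen_inter (𝒜 : FunSpace A) {U V : Set A} (hU : IsOpen[𝒜.top] U)
    (hV : IsOpen[𝒜.top] V) : IsOpen[𝒜.top] (U ∩ V) := by
  let _ := 𝒜.top
  exact IsOpen.inter hU hV

/-- The structure induced on `X` along `k` is coarser than the one induced along `i`. -/
def Refines (𝒜 : FunSpace A) (i : X → A) (ℬ : FunSpace B) (k : X → B) : Prop :=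
  (∀ V, IsOpen[ℬ.top] V → ∀ x, k x ∈ V →
    ∃ O, IsOpen[𝒜.top] O ∧ i x ∈ O ∧ ∀ x', i x' ∈ O → k x' ∈ V) ∧
  (∀ x G, ℬ.RegAt G (k x) → ∃ F, 𝒜.RegAt F (i x) ∧
    ∃ O, IsOpen[𝒜.top] O ∧ i x ∈ O ∧ ∀ x', i x' ∈ O → G (k x') = F (i x'))

lemma Refines.top_le {𝒜 : FunSpace A} {i : X → A} {ℬ : FunSpace B} {k : X → B}
    (h : Refines 𝒜 i ℬ k) : (𝒜.induced i).top ≤ (ℬ.induced k).top := by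
  intro s hs
  obtain ⟨V, hV, rfl⟩ := hs
  refine (@isOpen_iff_forall_mem_open X (𝒜.induced i).top _).2 fun x hx => ?_
  obtain ⟨O, hO, hxO, hsub⟩ := h.1 V hV x hx
  exact ⟨i ⁻¹' O, fun x' hx' => hsub x' hx', ⟨O, hO, rfl⟩, hxO⟩

lemma Refines.regAt {𝒜 : FunSpace A} {i : X → A} {ℬ : FunSpace B} {k : X → B}
    (h : Refines 𝒜 i ℬ k) {g : X → ℂ} {x : X} (hg : (ℬ.induced k).RegAt g x) :
    (𝒜.induced i).RegAt g x := by
  obtain ⟨G, hG, V, hV, hxV, hgG⟩ := hg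
  obtain ⟨F, hF, O, hO, hxO, hGF⟩ := h.2 x G hG
  obtain ⟨O', hO', hxO', hsub⟩ := h.1 V hV x hxV
  refine ⟨F, hF, O ∩ O', 𝒜.isOpen_inter hO hO', ⟨hxO, hxO'⟩, fun x' hx' => ?_⟩
  rw [hgG x' (hsub x' hx'.2), hGF x' hx'.1]

lemma ext_of {𝒳 𝒴 : FunSpace X} (h : 𝒳.top = 𝒴.top)
    (h' : ∀ g x, 𝒳.RegAt g x ↔ 𝒴.RegAt g x) : 𝒳 = 𝒴 := by
  cases 𝒳; cases 𝒴
  simp only [mk.injEq]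
  exact ⟨h, funext fun g => funext fun x => propext (h' g x)⟩

lemma induced_eq {𝒜 : FunSpace A} {i : X → A} {ℬ : FunSpace B} {k : X → B}
    (h : Refines 𝒜 i ℬ k) (h' : Refines ℬ k 𝒜 i) : 𝒜.induced i = ℬ.induced k :=
  ext_of (le_antisymm h.top_le h'.top_le) fun _ _ => ⟨h'.regAt, h.regAt⟩

lemma induced_induced (𝒜 : FunSpace A) (i : X → A) (k : Y → X) :
    (𝒜.induced i).induced k = 𝒜.induced (i ∘ k) := by
  refine ext_of induced_compose fun g y => ⟨?_, ?_⟩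
  · rintro ⟨F, ⟨F', hF', U', hU', hyU', hFF'⟩, U, ⟨V, hV, rfl⟩, hyU, hgF⟩
    exact ⟨F', hF', V ∩ U', 𝒜.isOpen_inter hV hU', ⟨hyU, hyU'⟩, fun y' hy' => by
      rw [hgF y' hy'.1, hFF' _ hy'.2]; rfl⟩
  · rintro ⟨F, hF, U, hU, hyU, hgF⟩
    exact ⟨F ∘ i, ⟨F, hF, U, hU, hyU, fun _ _ => rfl⟩, i ⁻¹' U, ⟨U, hU, rfl⟩, hyU, hgF⟩

/-- Structures whose regular functions at a point can be added, multiplied and inverted where they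
do not vanish. -/
structure IsRinged (𝒳 : FunSpace X) : Prop where
  const : ∀ (c : ℂ) x, 𝒳.RegAt (fun _ => c) x
  add : ∀ f g x, 𝒳.RegAt f x → 𝒳.RegAt g x → 𝒳.RegAt (fun y => f y + g y) x
  mul : ∀ f g x, 𝒳.RegAt f x → 𝒳.RegAt g x → 𝒳.RegAt (fun y => f y * g y) x
  inv : ∀ f x, 𝒳.RegAt f x → f x ≠ 0 → 𝒳.RegAt (fun y => (f y)⁻¹) x
  ne_zero : ∀ f x, 𝒳.RegAt f x → f x ≠ 0 →
    ∃ U, IsOpen[𝒳.top] U ∧ x ∈ U ∧ ∀ y ∈ U, f y ≠ 0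

/-- Regularity at a point only depends on the values near this point. -/
def IsLocal (𝒳 : FunSpace X) : Prop :=
  ∀ f g x U, IsOpen[𝒳.top] U → x ∈ U → (∀ y ∈ U, g y = f y) → 𝒳.RegAt f x → 𝒳.RegAt g x

lemma isLocal_induced (𝒜 : FunSpace A) (i : X → A) : (𝒜.induced i).IsLocal := by
  rintro f g x _ ⟨U, hU, rfl⟩ hx hfg ⟨F, hF, V, hV, hxV, hfF⟩
  exact ⟨F, hF, U ∩ V, 𝒜.isOpen_inter hU hV, ⟨hx, hxV⟩, fun b hb => by
    rw [hfg b hb.1, hfF b hb.2]⟩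

lemma IsRinged.induced {𝒜 : FunSpace A} (h : 𝒜.IsRinged) (i : X → A) :
    (𝒜.induced i).IsRinged where
  const c x := ⟨fun _ => c, h.const c _, Set.univ, @isOpen_univ _ 𝒜.top, trivial, fun _ _ => rfl⟩
  add := by
    rintro f g x ⟨F, hF, U, hU, hxU, hfF⟩ ⟨G, hG, V, hV, hxV, hgG⟩
    exact ⟨_, h.add _ _ _ hF hG, U ∩ V, 𝒜.isOpen_inter hU hV, ⟨hxU, hxV⟩,
      fun b hb => by simp only [hfF b hb.1, hgG b hb.2]⟩
  mul := by
    rintro f g x ⟨F, hF, U, hU, hxU, hfF⟩ ⟨G, hG, V, hV, hxV, hgG⟩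
    exact ⟨_, h.mul _ _ _ hF hG, U ∩ V, 𝒜.isOpen_inter hU hV, ⟨hxU, hxV⟩,
      fun b hb => by simp only [hfF b hb.1, hgG b hb.2]⟩
  inv := by
    rintro f x ⟨F, hF, U, hU, hxU, hfF⟩ hx
    exact ⟨_, h.inv _ _ hF (by rwa [hfF x hxU] at hx), U, hU, hxU, fun b hb => by simp only [hfF b hb]⟩
  ne_zero := by
    rintro f x ⟨F, hF, U, hU, hxU, hfF⟩ hx
    obtain ⟨V, hV, hxV, hne⟩ := h.ne_zero F _ hF (by rwa [hfF x hxU] at hx)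
    exact ⟨i ⁻¹' (U ∩ V), ⟨_, 𝒜.isOpen_inter hU hV, rfl⟩, ⟨hxU, hxV⟩, fun y hy => by
      rw [hfF y hy.1]; exact hne _ hy.2⟩

lemma isOpen_quot {𝒜 : FunSpace A} {q : A → Q} {U : Set Q} :
    IsOpen[(𝒜.quot q).top] U ↔ IsOpen[𝒜.top] (q ⁻¹' U) := Iff.rfl

lemma IsRinged.quot {𝒜 : FunSpace A} (h : 𝒜.IsRinged) (q : A → Q) : (𝒜.quot q).IsRinged := by
  have key : ∀ f x, (𝒜.quot q).RegAt f x → f x ≠ 0 →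
    ∃ U, IsOpen[(𝒜.quot q).top] U ∧ x ∈ U ∧ (∀ y ∈ U, f y ≠ 0) ∧
      ∀ a, q a ∈ U → 𝒜.RegAt (f ∘ q) a := by
    rintro f x ⟨U, hU, hxU, hf⟩ hx
    refine ⟨{y | y ∈ U ∧ f y ≠ 0}, ?_, ⟨hxU, hx⟩, fun y hy => hy.2, fun a ha => hf a ha.1⟩
    refine (@isOpen_iff_forall_mem_open A 𝒜.top _).2 fun a ha => ?_
    obtain ⟨V, hV, haV, hne⟩ := h.ne_zero _ a (hf a ha.1) ha.2
    exact ⟨q ⁻¹' U ∩ V, fun y hy => ⟨hy.1, hne y hy.2⟩, 𝒜.isOpen_inter hU hV, ha.1, haV⟩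
  refine ⟨fun c x => ⟨Set.univ, @isOpen_univ _ (𝒜.quot q).top, trivial, fun a _ => h.const c a⟩,
    ?_, ?_, ?_, ?_⟩
  · rintro f g x ⟨U, hU, hxU, hf⟩ ⟨V, hV, hxV, hg⟩
    exact ⟨U ∩ V, (𝒜.quot q).isOpen_inter hU hV, ⟨hxU, hxV⟩,
      fun a ha => h.add _ _ a (hf a ha.1) (hg a ha.2)⟩
  · rintro f g x ⟨U, hU, hxU, hf⟩ ⟨V, hV, hxV, hg⟩
    exact ⟨U ∩ V, (𝒜.quot q).isOpen_inter hU hV, ⟨hxU, hxV⟩,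
      fun a ha => h.mul _ _ a (hf a ha.1) (hg a ha.2)⟩
  · intro f x hf hx
    obtain ⟨U, hU, hxU, hne, hreg⟩ := key f x hf hx
    exact ⟨U, hU, hxU, fun a ha => h.inv _ a (hreg a ha) (hne _ ha)⟩
  · intro f x hf hx
    obtain ⟨U, hU, hxU, hne, -⟩ := key f x hf hx
    exact ⟨U, hU, hxU, hne⟩

section RingedLemmas

variable {𝒳 : FunSpace X} (h : 𝒳.IsRinged)
include h

lemma IsRinged.sum {ι : Type*} (s : Finset ι) (f : ι → X → ℂ) (x : X)
    (hf : ∀ i ∈ s, 𝒳.RegAt (f i) x) : 𝒳.RegAt (fun y => ∑ i ∈ s, f i y) x := by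
  classical
  induction s using Finset.induction_on with
  | empty => simpa using h.const 0 x
  | insert a s ha ih =>
    simp only [Finset.sum_insert ha]
    exact h.add _ _ x (hf a (by simp)) (ih fun i hi => hf i (by simp [hi]))

lemma IsRinged.prod {ι : Type*} (s : Finset ι) (f : ι → X → ℂ) (x : X)
    (hf : ∀ i ∈ s, 𝒳.RegAt (f i) x) : 𝒳.RegAt (fun y => ∏ i ∈ s, f i y) x := by
  classical
  induction s using Finset.induction_on with
  | empty => simpa using h.const 1 x
  | insert a s ha ih =>
    simp only [Finset.prod_insert ha]
    exact h.mul _ _ x (hf a (by simp)) (ih fun i hi => hf i (by simp [hi]))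

lemma IsRinged.pow (f : X → ℂ) (x : X) (hf : 𝒳.RegAt f x) (k : ℕ) :
    𝒳.RegAt (fun y => f y ^ k) x := by
  simpa using h.prod (Finset.range k) (fun _ => f) x fun _ _ => hf

lemma IsRinged.neg (f : X → ℂ) (x : X) (hf : 𝒳.RegAt f x) : 𝒳.RegAt (fun y => - f y) x := by
  simpa using h.mul _ _ x (h.const (-1) x) hf

lemma IsRinged.sub (f g : X → ℂ) (x : X) (hf : 𝒳.RegAt f x) (hg : 𝒳.RegAt g x) :
    𝒳.RegAt (fun y => f y - g y) x := by
  simpa [sub_eq_add_neg] using h.add _ _ x hf (h.neg _ x hg)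

lemma IsRinged.div (f g : X → ℂ) (x : X) (hf : 𝒳.RegAt f x) (hg : 𝒳.RegAt g x)
    (hx : g x ≠ 0) : 𝒳.RegAt (fun y => f y / g y) x := by
  simpa [div_eq_mul_inv] using h.mul _ _ x hf (h.inv _ x hg hx)

lemma IsRinged.det {ι : Type*} [Fintype ι] [DecidableEq ι] (M : X → Matrix ι ι ℂ) (x : X)
    (hM : ∀ i j, 𝒳.RegAt (fun y => M y i j) x) : 𝒳.RegAt (fun y => (M y).det) x := by
  simp only [Matrix.det_apply]
  refine h.sum _ _ x fun σ _ => ?_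
  have := h.mul _ _ x (h.const ((Perm.sign σ : ℤ) : ℂ) x)
    (h.prod Finset.univ (fun i y => M y (σ i) i) x fun i _ => hM _ _)
  simpa [Units.smul_def] using this

lemma IsRinged.mul_apply {ι κ μ : Type*} [Fintype κ] (M : X → Matrix ι κ ℂ)
    (N : X → Matrix κ μ ℂ) (x : X) (hM : ∀ i j, 𝒳.RegAt (fun y => M y i j) x)
    (hN : ∀ i j, 𝒳.RegAt (fun y => N y i j) x) (i : ι) (j : μ) :
    𝒳.RegAt (fun y => (M y * N y) i j) x := by
  simp only [Matrix.mul_apply]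
  exact h.sum _ _ x fun k _ => h.mul _ _ x (hM _ _) (hN _ _)

lemma IsRinged.pow_apply {ι : Type*} [Fintype ι] [DecidableEq ι] (M : X → Matrix ι ι ℂ)
    (x : X) (hM : ∀ i j, 𝒳.RegAt (fun y => M y i j) x) (k : ℕ) :
    ∀ i j, 𝒳.RegAt (fun y => (M y ^ k) i j) x := by
  induction k with
  | zero => intro i j; simpa using h.const _ x
  | succ k ih =>
    intro i j
    simp only [pow_succ]
    exact h.mul_apply _ _ x ih hM i j

lemma IsRinged.adjugate_apply {ι : Type*} [Fintype ι] [DecidableEq ι] (M : X → Matrix ι ι ℂ)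
    (x : X) (hM : ∀ i j, 𝒳.RegAt (fun y => M y i j) x) (i j : ι) :
    𝒳.RegAt (fun y => (M y).adjugate i j) x := by
  simp only [Matrix.adjugate_apply]
  refine h.det _ x fun a b => ?_
  by_cases hab : a = j
  · subst hab; simpa using h.const _ x
  · simpa [Matrix.updateRow_ne hab] using hM a b

lemma IsRinged.inv_apply {ι : Type*} [Fintype ι] [DecidableEq ι] (M : X → Matrix ι ι ℂ)
    (x : X) (hM : ∀ i j, 𝒳.RegAt (fun y => M y i j) x) (hx : (M x).det ≠ 0) (i j : ι) :
    𝒳.RegAt (fun y => (M y)⁻¹ i j) x := by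
  simp only [Matrix.inv_def, Matrix.smul_apply, smul_eq_mul, Ring.inverse_eq_inv']
  exact h.mul _ _ x (h.inv _ x (h.det M x hM) hx) (h.adjugate_apply M x hM i j)

lemma IsRinged.mvPolynomial {ι : Type*} (f : ι → X → ℂ) (x : X) (hf : ∀ i, 𝒳.RegAt (f i) x)
    (p : MvPolynomial ι ℂ) : 𝒳.RegAt (fun y => MvPolynomial.eval (fun i => f i y) p) x := by
  induction p using MvPolynomial.induction_on with
  | C a => simpa using h.const a x
  | add p q hp hq => simpa using h.add _ _ x hp hq
  | mul_X p i hp => simpa using h.mul _ _ x hp (hf i)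

end RingedLemmas

end Refinement

end FunSpace

section Polynomial

variable {E E' : Type*} [AddCommGroup E] [Module ℂ E] [AddCommGroup E'] [Module ℂ E']

lemma dual_mem_polyFun (l : Dual ℂ E) : (fun x => l x) ∈ polyFun E :=
  Algebra.subset_adjoin ⟨l, rfl⟩

lemma polyFun_comp {f : E → E'} (hf : ∀ l : Dual ℂ E', (fun x => l (f x)) ∈ polyFun E)
    {p : E' → ℂ} (hp : p ∈ polyFun E') : p ∘ f ∈ polyFun E := by
  induction hp using Algebra.adjoin_induction with
  | mem p hp => obtain ⟨l, rfl⟩ := hp; exact hf l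
  | algebraMap r => exact (polyFun E).algebraMap_mem r
  | add p q _ _ hp hq => exact (polyFun E).add_mem hp hq
  | mul p q _ _ hp hq => exact (polyFun E).mul_mem hp hq

lemma isOpen_zariski_ne_zero {p : E → ℂ} (hp : p ∈ polyFun E) :
    IsOpen[(zariski E).top] {x | p x ≠ 0} :=
  TopologicalSpace.isOpen_generateFrom_of_mem ⟨p, hp, rfl⟩

lemma zariski_isRinged (E : Type*) [AddCommGroup E] [Module ℂ E] : (zariski E).IsRinged where
  const c x := ⟨fun _ => c, (polyFun E).algebraMap_mem c, fun _ => 1, (polyFun E).one_mem,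
    one_ne_zero, fun y _ => by simp⟩
  add := by
    rintro f g x ⟨p, hp, q, hq, hx, hf⟩ ⟨p', hp', q', hq', hx', hg⟩
    refine ⟨p * q' + p' * q, add_mem (mul_mem hp hq') (mul_mem hp' hq), q * q', mul_mem hq hq',
      mul_ne_zero hx hx', fun y hy => ?_⟩
    have h1 : q y ≠ 0 := left_ne_zero_of_mul hy
    have h2 : q' y ≠ 0 := right_ne_zero_of_mul hy
    simp only [hf y h1, hg y h2, Pi.add_apply, Pi.mul_apply]
    field_simp
  mul := by
    rintro f g x ⟨p, hp, q, hq, hx, hf⟩ ⟨p', hp', q', hq', hx', hg⟩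
    refine ⟨p * p', mul_mem hp hp', q * q', mul_mem hq hq', mul_ne_zero hx hx', fun y hy => ?_⟩
    have h1 : q y ≠ 0 := left_ne_zero_of_mul hy
    have h2 : q' y ≠ 0 := right_ne_zero_of_mul hy
    simp only [hf y h1, hg y h2, Pi.mul_apply]
    field_simp
  inv := by
    rintro f x ⟨p, hp, q, hq, hx, hf⟩ hfx
    refine ⟨q * q, mul_mem hq hq, p * q, mul_mem hp hq, mul_ne_zero ?_ hx, fun y hy => ?_⟩
    · intro h0; exact hfx (by rw [hf x hx, h0, zero_div])
    have h1 : p y ≠ 0 := left_ne_zero_of_mul hy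
    have h2 : q y ≠ 0 := right_ne_zero_of_mul hy
    simp only [hf y h2, Pi.mul_apply]
    field_simp
  ne_zero := by
    rintro f x ⟨p, hp, q, hq, hx, hf⟩ hfx
    refine ⟨{y | (p * q) y ≠ 0}, isOpen_zariski_ne_zero (mul_mem hp hq), ?_, fun y hy => ?_⟩
    · refine mul_ne_zero ?_ hx
      intro h0; exact hfx (by rw [hf x hx, h0, zero_div])
    · rw [hf y (right_ne_zero_of_mul hy)]
      exact div_ne_zero (left_ne_zero_of_mul hy) (right_ne_zero_of_mul hy)

lemma zariski_regAt_of_mem {p : E → ℂ} (hp : p ∈ polyFun E) (x : E) : (zariski E).RegAt p x :=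
  ⟨p, hp, fun _ => 1, (polyFun E).one_mem, one_ne_zero, fun y _ => by simp⟩

lemma zariski_isMorphism {f : E → E'}
    (hf : ∀ l : Dual ℂ E', (fun x => l (f x)) ∈ polyFun E) :
    IsMorphism (zariski E) (zariski E') f := by
  refine ⟨?_, ?_⟩
  · let _ := (zariski E).top
    refine continuous_generateFrom_iff.2 ?_
    rintro _ ⟨p, hp, rfl⟩
    exact isOpen_zariski_ne_zero (polyFun_comp hf hp)
  · rintro x g ⟨p, hp, q, hq, hx, hg⟩
    exact ⟨_, polyFun_comp hf hp, _, polyFun_comp hf hq, hx, fun y hy => hg _ hy⟩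

lemma zariski_isMorphism_linear (f : E →ₗ[ℂ] E') :
    IsMorphism (zariski E) (zariski E') f :=
  zariski_isMorphism fun l => dual_mem_polyFun (l.comp f)

lemma zariski_basis {E : Type*} [AddCommGroup E] [Module ℂ E] {U : Set E}
    (hU : IsOpen[(zariski E).top] U) {x : E} (hx : x ∈ U) :
    ∃ p ∈ polyFun E, p x ≠ 0 ∧ ∀ y, p y ≠ 0 → y ∈ U := by
  induction hU with
  | basic s hs => obtain ⟨p, hp, rfl⟩ := hs; exact ⟨p, hp, hx, fun y hy => hy⟩
  | univ => exact ⟨fun _ => 1, (polyFun E).one_mem, one_ne_zero, fun _ _ => trivial⟩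
  | inter s t _ _ hs ht =>
    obtain ⟨p, hp, hpx, hps⟩ := hs hx.1
    obtain ⟨q, hq, hqx, hqt⟩ := ht hx.2
    exact ⟨p * q, mul_mem hp hq, mul_ne_zero hpx hqx, fun y hy =>
      ⟨hps y (left_ne_zero_of_mul hy), hqt y (right_ne_zero_of_mul hy)⟩⟩
  | sUnion S _ ih =>
    obtain ⟨s, hs, hxs⟩ := hx
    obtain ⟨p, hp, hpx, hps⟩ := ih s hs hxs
    exact ⟨p, hp, hpx, fun y hy => ⟨s, hs, hps y hy⟩⟩

/-- Polynomial functions on a coordinate space are evaluations of polynomials. -/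
lemma mem_polyFun_pi {ι : Type*} [Fintype ι] {p : (ι → ℂ) → ℂ} :
    p ∈ polyFun (ι → ℂ) ↔ ∃ P : MvPolynomial ι ℂ, ∀ x, p x = MvPolynomial.eval x P := by
  classical
  constructor
  · intro hp
    induction hp using Algebra.adjoin_induction with
    | mem p hp =>
      obtain ⟨l, rfl⟩ := hp
      refine ⟨∑ i, MvPolynomial.C (l (Pi.single i 1)) * MvPolynomial.X i, fun x => ?_⟩
      simp only [map_sum, map_mul, MvPolynomial.eval_C, MvPolynomial.eval_X]
      conv_lhs => rw [pi_eq_sum_univ' x]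
      simp [mul_comm]
    | algebraMap r => exact ⟨MvPolynomial.C r, fun x => by simp⟩
    | add p q _ _ hp hq =>
      obtain ⟨P, hP⟩ := hp; obtain ⟨Q, hQ⟩ := hq
      exact ⟨P + Q, fun x => by simp [hP, hQ]⟩
    | mul p q _ _ hp hq =>
      obtain ⟨P, hP⟩ := hp; obtain ⟨Q, hQ⟩ := hq
      exact ⟨P * Q, fun x => by simp [hP, hQ]⟩
  · rintro ⟨P, hP⟩
    obtain rfl : p = fun x => MvPolynomial.eval x P := funext hP
    induction P using MvPolynomial.induction_on with
    | C a =>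
      simp only [MvPolynomial.eval_C]
      exact (polyFun (ι → ℂ)).algebraMap_mem a
    | add P Q hp hq =>
      simp only [map_add]
      exact (polyFun (ι → ℂ)).add_mem (hp fun _ => rfl) (hq fun _ => rfl)
    | mul_X P i hp =>
      simp only [map_mul, MvPolynomial.eval_X]
      exact (polyFun (ι → ℂ)).mul_mem (hp fun _ => rfl)
        (dual_mem_polyFun (LinearMap.proj i : (ι → ℂ) →ₗ[ℂ] ℂ))

end Polynomial

section Analytic

/-- A norm on a finite-dimensional complex vector space. -/
noncomputable abbrev coordNorm (E : Type*) [AddCommGroup E] [Module ℂ E] [Module.Finite ℂ E] :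
    NormedAddCommGroup E :=
  NormedAddCommGroup.induced E (Fin (Module.finrank ℂ E) → ℂ)
    ((finBasis ℂ E).equivFun : E →ₗ[ℂ] _) (finBasis ℂ E).equivFun.injective

noncomputable abbrev coordNormedSpace (E : Type*) [AddCommGroup E] [Module ℂ E] [Module.Finite ℂ E] :
    letI := coordNorm E; NormedSpace ℂ E :=
  letI := coordNorm E
  NormedSpace.induced ℂ E (Fin (Module.finrank ℂ E) → ℂ) ((finBasis ℂ E).equivFun)

variable {E : Type*} [NormedAddCommGroup E] [NormedSpace ℂ E] [FiniteDimensional ℂ E]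

lemma analytic_top : (analytic E).top = (inferInstance : TopologicalSpace E) := by
  let e := (finBasis ℂ E).equivFun.toContinuousLinearEquiv
  exact (e.toHomeomorph.isInducing.eq_induced).symm

lemma analytic_regAt {f : E → ℂ} {x : E} : (analytic E).RegAt f x ↔ AnalyticAt ℂ f x := by
  let e := (finBasis ℂ E).equivFun.toContinuousLinearEquiv
  change AnalyticAt ℂ (fun z => f (e.symm z)) (e x) ↔ _
  constructor
  · intro h
    have := h.comp_of_eq (f := fun y => e y) (x := x) (e.analyticAt x) rfl
    simpa [Function.comp_def] using this
  · intro h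
    exact h.comp_of_eq (f := fun y => e.symm y) (x := e x) (e.symm.analyticAt _) (by simp)

lemma analytic_isRinged (E : Type*) [AddCommGroup E] [Module ℂ E] [Module.Finite ℂ E] :
    (analytic E).IsRinged := by
  let _ := coordNorm E
  let _ := coordNormedSpace E
  constructor
  · intro c x; exact analytic_regAt.2 analyticAt_const
  · intro f g x hf hg; exact analytic_regAt.2 ((analytic_regAt.1 hf).add (analytic_regAt.1 hg))
  · intro f g x hf hg; exact analytic_regAt.2 ((analytic_regAt.1 hf).mul (analytic_regAt.1 hg))
  · intro f x hf hx; exact analytic_regAt.2 ((analytic_regAt.1 hf).inv hx)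
  · intro f x hf hx
    obtain ⟨U, hU, hUo, hxU⟩ :=
      eventually_nhds_iff.1 ((analytic_regAt.1 hf).continuousAt.eventually_ne hx)
    exact ⟨U, by rw [analytic_top]; exact hUo, hxU, hU⟩

lemma analytic_isMorphism_linear {E E' : Type*} [AddCommGroup E] [Module ℂ E] [Module.Finite ℂ E]
    [AddCommGroup E'] [Module ℂ E'] [Module.Finite ℂ E'] (f : E →ₗ[ℂ] E') :
    IsMorphism (analytic E) (analytic E') f := by
  let _ := coordNorm E
  let _ := coordNormedSpace E
  let _ := coordNorm E'
  let _ := coordNormedSpace E'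
  let F := LinearMap.toContinuousLinearMap f
  refine ⟨?_, fun x g hg => analytic_regAt.2 ?_⟩
  · rw [analytic_top, analytic_top]; exact F.continuous
  · exact (analytic_regAt.1 hg).comp_of_eq (F.analyticAt x) rfl

end Analytic


section Frames

variable {V : Type*} [AddCommGroup V] [Module ℂ V] {r : ℕ}

/-- The family obtained from `x` by the matrix `g`. -/
def mix (g : Matrix (Fin r) (Fin r) ℂ) (x : Fin r → V) (k : Fin r) : V := ∑ l, g k l • x l

lemma mix_one (x : Fin r → V) : mix 1 x = x := by
  funext k; simp [mix, Matrix.one_apply, ite_smul]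

lemma mix_mul (g h : Matrix (Fin r) (Fin r) ℂ) (x : Fin r → V) :
    mix (g * h) x = mix g (mix h x) := by
  funext k
  simp only [mix, Matrix.mul_apply, Finset.sum_smul, Finset.smul_sum, smul_smul]
  rw [sum_comm]

lemma span_mix_le (g : Matrix (Fin r) (Fin r) ℂ) (x : Fin r → V) :
    Span (mix g x) ≤ Span x := by
  rw [Submodule.span_le]
  rintro _ ⟨k, rfl⟩
  exact Submodule.sum_mem _ fun l _ => Submodule.smul_mem _ _ (Submodule.subset_span ⟨l, rfl⟩)

lemma span_mix {g : Matrix (Fin r) (Fin r) ℂ} (hg : g.det ≠ 0) (x : Fin r → V) :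
    Span (mix g x) = Span x := by
  refine le_antisymm (span_mix_le g x) ?_
  have h : x = mix g⁻¹ (mix g x) := by
    rw [← mix_mul, Matrix.nonsing_inv_mul _ (isUnit_iff_ne_zero.2 hg), mix_one]
  conv_lhs => rw [h]
  exact span_mix_le _ _

lemma exists_mix_of_span_eq {x y : Fin r → V}
    (hx : Module.finrank ℂ (Span x) = r)
    (h : Span y = Span x) :
    ∃ g : Matrix (Fin r) (Fin r) ℂ, g.det ≠ 0 ∧ y = mix g x := by
  have key : ∀ u v : Fin r → V, Span v = Span u →
      ∃ g : Matrix (Fin r) (Fin r) ℂ, v = mix g u := by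
    intro u v huv
    have : ∀ k, ∃ c : Fin r → ℂ, ∑ l, c l • u l = v k := fun k =>
      (Submodule.mem_span_range_iff_exists_fun ℂ).1 (huv ▸ Submodule.subset_span ⟨k, rfl⟩)
    choose g hg using this
    exact ⟨g, funext fun k => (hg k).symm⟩
  obtain ⟨g, hg⟩ := key x y h
  obtain ⟨g', hg'⟩ := key y x h.symm
  have hli : LinearIndependent ℂ x :=
    linearIndependent_iff_card_eq_finrank_span.2 (by rw [Set.finrank, hx, Fintype.card_fin])
  refine ⟨g, ?_, hg⟩
  have h1 : mix (g' * g) x = x := by rw [mix_mul, ← hg, ← hg']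
  have h2 : g' * g = 1 := by
    ext k l
    have h3 : ∑ l, ((g' * g) k l - (1 : Matrix (Fin r) (Fin r) ℂ) k l) • x l = 0 := by
      have h4 := congrFun h1 k
      have h5 := congrFun (mix_one x) k
      simp only [mix] at h4 h5
      simp only [sub_smul, sum_sub_distrib, h4, h5, sub_self]
    exact sub_eq_zero.1 (Fintype.linearIndependent_iff.1 hli _ h3 l)
  have := congrArg Matrix.det h2
  rw [Matrix.det_mul, Matrix.det_one] at this
  exact right_ne_zero_of_mul (by rw [this]; exact one_ne_zero)

lemma mix_map {V' : Type*} [AddCommGroup V'] [Module ℂ V'] (f : V →ₗ[ℂ] V')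
    (g : Matrix (Fin r) (Fin r) ℂ) (x : Fin r → V) :
    mix g (fun k => f (x k)) = fun k => f (mix g x k) := by
  funext k; simp [mix]

end Frames

section Diagonal

variable {W : Type*} [AddCommGroup W] [Module ℂ W] {n : ℕ}

/-- The square of a linear form. -/
def sqForm (l : Dual ℂ W) : QuadraticForm ℂ W := QuadraticMap.linMulLin l l

@[simp] theorem sqForm_apply (l : Dual ℂ W) (x : W) : sqForm l x = l x * l x := rfl

/-- `∑ cᵢ ℓᵢ²`. -/
def sumSq (c : Fin n → ℂ) (l : Fin n → Dual ℂ W) : QuadraticForm ℂ W :=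
  ∑ i, c i • sqForm (l i)

lemma sumSq_apply (c : Fin n → ℂ) (l : Fin n → Dual ℂ W) (x : W) :
    sumSq c l x = ∑ i, c i * (l i x * l i x) := by
  simp [sumSq]

lemma polar_sumSq (c : Fin n → ℂ) (l : Fin n → Dual ℂ W) (x y : W) :
    polar (sumSq c l) x y = 2 * ∑ i, c i * (l i x * l i y) := by
  simp only [polar, sumSq_apply, map_add, mul_sum, ← sum_sub_distrib]
  exact sum_congr rfl fun i _ => by ring

lemma sumSq_comb (a b : ℂ) (c d : Fin n → ℂ) (l : Fin n → Dual ℂ W) :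
    a • sumSq c l + b • sumSq d l = sumSq (fun i => a * c i + b * d i) l := by
  simp only [sumSq, Finset.smul_sum, smul_smul, add_smul, sum_add_distrib]

lemma isDegenerate_sumSq (w : Basis (Fin n) ℂ W) (c : Fin n → ℂ) :
    IsDegenerate (sumSq c w.coord) ↔ ∃ i, c i = 0 := by
  constructor
  · rintro ⟨u, hu, h⟩
    by_contra! hc
    refine hu (w.ext_elem fun i => ?_)
    have := h (w i)
    rw [polar_sumSq] at this
    simp only [Basis.coord_apply, Basis.repr_self, Finsupp.single_apply, mul_ite,
      mul_one, mul_zero, Finset.sum_ite_eq, mem_univ, if_true] at this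
    simpa [hc i] using this
  · rintro ⟨i, hi⟩
    refine ⟨w i, w.ne_zero i, fun v => ?_⟩
    rw [polar_sumSq]
    simp only [Basis.coord_apply, Basis.repr_self, Finsupp.single_apply, ite_mul,
      one_mul, zero_mul, mul_ite, mul_zero, Finset.sum_ite_eq, mem_univ, if_true, hi]

/-- `φ₁ = ∑ αᵢ cᵢ zᵢ²` and `φ₂ = ∑ cᵢ zᵢ²` in the coordinates of the basis `w`. -/
structure IsDiag (φ₁ φ₂ : QuadraticForm ℂ W) (w : Basis (Fin n) ℂ W) (α c : Fin n → ℂ) :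
    Prop where
  inj : Injective α
  ne : ∀ i, c i ≠ 0
  fst : φ₁ = sumSq (fun i => α i * c i) w.coord
  snd : φ₂ = sumSq c w.coord

lemma isStandardBasis_iff {φ₁ φ₂ : QuadraticForm ℂ W} {w : Basis (Fin n) ℂ W}
    {α : Fin n → ℂ} : IsStandardBasis φ₁ φ₂ w α ↔ IsDiag φ₁ φ₂ w α 1 := by
  have hz : ∀ z : Fin n → ℂ, ∀ i, w.coord i (∑ j, z j • w j) = z i := by
    intro z i
    simp [Finsupp.single_apply]
  constructor
  · rintro ⟨h, h'⟩
    refine ⟨h, fun _ => one_ne_zero, ?_, ?_⟩ <;> ext x <;>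
      rw [sumSq_apply, ← w.sum_repr x]
    · rw [(h' _).1]; simp only [hz]; simp [sq]
    · rw [(h' _).2]; simp only [hz]; simp [sq]
  · rintro ⟨h, -, h1, h2⟩
    refine ⟨h, fun z => ⟨?_, ?_⟩⟩
    · rw [h1, sumSq_apply]; simp only [hz]; simp [sq]
    · rw [h2, sumSq_apply]; simp only [hz]; simp [sq]

variable {φ₁ φ₂ : QuadraticForm ℂ W} {w : Basis (Fin n) ℂ W} {α c : Fin n → ℂ}

lemma IsDiag.rescale (h : IsDiag φ₁ φ₂ w α c) (d : Fin n → ℂˣ) :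
    IsDiag φ₁ φ₂ (w.unitsSMul d) α (fun i => c i * (d i : ℂ) ^ 2) := by
  refine ⟨h.inj, fun i => mul_ne_zero (h.ne i) (pow_ne_zero _ (d i).ne_zero), ?_, ?_⟩
  · rw [h.fst]; ext x; simp only [sumSq_apply]
    refine sum_congr rfl fun i _ => ?_
    simp only [Basis.coord_apply, Basis.repr_unitsSMul, Units.smul_def, smul_eq_mul,
      Units.val_inv_eq_inv_val]
    have := (d i).ne_zero
    field_simp
  · rw [h.snd]; ext x; simp only [sumSq_apply]
    refine sum_congr rfl fun i _ => ?_
    simp only [Basis.coord_apply, Basis.repr_unitsSMul, Units.smul_def, smul_eq_mul,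
      Units.val_inv_eq_inv_val]
    have := (d i).ne_zero
    field_simp

lemma IsDiag.comb (h : IsDiag φ₁ φ₂ w α c) (a b : ℂ) :
    a • φ₁ + b • φ₂ = sumSq (fun i => (a * α i + b) * c i) w.coord := by
  rw [h.fst, h.snd, sumSq_comb]
  congr 1; funext i; ring

lemma IsDiag.isDegenerate_comb (h : IsDiag φ₁ φ₂ w α c) (a b : ℂ) :
    IsDegenerate (a • φ₁ + b • φ₂) ↔ ∃ i, a * α i + b = 0 := by
  rw [h.comb, isDegenerate_sumSq]
  simp [h.ne]

lemma IsDiag.not_isDegenerate (h : IsDiag φ₁ φ₂ w α c) : ¬ IsDegenerate φ₂ := by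
  have := h.isDegenerate_comb 0 1
  simpa using this

/-- The Möbius transform of `t` by the matrix `g`. -/
noncomputable def mob (g : Mat₂) (t : ℂ) : ℂ :=
  (g 0 0 * t + g 0 1) / (g 1 0 * t + g 1 1)

/-- The denominator of the Möbius transform. -/
def mobDen (g : Mat₂) (t : ℂ) : ℂ := g 1 0 * t + g 1 1

lemma mob_sub {g : Mat₂} {s t : ℂ} (hs : mobDen g s ≠ 0)
    (ht : mobDen g t ≠ 0) :
    mob g s - mob g t = g.det * (s - t) / (mobDen g s * mobDen g t) := by
  unfold mob mobDen at *
  rw [Matrix.det_fin_two, div_sub_div _ _ hs ht]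
  congr 1
  ring

lemma mob_mul_mobDen {g : Mat₂} {t : ℂ} (ht : mobDen g t ≠ 0) :
    mob g t * mobDen g t = g 0 0 * t + g 0 1 :=
  div_mul_cancel₀ _ ht

lemma IsDiag.mobius (h : IsDiag φ₁ φ₂ w α c) {g : Mat₂} (hg : g.det ≠ 0)
    (hd : ∀ i, mobDen g (α i) ≠ 0) :
    IsDiag (g 0 0 • φ₁ + g 0 1 • φ₂) (g 1 0 • φ₁ + g 1 1 • φ₂) w (fun i => mob g (α i))
      (fun i => mobDen g (α i) * c i) := by
  refine ⟨fun i j hij => ?_, fun i => mul_ne_zero (hd i) (h.ne i), ?_, ?_⟩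
  · have := mob_sub (hd i) (hd j)
    rw [show mob g (α i) - mob g (α j) = 0 from sub_eq_zero.2 hij, eq_comm, div_eq_zero_iff] at this
    rcases this with h1 | h1
    · exact h.inj (sub_eq_zero.1 ((mul_eq_zero.1 h1).resolve_left hg))
    · exact absurd h1 (mul_ne_zero (hd i) (hd j))
  · rw [h.comb]; congr 1; funext i
    rw [← mul_assoc, mob_mul_mobDen (hd i)]
  · rw [h.comb]; rfl

lemma IsDiag.mix_diag (h : IsDiag φ₁ φ₂ w α c) {g : Mat₂} (hg : g.det ≠ 0)
    (hd : ¬ IsDegenerate (mix g ![φ₁, φ₂] 1)) :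
    (∀ i, mobDen g (α i) ≠ 0) ∧ IsDiag (mix g ![φ₁, φ₂] 0) (mix g ![φ₁, φ₂] 1) w
      (fun i => mob g (α i)) (fun i => mobDen g (α i) * c i) := by
  simp only [PencilModuli.mix, Fin.sum_univ_two, Matrix.cons_val_zero, Matrix.cons_val_one] at *
  have hd' : ∀ i, mobDen g (α i) ≠ 0 := by
    rw [h.isDegenerate_comb] at hd; push Not at hd; exact hd
  exact ⟨hd', h.mobius hg hd'⟩

lemma IsDiag.pullback (h : IsDiag φ₁ φ₂ w α c) (T : W ≃ₗ[ℂ] W) :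
    IsDiag (pullback T φ₁) (pullback T φ₂) (w.map T.symm) α c := by
  refine ⟨h.inj, h.ne, ?_, ?_⟩
  · rw [h.fst]; ext x
    change sumSq _ _ (T x) = _
    simp only [sumSq_apply]
    rfl
  · rw [h.snd]; ext x
    change sumSq _ _ (T x) = _
    simp only [sumSq_apply]
    rfl

lemma IsDiag.linearIndependent (h : IsDiag φ₁ φ₂ w α c) (hn : 2 ≤ n) :
    LinearIndependent ℂ ![φ₁, φ₂] := by
  rw [LinearIndependent.pair_iff]
  intro s t hst
  rw [h.comb] at hst
  have key : ∀ i, s * α i + t = 0 := by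
    intro i
    have := DFunLike.congr_fun hst (w i)
    rw [sumSq_apply] at this
    simpa [Finsupp.single_apply, h.ne i] using this
  have h0 := key ⟨0, by omega⟩
  have h1 := key ⟨1, by omega⟩
  have hne : α ⟨0, by omega⟩ - α ⟨1, by omega⟩ ≠ 0 := sub_ne_zero.2 fun hh => by
    simpa using h.inj hh
  have hs : s = 0 := by
    have : s * (α ⟨0, by omega⟩ - α ⟨1, by omega⟩) = 0 := by linear_combination h0 - h1
    exact (mul_eq_zero.1 this).resolve_right hne
  subst hs
  exact ⟨rfl, by simpa using h0⟩

lemma IsDiag.isNonsingular (h : IsDiag φ₁ φ₂ w α c) (hn : 2 ≤ n) :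
    IsNonsingular (span ℂ {φ₁, φ₂}) := by
  have hli := h.linearIndependent hn
  have hpair := LinearIndependent.pair_iff.1 hli
  have hfin : dim W = n := by simpa using Module.finrank_eq_card_basis w
  refine ⟨?_, ⟨φ₂, Submodule.subset_span (by simp), h.not_isDegenerate⟩, ?_⟩
  · have := finrank_span_eq_card hli
    rwa [Matrix.range_cons_cons_empty, Fintype.card_fin] at this
  · have hne : ∀ i, φ₁ - α i • φ₂ ≠ 0 := by
      intro i hi
      have := hpair 1 (-α i) (by rw [one_smul, neg_smul, ← sub_eq_add_neg, hi])
      exact one_ne_zero this.1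
    have hinj : Injective fun i =>
        Projectivization.mk ℂ (φ₁ - α i • φ₂) (hne i) := by
      intro i j hij
      obtain ⟨a, ha⟩ := (Projectivization.mk_eq_mk_iff' ℂ _ _ _ _).1 hij
      have h1 := hpair (a - 1) (α i - a * α j) (by
        have : a • φ₁ - (a * α j) • φ₂ - (φ₁ - α i • φ₂) = 0 := by
          rw [← ha, smul_sub, smul_smul, sub_self]
        rw [← this]; module)
      have h2 : a = 1 := sub_eq_zero.1 h1.1
      subst h2
      exact h.inj (by simpa [sub_eq_zero] using h1.2)
    have hset : {ℓ : Projectivization ℂ (QuadraticForm ℂ W) |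
        ℓ.rep ∈ span ℂ {φ₁, φ₂} ∧ IsDegenerate ℓ.rep} =
        range fun i => Projectivization.mk ℂ (φ₁ - α i • φ₂) (hne i) := by
      ext ℓ
      constructor
      · rintro ⟨h1, h2⟩
        obtain ⟨a, b, hab⟩ := Submodule.mem_span_pair.1 h1
        rw [← hab, h.isDegenerate_comb] at h2
        obtain ⟨i, hi⟩ := h2
        have hb : b = - (a * α i) := by linear_combination hi
        refine ⟨i, ?_⟩
        rw [← ℓ.mk_rep]
        refine ((Projectivization.mk_eq_mk_iff' ℂ _ _ _ _).2 ⟨a, ?_⟩).symm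
        rw [← hab, hb]; module
      · rintro ⟨i, rfl⟩
        obtain ⟨a, ha⟩ := Projectivization.exists_smul_eq_mk_rep ℂ _ (hne i)
        have hrep : (Projectivization.mk ℂ (φ₁ - α i • φ₂) (hne i)).rep =
            (a : ℂ) • φ₁ + (-(a * α i) : ℂ) • φ₂ := by
          rw [← ha, Units.smul_def]; module
        refine ⟨?_, ?_⟩
        · rw [hrep]; exact Submodule.mem_span_pair.2 ⟨_, _, rfl⟩
        · rw [hrep, h.isDegenerate_comb]; exact ⟨i, by ring⟩
    rw [hset, ← Set.image_univ, Set.ncard_image_of_injective _ hinj, Set.ncard_univ, hfin]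
    simp

lemma polar_eq_sum (φ : QuadraticForm ℂ W) (w : Basis (Fin n) ℂ W) (x y : W) :
    polar φ x y =
      ∑ i, ∑ j, w.repr x i * w.repr y j * polar φ (w i) (w j) := by
  change QuadraticMap.polarBilin φ x y = ∑ i, ∑ j, w.repr x i * w.repr y j *
    QuadraticMap.polarBilin φ (w i) (w j)
  conv_lhs => rw [← w.sum_repr x, ← w.sum_repr y]
  simp only [map_sum, LinearMap.sum_apply, map_smul, LinearMap.smul_apply, smul_eq_mul,
    mul_sum]
  rw [sum_comm]
  exact sum_congr rfl fun i _ => sum_congr rfl fun j _ => by ring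

lemma eq_sumSq_of_orthogonal {φ : QuadraticForm ℂ W} {w : Basis (Fin n) ℂ W}
    (h : ∀ i j, i ≠ j → polar φ (w i) (w j) = 0) :
    φ = sumSq (fun i => φ (w i)) w.coord := by
  ext x
  have h2 : ∀ y, polar φ y y = 2 * φ y := by
    intro y; rw [QuadraticMap.polar_self]; simp
  have h3 := polar_eq_sum φ w x x
  have h4 : ∀ i, ∑ j, w.repr x i * w.repr x j * polar φ (w i) (w j) =
      2 * (φ (w i) * (w.repr x i * w.repr x i)) := by
    intro i
    rw [sum_eq_single i]
    · rw [h2]; ring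
    · intro j _ hj; rw [h i j hj.symm, mul_zero]
    · simp
  rw [h2, sum_congr rfl fun i _ => h4 i, ← mul_sum] at h3
  rw [sumSq_apply]
  exact mul_left_cancel₀ two_ne_zero h3

lemma exists_isDiag [Module.Finite ℂ W] (hn : 0 < dim W)
    (h : IsNonsingular (span ℂ {φ₁, φ₂})) (h2 : ¬ IsDegenerate φ₂) :
    ∃ (w : Basis (Fin (dim W)) ℂ W) (α c : Fin (dim W) → ℂ),
      IsDiag φ₁ φ₂ w α c := by
  obtain ⟨h1, -, hcard⟩ := h
  set L := {ℓ : Projectivization ℂ (QuadraticForm ℂ W) |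
    ℓ.rep ∈ span ℂ {φ₁, φ₂} ∧ IsDegenerate ℓ.rep} with hL
  have key : ∀ ℓ : L, ∃ (t : ℂ) (u : W), u ≠ 0 ∧
      (∀ v, polar φ₁ u v = t * polar φ₂ u v) ∧
      ∃ a : ℂ, ℓ.1.rep = a • (φ₁ - t • φ₂) := by
    rintro ⟨ℓ, hℓ, u, hu, huv⟩
    obtain ⟨a, b, hab⟩ := Submodule.mem_span_pair.1 hℓ
    have hp : ∀ v, a * polar φ₁ u v + b * polar φ₂ u v = 0 := by
      intro v
      have := huv v
      rw [← hab] at this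
      simpa [QuadraticMap.polar_add, QuadraticMap.polar_smul] using this
    have ha : a ≠ 0 := by
      rintro rfl
      have hb : b ≠ 0 := by
        rintro rfl
        exact ℓ.rep_nonzero (by rw [← hab]; simp)
      exact h2 ⟨u, hu, fun v => by simpa [hb] using hp v⟩
    refine ⟨-b / a, u, hu, fun v => ?_, a, ?_⟩
    · field_simp
      linear_combination hp v
    · rw [← hab, smul_sub, smul_smul, mul_div_cancel₀ _ ha]; module
  choose t u hu hpol a ha using key
  have htinj : Injective t := by
    intro ℓ ℓ' hll
    have ha0 : ∀ ℓ, a ℓ ≠ 0 := by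
      intro ℓ h0
      exact ℓ.1.rep_nonzero (by rw [ha ℓ, h0, zero_smul])
    refine Subtype.ext ?_
    rw [← ℓ.1.mk_rep, ← ℓ'.1.mk_rep]
    refine (Projectivization.mk_eq_mk_iff' ℂ _ _ _ _).2 ⟨a ℓ * (a ℓ')⁻¹, ?_⟩
    rw [ha ℓ, ha ℓ', hll, smul_smul, mul_assoc, inv_mul_cancel₀ (ha0 ℓ'), mul_one]
  have hLfin : L.Finite := Set.finite_of_ncard_pos (by rw [hcard]; exact hn)
  have := hLfin.fintype
  have hcard' : Fintype.card L = dim W := by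
    rw [← hcard, ← Nat.card_eq_fintype_card]; rfl
  let e : Fin (dim W) ≃ L := (Fintype.equivFinOfCardEq hcard').symm
  have hB2 : Injective (QuadraticMap.polarBilin φ₂) := by
    rw [← LinearMap.ker_eq_bot, LinearMap.ker_eq_bot']
    intro x hx
    by_contra hx0
    exact h2 ⟨x, hx0, fun v => by simpa using LinearMap.congr_fun hx v⟩
  let B2 := (QuadraticMap.polarBilin φ₂).linearEquivOfInjective hB2
    (Subspace.dual_finrank_eq (K := ℂ) (V := W)).symm
  let f : Module.End ℂ W := B2.symm.toLinearMap.comp (QuadraticMap.polarBilin φ₁)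
  have hf : ∀ ℓ, f.HasEigenvector (t ℓ) (u ℓ) := by
    intro ℓ
    refine ⟨?_, hu ℓ⟩
    rw [Module.End.mem_eigenspace_iff]
    refine B2.injective ?_
    change B2 (B2.symm _) = _
    rw [B2.apply_symm_apply, map_smul]
    ext v
    exact hpol ℓ v
  have hli : LinearIndependent ℂ (fun i => u (e i)) :=
    f.eigenvectors_linearIndependent' (fun i => t (e i)) (htinj.comp e.injective) _
      fun i => hf (e i)
  have : Nonempty (Fin (dim W)) := ⟨⟨0, hn⟩⟩
  let w := basisOfLinearIndependentOfCardEqFinrank hli (by simp)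
  have hw : ∀ i, w i = u (e i) := fun i => by
    simp [w]
  have horth2 : ∀ i j, i ≠ j → polar φ₂ (w i) (w j) = 0 := by
    intro i j hij
    have h3 := hpol (e i) (w j)
    have h4 := hpol (e j) (w i)
    rw [← hw] at h3 h4
    rw [QuadraticMap.polar_comm, h3, QuadraticMap.polar_comm φ₂ (w j)] at h4
    have h5 : t (e i) - t (e j) ≠ 0 :=
      sub_ne_zero.2 fun h6 => hij (e.injective (htinj h6))
    have h6 : (t (e i) - t (e j)) * polar φ₂ (w i) (w j) = 0 := by
      linear_combination h4
    exact (mul_eq_zero.1 h6).resolve_left h5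
  have horth1 : ∀ i j, i ≠ j → polar φ₁ (w i) (w j) = 0 := by
    intro i j hij
    rw [hw i, hpol, ← hw i, horth2 i j hij, mul_zero]
  have hs2 := eq_sumSq_of_orthogonal horth2
  have hs1 := eq_sumSq_of_orthogonal horth1
  refine ⟨w, fun i => t (e i), fun i => φ₂ (w i), htinj.comp e.injective, fun i hi => ?_, ?_, hs2⟩
  · rw [hs2, isDegenerate_sumSq] at h2
    exact h2 ⟨i, hi⟩
  · have : ∀ i, φ₁ (w i) = t (e i) * φ₂ (w i) := by
      intro i
      have h3 := hpol (e i) (w i)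
      rw [← hw, QuadraticMap.polar_self, QuadraticMap.polar_self] at h3
      simp only [nsmul_eq_mul, Nat.cast_ofNat] at h3
      linear_combination h3 / 2
    conv_lhs => rw [hs1]
    congr 1
    funext i
    exact this i

/-- Two diagonalizations of the same pair of forms differ by a permutation and a rescaling. -/
lemma IsDiag.unique (h : IsDiag φ₁ φ₂ w α c) {w' : Basis (Fin n) ℂ W} {α' c' : Fin n → ℂ}
    (h' : IsDiag φ₁ φ₂ w' α' c') :
    ∃ (π : Perm (Fin n)) (s : Fin n → ℂ), (∀ j, s j ≠ 0) ∧ (∀ j, α' j = α (π j)) ∧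
      (∀ j, c' j = s j ^ 2 * c (π j)) ∧ ∀ x j, w.repr x (π j) = s j * w'.repr x j := by
  have key : ∀ j i, (α i - α' j) * w.repr (w' j) i = 0 := by
    intro j i
    have e1 : ∀ v, polar φ₁ (w' j) v = α' j * polar φ₂ (w' j) v := by
      intro v
      rw [h'.fst, h'.snd, polar_sumSq, polar_sumSq]
      simp only [Basis.coord_apply, Basis.repr_self, Finsupp.single_apply, ite_mul,
        one_mul, zero_mul, mul_ite, mul_zero, Finset.sum_ite_eq, mem_univ, if_true]
      ring
    have e2 := e1 (w i)
    rw [h.fst, h.snd, polar_sumSq, polar_sumSq] at e2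
    simp only [Basis.coord_apply, Basis.repr_self, Finsupp.single_apply,
      mul_one, mul_ite, mul_zero, Finset.sum_ite_eq, mem_univ, if_true] at e2
    have h3 := h.ne i
    have : c i * ((α i - α' j) * w.repr (w' j) i) = 0 := by linear_combination e2 / 2
    exact (mul_eq_zero.1 this).resolve_left h3
  have ex : ∀ j, ∃ i, w.repr (w' j) i ≠ 0 := by
    intro j
    by_contra! hj
    exact w'.ne_zero j (w.ext_elem fun i => by simpa using hj i)
  choose p hp using ex
  have hαp : ∀ j, α' j = α (p j) := fun j =>
    (sub_eq_zero.1 ((mul_eq_zero.1 (key j (p j))).resolve_right (hp j))).symm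
  have hpinj : Injective p := fun i j hij => h'.inj (by rw [hαp, hαp, hij])
  let π : Perm (Fin n) := Equiv.ofBijective p (Finite.injective_iff_bijective.1 hpinj)
  have hoff : ∀ j i, i ≠ p j → w.repr (w' j) i = 0 := by
    intro j i hi
    refine (mul_eq_zero.1 (key j i)).resolve_left fun h0 => hi (h.inj ?_)
    rw [← hαp]; exact sub_eq_zero.1 h0
  have hrepr : ∀ x j, w.repr x (p j) = w.repr (w' j) (p j) * w'.repr x j := by
    intro x j
    conv_lhs => rw [← w'.sum_repr x]
    simp only [map_sum, map_smul, Finsupp.coe_finsetSum, Finset.sum_apply, Finsupp.smul_apply,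
      smul_eq_mul]
    rw [sum_eq_single j]
    · ring
    · intro k _ hk
      rw [hoff k (p j) fun h0 => hk (hpinj h0).symm, mul_zero]
    · simp
  refine ⟨π, fun j => w.repr (w' j) (p j), hp, hαp, fun j => ?_, hrepr⟩
  have e1 : φ₂ (w' j) = c' j := by
    rw [h'.snd, sumSq_apply]
    simp [Finsupp.single_apply]
  have e2 : φ₂ (w' j) = c (p j) * (w.repr (w' j) (p j) * w.repr (w' j) (p j)) := by
    rw [h.snd, sumSq_apply, sum_eq_single (p j)]
    · rfl
    · intro i _ hi
      rw [Basis.coord_apply, hoff j i hi]; simp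
    · simp
  rw [← e1, e2]
  change _ = _ * c (p j)
  ring

end Diagonal


namespace FunSpace

variable {X Y Z A B Q R : Type*}

lemma IsMorphism.isOpen_preimage {𝒳 : FunSpace X} {𝒴 : FunSpace Y} {f : X → Y}
    (h : IsMorphism 𝒳 𝒴 f) {U : Set Y} (hU : IsOpen[𝒴.top] U) : IsOpen[𝒳.top] (f ⁻¹' U) :=
  (@continuous_def X Y 𝒳.top 𝒴.top f).1 h.1 U hU

lemma IsMorphism.of_isOpen {𝒳 : FunSpace X} {𝒴 : FunSpace Y} {f : X → Y}
    (h : ∀ U, IsOpen[𝒴.top] U → IsOpen[𝒳.top] (f ⁻¹' U))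
    (h' : ∀ x g, 𝒴.RegAt g (f x) → 𝒳.RegAt (g ∘ f) x) : IsMorphism 𝒳 𝒴 f :=
  ⟨(@continuous_def X Y 𝒳.top 𝒴.top f).2 h, h'⟩

lemma IsMorphism.comp {𝒳 : FunSpace X} {𝒴 : FunSpace Y} {𝒵 : FunSpace Z} {g : Y → Z}
    {f : X → Y} (hg : IsMorphism 𝒴 𝒵 g) (hf : IsMorphism 𝒳 𝒴 f) : IsMorphism 𝒳 𝒵 (g ∘ f) :=
  .of_isOpen (fun _ hU => hf.isOpen_preimage (hg.isOpen_preimage hU))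
    fun x k hk => hf.2 x (k ∘ g) (hg.2 (f x) k hk)

lemma isMorphism_induced (𝒳 : FunSpace X) (i : A → X) : IsMorphism (𝒳.induced i) 𝒳 i :=
  .of_isOpen (fun U hU => ⟨U, hU, rfl⟩)
    fun _ g hg => ⟨g, hg, Set.univ, @isOpen_univ _ 𝒳.top, trivial, fun _ _ => rfl⟩

lemma IsMorphism.induced {𝒳 : FunSpace X} {𝒴 : FunSpace Y} {F : X → Y}
    (h : IsMorphism 𝒳 𝒴 F) {i : A → X} {k : B → Y} {f : A → B} (hf : ∀ a, k (f a) = F (i a)) :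
    IsMorphism (𝒳.induced i) (𝒴.induced k) f := by
  refine .of_isOpen ?_ ?_
  · rintro _ ⟨U, hU, rfl⟩
    refine ⟨_, h.isOpen_preimage hU, ?_⟩
    ext a; simp [hf]
  · rintro a g ⟨G, hG, U, hU, haU, hgG⟩
    rw [hf] at hG haU
    refine ⟨_, h.2 _ _ hG, _, h.isOpen_preimage hU, haU, fun b hb => ?_⟩
    have := hgG (f b) (by rw [hf]; exact hb)
    simp [this, hf]

lemma isMorphism_quot {𝒳 : FunSpace X} (q : X → Q) (h : ∀ {g : Q → ℂ} {x},
    (𝒳.quot q).RegAt g (q x) → 𝒳.RegAt (g ∘ q) x) : IsMorphism 𝒳 (𝒳.quot q) q :=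
  .of_isOpen (fun _ hU => hU) fun _ _ hg => h hg

lemma quot_regAt_comp {𝒳 : FunSpace X} {q : X → Q} {g : Q → ℂ} {x : X}
    (h : (𝒳.quot q).RegAt g (q x)) : 𝒳.RegAt (g ∘ q) x := by
  obtain ⟨U, -, hx, h⟩ := h
  exact h x hx

lemma isMorphism_mk (𝒳 : FunSpace X) (q : X → Q) : IsMorphism 𝒳 (𝒳.quot q) q :=
  isMorphism_quot q quot_regAt_comp

lemma IsMorphism.quot {𝒳 : FunSpace X} {𝒴 : FunSpace Y} {f : X → Y}
    (h : IsMorphism 𝒳 𝒴 f) {q : X → Q} {r : Y → R} {F : Q → R} (hF : ∀ x, F (q x) = r (f x)) :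
    IsMorphism (𝒳.quot q) (𝒴.quot r) F := by
  have key : ∀ U : Set R, q ⁻¹' (F ⁻¹' U) = f ⁻¹' (r ⁻¹' U) := by
    intro U; ext x; simp [hF]
  have ho : ∀ U : Set R, IsOpen[(𝒴.quot r).top] U → IsOpen[(𝒳.quot q).top] (F ⁻¹' U) := by
    intro U hU
    rw [isOpen_quot, key]
    exact h.isOpen_preimage hU
  refine .of_isOpen ho ?_
  rintro x g ⟨U, hU, hxU, hg⟩
  refine ⟨_, ho U hU, hxU, fun a ha => ?_⟩
  have h1 := h.2 a _ (hg (f a) (by rw [← hF]; exact ha))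
  have h2 : (g ∘ F) ∘ q = (g ∘ r) ∘ f := by funext y; simp [hF]
  rw [h2]; exact h1

lemma Refines.of_isMorphism {𝒜 : FunSpace A} {ℬ : FunSpace B} {F : A → B}
    (h : IsMorphism 𝒜 ℬ F) {i : X → A} {k : X → B} (hk : ∀ x, F (i x) = k x) :
    Refines 𝒜 i ℬ k :=
  ⟨fun V hV x hx => ⟨_, h.isOpen_preimage hV, by simpa [hk] using hx,
      fun x' hx' => by simpa [hk] using hx'⟩,
    fun x G hG => ⟨G ∘ F, h.2 _ _ (by rwa [hk]), Set.univ, @isOpen_univ _ 𝒜.top, trivial,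
      fun x' _ => by simp [hk]⟩⟩

end FunSpace

section Poised

variable {W : Type*} [AddCommGroup W] [Module ℂ W] {n : ℕ}

/-- The vectors `∑ αᵢᵏ uᵢ wᵢ`, `k = 0, 1, 2`. -/
noncomputable def powVec (w : Basis (Fin n) ℂ W) (α u : Fin n → ℂ) (k : Fin 3) : W :=
  w.equivFun.symm fun i => α i ^ (k : ℕ) * u i

@[simp] theorem repr_powVec (w : Basis (Fin n) ℂ W) (α u : Fin n → ℂ) (k : Fin 3)
    (i : Fin n) : w.repr (powVec w α u k) i = α i ^ (k : ℕ) * u i := by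
  rw [← Basis.equivFun_apply, powVec, LinearEquiv.apply_symm_apply]

/-- The action of a `2 × 2` matrix on quadratic polynomials. -/
def symSq (g : Mat₂) : Mat₃ :=
  !![g 1 1 ^ 2, 2 * g 1 0 * g 1 1, g 1 0 ^ 2;
    g 0 1 * g 1 1, g 0 0 * g 1 1 + g 0 1 * g 1 0, g 0 0 * g 1 0;
    g 0 1 ^ 2, 2 * g 0 0 * g 0 1, g 0 0 ^ 2]

lemma det_symSq (g : Mat₂) : (symSq g).det = g.det ^ 3 := by
  rw [symSq, Matrix.det_fin_three, Matrix.det_fin_two]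
  simp
  ring

lemma powVec_mobius (w : Basis (Fin n) ℂ W) (α u : Fin n → ℂ)
    {g : Mat₂} (hd : ∀ i, mobDen g (α i) ≠ 0) :
    powVec w (fun i => mob g (α i)) (fun i => mobDen g (α i) ^ 2 * u i) =
      mix (symSq g) (powVec w α u) := by
  funext k
  refine w.ext_elem fun i => ?_
  simp only [mix, map_sum, map_smul, Finsupp.coe_finsetSum, Finset.sum_apply, Finsupp.smul_apply,
    smul_eq_mul, repr_powVec]
  have h := mob_mul_mobDen (hd i)
  fin_cases k <;> simp [symSq, Fin.sum_univ_three]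
  · rw [mobDen]; ring
  · rw [show mob g (α i) * (mobDen g (α i) ^ 2 * u i) =
      (mob g (α i) * mobDen g (α i)) * mobDen g (α i) * u i by ring, h, mobDen]; ring
  · rw [show mob g (α i) ^ 2 * (mobDen g (α i) ^ 2 * u i) =
      (mob g (α i) * mobDen g (α i)) ^ 2 * u i by ring, h]; ring

lemma span_powVec_mobius (w : Basis (Fin n) ℂ W) (α u : Fin n → ℂ)
    {g : Mat₂} (hg : g.det ≠ 0) (hd : ∀ i, mobDen g (α i) ≠ 0) :
    Span (powVec w (fun i => mob g (α i))
      (fun i => mobDen g (α i) ^ 2 * u i)) = Span (powVec w α u) := by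
  rw [powVec_mobius w α u hd, span_mix]
  rw [det_symSq]; exact pow_ne_zero _ hg

lemma range_fin_two {V : Type*} (x : Fin 2 → V) : range x = {x 0, x 1} := by
  ext y; simp [Fin.exists_fin_two, eq_comm]

lemma range_fin_three {V : Type*} (x : Fin 3 → V) : range x = {x 0, x 1, x 2} := by
  ext y
  simp only [Set.mem_range, Set.mem_insert_iff, Set.mem_singleton_iff]
  constructor
  · rintro ⟨i, rfl⟩; fin_cases i <;> simp
  · rintro (rfl | rfl | rfl) <;> exact ⟨_, rfl⟩

lemma repr_alphaMap (w : Basis (Fin n) ℂ W) (α : Fin n → ℂ) (u : W) (i : Fin n) :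
    w.repr (alphaMap w α u) i = α i * w.repr u i := by
  conv_lhs => rw [← w.sum_repr u]
  simp [alphaMap, map_sum, Finsupp.single_apply]
  ring

lemma span_alphaMap (w : Basis (Fin n) ℂ W) (α : Fin n → ℂ) (u : W) :
    span ℂ {u, alphaMap w α u, alphaMap w α (alphaMap w α u)} =
      Span (powVec w α (w.repr u)) := by
  rw [range_fin_three]
  congr 3
  · refine w.ext_elem fun i => ?_; simp
  · refine w.ext_elem fun i => ?_; simp [repr_alphaMap]
  · congr 1; refine w.ext_elem fun i => ?_; simp [repr_alphaMap]; ring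

lemma span_pair_eq {V : Type*} [AddCommGroup V] [Module ℂ V] (a b : V) :
    span ℂ {a, b} = span ℂ (range ![a, b]) := by
  rw [range_fin_two]; rfl

variable {φ₁ φ₂ : QuadraticForm ℂ W}

lemma isPoised_iff [Module.Finite ℂ W] (hn : 2 ≤ dim W)
    {w : Basis (Fin (dim W)) ℂ W}
    {α c : Fin (dim W) → ℂ} (h : IsDiag φ₁ φ₂ w α c) {P : Submodule ℂ W} :
    IsPoised (span ℂ {φ₁, φ₂}) P ↔ ∃ u : Fin (dim W) → ℂ,
      (∀ i, u i ≠ 0) ∧ P = Span (powVec w α u) := by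
  constructor
  · rintro ⟨ψ₁, ψ₂, ⟨-, -, hnd, hspan⟩, w', β, u, hstd, hu, rfl⟩
    rw [isStandardBasis_iff] at hstd
    rw [span_pair_eq, span_pair_eq φ₁] at hspan
    obtain ⟨g, hg, hgm⟩ := exists_mix_of_span_eq
      (by rw [← span_pair_eq]; exact (h.isNonsingular hn).1) hspan
    have h0 := congrFun hgm 0
    have h1 := congrFun hgm 1
    simp only [Matrix.cons_val_zero, Matrix.cons_val_one] at h0 h1
    rw [h1] at hnd
    obtain ⟨hd, hdiag⟩ := h.mix_diag hg hnd
    rw [← h0, ← h1] at hdiag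
    obtain ⟨π, s, hs, hβ, -, hrepr⟩ := hdiag.unique hstd
    refine ⟨fun i => w.repr u i / mobDen g (α i) ^ 2, fun i => ?_, ?_⟩
    · obtain ⟨j, rfl⟩ := π.surjective i
      simp only [hrepr]
      exact div_ne_zero (mul_ne_zero (hs j) (hu j)) (pow_ne_zero _ (hd _))
    · rw [span_alphaMap, ← span_powVec_mobius w α _ hg hd]
      congr 2
      funext k
      refine w.ext_elem fun i => ?_
      obtain ⟨j, rfl⟩ := π.surjective i
      rw [hrepr, repr_powVec, repr_powVec, hβ, mul_div_cancel₀ _ (pow_ne_zero _ (hd _)), hrepr]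
      ring
  · rintro ⟨u, hu, rfl⟩
    obtain ⟨t, ht⟩ : ∃ t : ℂ, ∀ i, α i + t ≠ 0 := by
      obtain ⟨t, ht⟩ := ((Set.finite_range fun i => - α i).infinite_compl).nonempty
      exact ⟨t, fun i hi => ht ⟨i, by linear_combination -hi⟩⟩
    let g : Mat₂ := !![1, t; 0, 1]
    have hg : g.det ≠ 0 := by simp [g, Matrix.det_fin_two]
    have hd : ∀ i, mobDen g (α i) = 1 := fun i => by simp [g, mobDen]
    have hmob : ∀ i, mob g (α i) = α i + t := fun i => by simp [g, mob]
    have hdiag := h.mobius hg fun i => by rw [hd]; exact one_ne_zero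
    have e0 : g 0 0 • φ₁ + g 0 1 • φ₂ = φ₁ + t • φ₂ := by simp [g]
    have e1 : g 1 0 • φ₁ + g 1 1 • φ₂ = φ₂ := by simp [g]
    rw [e0, e1] at hdiag
    simp only [hd, hmob, one_mul] at hdiag
    choose d hd2 using fun i => IsAlgClosed.exists_pow_nat_eq (c i)⁻¹ zero_lt_two
    have hd0 : ∀ i, d i ≠ 0 := fun i hi => by
      have := hd2 i
      rw [hi, zero_pow two_ne_zero, eq_comm, inv_eq_zero] at this
      exact h.ne i this
    let e : Fin (dim W) → ℂˣ := fun i => Units.mk0 (d i) (hd0 i)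
    have hstd := hdiag.rescale e
    have hc : (fun i => c i * (e i : ℂ) ^ 2) = 1 := by
      funext i; simp [e, hd2, h.ne i]
    rw [hc] at hstd
    have hrepr : ∀ x i, (w.unitsSMul e).repr x i = (d i)⁻¹ * w.repr x i := by
      intro x i
      rw [Basis.repr_unitsSMul, Units.smul_def, smul_eq_mul, Units.val_inv_eq_inv_val]
      rfl
    have hrepru : ∀ i, w.repr (w.equivFun.symm u) i = u i := by
      intro i; rw [← Basis.equivFun_apply, LinearEquiv.apply_symm_apply]
    refine ⟨φ₁ + t • φ₂, φ₂, ⟨hdiag.linearIndependent hn, ?_, h.not_isDegenerate, ?_⟩,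
      w.unitsSMul e, fun i => α i + t, w.equivFun.symm u, isStandardBasis_iff.2 hstd, ?_, ?_⟩
    · have := hdiag.isDegenerate_comb 1 0
      simpa [ht] using this
    · rw [span_pair_eq, span_pair_eq φ₁, ← span_mix hg ![φ₁, φ₂]]
      congr 2
      funext k
      fin_cases k <;> simp [mix, g]
    · intro i
      rw [hrepr, hrepru]
      exact mul_ne_zero (inv_ne_zero (hd0 i)) (hu i)
    · rw [span_alphaMap, ← span_powVec_mobius w α u hg fun i => by rw [hd]; exact one_ne_zero]
      congr 2
      funext k
      refine (w.unitsSMul e).ext_elem fun i => ?_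
      rw [repr_powVec, hrepr, hrepr, repr_powVec, hrepru, hd, hmob]
      ring

end Poised

section Orbits

/-- `mix g` as a linear map. -/
def mixLin {V : Type*} [AddCommGroup V] [Module ℂ V] {r : ℕ} (g : Matrix (Fin r) (Fin r) ℂ) :
    (Fin r → V) →ₗ[ℂ] (Fin r → V) :=
  LinearMap.pi fun k => ∑ l, g k l • LinearMap.proj l

lemma mixLin_apply {V : Type*} [AddCommGroup V] [Module ℂ V] {r : ℕ}
    (g : Matrix (Fin r) (Fin r) ℂ) (x : Fin r → V) : mixLin g x = mix g x := by
  funext k; simp [mixLin, mix]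

variable {W : Type*} [AddCommGroup W] [Module ℂ W]

lemma exists_frame {V : Type*} [AddCommGroup V] [Module ℂ V] {r : ℕ} (hr : 0 < r)
    (P : Submodule ℂ V) (hP : Module.finrank ℂ P = r) :
    ∃ x : Fin r → V, Span x = P := by
  have : Module.Finite ℂ P := Module.finite_of_finrank_pos (by omega)
  let b := Module.finBasisOfFinrankEq ℂ P hP
  refine ⟨fun i => (b i : V), ?_⟩
  have h := congrArg (Submodule.map P.subtype) b.span_eq
  rw [Submodule.map_span, Submodule.map_top, Submodule.range_subtype, ← Set.range_comp] at h
  exact h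

lemma exists_nondegenerate_mix {x : Fin 2 → QuadraticForm ℂ W}
    (h : IsNonsingular (Span x)) :
    ∃ g : Mat₂, g.det ≠ 0 ∧ ¬ IsDegenerate (mix g x 1) := by
  obtain ⟨h1, ⟨φ, hφ, hnd⟩, -⟩ := h
  rw [range_fin_two] at hφ
  obtain ⟨a, b, rfl⟩ := Submodule.mem_span_pair.1 hφ
  by_cases ha : a = 0
  · subst ha
    by_cases hb : b = 0
    · subst hb
      exfalso
      have hsub : ∀ u : W, u = 0 := by
        intro u
        by_contra hu
        exact hnd ⟨u, hu, fun v => by simp [polar]⟩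
      have hz : ∀ ψ : QuadraticForm ℂ W, ψ = 0 := by
        intro ψ; ext v; rw [hsub v]; simp
      have : Span x = ⊥ := by
        rw [Submodule.span_eq_bot]; rintro _ ⟨k, rfl⟩; exact hz _
      rw [this, finrank_bot] at h1
      omega
    · exact ⟨!![1, 0; 0, b], by simpa [Matrix.det_fin_two] using hb, by
        simpa [mix, Fin.sum_univ_two] using hnd⟩
  · exact ⟨!![0, 1; a, b], by simpa [Matrix.det_fin_two] using ha, by
      simpa [mix, Fin.sum_univ_two] using hnd⟩

lemma exists_isDiag_frame [Module.Finite ℂ W] (hn : 0 < dim W) {x : Fin 2 → QuadraticForm ℂ W}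
    (h : IsNonsingular (Span x)) (hx : ¬ IsDegenerate (x 1)) :
    ∃ (w : Basis (Fin (dim W)) ℂ W) (α c : Fin (dim W) → ℂ),
      IsDiag (x 0) (x 1) w α c :=
  exists_isDiag hn (by rwa [range_fin_two] at h) hx

lemma IsDiag.isNonsingular_frame {x : Fin 2 → QuadraticForm ℂ W} {n : ℕ}
    {w : Basis (Fin n) ℂ W} {α c : Fin n → ℂ}
    (h : IsDiag (x 0) (x 1) w α c) (hn : 2 ≤ n) :
    IsNonsingular (Span x) := by
  rw [range_fin_two]; exact h.isNonsingular hn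

lemma isNonsingular_pullback [Module.Finite ℂ W] (hn : 2 ≤ dim W) {x : Fin 2 → QuadraticForm ℂ W}
    (h : IsNonsingular (Span x)) (T : W ≃ₗ[ℂ] W) :
    IsNonsingular (span ℂ (range fun k => pullback T (x k))) := by
  obtain ⟨g, hg, hnd⟩ := exists_nondegenerate_mix h
  rw [← span_mix hg] at h ⊢
  obtain ⟨w, α, c, hd⟩ := exists_isDiag_frame (by omega) h hnd
  rw [mix_map]
  exact (hd.pullback T).isNonsingular_frame hn

lemma span_pullback (x : Fin 2 → QuadraticForm ℂ W) (T : W ≃ₗ[ℂ] W) :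
    span ℂ (range fun k => pullback T (x k)) =
      (Span x).map (pullback T) := by
  rw [Submodule.map_span, ← Set.range_comp]; rfl

lemma span_symm_map (x : Fin 3 → W) (T : W ≃ₗ[ℂ] W) :
    span ℂ (range fun k => T.symm (x k)) =
      (Span x).map (T.symm : W →ₗ[ℂ] W) := by
  rw [Submodule.map_span, ← Set.range_comp]; rfl

/-- The linear action on frames of pencils. -/
def pencilAct (g : Mat₂) (T : W ≃ₗ[ℂ] W) : PencilAmb W →ₗ[ℂ] PencilAmb W :=
  (mixLin g).comp ((pullback T).compLeft (Fin 2))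

/-- The linear action on frames of triples of vectors. -/
def vecAct (h : Mat₃) (T : W ≃ₗ[ℂ] W) : (Fin 3 → W) →ₗ[ℂ] (Fin 3 → W) :=
  (mixLin h).comp ((T.symm : W →ₗ[ℂ] W).compLeft (Fin 3))

lemma pencilAct_apply (g : Mat₂) (T : W ≃ₗ[ℂ] W) (x : PencilAmb W) :
    pencilAct g T x = mix g fun k => pullback T (x k) := mixLin_apply _ _

lemma vecAct_apply (h : Mat₃) (T : W ≃ₗ[ℂ] W) (x : Fin 3 → W) :
    vecAct h T x = mix h fun k => T.symm (x k) := mixLin_apply _ _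

/-- The linear action on frames of pairs. -/
def pairAct (g : Mat₂) (h : Mat₃) (T : W ≃ₗ[ℂ] W) :
    PairAmb W →ₗ[ℂ] PairAmb W := (pencilAct g T).prodMap (vecAct h T)

lemma span_pencilAct {g : Mat₂} (hg : g.det ≠ 0) (T : W ≃ₗ[ℂ] W)
    (x : PencilAmb W) : Span (pencilAct g T x) =
      (Span x).map (pullback T) := by
  rw [← span_pullback, pencilAct_apply]; exact span_mix hg _

lemma span_vecAct {h : Mat₃} (hh : h.det ≠ 0) (T : W ≃ₗ[ℂ] W)
    (x : Fin 3 → W) : Span (vecAct h T x) =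
      (Span x).map (T.symm : W →ₗ[ℂ] W) := by
  rw [← span_symm_map, vecAct_apply]; exact span_mix hh _

lemma isNonsingular_pencilAct [Module.Finite ℂ W] (hn : 2 ≤ dim W) {g : Mat₂}
    (hg : g.det ≠ 0) (T : W ≃ₗ[ℂ] W) {x : PencilAmb W}
    (hx : IsNonsingular (Span x)) :
    IsNonsingular (Span (pencilAct g T x)) := by
  rw [span_pencilAct hg, ← span_pullback]; exact isNonsingular_pullback hn hx T

/-- The action on frames of nonsingular pencils. -/
def pencilFrameAct [Module.Finite ℂ W] (hn : 2 ≤ dim W) {g : Mat₂}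
    (hg : g.det ≠ 0) (T : W ≃ₗ[ℂ] W) (a : PencilFrame W) : PencilFrame W :=
  ⟨pencilAct g T a.1, isNonsingular_pencilAct hn hg T a.2⟩

/-- The action on frames of pairs. -/
def pairFrameAct [Module.Finite ℂ W] (hn : 2 ≤ dim W) {g : Mat₂}
    {h : Mat₃} (hg : g.det ≠ 0) (hh : h.det ≠ 0) (T : W ≃ₗ[ℂ] W)
    (a : PairFrame W) : PairFrame W :=
  ⟨pairAct g h T a.1, isNonsingular_pencilAct hn hg T a.2.1, by
    change Module.finrank ℂ (Span (vecAct h T a.1.2)) = 3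
    rw [span_vecAct hh]
    exact (LinearEquiv.finrank_map_eq T.symm _).trans a.2.2⟩

lemma frameToModuli_act [Module.Finite ℂ W] (hn : 2 ≤ dim W) {g : Mat₂}
    (hg : g.det ≠ 0) (T : W ≃ₗ[ℂ] W) (a : PencilFrame W) :
    frameToModuli (pencilFrameAct hn hg T a) = frameToModuli a :=
  (Quotient.sound (s := pencilSetoid W) ⟨T, span_pencilAct hg T a.1⟩).symm

lemma frameToRefined_act [Module.Finite ℂ W] (hn : 2 ≤ dim W) {g : Mat₂}
    {h : Mat₃} (hg : g.det ≠ 0) (hh : h.det ≠ 0) (T : W ≃ₗ[ℂ] W)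
    (a : PairFrame W) : frameToRefined (pairFrameAct hn hg hh T a) = frameToRefined a :=
  (Quotient.sound (s := pairSetoid W) ⟨T, span_pencilAct hg T a.1.1, span_vecAct hh T a.1.2⟩).symm

lemma frameToModuli_eq [Module.Finite ℂ W] (hn : 2 ≤ dim W) {a b : PencilFrame W}
    (h : frameToModuli a = frameToModuli b) :
    ∃ (g : Mat₂) (hg : g.det ≠ 0) (T : W ≃ₗ[ℂ] W),
      b = pencilFrameAct hn hg T a := by
  obtain ⟨T, hT⟩ := Quotient.exact (s := pencilSetoid W) h
  change Span b.1 = (Span a.1).map _ at hT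
  rw [← span_pullback] at hT
  obtain ⟨g, hg, hb⟩ := exists_mix_of_span_eq (isNonsingular_pullback hn a.2 T).1 hT
  exact ⟨g, hg, T, Subtype.ext (hb.trans (pencilAct_apply _ _ _).symm)⟩

lemma frameToRefined_eq [Module.Finite ℂ W] (hn : 2 ≤ dim W) {a b : PairFrame W}
    (h : frameToRefined a = frameToRefined b) :
    ∃ (g : Mat₂) (k : Mat₃) (hg : g.det ≠ 0)
      (hk : k.det ≠ 0) (T : W ≃ₗ[ℂ] W), b = pairFrameAct hn hg hk T a := by
  obtain ⟨T, hT, hP⟩ := Quotient.exact (s := pairSetoid W) h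
  change Span b.1.1 = (Span a.1.1).map _ at hT
  change Span b.1.2 = (Span a.1.2).map _ at hP
  rw [← span_pullback] at hT
  obtain ⟨g, hg, hb⟩ := exists_mix_of_span_eq (isNonsingular_pullback hn a.2.1 T).1 hT
  rw [← span_symm_map] at hP
  obtain ⟨k, hk, hb'⟩ := exists_mix_of_span_eq (by
    rw [span_symm_map]; exact (LinearEquiv.finrank_map_eq T.symm _).trans a.2.2) hP
  exact ⟨g, k, hg, hk, T, Subtype.ext (Prod.ext
    (hb.trans (pencilAct_apply _ _ _).symm) (hb'.trans (vecAct_apply _ _ _).symm))⟩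

lemma isPoised_of_equiv [Module.Finite ℂ W] (hn : 2 ≤ dim W) {Φ : NSPencil W} {P : Submodule ℂ W}
    (h : IsPoised Φ.1 P) (T : W ≃ₗ[ℂ] W) :
    IsPoised (Φ.1.map (pullback T)) (P.map (T.symm : W →ₗ[ℂ] W)) := by
  obtain ⟨x, hx⟩ := exists_frame two_pos Φ.1 Φ.2.1
  have hns := Φ.2
  rw [← hx] at hns h ⊢
  obtain ⟨g, hg, hnd⟩ := exists_nondegenerate_mix hns
  rw [← span_mix hg] at hns h ⊢
  obtain ⟨w, α, c, hd⟩ := exists_isDiag_frame (by omega) hns hnd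
  rw [← span_pullback, range_fin_two]
  rw [range_fin_two, isPoised_iff hn hd] at h
  rw [isPoised_iff hn (hd.pullback T)]
  obtain ⟨u, hu, rfl⟩ := h
  refine ⟨u, hu, ?_⟩
  rw [← span_symm_map]
  congr 2

lemma frameToModuli_surjective : Function.Surjective (frameToModuli (W := W)) := by
  intro m
  obtain ⟨⟨Φ, hΦ⟩, rfl⟩ := Quotient.exists_rep m
  obtain ⟨x, rfl⟩ := exists_frame two_pos Φ hΦ.1
  exact ⟨⟨x, hΦ⟩, rfl⟩

lemma frameToRefined_surjective : Function.Surjective (frameToRefined (W := W)) := by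
  intro m
  obtain ⟨⟨⟨Φ, hΦ⟩, ⟨P, hP⟩⟩, rfl⟩ := Quotient.exists_rep m
  obtain ⟨x, rfl⟩ := exists_frame two_pos Φ hΦ.1
  obtain ⟨y, rfl⟩ := exists_frame three_pos P hP
  exact ⟨⟨(x, y), hΦ, hP⟩, rfl⟩

lemma frameToCorr_surjective : Function.Surjective (frameToCorr (W := W)) := by
  rintro ⟨_, ⟨⟨Φ, hΦ⟩, ⟨P, hP⟩, h, rfl⟩⟩
  obtain ⟨x, rfl⟩ := exists_frame two_pos Φ hΦ.1
  obtain ⟨y, rfl⟩ := exists_frame three_pos P hP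
  exact ⟨⟨⟨(x, y), hΦ, hP⟩, h⟩, rfl⟩

/-- `[(Φ, P)] ↦ [Φ]`. -/
def forget : RefinedModuli W → Moduli W :=
  Quotient.map' (s₁ := pairSetoid W) (s₂ := pencilSetoid W) Prod.fst
    fun _ _ ⟨T, h, _⟩ => ⟨T, h⟩

lemma forget_p₂ (s : corr W) : forget (p₂ s) = p₁ s := by
  obtain ⟨_, ⟨Φ, P, h, rfl⟩⟩ := s
  rfl

lemma coe_corr (s : corr W) : (s : Moduli W × RefinedModuli W) = (forget (p₂ s), p₂ s) := by
  rw [forget_p₂]; rfl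

lemma p₂_injective : Injective (p₂ (W := W)) := by
  intro s t h
  refine Subtype.ext ?_
  rw [coe_corr, coe_corr, h]

lemma frameToRefined_mem_range_p₂ [Module.Finite ℂ W] (hn : 2 ≤ dim W) (a : PairFrame W) :
    frameToRefined a ∈ range (p₂ (W := W)) ↔
      IsPoised (Span a.1.1) (Span a.1.2) := by
  constructor
  · rintro ⟨⟨_, ⟨Φ, P, h, rfl⟩⟩, hs⟩
    obtain ⟨T, hT, hP⟩ := Quotient.exact (s := pairSetoid W) hs
    change Span a.1.1 = _ at hT
    change Span a.1.2 = _ at hP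
    rw [hT, hP]
    exact isPoised_of_equiv hn h T
  · intro h
    exact ⟨frameToCorr ⟨a, h⟩, rfl⟩

end Orbits

section Structures

variable {W : Type*} [AddCommGroup W] [Module ℂ W]
  {𝒞 : FunSpace (PencilAmb W)} {𝒜 : FunSpace (PairAmb W)}
  {𝒟 : FunSpace (PencilAmb W × PairAmb W)}

lemma restrict_corr_eq
    (h₁ : IsMorphism 𝒟 𝒜 Prod.snd)
    (h₂ : IsMorphism 𝒜 𝒟 fun a => (a.1, a)) :
    (prodOf 𝒟).restrict (corr W) = (refinedOf 𝒜).induced p₂ := by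
  refine induced_eq (Refines.of_isMorphism (F := Prod.snd) ?_ fun _ => rfl)
    (Refines.of_isMorphism (F := fun x => (forget x, x)) ?_ fun s => (coe_corr s).symm)
  · exact IsMorphism.quot (f := (Prod.snd : PencilFrame W × PairFrame W → PairFrame W))
      (h₁.induced fun _ => rfl) fun _ => rfl
  · exact IsMorphism.quot
      (f := fun a : PairFrame W => ((⟨a.1.1, a.2.1⟩ : PencilFrame W), a))
      (h₂.induced fun _ => rfl) fun _ => rfl

lemma isMorphism_forget (h : IsMorphism 𝒜 𝒞 Prod.fst) :
    IsMorphism (refinedOf 𝒜) (moduliOf 𝒞) forget :=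
  IsMorphism.quot (f := fun a : PairFrame W => (⟨a.1.1, a.2.1⟩ : PencilFrame W))
    (h.induced fun _ => rfl) fun _ => rfl

lemma corrVar_eq : corrVar W = (refinedVar W).induced p₂ := by
  have h₁ := zariski_isMorphism_linear (LinearMap.snd ℂ (PencilAmb W) (PairAmb W))
  have h₂ := zariski_isMorphism_linear
    ((LinearMap.fst ℂ (PencilAmb W) (Fin 3 → W)).prod (LinearMap.id (M := PairAmb W)))
  exact restrict_corr_eq h₁ h₂

/-- The refined moduli space as a complex space. -/
noncomputable def refinedAn (W : Type*) [AddCommGroup W] [Module ℂ W] [Module.Finite ℂ W] :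
    FunSpace (RefinedModuli W) := refinedOf (analytic _)

lemma corrAn_eq [Module.Finite ℂ W] : corrAn W = (refinedAn W).induced p₂ :=
by
  have h₁ := analytic_isMorphism_linear (LinearMap.snd ℂ (PencilAmb W) (PairAmb W))
  have h₂ := analytic_isMorphism_linear
    ((LinearMap.fst ℂ (PencilAmb W) (Fin 3 → W)).prod (LinearMap.id (M := PairAmb W)))
  exact restrict_corr_eq h₁ h₂

lemma isMorphism_p₁ :
    IsMorphism (corrVar W) (moduliVar W) p₁ := by
  rw [corrVar_eq]
  have h := isMorphism_forget (zariski_isMorphism_linear (LinearMap.fst ℂ (PencilAmb W) (Fin 3 → W)))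
  have h' := h.comp (isMorphism_induced (refinedVar W) p₂)
  rwa [show forget ∘ p₂ = p₁ from funext forget_p₂] at h'

end Structures


namespace FunSpace

variable {X A B Q : Type*} {E F : Type*} [AddCommGroup E] [Module ℂ E] [AddCommGroup F] [Module ℂ F]

/-- All linear functionals of the vector-valued function `R` are regular at `x`. -/
def RegMapAt (𝒳 : FunSpace X) (R : X → E) (x : X) : Prop :=
  ∀ l : Dual ℂ E, 𝒳.RegAt (fun y => l (R y)) x

section Calculus

variable {𝒳 : FunSpace X} {x : X}

lemma RegMapAt.map {R : X → E} (h : 𝒳.RegMapAt R x) (f : E →ₗ[ℂ] F) :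
    𝒳.RegMapAt (fun y => f (R y)) x := fun l => h (l.comp f)

lemma RegMapAt.apply {ι : Type*} {V : ι → Type*} [∀ i, AddCommGroup (V i)] [∀ i, Module ℂ (V i)]
    {R : X → ∀ i, V i} (h : 𝒳.RegMapAt R x) (i : ι) :
    𝒳.RegMapAt (fun y => R y i) x := h.map (LinearMap.proj i)

lemma RegMapAt.regAt {f : X → ℂ} (h : 𝒳.RegMapAt f x) : 𝒳.RegAt f x := h LinearMap.id

variable (hX : 𝒳.IsRinged)
include hX

lemma IsRinged.regMapAt {f : X → ℂ} (h : 𝒳.RegAt f x) : 𝒳.RegMapAt f x := by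
  intro l
  have : (fun y => l (f y)) = fun y => f y * l 1 := by
    funext y
    rw [← smul_eq_mul, ← map_smul, smul_eq_mul, mul_one]
  rw [this]
  exact hX.mul _ _ x h (hX.const _ x)

lemma IsRinged.regMapAt_const (v : E) : 𝒳.RegMapAt (fun _ => v) x := fun _ => hX.const _ x

lemma IsRinged.regMapAt_smul {f : X → ℂ} {R : X → E} (hf : 𝒳.RegAt f x)
    (h : 𝒳.RegMapAt R x) : 𝒳.RegMapAt (fun y => f y • R y) x := fun l => by
  simp only [map_smul, smul_eq_mul]
  exact hX.mul _ _ x hf (h l)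

lemma IsRinged.regMapAt_sum {ι : Type*} (s : Finset ι) {R : ι → X → E}
    (h : ∀ i ∈ s, 𝒳.RegMapAt (R i) x) : 𝒳.RegMapAt (fun y => ∑ i ∈ s, R i y) x := fun l => by
  simp only [map_sum]
  exact hX.sum _ _ x fun i hi => h i hi l

lemma IsRinged.regMapAt_pi {ι : Type*} [Finite ι] {V : ι → Type*} [∀ i, AddCommGroup (V i)]
    [∀ i, Module ℂ (V i)] {R : X → ∀ i, V i} (h : ∀ i, 𝒳.RegMapAt (fun y => R y i) x) :
    𝒳.RegMapAt R x := fun l => by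
  classical
  have := Fintype.ofFinite ι
  have : (fun y => l (R y)) = fun y => ∑ i, (l.comp (LinearMap.single ℂ V i)) (R y i) := by
    funext y
    conv_lhs => rw [← Finset.univ_sum_single (R y)]
    simp
  rw [this]
  exact hX.sum _ _ x fun i _ => h i _

lemma IsRinged.regMapAt_prod {R : X → E} {S : X → F} (hR : 𝒳.RegMapAt R x)
    (hS : 𝒳.RegMapAt S x) : 𝒳.RegMapAt (fun y => (R y, S y)) x := fun l => by
  have : (fun y => l (R y, S y)) =
      fun y => (l.comp (LinearMap.inl ℂ E F)) (R y) + (l.comp (LinearMap.inr ℂ E F)) (S y) := by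
    funext y
    simp [← map_add]
  rw [this]
  exact hX.add _ _ x (hR _) (hS _)

lemma IsRinged.regMapAt_of_basis {ι : Type*} [Finite ι] (b : Basis ι ℂ E) {R : X → E}
    (h : ∀ i, 𝒳.RegAt (fun y => b.repr (R y) i) x) : 𝒳.RegMapAt R x := by
  have := Fintype.ofFinite ι
  have e : R = fun y => ∑ i, b.repr (R y) i • b i := funext fun y => (b.sum_repr _).symm
  rw [e]
  exact hX.regMapAt_sum _ fun i _ => hX.regMapAt_smul (h i) (hX.regMapAt_const _)

lemma IsRinged.regMapAt_mix {r : ℕ} {M : X → Matrix (Fin r) (Fin r) ℂ} {R : X → Fin r → E}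
    (hM : ∀ i j, 𝒳.RegAt (fun y => M y i j) x) (h : 𝒳.RegMapAt R x) :
    𝒳.RegMapAt (fun y => mix (M y) (R y)) x :=
  hX.regMapAt_pi fun k => hX.regMapAt_sum _ fun l _ => hX.regMapAt_smul (hM k l) (h.apply l)

end Calculus

lemma regMapAt_zariski (E : Type*) [AddCommGroup E] [Module ℂ E] (x : E) :
    (zariski E).RegMapAt (fun y => y) x := fun l => zariski_regAt_of_mem (dual_mem_polyFun l) x

lemma regMapAt_analytic (E : Type*) [AddCommGroup E] [Module ℂ E] [Module.Finite ℂ E] (x : E) :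
    (analytic E).RegMapAt (fun y => y) x := by
  let _ := coordNorm E
  let _ := coordNormedSpace E
  exact fun l => analytic_regAt.2 ((LinearMap.toContinuousLinearMap l).analyticAt x)

lemma RegMapAt.induced {𝒜 : FunSpace A} {R : A → E} {i : X → A} {x : X}
    (h : 𝒜.RegMapAt R (i x)) : (𝒜.induced i).RegMapAt (fun y => R (i y)) x :=
  fun l => ⟨_, h l, Set.univ, @isOpen_univ _ 𝒜.top, trivial, fun _ _ => rfl⟩

/-- The regular functions are closed under composition with holomorphic functions. -/
structure IsAnalytic (𝒳 : FunSpace X) : Prop where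
  comp : ∀ (k : ℕ) (R : X → Fin k → ℂ) (x : X), (∀ i, 𝒳.RegAt (fun y => R y i) x) →
    ∀ G : (Fin k → ℂ) → ℂ, AnalyticAt ℂ G (R x) → 𝒳.RegAt (fun y => G (R y)) x
  nhds : ∀ (k : ℕ) (R : X → Fin k → ℂ) (x : X), (∀ i, 𝒳.RegAt (fun y => R y i) x) →
    ∀ V : Set (Fin k → ℂ), IsOpen V → R x ∈ V → ∃ U, IsOpen[𝒳.top] U ∧ x ∈ U ∧ ∀ y ∈ U, R y ∈ V

lemma isAnalytic_analytic (E : Type*) [AddCommGroup E] [Module ℂ E] [Module.Finite ℂ E] :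
    (analytic E).IsAnalytic := by
  let _ := coordNorm E
  let _ := coordNormedSpace E
  have key : ∀ (k : ℕ) (R : E → Fin k → ℂ) (x : E),
      (∀ i, (analytic E).RegAt (fun y => R y i) x) → AnalyticAt ℂ R x := by
    intro k R x h
    rw [analyticAt_pi_iff]
    exact fun i => analytic_regAt.1 (h i)
  refine ⟨fun k R x h G hG => analytic_regAt.2 (hG.comp_of_eq (key k R x h) rfl), ?_⟩
  intro k R x h V hV hx
  obtain ⟨U, hU, hUo, hxU⟩ := eventually_nhds_iff.1
    ((key k R x h).continuousAt.eventually (hV.mem_nhds hx))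
  exact ⟨U, by rw [analytic_top]; exact hUo, hxU, hU⟩

lemma IsAnalytic.induced {𝒜 : FunSpace A} (h : 𝒜.IsAnalytic) (i : X → A) :
    (𝒜.induced i).IsAnalytic := by
  have key : ∀ (k : ℕ) (R : X → Fin k → ℂ) (x : X),
      (∀ j, (𝒜.induced i).RegAt (fun y => R y j) x) →
      ∃ R' : A → Fin k → ℂ, (∀ j, 𝒜.RegAt (fun y => R' y j) (i x)) ∧
        ∃ U, IsOpen[𝒜.top] U ∧ i x ∈ U ∧ ∀ y, i y ∈ U → R y = R' (i y) := by
    intro k R x hR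
    choose F hF U hU hxU hRF using hR
    refine ⟨fun y j => F j y, hF, ⋂ j, U j, ?_, Set.mem_iInter.2 hxU, fun y hy => ?_⟩
    · let _ := 𝒜.top
      exact isOpen_iInter_of_finite hU
    · funext j; exact hRF j y (Set.mem_iInter.1 hy j)
  constructor
  · intro k R x hR G hG
    obtain ⟨R', hR', U, hU, hxU, hRR⟩ := key k R x hR
    rw [hRR x hxU] at hG
    exact ⟨_, h.comp k R' (i x) hR' G hG, U, hU, hxU, fun y hy => by simp only [hRR y hy]⟩
  · intro k R x hR V hV hx
    obtain ⟨R', hR', U, hU, hxU, hRR⟩ := key k R x hR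
    rw [hRR x hxU] at hx
    obtain ⟨U', hU', hxU', hR'V⟩ := h.nhds k R' (i x) hR' V hV hx
    exact ⟨_, ⟨_, 𝒜.isOpen_inter hU hU', rfl⟩, ⟨hxU, hxU'⟩, fun y hy => by
      rw [hRR y hy.1]; exact hR'V _ hy.2⟩

lemma IsAnalytic.quot {𝒜 : FunSpace A} (h : 𝒜.IsAnalytic) (q : A → Q) :
    (𝒜.quot q).IsAnalytic := by
  have key : ∀ (k : ℕ) (R : Q → Fin k → ℂ) (x : Q),
      (∀ j, (𝒜.quot q).RegAt (fun y => R y j) x) →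
      ∃ U, IsOpen[(𝒜.quot q).top] U ∧ x ∈ U ∧ ∀ a, q a ∈ U → ∀ j, 𝒜.RegAt (fun y => R (q y) j) a := by
    intro k R x hR
    choose U hU hxU hRU using hR
    refine ⟨⋂ j, U j, ?_, Set.mem_iInter.2 hxU, fun a ha j => hRU j a (Set.mem_iInter.1 ha j)⟩
    let _ := (𝒜.quot q).top
    exact isOpen_iInter_of_finite hU
  have key2 : ∀ (k : ℕ) (R : Q → Fin k → ℂ) (x : Q),
      (∀ j, (𝒜.quot q).RegAt (fun y => R y j) x) → ∀ V : Set (Fin k → ℂ), IsOpen V → R x ∈ V →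
      ∃ U, IsOpen[(𝒜.quot q).top] U ∧ x ∈ U ∧ (∀ y ∈ U, R y ∈ V) ∧
        ∀ a, q a ∈ U → ∀ j, 𝒜.RegAt (fun y => R (q y) j) a := by
    intro k R x hR V hV hx
    obtain ⟨U, hU, hxU, hreg⟩ := key k R x hR
    refine ⟨{y | y ∈ U ∧ R y ∈ V}, ?_, ⟨hxU, hx⟩, fun y hy => hy.2, fun a ha => hreg a ha.1⟩
    refine (@isOpen_iff_forall_mem_open A 𝒜.top _).2 fun a ha => ?_
    obtain ⟨U', hU', haU', hV'⟩ := h.nhds k (fun y => R (q y)) a (hreg a ha.1) V hV ha.2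
    exact ⟨q ⁻¹' U ∩ U', fun y hy => ⟨hy.1, hV' y hy.2⟩, 𝒜.isOpen_inter hU hU', ha.1, haU'⟩
  constructor
  · intro k R x hR G hG
    have hev : ∀ᶠ z in 𝓝 (R x), AnalyticAt ℂ G z := hG.eventually_analyticAt
    obtain ⟨V, hV, hVo, hxV⟩ := eventually_nhds_iff.1 hev
    obtain ⟨U, hU, hxU, hUV, hreg⟩ := key2 k R x hR V hVo hxV
    exact ⟨U, hU, hxU, fun a ha => h.comp k (fun y => R (q y)) a (hreg a ha) G (hV _ (hUV _ ha))⟩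
  · intro k R x hR V hV hx
    obtain ⟨U, hU, hxU, hUV, -⟩ := key2 k R x hR V hV hx
    exact ⟨U, hU, hxU, hUV⟩

lemma IsAnalytic.regAt_comp {𝒳 : FunSpace X} (h : 𝒳.IsAnalytic) [Module.Finite ℂ E] {R : X → E}
    {x : X} (hR : 𝒳.RegMapAt R x) {G : E → ℂ} (hG : (analytic E).RegAt G (R x)) :
    𝒳.RegAt (fun y => G (R y)) x := by
  have h1 := h.comp _ (fun y => (finBasis ℂ E).equivFun (R y)) x
    (fun i => hR ((finBasis ℂ E).coord i)) _ hG
  simpa using h1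

lemma IsAnalytic.exists_isOpen {𝒳 : FunSpace X} (h : 𝒳.IsAnalytic) [Module.Finite ℂ E]
    {R : X → E} {x : X} (hR : 𝒳.RegMapAt R x) {V : Set E} (hV : IsOpen[(analytic E).top] V)
    (hx : R x ∈ V) : ∃ U, IsOpen[𝒳.top] U ∧ x ∈ U ∧ ∀ y ∈ U, R y ∈ V := by
  obtain ⟨V', hV', rfl⟩ := hV
  exact h.nhds _ (fun y => (finBasis ℂ E).equivFun (R y)) x
    (fun i => hR ((finBasis ℂ E).coord i)) V' hV' hx

lemma Refines.analytic_of {𝒜 : FunSpace A} (h : 𝒜.IsAnalytic) [Module.Finite ℂ E] {i : X → A}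
    {k : X → E} (R : A → E) (hk : ∀ x, R (i x) = k x) (hR : ∀ x, 𝒜.RegMapAt R (i x)) :
    Refines 𝒜 i (analytic E) k := by
  constructor
  · intro V hV x hx
    obtain ⟨U, hU, hxU, hUV⟩ := h.exists_isOpen (hR x) hV (by rwa [hk])
    exact ⟨U, hU, hxU, fun x' hx' => by rw [← hk]; exact hUV _ hx'⟩
  · intro x G hG
    rw [← hk] at hG
    exact ⟨_, h.regAt_comp (hR x) hG, Set.univ, @isOpen_univ _ 𝒜.top, trivial,
      fun x' _ => by rw [hk]⟩

lemma IsRinged.polyFun_comp {𝒳 : FunSpace X} (h : 𝒳.IsRinged) {R : X → E} {x : X}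
    (hR : 𝒳.RegMapAt R x) {p : E → ℂ} (hp : p ∈ polyFun E) : 𝒳.RegAt (fun y => p (R y)) x := by
  induction hp using Algebra.adjoin_induction with
  | mem p hp => obtain ⟨l, rfl⟩ := hp; exact hR l
  | algebraMap r => exact h.const r x
  | add p q _ _ hp hq => exact h.add _ _ x hp hq
  | mul p q _ _ hp hq => exact h.mul _ _ x hp hq

lemma Refines.zariski_of {𝒜 : FunSpace A} (h : 𝒜.IsRinged) {i : X → A}
    {k : X → E} (R : A → E) (hk : ∀ x, R (i x) = k x) (hR : ∀ x, 𝒜.RegMapAt R (i x)) :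
    Refines 𝒜 i (zariski E) k := by
  have key : ∀ x p, p ∈ polyFun E → p (k x) ≠ 0 → ∃ O, IsOpen[𝒜.top] O ∧ i x ∈ O ∧
      ∀ x', i x' ∈ O → p (k x') ≠ 0 := by
    intro x p hp hpx
    obtain ⟨O, hO, hxO, hne⟩ := h.ne_zero _ _ (h.polyFun_comp (hR x) hp) (by rwa [hk])
    exact ⟨O, hO, hxO, fun x' hx' => by rw [← hk]; exact hne _ hx'⟩
  constructor
  · intro V hV x hx
    obtain ⟨p, hp, hpx, hpV⟩ := zariski_basis hV hx
    obtain ⟨O, hO, hxO, hne⟩ := key x p hp hpx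
    exact ⟨O, hO, hxO, fun x' hx' => hpV _ (hne x' hx')⟩
  · rintro x G ⟨p, hp, q, hq, hqx, hG⟩
    obtain ⟨O, hO, hxO, hne⟩ := key x q hq hqx
    refine ⟨_, h.div _ _ _ (h.polyFun_comp (hR x) hp) (h.polyFun_comp (hR x) hq)
      (by rwa [hk]), O, hO, hxO, fun x' hx' => ?_⟩
    rw [hG _ (hne x' hx'), hk]

end FunSpace

lemma isChartOn_of {X Q E : Type*} [AddCommGroup E] [Module ℂ E] [Module.Finite ℂ E]
    {𝒬 : FunSpace Q} {j : X → Q} {ψ : X → E} {U : Set X}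
    (hU : IsOpen[(𝒬.induced j).top] U) (hψ : Set.InjOn ψ U)
    (hD : IsOpen[(analytic E).top] (ψ '' U))
    (h₁ : Refines 𝒬 (fun u : U => j u) (analytic E) (fun u : U => ψ u))
    (h₂ : Refines (analytic E) (fun u : U => ψ u) 𝒬 (fun u : U => j u)) :
    IsChartOn (𝒬.induced j) ψ U :=
  ⟨hU, hψ, hD, (induced_induced _ _ _).trans (induced_eq h₁ h₂)⟩


section Operator

variable {W : Type*} [AddCommGroup W] [Module ℂ W] [Module.Finite ℂ W]

/-- The Gram matrix of the polar form. -/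
noncomputable def gram (φ : QuadraticForm ℂ W) :
    Matrix (Fin (dim W)) (Fin (dim W)) ℂ :=
  Matrix.of fun i j => polar φ (finBasis ℂ W i) (finBasis ℂ W j)

lemma polar_eq_gram (φ : QuadraticForm ℂ W) (x y : W) :
    polar φ x y = (gram φ).mulVec ((finBasis ℂ W).repr x) ⬝ᵥ
      ((finBasis ℂ W).repr y) := by
  rw [polar_eq_sum φ (finBasis ℂ W)]
  simp only [dotProduct, Matrix.mulVec, gram, Matrix.of_apply, Finset.sum_mul]
  rw [sum_comm]
  refine sum_congr rfl fun i _ => sum_congr rfl fun j _ => ?_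
  rw [QuadraticMap.polar_comm]; ring

lemma isDegenerate_iff_det_gram (φ : QuadraticForm ℂ W) :
    IsDegenerate φ ↔ (gram φ).det = 0 := by
  rw [← Matrix.exists_mulVec_eq_zero_iff]
  constructor
  · rintro ⟨u, hu, h⟩
    refine ⟨(finBasis ℂ W).equivFun u, by simpa using hu, ?_⟩
    ext j
    have := h (finBasis ℂ W j)
    rw [polar_eq_gram] at this
    simpa [dotProduct, Finsupp.single_apply] using this
  · rintro ⟨v, hv, h⟩
    refine ⟨(finBasis ℂ W).equivFun.symm v, (LinearEquiv.map_ne_zero_iff _).2 hv, fun y => ?_⟩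
    rw [polar_eq_gram, ← Basis.equivFun_apply, LinearEquiv.apply_symm_apply, h]
    simp

/-- The matrix of the operator `φ₂⁻¹ φ₁`. -/
noncomputable def opMat (φ₁ φ₂ : QuadraticForm ℂ W) :
    Matrix (Fin (dim W)) (Fin (dim W)) ℂ := (gram φ₂)⁻¹ * gram φ₁

/-- The operator `φ₂⁻¹ φ₁`. -/
noncomputable def opVec (φ₁ φ₂ : QuadraticForm ℂ W) (u : W) : W :=
  (finBasis ℂ W).equivFun.symm ((opMat φ₁ φ₂).mulVec ((finBasis ℂ W).equivFun u))

lemma polar_opVec {φ₁ φ₂ : QuadraticForm ℂ W} (h : ¬ IsDegenerate φ₂) (u y : W) :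
    polar φ₂ (opVec φ₁ φ₂ u) y = polar φ₁ u y := by
  rw [isDegenerate_iff_det_gram] at h
  rw [polar_eq_gram, polar_eq_gram, opVec, ← Basis.equivFun_apply,
    LinearEquiv.apply_symm_apply, Matrix.mulVec_mulVec, opMat, ← mul_assoc,
    Matrix.mul_nonsing_inv _ (isUnit_iff_ne_zero.2 h), one_mul]
  rfl

variable {φ₁ φ₂ : QuadraticForm ℂ W} {n : ℕ} {w : Basis (Fin n) ℂ W} {α c : Fin n → ℂ}

omit [Module.Finite ℂ W] in
lemma IsDiag.polar_snd (h : IsDiag φ₁ φ₂ w α c) (x : W) (i : Fin n) :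
    polar φ₂ x (w i) = 2 * (c i * w.repr x i) := by
  rw [h.snd, polar_sumSq]; simp [Finsupp.single_apply]

omit [Module.Finite ℂ W] in
lemma IsDiag.polar_fst (h : IsDiag φ₁ φ₂ w α c) (x : W) (i : Fin n) :
    polar φ₁ x (w i) = 2 * (α i * c i * w.repr x i) := by
  rw [h.fst, polar_sumSq]; simp [Finsupp.single_apply]

omit [Module.Finite ℂ W] in
lemma IsDiag.polar_eq_iff (h : IsDiag φ₁ φ₂ w α c) (x y : W) :
    (∀ z, polar φ₁ x z = polar φ₂ y z) ↔
      ∀ i, w.repr y i = α i * w.repr x i := by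
  constructor
  · intro hz i
    have := hz (w i)
    rw [h.polar_fst, h.polar_snd] at this
    refine mul_left_cancel₀ (h.ne i) ?_
    linear_combination -this / 2
  · intro hi z
    rw [h.fst, h.snd, polar_sumSq, polar_sumSq]
    congr 1
    refine sum_congr rfl fun i _ => ?_
    simp only [Basis.coord_apply, hi]
    ring

lemma IsDiag.repr_opVec (h : IsDiag φ₁ φ₂ w α c) (u : W) (i : Fin n) :
    w.repr (opVec φ₁ φ₂ u) i = α i * w.repr u i :=
  (h.polar_eq_iff u _).1 (fun z => (polar_opVec h.not_isDegenerate u z).symm) i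

lemma IsDiag.repr_opMat_pow (h : IsDiag φ₁ φ₂ w α c) (u : W) (k : ℕ) (i : Fin n) :
    w.repr ((finBasis ℂ W).equivFun.symm
      ((opMat φ₁ φ₂ ^ k).mulVec ((finBasis ℂ W).repr u))) i = α i ^ k * w.repr u i := by
  set b := finBasis ℂ W
  induction k generalizing i with
  | zero =>
    rw [pow_zero, Matrix.one_mulVec, ← Basis.equivFun_apply b, LinearEquiv.symm_apply_apply]
    simp
  | succ k ih =>
    have e : b.equivFun.symm ((opMat φ₁ φ₂ ^ (k + 1)).mulVec (b.repr u)) =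
        opVec φ₁ φ₂ (b.equivFun.symm ((opMat φ₁ φ₂ ^ k).mulVec (b.repr u))) := by
      rw [opVec, LinearEquiv.apply_symm_apply, Matrix.mulVec_mulVec, ← pow_succ']
    rw [e, h.repr_opVec, ih]
    ring

/-- The determinant of `u, α u, α² u, …` -/
noncomputable def cyc (φ₁ φ₂ : QuadraticForm ℂ W) (u : W) : ℂ :=
  (Matrix.of fun k : Fin (dim W) =>
    (opMat φ₁ φ₂ ^ (k : ℕ)).mulVec ((finBasis ℂ W).repr u)).det

lemma IsDiag.cyc_ne_zero_iff {w : Basis (Fin (dim W)) ℂ W}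
    {α c : Fin (dim W) → ℂ} (h : IsDiag φ₁ φ₂ w α c) (u : W) :
    cyc φ₁ φ₂ u ≠ 0 ↔ ∀ i, w.repr u i ≠ 0 := by
  set b := finBasis ℂ W
  have hy : ∀ k i, w.repr (b.equivFun.symm ((opMat φ₁ φ₂ ^ k).mulVec (b.repr u))) i =
      α i ^ k * w.repr u i := h.repr_opMat_pow u
  have hm : (Matrix.of fun k : Fin (dim W) =>
      (opMat φ₁ φ₂ ^ (k : ℕ)).mulVec (b.repr u)) =
      (Matrix.vandermonde α).transpose * Matrix.diagonal (w.repr u) *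
        (b.toMatrix w).transpose := by
    ext k i
    have e : (opMat φ₁ φ₂ ^ (k : ℕ)).mulVec (b.repr u) i =
        b.repr (b.equivFun.symm ((opMat φ₁ φ₂ ^ (k : ℕ)).mulVec (b.repr u))) i :=
      (congrFun (LinearEquiv.apply_symm_apply b.equivFun _) i).symm
    rw [Matrix.of_apply, e, ← Basis.toMatrix_mulVec_repr w b, Matrix.mul_apply]
    simp only [Matrix.mulVec, dotProduct, hy, Matrix.mul_diagonal, Matrix.transpose_apply,
      Matrix.vandermonde_apply]
    exact sum_congr rfl fun j _ => by ring
  have hb : (b.toMatrix w).det ≠ 0 := by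
    have := congrArg Matrix.det (b.toMatrix_mul_toMatrix_flip w)
    rw [Matrix.det_mul, Matrix.det_one] at this
    exact left_ne_zero_of_mul (by rw [this]; exact one_ne_zero)
  rw [cyc, hm, Matrix.det_mul, Matrix.det_mul, Matrix.det_transpose, Matrix.det_transpose,
    Matrix.det_diagonal]
  have hv := Matrix.det_vandermonde_ne_zero_iff.2 h.inj
  simp [hv, hb, Finset.prod_eq_zero_iff]

end Operator

section System

variable {W : Type*} [AddCommGroup W] [Module ℂ W] {n : ℕ}

/-- The rows of `X` are the coefficients of vectors `u, u', u''` with `φ₁ u = φ₂ u'`,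
`φ₁ u' = φ₂ u''`. -/
def IsSys (φ : Fin 2 → QuadraticForm ℂ W) (v : Fin 3 → W) (X : Mat₃) : Prop :=
  ∀ (r : Fin 2) (y : W), polar (φ 0) (mix X v r.castSucc) y =
    polar (φ 1) (mix X v r.succ) y

lemma eq_zero_of_cubic {α : Fin n → ℂ} (hα : Injective α) (hn : 4 ≤ n) {C : Fin 4 → ℂ}
    (h : ∀ i, ∑ k : Fin 4, α i ^ (k : ℕ) * C k = 0) : C = 0 :=
  Matrix.eq_zero_of_forall_index_sum_pow_mul_eq_zero (f := fun i : Fin 4 => α (Fin.castLE hn i))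
    (fun i j hij => Fin.castLE_injective hn (hα hij)) fun j => h _

variable {φ : Fin 2 → QuadraticForm ℂ W} {w : Basis (Fin n) ℂ W} {α c : Fin n → ℂ}

lemma IsDiag.isSys_iff (h : IsDiag (φ 0) (φ 1) w α c) (v : Fin 3 → W)
    (X : Mat₃) : IsSys φ v X ↔ mix X v = powVec w α (w.repr (mix X v 0)) := by
  have e : IsSys φ v X ↔ ∀ (r : Fin 2) i, w.repr (mix X v r.succ) i =
      α i * w.repr (mix X v r.castSucc) i := forall_congr' fun r => h.polar_eq_iff _ _
  rw [e]
  constructor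
  · intro h
    have h0 := h 0
    have h1 := h 1
    simp only [Fin.isValue, Fin.succ_zero_eq_one, Fin.castSucc_zero, Fin.succ_one_eq_two,
      Fin.castSucc_one] at h0 h1
    funext k
    refine w.ext_elem fun i => ?_
    rw [repr_powVec]
    fin_cases k
    · simp
    · simpa using h0 i
    · simp [h1, h0]; ring
  · intro h r i
    rw [h]
    fin_cases r <;> simp <;> ring

lemma linearIndependent_powVec (hα : Injective α) (hn : 4 ≤ n) {u : Fin n → ℂ}
    (hu : ∀ i, u i ≠ 0) : LinearIndependent ℂ (powVec w α u) := by
  rw [Fintype.linearIndependent_iff]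
  intro g hg
  have : (![g 0, g 1, g 2, 0] : Fin 4 → ℂ) = 0 := by
    refine eq_zero_of_cubic hα hn fun i => ?_
    have h1 := congrArg (fun x => w.repr x i) hg
    simp only [Fin.sum_univ_three, map_add, map_smul, Finsupp.add_apply, Finsupp.smul_apply,
      smul_eq_mul, repr_powVec, map_zero, Finsupp.zero_apply] at h1
    simp only [Fin.sum_univ_four]
    simp at h1 ⊢
    refine mul_right_cancel₀ (hu i) ?_
    linear_combination h1
  intro k
  fin_cases k
  · simpa using congrFun this 0
  · simpa using congrFun this 1
  · simpa using congrFun this 2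

lemma IsDiag.exists_isSys (h : IsDiag (φ 0) (φ 1) w α c) (hn : 4 ≤ n) {u : Fin n → ℂ}
    (hu : ∀ i, u i ≠ 0) {v : Fin 3 → W}
    (hv : Span v = Span (powVec w α u)) :
    ∃ X : Mat₃, X.det ≠ 0 ∧ mix X v = powVec w α u ∧
      ∀ Y, IsSys φ v Y ↔ ∃ p : ℂ, Y = p • X := by
  have hli := linearIndependent_powVec (w := w) h.inj hn hu
  obtain ⟨g, hg, rfl⟩ := exists_mix_of_span_eq
    (by rw [finrank_span_eq_card hli, Fintype.card_fin]) hv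
  have hgu := isUnit_iff_ne_zero.2 hg
  refine ⟨g⁻¹, ?_, ?_, fun Y => ?_⟩
  · rw [Matrix.det_nonsing_inv, Ring.inverse_eq_inv']
    exact inv_ne_zero hg
  · rw [← mix_mul, Matrix.nonsing_inv_mul _ hgu, mix_one]
  · rw [h.isSys_iff, ← mix_mul]
    have hrepr : ∀ (Z : Mat₃) k i, w.repr (mix Z (powVec w α u) k) i =
        (Z k 0 + Z k 1 * α i + Z k 2 * α i ^ 2) * u i := by
      intro Z k i
      simp [mix, Fin.sum_univ_three]; ring
    constructor
    · intro hY
      set Z := Y * g with hZ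
      have h1 : ∀ i, ∑ k : Fin 4, α i ^ (k : ℕ) *
          (![- Z 1 0, Z 0 0 - Z 1 1, Z 0 1 - Z 1 2, Z 0 2] : Fin 4 → ℂ) k = 0 := by
        intro i
        have := congrArg (fun x => w.repr x i) (congrFun hY 1)
        simp only [repr_powVec, hrepr] at this
        simp only [Fin.sum_univ_four]
        simp at this ⊢
        refine mul_right_cancel₀ (hu i) ?_
        linear_combination -this
      have h2 : ∀ i, ∑ k : Fin 4, α i ^ (k : ℕ) *
          (![- Z 2 0, Z 1 0 - Z 2 1, Z 1 1 - Z 2 2, Z 1 2] : Fin 4 → ℂ) k = 0 := by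
        intro i
        have e1 := congrArg (fun x => w.repr x i) (congrFun hY 1)
        have e2 := congrArg (fun x => w.repr x i) (congrFun hY 2)
        simp only [repr_powVec, hrepr] at e1 e2
        simp only [Fin.sum_univ_four]
        simp at e1 e2 ⊢
        refine mul_right_cancel₀ (hu i) ?_
        linear_combination α i * e1 - e2
      have h1' := eq_zero_of_cubic h.inj hn h1
      have h2' := eq_zero_of_cubic h.inj hn h2
      have a0 := congrFun h1' 0
      have a1 := congrFun h1' 1
      have a2 := congrFun h1' 2
      have a3 := congrFun h1' 3
      have b0 := congrFun h2' 0
      have b1 := congrFun h2' 1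
      have b2 := congrFun h2' 2
      have b3 := congrFun h2' 3
      simp at a0 a1 a2 a3 b0 b1 b2 b3
      refine ⟨Z 0 0, ?_⟩
      have hZ1 : Z = Z 0 0 • (1 : Mat₃) := by
        ext i j
        fin_cases i <;> fin_cases j <;> simp
        · linear_combination a2 + b3
        · exact a3
        · exact a0
        · linear_combination -a1
        · exact b3
        · exact b0
        · linear_combination -b1 + a0
        · linear_combination -a1 - b2
      calc Y = Z * g⁻¹ := by rw [hZ, mul_assoc, Matrix.mul_nonsing_inv _ hgu, mul_one]
        _ = Z 0 0 • g⁻¹ := by conv_lhs => rw [hZ1, smul_mul_assoc, one_mul]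
    · rintro ⟨p, rfl⟩
      rw [smul_mul_assoc, Matrix.nonsing_inv_mul _ hgu]
      funext k
      refine w.ext_elem fun i => ?_
      rw [repr_powVec, hrepr, hrepr]
      fin_cases k <;> simp <;> ring

lemma IsDiag.span_eq_of_isSys (h : IsDiag (φ 0) (φ 1) w α c) (hn : 4 ≤ n) {v : Fin 3 → W}
    (hv : Module.finrank ℂ (Span v) = 3) {X : Mat₃}
    (hX : IsSys φ v X) (hu : ∀ i, w.repr (mix X v 0) i ≠ 0) :
    Span v =
      Span (powVec w α (w.repr (mix X v 0))) := by
  rw [h.isSys_iff] at hX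
  rw [← hX]
  have := Module.finite_of_finrank_pos (R := ℂ) (M := Span v) (by omega)
  refine (Submodule.eq_of_le_of_finrank_eq (span_mix_le X v) ?_).symm
  rw [hv, hX, finrank_span_eq_card (linearIndependent_powVec (w := w) h.inj hn hu),
    Fintype.card_fin]

end System


section Regularity

variable {X W : Type*} [AddCommGroup W] [Module ℂ W] [Module.Finite ℂ W] {𝒳 : FunSpace X}
  (hX : 𝒳.IsRinged) {x : X}

/-- The polar form of a variable quadratic form at two fixed vectors. -/
def polarLin (u v : W) : QuadraticForm ℂ W →ₗ[ℂ] ℂ where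
  toFun φ := polar φ u v
  map_add' φ ψ := QuadraticMap.polar_add φ ψ u v
  map_smul' c φ := QuadraticMap.polar_smul φ c u v

include hX

lemma FunSpace.IsRinged.regAt_polar {φ : X → QuadraticForm ℂ W} {u v : X → W}
    (hφ : 𝒳.RegMapAt φ x) (hu : 𝒳.RegMapAt u x) (hv : 𝒳.RegMapAt v x) :
    𝒳.RegAt (fun y => polar (φ y) (u y) (v y)) x := by
  have e : (fun y => polar (φ y) (u y) (v y)) = fun y => ∑ i, ∑ j,
      (finBasis ℂ W).repr (u y) i * (finBasis ℂ W).repr (v y) j *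
        polar (φ y) (finBasis ℂ W i) (finBasis ℂ W j) :=
    funext fun y => polar_eq_sum _ _ _ _
  rw [e]
  refine hX.sum _ _ _ fun i _ => hX.sum _ _ _ fun j _ => hX.mul _ _ _ (hX.mul _ _ _ ?_ ?_) ?_
  · exact hu ((finBasis ℂ W).coord i)
  · exact hv ((finBasis ℂ W).coord j)
  · exact hφ (polarLin _ _)

lemma FunSpace.IsRinged.regAt_det_gram {φ : X → QuadraticForm ℂ W} (hφ : 𝒳.RegMapAt φ x) :
    𝒳.RegAt (fun y => (gram (φ y)).det) x :=
  hX.det _ _ fun _ _ => hφ (polarLin _ _)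

lemma FunSpace.IsRinged.regAt_opMat {φ ψ : X → QuadraticForm ℂ W} (hφ : 𝒳.RegMapAt φ x)
    (hψ : 𝒳.RegMapAt ψ x) (h : ¬ IsDegenerate (ψ x)) (i j : Fin (dim W)) :
    𝒳.RegAt (fun y => opMat (φ y) (ψ y) i j) x := by
  rw [isDegenerate_iff_det_gram] at h
  exact hX.mul_apply _ _ _ (hX.inv_apply _ _ (fun _ _ => hψ (polarLin _ _)) h)
    (fun _ _ => hφ (polarLin _ _)) i j

lemma FunSpace.IsRinged.regMapAt_opVec {φ ψ : X → QuadraticForm ℂ W} {u : X → W}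
    (hφ : 𝒳.RegMapAt φ x) (hψ : 𝒳.RegMapAt ψ x) (h : ¬ IsDegenerate (ψ x))
    (hu : 𝒳.RegMapAt u x) : 𝒳.RegMapAt (fun y => opVec (φ y) (ψ y) (u y)) x := by
  refine RegMapAt.map (hX.regMapAt_pi fun i => hX.regMapAt ?_)
    ((finBasis ℂ W).equivFun.symm : (Fin (dim W) → ℂ) →ₗ[ℂ] W)
  simp only [Matrix.mulVec, dotProduct]
  exact hX.sum _ _ _ fun j _ => hX.mul _ _ _ (hX.regAt_opMat hφ hψ h i j)
    (hu ((finBasis ℂ W).coord j))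

lemma FunSpace.IsRinged.regAt_cyc {φ ψ : X → QuadraticForm ℂ W} {u : X → W}
    (hφ : 𝒳.RegMapAt φ x) (hψ : 𝒳.RegMapAt ψ x) (h : ¬ IsDegenerate (ψ x))
    (hu : 𝒳.RegMapAt u x) : 𝒳.RegAt (fun y => cyc (φ y) (ψ y) (u y)) x := by
  refine hX.det _ _ fun k i => ?_
  simp only [Matrix.of_apply, Matrix.mulVec, dotProduct]
  exact hX.sum _ _ _ fun j _ => hX.mul _ _ _
    (hX.pow_apply _ _ (hX.regAt_opMat hφ hψ h) _ _ _) (hu ((finBasis ℂ W).coord j))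

end Regularity

section LocalSystem

variable {W : Type*} [AddCommGroup W] [Module ℂ W] [Module.Finite ℂ W]

/-- The matrix of the linear system `IsSys φ v` together with the evaluation of the entry
`(0, j)`. -/
noncomputable def sysMat (φ : Fin 2 → QuadraticForm ℂ W) (v : Fin 3 → W) (j : Fin 3) :
    Matrix (Option (Fin 2 × Fin (dim W))) (Fin 3 × Fin 3) ℂ :=
  Matrix.of fun o p => o.elim (if p = (0, j) then 1 else 0) fun r =>
    (if p.1 = r.1.castSucc then
      polar (φ 0) (v p.2) (finBasis ℂ W r.2) else 0) -
    (if p.1 = r.1.succ then polar (φ 1) (v p.2) (finBasis ℂ W r.2) else 0)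

omit [Module.Finite ℂ W] in
lemma polar_mix_left (φ : QuadraticForm ℂ W) (X : Mat₃) (v : Fin 3 → W)
    (r : Fin 3) (y : W) : polar φ (mix X v r) y =
      ∑ l, X r l * polar φ (v l) y := by
  simp only [mix, Fin.sum_univ_three, QuadraticMap.polar_add_left, QuadraticMap.polar_smul_left,
    smul_eq_mul]

lemma sysMat_mulVec_some (φ : Fin 2 → QuadraticForm ℂ W) (v : Fin 3 → W) (j : Fin 3)
    (X : Mat₃) (r : Fin 2 × Fin (dim W)) :
    (sysMat φ v j).mulVec (fun p => X p.1 p.2) (some r) =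
      polar (φ 0) (mix X v r.1.castSucc) (finBasis ℂ W r.2) -
      polar (φ 1) (mix X v r.1.succ) (finBasis ℂ W r.2) := by
  simp only [polar_mix_left, Matrix.mulVec, dotProduct, sysMat, Matrix.of_apply, Option.elim_some,
    sub_mul, ite_mul, zero_mul, sum_sub_distrib, Fintype.sum_prod_type]
  congr 1
  · rw [sum_eq_single r.1.castSucc (fun b _ hb => by simp [hb]) (by simp)]
    exact sum_congr rfl fun l _ => by simp [mul_comm]
  · rw [sum_eq_single r.1.succ (fun b _ hb => by simp [hb]) (by simp)]
    exact sum_congr rfl fun l _ => by simp [mul_comm]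

lemma sysMat_mulVec_none (φ : Fin 2 → QuadraticForm ℂ W) (v : Fin 3 → W) (j : Fin 3)
    (X : Mat₃) :
    (sysMat φ v j).mulVec (fun p => X p.1 p.2) none = X 0 j := by
  simp [Matrix.mulVec, dotProduct, sysMat]

lemma isSys_iff_mulVec (φ : Fin 2 → QuadraticForm ℂ W) (v : Fin 3 → W) (j : Fin 3)
    (X : Mat₃) (t : ℂ) : IsSys φ v X ∧ X 0 j = t ↔
      (sysMat φ v j).mulVec (fun p => X p.1 p.2) = fun o => o.elim t fun _ => 0 := by
  constructor
  · rintro ⟨h, h'⟩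
    funext o
    cases o with
    | none => rw [sysMat_mulVec_none, h']; rfl
    | some r => rw [sysMat_mulVec_some, h, sub_self]; rfl
  · intro h
    refine ⟨fun r y => ?_, (sysMat_mulVec_none φ v j X).symm.trans (by rw [h]; rfl)⟩
    have hb : ∀ k, polar (φ 0) (mix X v r.castSucc) (finBasis ℂ W k) =
        polar (φ 1) (mix X v r.succ) (finBasis ℂ W k) := fun k => by
      have := sysMat_mulVec_some φ v j X (r, k)
      rw [h] at this
      exact (sub_eq_zero.1 this.symm)
    have hl : (QuadraticMap.polarBilin (φ 0) (mix X v r.castSucc)) =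
        (QuadraticMap.polarBilin (φ 1) (mix X v r.succ)) := (finBasis ℂ W).ext hb
    exact LinearMap.congr_fun hl y

lemma exists_mul_eq_one_of_mulVec_injective {ι κ : Type*} [Fintype ι] [Fintype κ] [DecidableEq κ]
    [DecidableEq ι] (N : Matrix ι κ ℂ) (h : ∀ z, N.mulVec z = 0 → z = 0) :
    ∃ L : Matrix κ ι ℂ, L * N = 1 := by
  obtain ⟨f, hf⟩ := (Matrix.toLin' N).exists_leftInverse_of_injective
    (LinearMap.ker_eq_bot'.2 fun z hz => h z hz)
  refine ⟨LinearMap.toMatrix' f, ?_⟩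
  have := congrArg LinearMap.toMatrix' hf
  rwa [LinearMap.toMatrix'_comp, LinearMap.toMatrix'_toLin', LinearMap.toMatrix'_id] at this

variable {φ : Fin 2 → QuadraticForm ℂ W}

lemma isPoised_frame_iff (hn : 2 ≤ dim W)
    {w : Basis (Fin (dim W)) ℂ W} {α c : Fin (dim W) → ℂ}
    {g : Mat₂} (hg : g.det ≠ 0) (h : IsDiag (mix g φ 0) (mix g φ 1) w α c)
    {P : Submodule ℂ W} : IsPoised (Span φ) P ↔
      ∃ u : Fin (dim W) → ℂ, (∀ i, u i ≠ 0) ∧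
        P = Span (powVec w α u) := by
  rw [← span_mix hg, range_fin_two, isPoised_iff hn h]

omit [Module.Finite ℂ W] in
lemma isNonsingular_frame_mix {g : Mat₂} (hg : g.det ≠ 0) :
    IsNonsingular (Span (mix g φ)) ↔
      IsNonsingular (Span φ) := by rw [span_mix hg]

/-- Near a frame of a pair `(Φ, P)` with `P` poised by `Φ`, the vector `u` and the coefficients of
`u, α(u), α²(u)` in the frame of `P` are regular functions of the frame. -/
structure LocalSys (a₀ : PairFrame W) where
  g : Mat₂
  det_g : g.det ≠ 0
  j : Fin 3
  X : PairFrame W → Mat₃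
  O : Set (PairFrame W)
  mem : a₀ ∈ O
  nondeg : ∀ a ∈ O, ¬ IsDegenerate (mix g a.1.1 1)
  cyc_ne : ∀ a ∈ O, cyc (mix g a.1.1 0) (mix g a.1.1 1) (mix (X a) a.1.2 0) ≠ 0
  poised_iff : ∀ a ∈ O,
    IsPoised (Span a.1.1) (Span a.1.2) ↔
      IsSys (mix g a.1.1) a.1.2 (X a) ∧ X a 0 j = 1
  unique : ∀ a ∈ O, ∀ Y, IsSys (mix g a.1.1) a.1.2 Y → Y 0 j = 1 → Y = X a
  isOpen : ∀ 𝒜 : FunSpace (PairAmb W), 𝒜.IsRinged → (∀ x, 𝒜.RegMapAt (fun y => y) x) →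
    IsOpen[(𝒜.induced Subtype.val).top] O
  regAt : ∀ 𝒜 : FunSpace (PairAmb W), 𝒜.IsRinged → (∀ x, 𝒜.RegMapAt (fun y => y) x) →
    ∀ a ∈ O, ∀ i k, (𝒜.induced Subtype.val).RegAt (fun b : PairFrame W => X b i k) a

lemma FunSpace.IsRinged.isOpen_ne_zero {X : Type*} {𝒳 : FunSpace X} (h : 𝒳.IsRinged)
    {U : Set X} (hU : IsOpen[𝒳.top] U) {f : X → ℂ} (hf : ∀ x ∈ U, 𝒳.RegAt f x) :
    IsOpen[𝒳.top] {x | x ∈ U ∧ f x ≠ 0} := by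
  let _ := 𝒳.top
  rw [isOpen_iff_forall_mem_open]
  rintro x ⟨hx, hfx⟩
  obtain ⟨V, hV, hxV, hVf⟩ := h.ne_zero f x (hf x hx) hfx
  exact ⟨U ∩ V, fun y hy => ⟨hy.1, hVf y hy.2⟩, hU.inter hV, hx, hxV⟩

lemma exists_localSys (hn : 4 ≤ dim W) (a₀ : PairFrame W)
    (h₀ : IsPoised (Span a₀.1.1) (Span a₀.1.2)) :
    Nonempty (LocalSys a₀) := by
  obtain ⟨g, hg, hnd⟩ := exists_nondegenerate_mix a₀.2.1
  have hdiag : ∀ a : PairFrame W, ¬ IsDegenerate (mix g a.1.1 1) →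
      ∃ (w : Basis (Fin (dim W)) ℂ W) (α c : Fin (dim W) → ℂ),
      IsDiag (mix g a.1.1 0) (mix g a.1.1 1) w α c := fun a ha =>
    exists_isDiag_frame (by omega) ((isNonsingular_frame_mix hg).2 a.2.1) ha
  have hX : ∀ a : PairFrame W, ¬ IsDegenerate (mix g a.1.1 1) →
      IsPoised (Span a.1.1) (Span a.1.2) →
      ∃ X : Mat₃, X.det ≠ 0 ∧
        (∀ Y, IsSys (mix g a.1.1) a.1.2 Y ↔ ∃ p : ℂ, Y = p • X) ∧
        cyc (mix g a.1.1 0) (mix g a.1.1 1) (mix X a.1.2 0) ≠ 0 := by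
    intro a ha hp
    obtain ⟨w, α, c, hd⟩ := hdiag a ha
    obtain ⟨u, hu, hP⟩ := (isPoised_frame_iff (by omega) hg hd).1 hp
    obtain ⟨X, hXd, hXm, hXi⟩ := hd.exists_isSys (φ := mix g a.1.1) hn hu hP
    refine ⟨X, hXd, hXi, (hd.cyc_ne_zero_iff _).2 fun i => ?_⟩
    rw [hXm, repr_powVec]
    simpa using hu i
  obtain ⟨X₀, hX₀d, hX₀i, hX₀c⟩ := hX a₀ hnd h₀
  obtain ⟨j, hj⟩ : ∃ j, X₀ 0 j ≠ 0 := by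
    by_contra hcon
    push Not at hcon
    exact hX₀d (Matrix.det_eq_zero_of_row_eq_zero 0 hcon)
  obtain ⟨L, hL⟩ := exists_mul_eq_one_of_mulVec_injective (sysMat (mix g a₀.1.1) a₀.1.2 j) (by
    intro z hz
    obtain ⟨h1, h2⟩ := (isSys_iff_mulVec (mix g a₀.1.1) a₀.1.2 j (Matrix.of fun i k => z (i, k)) 0).2
      (by refine (Eq.trans ?_ hz).trans ?_
          · rfl
          · funext o; cases o <;> rfl)
    obtain ⟨p, hp⟩ := (hX₀i _).1 h1
    rw [hp] at h2
    have hp0 : p = 0 := by simpa [hj] using h2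
    funext q
    have := congrFun (congrFun hp q.1) q.2
    simpa [hp0] using this)
  set e : Option (Fin 2 × Fin (dim W)) → ℂ := fun o => o.elim 1 fun _ => 0 with he
  set N : PairFrame W → Matrix _ _ ℂ := fun a => sysMat (mix g a.1.1) a.1.2 j with hN
  set Z : PairFrame W → (Fin 3 × Fin 3 → ℂ) := fun a => (L * N a)⁻¹.mulVec (L.mulVec e) with hZ
  set X : PairFrame W → Mat₃ := fun a => Matrix.of fun i k => Z a (i, k) with hXX
  have huniq : ∀ a, (L * N a).det ≠ 0 → ∀ Y, IsSys (mix g a.1.1) a.1.2 Y → Y 0 j = 1 → Y = X a := by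
    intro a ha Y hY hYj
    have h1 := (isSys_iff_mulVec _ _ j Y 1).1 ⟨hY, hYj⟩
    have h2 : (L * N a).mulVec (fun p => Y p.1 p.2) = L.mulVec e := by
      rw [← Matrix.mulVec_mulVec]; exact congrArg _ h1
    ext i k
    simp only [hXX, hZ, Matrix.of_apply]
    rw [← h2, Matrix.mulVec_mulVec, Matrix.nonsing_inv_mul _ (isUnit_iff_ne_zero.2 ha),
      Matrix.one_mulVec]
  have hpX : ∀ a, ¬ IsDegenerate (mix g a.1.1 1) → (L * N a).det ≠ 0 →
      IsPoised (Span a.1.1) (Span a.1.2) →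
      IsSys (mix g a.1.1) a.1.2 (X a) ∧ X a 0 j = 1 ∧
        cyc (mix g a.1.1 0) (mix g a.1.1 1) (mix (X a) a.1.2 0) ≠ 0 := by
    intro a hnda ha hp
    obtain ⟨X₁, hd, hi, hc⟩ := hX a hnda hp
    have hj1 : X₁ 0 j ≠ 0 := by
      intro h0
      have h1 := (isSys_iff_mulVec _ _ j X₁ 0).1 ⟨(hi _).2 ⟨1, (one_smul _ _).symm⟩, h0⟩
      have h2 : (L * N a).mulVec (fun p => X₁ p.1 p.2) = 0 := by
        rw [← Matrix.mulVec_mulVec, hN]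
        rw [h1]
        have : (fun o : Option (Fin 2 × Fin (dim W)) =>
            o.elim (0 : ℂ) fun _ => (0 : ℂ)) = 0 := by funext o; cases o <;> rfl
        rw [this, Matrix.mulVec_zero]
      have h3 := Matrix.eq_zero_of_mulVec_eq_zero ha h2
      apply hd
      have : X₁ = 0 := by ext i k; exact congrFun h3 (i, k)
      rw [this, Matrix.det_zero]
    have hs : IsSys (mix g a.1.1) a.1.2 ((X₁ 0 j)⁻¹ • X₁) := (hi _).2 ⟨_, rfl⟩
    have hs1 : ((X₁ 0 j)⁻¹ • X₁) 0 j = 1 := by simp [hj1]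
    have heq := huniq a ha _ hs hs1
    rw [← heq]
    refine ⟨hs, hs1, ?_⟩
    obtain ⟨w, α, c, hd⟩ := hdiag a hnda
    rw [hd.cyc_ne_zero_iff] at hc ⊢
    intro i
    have : mix ((X₁ 0 j)⁻¹ • X₁) a.1.2 0 = (X₁ 0 j)⁻¹ • mix X₁ a.1.2 0 := by
      simp [mix, Finset.smul_sum, mul_smul]
    rw [this]
    simpa using ⟨hj1, hc i⟩
  have hreg : ∀ 𝒜 : FunSpace (PairAmb W), 𝒜.IsRinged → (∀ x, 𝒜.RegMapAt (fun y => y) x) →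
      ∀ a : PairFrame W, (𝒜.induced Subtype.val).RegMapAt (fun b : PairFrame W => mix g b.1.1) a ∧
        (𝒜.induced Subtype.val).RegMapAt (fun b : PairFrame W => b.1.2) a ∧
        ∀ p q, (𝒜.induced Subtype.val).RegAt (fun b : PairFrame W => (L * N b) p q) a := by
    intro 𝒜 h𝒜 hid a
    have hR := h𝒜.induced (Subtype.val : PairFrame W → PairAmb W)
    have h0 : (𝒜.induced Subtype.val).RegMapAt (fun b : PairFrame W => b.1) a :=
      (hid a.1).induced (i := Subtype.val)
    have h1 := h0.map (LinearMap.fst ℂ _ _)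
    have h2 := h0.map (LinearMap.snd ℂ _ _)
    have h1' : (𝒜.induced Subtype.val).RegMapAt (fun b : PairFrame W => mix g b.1.1) a :=
      hR.regMapAt_mix (fun _ _ => hR.const _ _) h1
    refine ⟨h1', h2, hR.mul_apply _ _ _ (fun _ _ => hR.const _ _) fun o p => ?_⟩
    cases o with
    | none => exact hR.const _ _
    | some r =>
      simp only [hN, sysMat, Matrix.of_apply, Option.elim_some]
      refine hR.sub _ _ _ ?_ ?_
      · split_ifs
        · exact hR.regAt_polar (h1'.apply 0) (h2.apply _) (hR.regMapAt_const _)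
        · exact hR.const _ _
      · split_ifs
        · exact hR.regAt_polar (h1'.apply 1) (h2.apply _) (hR.regMapAt_const _)
        · exact hR.const _ _
  have hregX : ∀ 𝒜 : FunSpace (PairAmb W), 𝒜.IsRinged → (∀ x, 𝒜.RegMapAt (fun y => y) x) →
      ∀ a, (L * N a).det ≠ 0 → ∀ i k,
        (𝒜.induced Subtype.val).RegAt (fun b : PairFrame W => X b i k) a := by
    intro 𝒜 h𝒜 hid a ha i k
    have hR := h𝒜.induced (Subtype.val : PairFrame W → PairAmb W)
    simp only [hXX, hZ, Matrix.of_apply, Matrix.mulVec, dotProduct]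
    exact hR.sum _ _ _ fun p _ => hR.mul _ _ _
      (hR.inv_apply _ _ (hreg 𝒜 h𝒜 hid a).2.2 ha _ _) (hR.const _ _)
  refine ⟨⟨g, hg, j, X, {a | ((True ∧ (gram (mix g a.1.1 1)).det ≠ 0) ∧ (L * N a).det ≠ 0) ∧
    cyc (mix g a.1.1 0) (mix g a.1.1 1) (mix (X a) a.1.2 0) ≠ 0}, ?_, ?_, ?_, ?_, ?_, ?_, ?_⟩⟩
  · have hL1 : (L * N a₀).det ≠ 0 := by rw [hN]; simp only [hL]; simp
    exact ⟨⟨⟨trivial, fun h => hnd ((isDegenerate_iff_det_gram _).2 h)⟩, hL1⟩,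
      (hpX a₀ hnd hL1 h₀).2.2⟩
  · exact fun a ha h => ha.1.1.2 ((isDegenerate_iff_det_gram _).1 h)
  · exact fun a ha => ha.2
  · intro a ha
    have hnda : ¬ IsDegenerate (mix g a.1.1 1) :=
      fun h => ha.1.1.2 ((isDegenerate_iff_det_gram _).1 h)
    constructor
    · exact fun hp => ⟨(hpX a hnda ha.1.2 hp).1, (hpX a hnda ha.1.2 hp).2.1⟩
    · rintro ⟨hs, -⟩
      obtain ⟨w, α, c, hd⟩ := hdiag a hnda
      have hu := (hd.cyc_ne_zero_iff _).1 ha.2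
      exact (isPoised_frame_iff (by omega) hg hd).2
        ⟨_, hu, hd.span_eq_of_isSys (φ := mix g a.1.1) hn a.2.2 hs hu⟩
  · exact fun a ha => huniq a ha.1.2
  · intro 𝒜 h𝒜 hid
    have hR := h𝒜.induced (Subtype.val : PairFrame W → PairAmb W)
    refine hR.isOpen_ne_zero (hR.isOpen_ne_zero (hR.isOpen_ne_zero
      (@isOpen_univ _ (𝒜.induced Subtype.val).top) fun a _ => ?_) fun a _ => ?_) fun a ha => ?_
    · exact hR.regAt_det_gram ((hreg 𝒜 h𝒜 hid a).1.apply 1)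
    · exact hR.det _ _ (hreg 𝒜 h𝒜 hid a).2.2
    · exact hR.regAt_cyc ((hreg 𝒜 h𝒜 hid a).1.apply 0) ((hreg 𝒜 h𝒜 hid a).1.apply 1)
        (fun h => ha.1.2 ((isDegenerate_iff_det_gram _).1 h))
        ((hR.regMapAt_mix (hregX 𝒜 h𝒜 hid a ha.2) (hreg 𝒜 h𝒜 hid a).2.1).apply 0)
  · exact fun 𝒜 h𝒜 hid a ha => hregX 𝒜 h𝒜 hid a ha.1.2

end LocalSystem


section LocallyClosed

variable {W : Type*} [AddCommGroup W] [Module ℂ W] [Module.Finite ℂ W]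

lemma isOpen_image_frameToRefined (hn : 2 ≤ dim W) {𝒜 : FunSpace (PairAmb W)}
    (h𝒜 : ∀ f : PairAmb W →ₗ[ℂ] PairAmb W, IsMorphism 𝒜 𝒜 f) {U : Set (PairFrame W)}
    (hU : IsOpen[(𝒜.induced Subtype.val).top] U) :
    IsOpen[(refinedOf 𝒜).top] (frameToRefined '' U) := by
  change IsOpen[(𝒜.induced Subtype.val).top] (frameToRefined ⁻¹' (frameToRefined '' U))
  let _ := (𝒜.induced (Subtype.val : PairFrame W → PairAmb W)).top
  rw [isOpen_iff_forall_mem_open]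
  rintro a ⟨u, hu, hua⟩
  obtain ⟨g, k, hg, hk, T, rfl⟩ := frameToRefined_eq hn hua.symm
  refine ⟨pairFrameAct hn hg hk T ⁻¹' U, fun b hb => ⟨_, hb, frameToRefined_act hn hg hk T b⟩,
    ?_, hu⟩
  exact ((h𝒜 (pairAct g k T)).induced (i := Subtype.val) (k := Subtype.val)
    (f := pairFrameAct hn hg hk T) fun _ => rfl).isOpen_preimage hU

lemma LocalSys.regMapAt {a₀ : PairFrame W} (S : LocalSys a₀) {𝒜 : FunSpace (PairAmb W)}
    (h𝒜 : 𝒜.IsRinged) (hid : ∀ x, 𝒜.RegMapAt (fun y => y) x) {a : PairFrame W} (ha : a ∈ S.O) :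
    (𝒜.induced Subtype.val).RegMapAt (fun b : PairFrame W => mix S.g b.1.1) a ∧
      (𝒜.induced Subtype.val).RegMapAt (fun b : PairFrame W => mix (S.X b) b.1.2) a := by
  have hR := h𝒜.induced (Subtype.val : PairFrame W → PairAmb W)
  have h0 : (𝒜.induced Subtype.val).RegMapAt (fun b : PairFrame W => b.1) a :=
    (hid a.1).induced (i := Subtype.val)
  exact ⟨hR.regMapAt_mix (fun _ _ => hR.const _ _) (h0.map (LinearMap.fst ℂ _ _)),
    hR.regMapAt_mix (S.regAt 𝒜 h𝒜 hid a ha) (h0.map (LinearMap.snd ℂ _ _))⟩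

lemma LocalSys.isOpen_not_poised {a₀ : PairFrame W} (S : LocalSys a₀) {𝒜 : FunSpace (PairAmb W)}
    (h𝒜 : 𝒜.IsRinged) (hid : ∀ x, 𝒜.RegMapAt (fun y => y) x) :
    IsOpen[(𝒜.induced Subtype.val).top] {a : PairFrame W | a ∈ S.O ∧
      ¬ IsPoised (Span a.1.1) (Span a.1.2)} := by
  have hR := h𝒜.induced (Subtype.val : PairFrame W → PairAmb W)
  have hO := S.isOpen 𝒜 h𝒜 hid
  have e : {a : PairFrame W | a ∈ S.O ∧
      ¬ IsPoised (Span a.1.1) (Span a.1.2)} =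
      (⋃ (r : Fin 2) (y : W), {a | a ∈ S.O ∧
        polar (mix S.g a.1.1 0 : QuadraticForm ℂ W) (mix (S.X a) a.1.2 r.castSucc) y -
        polar (mix S.g a.1.1 1 : QuadraticForm ℂ W) (mix (S.X a) a.1.2 r.succ) y ≠ 0}) ∪
      {a | a ∈ S.O ∧ S.X a 0 S.j - 1 ≠ 0} := by
    ext a
    simp only [Set.mem_ofPred_eq, Set.mem_union, Set.mem_iUnion, sub_ne_zero]
    constructor
    · rintro ⟨ha, hp⟩
      rw [S.poised_iff a ha, not_and_or] at hp
      refine hp.imp (fun h => ?_) fun h => ⟨ha, h⟩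
      simp only [IsSys, not_forall] at h
      obtain ⟨r, y, h⟩ := h
      exact ⟨r, y, ha, h⟩
    · rintro (⟨r, y, ha, h⟩ | ⟨ha, h⟩)
      · exact ⟨ha, fun hp => h (((S.poised_iff a ha).1 hp).1 r y)⟩
      · exact ⟨ha, fun hp => h ((S.poised_iff a ha).1 hp).2⟩
  rw [e]
  let _ := (𝒜.induced (Subtype.val : PairFrame W → PairAmb W)).top
  refine IsOpen.union (isOpen_iUnion fun r => isOpen_iUnion fun y =>
    hR.isOpen_ne_zero hO fun a ha => hR.sub _ _ _ ?_ ?_)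
    (hR.isOpen_ne_zero hO fun a ha => hR.sub _ _ _ (S.regAt 𝒜 h𝒜 hid a ha _ _) (hR.const _ _))
  · exact hR.regAt_polar ((S.regMapAt h𝒜 hid ha).1.apply 0) ((S.regMapAt h𝒜 hid ha).2.apply _)
      (hR.regMapAt_const _)
  · exact hR.regAt_polar ((S.regMapAt h𝒜 hid ha).1.apply 1) ((S.regMapAt h𝒜 hid ha).2.apply _)
      (hR.regMapAt_const _)

lemma isLocallyClosed_range_p₂ (hn : 4 ≤ dim W) :
    @IsLocallyClosed _ (refinedVar W).top (range (p₂ (W := W))) := by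
  let _ := (refinedVar W).top
  have hmor : ∀ f : PairAmb W →ₗ[ℂ] PairAmb W, IsMorphism (zariski _) (zariski _) f :=
    fun f => zariski_isMorphism_linear f
  have hid := regMapAt_zariski (PairAmb W)
  have hri := zariski_isRinged (PairAmb W)
  rw [isLocallyClosed_iff_isOpen_coborder, isOpen_iff_forall_mem_open]
  intro y hy
  by_cases hys : y ∈ range (p₂ (W := W))
  · obtain ⟨a₀, rfl⟩ := frameToRefined_surjective y
    rw [frameToRefined_mem_range_p₂ (by omega)] at hys
    obtain ⟨S⟩ := exists_localSys hn a₀ hys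
    refine ⟨frameToRefined '' S.O, ?_, isOpen_image_frameToRefined (by omega) hmor
      (S.isOpen _ hri hid), ⟨a₀, S.mem, rfl⟩⟩
    rintro _ ⟨a, ha, rfl⟩
    rw [coborder, Set.mem_compl_iff, Set.mem_sdiff, not_and_not_right]
    intro hcl
    rw [frameToRefined_mem_range_p₂ (by omega)]
    by_contra hnp
    obtain ⟨z, ⟨b, hb, rfl⟩, hz⟩ := mem_closure_iff.1 hcl _ (isOpen_image_frameToRefined
      (by omega) hmor (S.isOpen_not_poised hri hid)) ⟨a, ⟨ha, hnp⟩, rfl⟩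
    exact hb.2 ((frameToRefined_mem_range_p₂ (by omega) b).1 hz)
  · have : y ∉ closure (range (p₂ (W := W))) := fun h => hy ⟨h, hys⟩
    refine ⟨(closure (range p₂))ᶜ, ?_, isClosed_closure.isOpen_compl, this⟩
    exact fun z hz h => hz h.1

lemma isEmbedding_p₂ (hn : 4 ≤ dim W) :
    IsEmbedding (corrVar W) (refinedVar W) p₂ :=
  ⟨p₂_injective, isLocallyClosed_range_p₂ hn, corrVar_eq⟩

end LocallyClosed

section InverseFunction

lemma RegMapAt.analyticAt {E F : Type*} [NormedAddCommGroup E] [NormedSpace ℂ E]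
    [FiniteDimensional ℂ E] [NormedAddCommGroup F] [NormedSpace ℂ F] [FiniteDimensional ℂ F]
    {f : E → F} {x : E} (h : (analytic E).RegMapAt f x) : AnalyticAt ℂ f x := by
  let b := finBasis ℂ F
  have e : f = fun y => ∑ i, b.repr (f y) i • b i := funext fun y => (b.sum_repr _).symm
  rw [e]
  exact Finset.analyticAt_fun_sum _ fun i _ =>
    (analytic_regAt.1 (h (b.coord i))).smul analyticAt_const

lemma regMapAt_of_analyticAt {E F : Type*} [NormedAddCommGroup E] [NormedSpace ℂ E]
    [FiniteDimensional ℂ E] [NormedAddCommGroup F] [NormedSpace ℂ F] [FiniteDimensional ℂ F]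
    {f : E → F} {x : E} (h : AnalyticAt ℂ f x) : (analytic E).RegMapAt f x := fun l =>
  analytic_regAt.2 (((LinearMap.toContinuousLinearMap l).analyticAt (f x)).comp h)

lemma exists_analyticAt_inverse {E F : Type*} [NormedAddCommGroup E] [NormedSpace ℂ E]
    [FiniteDimensional ℂ E] [NormedAddCommGroup F] [NormedSpace ℂ F] [FiniteDimensional ℂ F]
    {f : E → F} {x : E} (hf : AnalyticAt ℂ f x) (D : E ≃L[ℂ] F)
    (hD : HasFDerivAt f (D : E →L[ℂ] F) x) :
    ∃ (G : F → E) (N : Set F), IsOpen N ∧ f x ∈ N ∧ G (f x) = x ∧ (∀ y ∈ N, f (G y) = y) ∧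
      ∀ y ∈ N, AnalyticAt ℂ G y := by
  have := FiniteDimensional.complete ℂ E
  have := FiniteDimensional.complete ℂ F
  have hc : ContDiffAt ℂ ⊤ f x := hf.contDiffAt
  have hstr : HasStrictFDerivAt f (D : E →L[ℂ] F) x := hc.hasStrictFDerivAt' hD (by simp)
  have hG : AnalyticAt ℂ (hc.localInverse hD (by simp)) (f x) :=
    (hc.to_localInverse hD (by simp)).analyticAt
  have hev := (hstr.eventually_right_inverse).and hG.eventually_analyticAt
  obtain ⟨N, hN, hNo, hxN⟩ := eventually_nhds_iff.1 hev
  refine ⟨_, N, hNo, hxN, hstr.localInverse_apply_image, fun y hy => (hN y hy).1,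
    fun y hy => (hN y hy).2⟩

lemma hasDerivAt_quadratic {F : Type*} [NormedAddCommGroup F] [NormedSpace ℂ F] (a b c d : F) :
    HasDerivAt (fun t : ℂ => a + t • b + t ^ 2 • (c + t • d)) b 0 := by
  have e1 : HasDerivAt (fun t : ℂ => t) 1 (0 : ℂ) := hasDerivAt_id' 0
  have := (((hasDerivAt_const (0 : ℂ) a).add (e1.smul_const b)).add
    ((e1.pow 2).smul ((hasDerivAt_const (0 : ℂ) c).add (e1.smul_const d))))
  exact this.congr_deriv (by simp)

lemma exists_regMapAt_inverse {E F : Type*} [AddCommGroup E] [Module ℂ E] [Module.Finite ℂ E]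
    [AddCommGroup F] [Module ℂ F] [Module.Finite ℂ F] {f : E → F} {x : E}
    (hf : (analytic E).RegMapAt f x) (D : E ≃ₗ[ℂ] F)
    (hD : ∀ h, ∃ R₁ R₂ : F, ∀ t : ℂ, f (x + t • h) = f x + t • D h + t ^ 2 • (R₁ + t • R₂)) :
    ∃ (G : F → E) (N : Set F), IsOpen[(analytic F).top] N ∧ f x ∈ N ∧ G (f x) = x ∧
      (∀ y ∈ N, f (G y) = y) ∧ ∀ y ∈ N, (analytic F).RegMapAt G y := by
  let _ := coordNorm E
  let _ := coordNormedSpace E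
  let _ := coordNorm F
  let _ := coordNormedSpace F
  have ha : AnalyticAt ℂ f x := RegMapAt.analyticAt hf
  have hfd : fderiv ℂ f x = (D.toContinuousLinearEquiv : E →L[ℂ] F) := by
    ext h
    obtain ⟨R₁, R₂, hR⟩ := hD h
    have h1 : HasDerivAt (fun t : ℂ => f (x + t • h)) (fderiv ℂ f x h) 0 :=
      (ha.differentiableAt.hasFDerivAt.hasLineDerivAt h)
    have h2 := hasDerivAt_quadratic (f x) (D h) R₁ R₂
    rw [show (fun t : ℂ => f (x + t • h)) = _ from funext hR] at h1
    exact h1.unique h2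
  obtain ⟨G, N, hN, h1, h2, h3, h4⟩ := exists_analyticAt_inverse ha D.toContinuousLinearEquiv
    (hfd ▸ ha.differentiableAt.hasFDerivAt)
  exact ⟨G, N, by rw [analytic_top]; exact hN, h1, h2, h3,
    fun y hy => regMapAt_of_analyticAt (h4 y hy)⟩

end InverseFunction


section LocalDiagonalization

variable {W : Type*} [AddCommGroup W] [Module ℂ W] {n : ℕ}

/-- The quadratic form `2 ∑ cᵢ lᵢ mᵢ`. -/
def crossSq (c : Fin n → ℂ) (l m : Fin n → Dual ℂ W) : QuadraticForm ℂ W :=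
  ∑ i, c i • (QuadraticMap.linMulLin (l i) (m i) + QuadraticMap.linMulLin (m i) (l i))

lemma crossSq_apply (c : Fin n → ℂ) (l m : Fin n → Dual ℂ W) (x : W) :
    crossSq c l m x = ∑ i, c i * (2 * (l i x * m i x)) := by
  rw [crossSq, sum_apply]
  refine sum_congr rfl fun i _ => ?_
  simp only [smul_apply, add_apply, QuadraticMap.linMulLin_apply,
    smul_eq_mul]
  ring

lemma polar_crossSq (c : Fin n → ℂ) (l m : Fin n → Dual ℂ W) (x y : W) :
    polar (crossSq c l m) x y = 2 * ∑ i, c i * (l i x * m i y + l i y * m i x) := by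
  simp only [polar, crossSq_apply, map_add, mul_sum,
    ← sum_sub_distrib]
  exact sum_congr rfl fun i _ => by ring

lemma quadraticForm_ext (w : Basis (Fin n) ℂ W) {φ ψ : QuadraticForm ℂ W}
    (h : ∀ i k, polar φ (w i) (w k) = polar ψ (w i) (w k)) : φ = ψ := by
  ext x
  have e := (polar_eq_sum φ w x x).trans
    ((sum_congr rfl fun i _ => sum_congr rfl fun k _ => by rw [h i k]).trans
      (polar_eq_sum ψ w x x).symm)
  rw [QuadraticMap.polar_self, QuadraticMap.polar_self] at e
  simpa using e

/-- The derivative of `(α, l) ↦ (∑ αᵢ lᵢ², ∑ lᵢ²)`. -/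
def sumSqDeriv (α : Fin n → ℂ) (l : Fin n → Dual ℂ W) :
    (Fin n → ℂ) × (Fin n → Dual ℂ W) →ₗ[ℂ] PencilAmb W where
  toFun p := ![sumSq p.1 l + crossSq α l p.2, crossSq 1 l p.2]
  map_add' p q := by
    funext k
    fin_cases k <;> ext x <;>
    simp [sumSq_apply, crossSq_apply, ← sum_add_distrib] <;>
    exact sum_congr rfl fun i _ => by ring
  map_smul' t p := by
    funext k
    fin_cases k <;> ext x <;>
    simp [sumSq_apply, crossSq_apply, mul_sum, ← sum_add_distrib] <;>
    exact sum_congr rfl fun i _ => by ring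

lemma sumSqDeriv_bijective {α : Fin n → ℂ} (hα : Injective α)
    (w : Basis (Fin n) ℂ W) : Function.Bijective (sumSqDeriv α w.coord) := by
  have hc : ∀ (c : Fin n → ℂ) (m : Fin n → Dual ℂ W) i k,
      polar (crossSq c w.coord m) (w i) (w k) =
        2 * (c i * m i (w k) + c k * m k (w i)) := by
    intro c m i k
    rw [polar_crossSq]
    simp [mul_add, sum_add_distrib, Finsupp.single_apply]
  have hs : ∀ (c : Fin n → ℂ) i k, polar (sumSq c w.coord) (w i) (w k) =
      if i = k then 2 * c i else 0 := by
    intro c i k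
    rw [polar_sumSq]
    by_cases h : i = k
    · subst h; simp [Finsupp.single_apply]
    · simp [Finsupp.single_apply, h]
  constructor
  · rw [injective_iff_map_eq_zero]
    rintro ⟨β, m⟩ h
    have h0 := congrFun h 0
    have h1 := congrFun h 1
    simp only [sumSqDeriv, LinearMap.coe_mk, AddHom.coe_mk, Matrix.cons_val_zero,
      Matrix.cons_val_one, Pi.zero_apply] at h0 h1
    have e1 : ∀ i k, m i (w k) + m k (w i) = 0 := by
      intro i k
      have := hc 1 m i k
      rw [h1] at this
      simpa [polar] using this.symm
    have e0 : ∀ i k, (if i = k then 2 * β i else 0) + 2 * (α i * m i (w k) + α k * m k (w i)) = 0 := by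
      intro i k
      have := congrArg (fun q : QuadraticForm ℂ W => polar q (w i) (w k)) h0
      rw [FunLike.coe_add, QuadraticMap.polar_add, hs, hc] at this
      rw [this]
      simp [polar]
    have hm : ∀ i k, m i (w k) = 0 := by
      intro i k
      by_cases hik : i = k
      · subst hik
        have := e1 i i
        linear_combination this / 2
      · have h2 := e0 i k
        rw [if_neg hik] at h2
        refine (mul_eq_zero.1 (?_ : (α i - α k) * m i (w k) = 0)).resolve_left
          (sub_ne_zero.2 fun h => hik (hα h))
        linear_combination h2 / 2 - α k * e1 i k
    have hm0 : m = 0 := funext fun i => w.ext fun k => hm i k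
    have hβ : β = 0 := by
      funext i
      have := e0 i i
      simp only [if_true, hm, mul_zero, add_zero] at this
      simpa using this
    rw [hm0, hβ]; rfl
  · intro ψ
    set P : Fin 2 → Fin n → Fin n → ℂ := fun r i k => polar (ψ r) (w i) (w k) with hP
    have hPs : ∀ r i k, P r i k = P r k i := fun r i k => QuadraticMap.polar_comm _ _ _
    set M : Fin n → Fin n → ℂ := fun i k => if i = k then P 1 i i / 4 else
      (P 0 i k - α k * P 1 i k) / (2 * (α i - α k)) with hM
    set m : Fin n → Dual ℂ W := fun i => w.constr ℂ (M i) with hm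
    have hmw : ∀ i k, m i (w k) = M i k := fun i k => w.constr_basis ℂ (M i) k
    refine ⟨(fun i => P 0 i i / 2 - 2 * α i * M i i, m), ?_⟩
    funext r
    refine quadraticForm_ext w fun i k => ?_
    have key : ∀ i k, i ≠ k → M i k + M k i = P 1 i k / 2 ∧
        α i * M i k + α k * M k i = P 0 i k / 2 := by
      intro i k hik
      have h1 : α i - α k ≠ 0 := sub_ne_zero.2 fun h => hik (hα h)
      have h2 : α k - α i ≠ 0 := sub_ne_zero.2 fun h => hik (hα h).symm
      simp only [hM, if_neg hik, if_neg (Ne.symm hik), hPs _ k i]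
      constructor <;> · field_simp; ring
    fin_cases r
    · change polar (sumSq _ w.coord + crossSq α w.coord m : QuadraticForm ℂ W) _ _ =
        P 0 i k
      rw [FunLike.coe_add, QuadraticMap.polar_add, hs, hc, hmw, hmw]
      by_cases hik : i = k
      · subst hik
        simp only [if_true]; ring
      · rw [if_neg hik, (key i k hik).2]; ring
    · change polar (crossSq 1 w.coord m) _ _ = P 1 i k
      rw [hc, hmw, hmw]
      simp only [Pi.one_apply, one_mul]
      by_cases hik : i = k
      · subst hik
        simp only [hM, if_true]; ring
      · rw [(key i k hik).1]; ring

lemma sumSq_expand (α β : Fin n → ℂ) (l m : Fin n → Dual ℂ W) (t : ℂ) :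
    (![sumSq (α + t • β) (l + t • m), sumSq 1 (l + t • m)] : PencilAmb W) =
      ![sumSq α l, sumSq 1 l] + t • sumSqDeriv α l (β, m) +
        t ^ 2 • (![crossSq β l m + sumSq α m, sumSq 1 m] + t • ![sumSq β m, 0]) := by
  funext k
  fin_cases k <;> ext x <;>
  simp [sumSqDeriv, sumSq_apply, crossSq_apply, mul_sum, ← sum_add_distrib] <;>
  exact sum_congr rfl fun i _ => by ring

variable [Module.Finite ℂ W]

lemma FunSpace.IsRinged.regMapAt_sumSq {X : Type*} {𝒳 : FunSpace X} (hX : 𝒳.IsRinged) {x : X}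
    {c : X → Fin n → ℂ} {l : X → Fin n → Dual ℂ W} (hc : 𝒳.RegMapAt c x)
    (hl : 𝒳.RegMapAt l x) : 𝒳.RegMapAt (fun y => sumSq (c y) (l y)) x := by
  set b := finBasis ℂ W
  have e : (fun y => sumSq (c y) (l y)) = fun y => ∑ i, ∑ j, ∑ k,
      (c y i * (l y i (b j) * l y i (b k))) • QuadraticMap.linMulLin (b.coord j) (b.coord k) := by
    funext y
    ext x
    simp only [sumSq_apply, sum_apply, smul_apply,
      QuadraticMap.linMulLin_apply, smul_eq_mul]
    refine sum_congr rfl fun i _ => ?_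
    have hx : l y i x = ∑ j, l y i (b j) * b.coord j x := by
      conv_lhs => rw [← b.sum_repr x]
      simp only [map_sum, map_smul, smul_eq_mul, Basis.coord_apply]
      exact sum_congr rfl fun j _ => mul_comm _ _
    rw [hx, Finset.sum_mul_sum, mul_sum]
    refine sum_congr rfl fun j _ => ?_
    rw [mul_sum]
    exact sum_congr rfl fun k _ => by ring
  rw [e]
  refine hX.regMapAt_sum _ fun i _ => hX.regMapAt_sum _ fun j _ => hX.regMapAt_sum _ fun k _ =>
    hX.regMapAt_smul (hX.mul _ _ _ (hc.apply i).regAt (hX.mul _ _ _ ?_ ?_)) (hX.regMapAt_const _)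
  · exact (hl.apply i) (Dual.eval ℂ W (b j))
  · exact (hl.apply i) (Dual.eval ℂ W (b k))

/-- A simultaneous diagonalization extends holomorphically to nearby pairs of forms. -/
lemma exists_local_diag {φ : PencilAmb W} {w : Basis (Fin n) ℂ W} {α : Fin n → ℂ}
    (h : IsDiag (φ 0) (φ 1) w α 1) :
    ∃ (A : PencilAmb W → Fin n → ℂ) (L : PencilAmb W → Fin n → Dual ℂ W)
      (N : Set (PencilAmb W)), IsOpen[(analytic _).top] N ∧ φ ∈ N ∧ A φ = α ∧ L φ = w.coord ∧
      ∀ ψ ∈ N, (∃ w' : Basis (Fin n) ℂ W, w'.coord = L ψ ∧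
        IsDiag (ψ 0) (ψ 1) w' (A ψ) 1) ∧ (analytic _).RegMapAt A ψ ∧ (analytic _).RegMapAt L ψ := by
  set E := (Fin n → ℂ) × (Fin n → Dual ℂ W)
  have hE := analytic_isRinged E
  have hP := analytic_isRinged (PencilAmb W)
  set f : E → PencilAmb W := fun p => ![sumSq p.1 p.2, sumSq 1 p.2] with hf
  have hfx : f (α, w.coord) = φ := by
    funext k
    fin_cases k
    · simp [hf, h.fst]
    · simp [hf, h.snd]
  have hid := regMapAt_analytic E (α, w.coord)
  have hreg : (analytic E).RegMapAt f (α, w.coord) := by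
    refine hE.regMapAt_pi fun k => ?_
    fin_cases k
    · exact hE.regMapAt_sumSq (hid.map (LinearMap.fst ℂ _ _)) (hid.map (LinearMap.snd ℂ _ _))
    · exact hE.regMapAt_sumSq (hE.regMapAt_const _) (hid.map (LinearMap.snd ℂ _ _))
  obtain ⟨G, N, hN, hxN, hGx, hfG, hG⟩ := exists_regMapAt_inverse hreg
    (LinearEquiv.ofBijective _ (sumSqDeriv_bijective h.inj w))
    (by
      rintro ⟨β, m⟩
      exact ⟨_, _, fun t => sumSq_expand α β w.coord m t⟩)
  rw [hfx] at hGx hxN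
  refine ⟨fun ψ => (G ψ).1, fun ψ => (G ψ).2,
    {ψ | (ψ ∈ N ∧ (Matrix.vandermonde (G ψ).1).det ≠ 0) ∧
      (Matrix.of fun i k => (G ψ).2 i (w k)).det ≠ 0}, ?_, ?_, congrArg Prod.fst hGx, congrArg Prod.snd hGx, ?_⟩
  · refine hP.isOpen_ne_zero (hP.isOpen_ne_zero hN fun ψ hψ => ?_) fun ψ hψ => ?_
    · exact hP.det _ _ fun i j => hP.pow _ _
        ((hG ψ hψ).map ((LinearMap.proj i).comp (LinearMap.fst ℂ _ _))).regAt _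
    · exact hP.det _ _ fun i j => ((hG ψ hψ.1).map (LinearMap.snd ℂ _ _)).apply i
        (Dual.eval ℂ W (w j))
  · refine ⟨⟨hxN, ?_⟩, ?_⟩
    · rw [hGx]; exact Matrix.det_vandermonde_ne_zero_iff.2 h.inj
    · rw [hGx]
      have : (Matrix.of fun i k => w.coord i (w k)) = (1 : Matrix (Fin n) (Fin n) ℂ) := by
        ext i k
        simp [Finsupp.single_apply, Matrix.one_apply, eq_comm]
      rw [this, Matrix.det_one]; exact one_ne_zero
  · rintro ψ ⟨⟨hψ, hv⟩, hd⟩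
    refine ⟨?_, (hG ψ hψ).map (LinearMap.fst ℂ _ _), (hG ψ hψ).map (LinearMap.snd ℂ _ _)⟩
    set T : W →ₗ[ℂ] (Fin n → ℂ) := LinearMap.pi (G ψ).2 with hT
    have hinj : Injective T := by
      rw [injective_iff_map_eq_zero]
      intro x hx
      have h1 : (Matrix.of fun i k => (G ψ).2 i (w k)).mulVec (w.repr x) = 0 := by
        funext i
        have := congrFun hx i
        simp only [hT, LinearMap.pi_apply, Pi.zero_apply] at this
        rw [← w.sum_repr x] at this
        simp only [map_sum, map_smul, smul_eq_mul] at this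
        simp only [Matrix.mulVec, dotProduct, Matrix.of_apply, Pi.zero_apply]
        rw [← this]
        exact sum_congr rfl fun k _ => mul_comm _ _
      have h2 := Matrix.eq_zero_of_mulVec_eq_zero hd h1
      exact w.ext_elem fun i => by simpa using congrFun h2 i
    have hbij : Function.Bijective T := by
      refine ⟨hinj, (LinearMap.injective_iff_surjective_of_finrank_eq_finrank ?_).1 hinj⟩
      rw [Module.finrank_eq_card_basis w]; simp
    refine ⟨Basis.ofEquivFun (LinearEquiv.ofBijective T hbij), ?_, ?_⟩
    · funext i
      ext x
      simp [hT]
    · have hco : (Basis.ofEquivFun (LinearEquiv.ofBijective T hbij)).coord = (G ψ).2 := by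
        funext i
        ext x
        simp [hT]
      have h3 := hfG ψ hψ
      refine ⟨Matrix.det_vandermonde_ne_zero_iff.1 hv, fun i => one_ne_zero, ?_, ?_⟩
      · rw [hco, ← congrFun h3 0]; simp [hf]
      · rw [hco, ← congrFun h3 1]; simp [hf]

lemma exists_standard_diag (hn : 0 < dim W) {φ : PencilAmb W}
    (h : IsNonsingular (Span φ)) (hx : ¬ IsDegenerate (φ 1)) :
    ∃ (w : Basis (Fin (dim W)) ℂ W) (α : Fin (dim W) → ℂ),
      IsDiag (φ 0) (φ 1) w α 1 := by
  obtain ⟨w, α, c, hd⟩ := exists_isDiag_frame hn h hx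
  choose s hs using fun i => IsAlgClosed.exists_pow_nat_eq (c i)⁻¹ (n := 2) (by norm_num)
  have hs0 : ∀ i, s i ≠ 0 := fun i h0 => by
    have := hs i
    rw [h0] at this
    exact inv_ne_zero (hd.ne i) (by rw [← this]; norm_num)
  have := hd.rescale fun i => Units.mk0 (s i) (hs0 i)
  refine ⟨w.unitsSMul fun i => Units.mk0 (s i) (hs0 i), α, ?_⟩
  convert this using 1
  funext i
  simp [hs, hd.ne i]

lemma isOpen_isNonsingular (hn : 2 ≤ dim W) : IsOpen[(analytic (PencilAmb W)).top]
    {x | IsNonsingular (Span x)} := by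
  let _ := (analytic (PencilAmb W)).top
  rw [isOpen_iff_forall_mem_open]
  intro x hx
  obtain ⟨g, hg, hnd⟩ := exists_nondegenerate_mix hx
  obtain ⟨w, α, hd⟩ := exists_standard_diag (by omega) ((isNonsingular_frame_mix hg).2 hx) hnd
  obtain ⟨A, L, N, hN, hxN, -, -, h⟩ := exists_local_diag hd
  refine ⟨mixLin g ⁻¹' N, fun y hy => ?_, (analytic_isMorphism_linear (mixLin g)).isOpen_preimage hN,
    by rw [Set.mem_preimage, mixLin_apply]; exact hxN⟩
  obtain ⟨⟨w', -, hd'⟩, -⟩ := h _ hy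
  rw [mixLin_apply] at hd'
  exact (isNonsingular_frame_mix hg).1 (hd'.isNonsingular_frame hn)

end LocalDiagonalization


lemma FunSpace.Refines.to_induced {X A B C : Type*} {𝒜 : FunSpace A} {ℬ : FunSpace B} {i : X → A}
    {k : C → B} {j : X → C} (h : Refines 𝒜 i ℬ fun x => k (j x)) :
    Refines 𝒜 i (ℬ.induced k) j := by
  refine ⟨?_, ?_⟩
  · rintro _ ⟨V, hV, rfl⟩ x hx
    exact h.1 V hV x hx
  · rintro x G ⟨F, hF, U, hU, hxU, hGF⟩
    obtain ⟨F', hF', O, hO, hxO, hFF'⟩ := h.2 x F hF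
    obtain ⟨O', hO', hxO', hsub⟩ := h.1 U hU x hxU
    exact ⟨F', hF', O ∩ O', 𝒜.isOpen_inter hO hO', ⟨hxO, hxO'⟩, fun x' hx' => by
      rw [hGF _ (hsub x' hx'.2), hFF' x' hx'.1]⟩

section FrameCharts

variable {W : Type*} [AddCommGroup W] [Module ℂ W] [Module.Finite ℂ W]

/-- The coordinates of an ambient pencil frame. -/
noncomputable def pencilCoord (W : Type*) [AddCommGroup W] [Module ℂ W] [Module.Finite ℂ W] :
    PencilAmb W ≃ₗ[ℂ] (Fin (Module.finrank ℂ (PencilAmb W)) → ℂ) :=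
  (finBasis ℂ (PencilAmb W)).equivFun

lemma isChartOn_pencilCoord (hn : 2 ≤ dim W) :
    IsChartOn (pencilFrameAn W) (fun a => pencilCoord W a.1) Set.univ := by
  refine isChartOn_of (@isOpen_univ _ (pencilFrameAn W).top) ?_ ?_ ?_ ?_
  · exact fun a _ b _ h => Subtype.ext ((pencilCoord W).injective h)
  · have e : (fun a : PencilFrame W => pencilCoord W a.1) '' Set.univ =
        (pencilCoord W).symm ⁻¹' {x | IsNonsingular (Span x)} := by
      ext y
      constructor
      · rintro ⟨a, -, rfl⟩
        simpa using a.2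
      · exact fun hy => ⟨⟨_, hy⟩, trivial, by simp⟩
    rw [e]
    exact (analytic_isMorphism_linear
      (pencilCoord W).symm.toLinearMap).isOpen_preimage (isOpen_isNonsingular hn)
  · exact Refines.of_isMorphism (analytic_isMorphism_linear
      (pencilCoord W).toLinearMap) fun _ => rfl
  · exact Refines.of_isMorphism (analytic_isMorphism_linear
      (pencilCoord W).symm.toLinearMap) fun a => (pencilCoord W).symm_apply_apply _

/-- The vectors `u, α(u), α²(u)`. -/
noncomputable def opPow (φ : Fin 2 → QuadraticForm ℂ W) (u : W) : Fin 3 → W :=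
  ![u, opVec (φ 0) (φ 1) u, opVec (φ 0) (φ 1) (opVec (φ 0) (φ 1) u)]

lemma IsDiag.opPow_eq {φ : Fin 2 → QuadraticForm ℂ W} {n : ℕ} {w : Basis (Fin n) ℂ W}
    {α c : Fin n → ℂ} (h : IsDiag (φ 0) (φ 1) w α c) (u : W) :
    opPow φ u = powVec w α (w.repr u) := by
  funext k
  refine w.ext_elem fun i => ?_
  rw [repr_powVec]
  fin_cases k
  · simp [opPow]
  · simp [opPow, h.repr_opVec]
  · simp [opPow, h.repr_opVec]; ring

lemma LocalSys.exists_diag {a₀ : PairFrame W} (S : LocalSys a₀) (hn : 4 ≤ dim W)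
    {φ : PencilAmb W} (hφ : IsNonsingular (Span φ))
    (h : ¬ IsDegenerate (mix S.g φ 1)) :
    ∃ (w : Basis (Fin (dim W)) ℂ W) (α c : Fin (dim W) → ℂ),
      IsDiag (mix S.g φ 0) (mix S.g φ 1) w α c :=
  exists_isDiag_frame (by omega) ((isNonsingular_frame_mix S.det_g).2 hφ) h

lemma LocalSys.mix_eq_opPow {a₀ : PairFrame W} (S : LocalSys a₀) (hn : 4 ≤ dim W)
    {a : PairFrame W} (ha : a ∈ S.O)
    (hp : IsPoised (Span a.1.1) (Span a.1.2)) :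
    mix (S.X a) a.1.2 = opPow (mix S.g a.1.1) (mix (S.X a) a.1.2 0) ∧ (S.X a).det ≠ 0 := by
  obtain ⟨w, α, c, hd⟩ := S.exists_diag hn a.2.1 (S.nondeg a ha)
  have h1 := (hd.isSys_iff _ _).1 ((S.poised_iff a ha).1 hp).1
  refine ⟨by rw [hd.opPow_eq]; exact h1, fun hX => ?_⟩
  have hli := linearIndependent_powVec (w := w) hd.inj hn ((hd.cyc_ne_zero_iff _).1 (S.cyc_ne a ha))
  rw [← h1] at hli
  obtain ⟨z, hz, hz'⟩ := Matrix.exists_vecMul_eq_zero_iff.2 hX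
  refine hz (funext fun k => Fintype.linearIndependent_iff.1 hli z ?_ k)
  simp only [mix, Finset.smul_sum, smul_smul]
  rw [sum_comm]
  refine Finset.sum_eq_zero fun l _ => ?_
  rw [← Finset.sum_smul]
  have := congrFun hz' l
  simp only [Matrix.vecMul, dotProduct, Pi.zero_apply] at this
  rw [this, zero_smul]

/-- The free entries of the coefficient matrix. -/
abbrev FreeEntries (j : Fin 3) : Type := {p : Fin 3 × Fin 3 // p ≠ (0, j)} → ℂ

/-- The matrix with given free entries and `1` at `(0, j)`. -/
noncomputable def freeMat (j : Fin 3) (h : FreeEntries j) : Mat₃ :=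
  Matrix.of fun i k => if hp : (i, k) ≠ (0, j) then h ⟨(i, k), hp⟩ else 1

lemma freeMat_entries (j : Fin 3) {X : Mat₃} (hX : X 0 j = 1) :
    freeMat j (fun p => X p.1.1 p.1.2) = X := by
  ext i k
  simp only [freeMat, Matrix.of_apply]
  split_ifs with h
  · rfl
  · rw [ne_eq, not_not, Prod.mk.injEq] at h
    rw [h.1, h.2, hX]

lemma entries_freeMat (j : Fin 3) (h : FreeEntries j) :
    (fun p : {p : Fin 3 × Fin 3 // p ≠ (0, j)} => freeMat j h p.1.1 p.1.2) = h := by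
  funext p
  simp only [freeMat, Matrix.of_apply]
  exact dif_pos p.2

lemma freeMat_self (j : Fin 3) (h : FreeEntries j) : freeMat j h 0 j = 1 := by
  simp [freeMat]

lemma FunSpace.IsRinged.regAt_freeMat {X : Type*} {𝒳 : FunSpace X} (hX : 𝒳.IsRinged) {x : X}
    {j : Fin 3} {h : X → FreeEntries j} (hh : 𝒳.RegMapAt h x) (i k : Fin 3) :
    𝒳.RegAt (fun y => freeMat j (h y) i k) x := by
  simp only [freeMat, Matrix.of_apply]
  split_ifs with hp
  · exact (hh.apply _).regAt
  · exact hX.const _ _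

/-- The space of parameters `(u, h)` of poised frames with given pencil. -/
abbrev FrameParam (W : Type*) (j : Fin 3) : Type _ := W × FreeEntries j

/-- The frame with given parameters. -/
noncomputable def frameOfParam (g : Mat₂) (j : Fin 3)
    (e : PencilAmb W × FrameParam W j) : PairAmb W :=
  (e.1, mix (freeMat j e.2.2)⁻¹ (opPow (mix g e.1) e.2.1))

lemma FunSpace.IsRinged.regMapAt_frameOfParam {X : Type*} {𝒳 : FunSpace X} (hX : 𝒳.IsRinged)
    {x : X} {g : Mat₂} {j : Fin 3} {e : X → PencilAmb W × FrameParam W j}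
    (he : 𝒳.RegMapAt e x) (hnd : ¬ IsDegenerate (mix g (e x).1 1))
    (hdet : (freeMat j (e x).2.2).det ≠ 0) :
    𝒳.RegMapAt (fun y => frameOfParam g j (e y)) x := by
  have h1 := he.map (LinearMap.fst ℂ _ _)
  have h2 := (he.map (LinearMap.snd ℂ _ _)).map (LinearMap.fst ℂ _ _)
  have h3 := (he.map (LinearMap.snd ℂ _ _)).map (LinearMap.snd ℂ _ _)
  have hg := hX.regMapAt_mix (M := fun _ => g) (fun _ _ => hX.const _ _) h1
  have ho : ∀ {u : X → W}, 𝒳.RegMapAt u x → 𝒳.RegMapAt (fun y =>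
      opVec (mix g (e y).1 0) (mix g (e y).1 1) (u y)) x := fun hu =>
    hX.regMapAt_opVec (hg.apply 0) (hg.apply 1) hnd hu
  refine hX.regMapAt_prod h1 (hX.regMapAt_mix (fun i k => hX.inv_apply _ _
    (fun i k => hX.regAt_freeMat h3 i k) hdet i k) (hX.regMapAt_pi fun k => ?_))
  fin_cases k
  · exact h2
  · exact ho h2
  · exact ho (ho h2)

lemma poisedFrame_isSubmersionAt (hn : 4 ≤ dim W) (a₀ : PoisedFrame W) :
    IsSubmersionAt (poisedFrameAn W) (pencilFrameAn W) poisedFrameProj a₀ := by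
  obtain ⟨S⟩ := exists_localSys hn a₀.1 a₀.2
  set F := FrameParam W S.j with hF
  set eF : F ≃ₗ[ℂ] (Fin (Module.finrank ℂ F) → ℂ) := (finBasis ℂ F).equivFun with heF
  set E := (Fin (Module.finrank ℂ (PencilAmb W)) → ℂ) × (Fin (Module.finrank ℂ F) → ℂ) with hE
  set 𝒬 : FunSpace (PairFrame W) := (analytic (PairAmb W)).induced Subtype.val with h𝒬
  have hri := analytic_isRinged (PairAmb W)
  have hid := regMapAt_analytic (PairAmb W)
  have hrE := analytic_isRinged E
  have hidE := regMapAt_analytic E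
  set cE : E ≃ₗ[ℂ] PencilAmb W × F := (pencilCoord W).symm.prodCongr eF.symm with hcE
  set par : PairFrame W → F := fun a => (mix (S.X a) a.1.2 0, fun p => S.X a p.1.1 p.1.2) with hpar
  set ψ : PairFrame W → E := fun a => (pencilCoord W a.1.1, eF (par a)) with hψ
  have hcψ : ∀ a, cE (ψ a) = (a.1.1, par a) := fun a =>
    Prod.ext ((pencilCoord W).symm_apply_apply _) (eF.symm_apply_apply _)
  have hrec : ∀ a ∈ S.O,
      IsPoised (Span a.1.1) (Span a.1.2) →
      freeMat S.j (par a).2 = S.X a ∧ frameOfParam S.g S.j (a.1.1, par a) = a.1 := by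
    intro a ha hp
    have h1 : freeMat S.j (par a).2 = S.X a := freeMat_entries _ ((S.poised_iff a ha).1 hp).2
    refine ⟨h1, ?_⟩
    obtain ⟨h2, h3⟩ := S.mix_eq_opPow hn ha hp
    rw [frameOfParam]
    refine Prod.ext rfl ?_
    change mix (freeMat S.j (par a).2)⁻¹ (opPow (mix S.g a.1.1) (mix (S.X a) a.1.2 0)) = a.1.2
    rw [h1, ← h2, ← mix_mul, Matrix.nonsing_inv_mul _ (isUnit_iff_ne_zero.2 h3), mix_one]
  have hpa : poisedFrameAn W = 𝒬.induced Subtype.val :=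
    (induced_induced _ _ _).symm
  refine ⟨_, _, fun a => ψ a.1, fun a => pencilCoord W a.1, {a | a.1 ∈ S.O}, Set.univ, S.mem, ?_,
    isChartOn_pencilCoord (by omega), fun _ _ => trivial, fun _ _ => rfl⟩
  rw [hpa]
  refine isChartOn_of ?_ ?_ ?_ ?_ ?_
  · exact ⟨S.O, S.isOpen _ hri hid, rfl⟩
  · intro a ha b hb hab
    have h1 := congrArg cE hab
    simp only [hcψ] at h1
    exact Subtype.ext (Subtype.ext (by
      rw [← (hrec a.1 ha a.2).2, ← (hrec b.1 hb b.2).2, h1]))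
  · obtain ⟨O', hO', hOO'⟩ := S.isOpen _ hri hid
    set D : Set E := {e | ((e ∈ cE ⁻¹' (Prod.fst ⁻¹'
        {x | IsNonsingular (Span x)}) ∧
      (gram (mix S.g (cE e).1 1)).det ≠ 0) ∧ (freeMat S.j (cE e).2.2).det ≠ 0) ∧
      cyc (mix S.g (cE e).1 0) (mix S.g (cE e).1 1) (cE e).2.1 ≠ 0} with hD
    have hc := fun e => (hidE e).map (cE : E →ₗ[ℂ] PencilAmb W × F)
    have hg := fun e => hrE.regMapAt_mix (M := fun _ => S.g) (fun _ _ => hrE.const _ _)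
      ((hc e).map (LinearMap.fst ℂ _ _))
    have hDo : IsOpen[(analytic E).top] D := by
      refine hrE.isOpen_ne_zero (hrE.isOpen_ne_zero (hrE.isOpen_ne_zero
        ((analytic_isMorphism_linear ((LinearMap.fst ℂ (PencilAmb W) F).comp
          (cE : E →ₗ[ℂ] PencilAmb W × F))).isOpen_preimage (isOpen_isNonsingular (by omega)))
        fun e _ => ?_) fun e _ => ?_) fun e he => ?_
      · exact hrE.regAt_det_gram ((hg e).apply 1)
      · exact hrE.det _ _ fun i k => hrE.regAt_freeMat
          (((hc e).map (LinearMap.snd ℂ _ _)).map (LinearMap.snd ℂ _ _)) i k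
      · exact hrE.regAt_cyc ((hg e).apply 0) ((hg e).apply 1)
          (fun h => he.1.2 ((isDegenerate_iff_det_gram _).1 h))
          (((hc e).map (LinearMap.snd ℂ _ _)).map (LinearMap.fst ℂ _ _))
    have e : (fun a : PoisedFrame W => ψ a.1) '' {a | a.1 ∈ S.O} =
        {e | e ∈ D ∧ frameOfParam S.g S.j (cE e) ∈ O'} := by
      ext e
      constructor
      · rintro ⟨a, ha, rfl⟩
        have ha' : a.1 ∈ S.O := ha
        refine ⟨⟨⟨⟨?_, ?_⟩, ?_⟩, ?_⟩, ?_⟩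
        · simp only [Set.mem_preimage, hcψ]; exact a.1.2.1
        · simp only [hcψ]
          exact fun h => S.nondeg a.1 ha' ((isDegenerate_iff_det_gram _).2 h)
        · simp only [hcψ]
          rw [(hrec a.1 ha' a.2).1]
          exact (S.mix_eq_opPow hn ha' a.2).2
        · simp only [hcψ]; exact S.cyc_ne a.1 ha'
        · simp only [hcψ]
          rw [(hrec a.1 ha' a.2).2]
          rw [← hOO'] at ha'
          exact ha'
      · rintro ⟨⟨⟨⟨h1, h2⟩, h3⟩, h4⟩, h5⟩
        simp only [Set.mem_preimage] at h1
        have hnd : ¬ IsDegenerate (mix S.g (cE e).1 1) :=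
          fun h => h2 ((isDegenerate_iff_det_gram _).1 h)
        obtain ⟨w, α, c, hd⟩ := S.exists_diag hn h1 hnd
        set φ := (cE e).1 with hφ
        set u := (cE e).2.1 with hu
        set X := freeMat S.j (cE e).2.2 with hX
        have hXu := isUnit_iff_ne_zero.2 h3
        have hu0 := (hd.cyc_ne_zero_iff _).1 h4
        have hv : frameOfParam S.g S.j (cE e) = (φ, mix X⁻¹ (powVec w α (w.repr u))) := by
          rw [frameOfParam, hd.opPow_eq]
        have hspan : Span (mix X⁻¹ (powVec w α (w.repr u))) =
            Span (powVec w α (w.repr u)) := span_mix (by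
          rw [Matrix.det_nonsing_inv, Ring.inverse_eq_inv']
          exact inv_ne_zero h3) _
        let a : PairFrame W := ⟨(φ, mix X⁻¹ (powVec w α (w.repr u))), h1, by
          change Module.finrank ℂ (Span (mix X⁻¹ _)) = 3
          rw [hspan, finrank_span_eq_card (linearIndependent_powVec hd.inj hn hu0),
            Fintype.card_fin]⟩
        have hp : IsPoised (Span a.1.1)
            (Span a.1.2) :=
          (isPoised_frame_iff (by omega) S.det_g hd).2 ⟨_, hu0, hspan⟩
        have haO : a ∈ S.O := by
          rw [← hOO']; rw [hv] at h5; exact h5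
        have hmix : mix X a.1.2 = powVec w α (w.repr u) := by
          change mix X (mix X⁻¹ _) = _
          rw [← mix_mul, Matrix.mul_nonsing_inv _ hXu, mix_one]
        have h0 : mix X a.1.2 0 = u := by
          rw [hmix]; refine w.ext_elem fun i => ?_
          rw [repr_powVec]; simp
        have hXa : X = S.X a := S.unique a haO X ((hd.isSys_iff _ _).2 (by rw [h0, hmix]))
          (freeMat_self _ _)
        refine ⟨⟨a, hp⟩, haO, cE.injective ?_⟩
        change cE (ψ a) = cE e
        rw [hcψ]
        refine Prod.ext rfl (Prod.ext ?_ ?_)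
        · change mix (S.X a) a.1.2 0 = u
          rw [← hXa, h0]
        · change (fun p : {p : Fin 3 × Fin 3 // p ≠ (0, S.j)} => S.X a p.1.1 p.1.2) = (cE e).2.2
          rw [← hXa]; exact entries_freeMat _ _
    rw [e]
    let _ := (analytic E).top
    rw [isOpen_iff_forall_mem_open]
    rintro x ⟨hx, hxO⟩
    obtain ⟨V, hV, hxV, hVO⟩ := (isAnalytic_analytic E).exists_isOpen
      (hrE.regMapAt_frameOfParam (hc x) (fun h => hx.1.1.2 ((isDegenerate_iff_det_gram _).1 h))
        hx.1.2) hO' hxO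
    exact ⟨D ∩ V, fun y hy => ⟨hy.1, hVO y hy.2⟩, hDo.inter hV, hx, hxV⟩
  · refine Refines.analytic_of ((isAnalytic_analytic _).induced _) ψ
      (fun _ => rfl) fun a => ?_
    have hR := hri.induced (Subtype.val : PairFrame W → PairAmb W)
    have h0 : 𝒬.RegMapAt (fun b : PairFrame W => b.1) a.1.1 :=
      (hid a.1.1.1).induced (i := Subtype.val)
    have hp : 𝒬.RegMapAt par a.1.1 := hR.regMapAt_prod ((S.regMapAt hri hid a.2).2.apply 0)
      (hR.regMapAt_pi fun p => hR.regMapAt (S.regAt _ hri hid _ a.2 _ _))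
    exact hR.regMapAt_prod ((h0.map (LinearMap.fst ℂ _ _)).map (pencilCoord W).toLinearMap)
      (hp.map eF.toLinearMap)
  · refine Refines.to_induced (Refines.analytic_of
      (isAnalytic_analytic E) (fun e => frameOfParam S.g S.j (cE e)) (fun a => ?_)
      fun a => ?_)
    · rw [hcψ]; exact (hrec a.1.1 a.2 a.1.2).2
    · refine hrE.regMapAt_frameOfParam ((hidE _).map (cE : E →ₗ[ℂ] PencilAmb W × F)) ?_ ?_
      · rw [hcψ]; exact S.nondeg _ a.2
      · rw [hcψ, (hrec a.1.1 a.2 a.1.2).1]; exact (S.mix_eq_opPow hn a.2 a.1.2).2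

lemma isOrbitSubmersion_p₁ (hn : 4 ≤ dim W) :
    IsOrbitSubmersion (poisedFrameAn W) (pencilFrameAn W) frameToCorr frameToModuli
      poisedFrameProj p₁ :=
  ⟨frameToCorr_surjective, frameToModuli_surjective, fun _ => rfl, poisedFrame_isSubmersionAt hn⟩

end FrameCharts


/-- Labels of the degenerate elements of a pencil used to write down invariants. -/
structure Marking (n : ℕ) where
  o : Fin n
  p : Fin n
  q : Fin n
  op : o ≠ p
  oq : o ≠ q
  pq : p ≠ q
  k : Fin n → Fin n
  l : Fin n → Fin n
  ko : ∀ i, k i ≠ o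
  lo : ∀ i, l i ≠ o
  ki : ∀ i, k i ≠ i
  li : ∀ i, l i ≠ i
  kl : ∀ i, k i ≠ l i

lemma exists_marking {n : ℕ} (hn : 4 ≤ n) : Nonempty (Marking n) := by
  have h : ∀ i : Fin n, ∃ kl : Fin n × Fin n, kl.1 ≠ ⟨0, by omega⟩ ∧ kl.2 ≠ ⟨0, by omega⟩ ∧
      kl.1 ≠ i ∧ kl.2 ≠ i ∧ kl.1 ≠ kl.2 := by
    intro i
    by_cases h1 : i = ⟨1, by omega⟩
    · exact ⟨(⟨2, by omega⟩, ⟨3, by omega⟩), by simp [h1]⟩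
    · by_cases h2 : i = ⟨2, by omega⟩
      · exact ⟨(⟨1, by omega⟩, ⟨3, by omega⟩), by simp [h2]⟩
      · exact ⟨(⟨1, by omega⟩, ⟨2, by omega⟩), by simp [Ne.symm h1, Ne.symm h2]⟩
  choose kl h1 h2 h3 h4 h5 using h
  exact ⟨⟨⟨0, by omega⟩, ⟨1, by omega⟩, ⟨2, by omega⟩, by simp, by simp, by simp,
    fun i => (kl i).1, fun i => (kl i).2, h1, h2, h3, h4, h5⟩⟩

section Moebius

variable {n : ℕ} (μ : Marking n)

/-- The cross ratios of the marked points `αᵢ`. -/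
noncomputable def kap (α : Fin n → ℂ) (i : Fin n) : ℂ :=
  (α i - α μ.o) * (α μ.p - α μ.q) / ((α i - α μ.q) * (α μ.p - α μ.o))

lemma mob_det_ne_zero_inj {α : Fin n → ℂ} (hα : Injective α)
    {g : Mat₂} (hg : g.det ≠ 0) (hd : ∀ i, mobDen g (α i) ≠ 0) :
    Injective fun i => mob g (α i) := by
  intro i j hij
  have h := mob_sub (hd i) (hd j)
  rw [show mob g (α i) = mob g (α j) from hij, sub_self] at h
  have h2 := (div_eq_zero_iff.1 h.symm).resolve_right (mul_ne_zero (hd i) (hd j))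
  exact hα (sub_eq_zero.1 ((mul_eq_zero.1 h2).resolve_left hg))

lemma kap_mob (α : Fin n → ℂ) {g : Mat₂} (hg : g.det ≠ 0)
    (hd : ∀ i, mobDen g (α i) ≠ 0) : kap μ (fun i => mob g (α i)) = kap μ α := by
  funext i
  have hi := hd i
  have ho := hd μ.o
  have hp := hd μ.p
  have hq := hd μ.q
  simp only [kap, mob_sub hi ho, mob_sub hp hq, mob_sub hi hq, mob_sub hp ho]
  by_cases h1 : α i - α μ.q = 0
  · simp [h1]
  by_cases h2 : α μ.p - α μ.o = 0
  · simp [h2]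
  field_simp

lemma mob_eq_of_mulVec {g : Mat₂} {t t' s : ℂ} (hs : s ≠ 0)
    (h0 : g 0 0 * t + g 0 1 = s * t') (h1 : g 1 0 * t + g 1 1 = s) :
    mobDen g t ≠ 0 ∧ mob g t = t' := by
  have hd : mobDen g t = s := h1
  refine ⟨hd ▸ hs, ?_⟩
  have := mob_mul_mobDen (g := g) (t := t) (hd ▸ hs)
  rw [hd, h0] at this
  exact mul_right_cancel₀ hs (this.trans (mul_comm _ _))

lemma exists_mob_of_kap_eq {α α' : Fin n → ℂ} (hα : Injective α)
    (hα' : Injective α') (h : ∀ i, i ≠ μ.o → i ≠ μ.p → i ≠ μ.q → kap μ α i = kap μ α' i) :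
    ∃ g : Mat₂, g.det ≠ 0 ∧ ∀ i, mobDen g (α i) ≠ 0 ∧ mob g (α i) = α' i := by
  have ne : ∀ {i j}, i ≠ j → α i - α j ≠ 0 := fun hij => sub_ne_zero.2 fun e => hij (hα e)
  have ne' : ∀ {i j}, i ≠ j → α' i - α' j ≠ 0 := fun hij => sub_ne_zero.2 fun e => hij (hα' e)
  have op := ne μ.op; have oq := ne μ.oq; have pq := ne μ.pq; have po := ne μ.op.symm
  have op' := ne' μ.op; have oq' := ne' μ.oq; have pq' := ne' μ.pq; have po' := ne' μ.op.symm
  set o := α μ.o; set p := α μ.p; set q := α μ.q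
  set o' := α' μ.o; set p' := α' μ.p; set q' := α' μ.q
  set M : Mat₂ := !![p - q, -o * (p - q); p - o, -q * (p - o)]
  set M' : Mat₂ := !![-q' * (p' - o'), o' * (p' - q'); -(p' - o'), p' - q']
  have hM : M.det ≠ 0 := by
    have : M.det = (p - q) * (p - o) * (o - q) := by simp [M, Matrix.det_fin_two]; ring
    rw [this]; exact mul_ne_zero (mul_ne_zero pq po) oq
  have hd' : (p' - q') * (p' - o') * (o' - q') ≠ 0 := mul_ne_zero (mul_ne_zero pq' po') oq'
  have hM' : M'.det ≠ 0 := by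
    have : M'.det = (p' - q') * (p' - o') * (o' - q') := by simp [M', Matrix.det_fin_two]; ring
    rw [this]; exact hd'
  refine ⟨M' * M, by rw [Matrix.det_mul]; exact mul_ne_zero hM' hM, fun i => ?_⟩
  suffices hs : ∃ s : ℂ, s ≠ 0 ∧ (α i - o) * (p - q) = s * ((α' i - o') * (p' - q')) ∧
      (α i - q) * (p - o) = s * ((α' i - q') * (p' - o')) by
    obtain ⟨s, hs, h1, h2⟩ := hs
    refine mob_eq_of_mulVec (s := s * ((p' - q') * (p' - o') * (o' - q'))) (mul_ne_zero hs hd') ?_ ?_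
    · simp [M, M', Matrix.mul_apply, Fin.sum_univ_two]
      linear_combination (-q' * (p' - o')) * h1 + o' * (p' - q') * h2
    · simp [M, M', Matrix.mul_apply, Fin.sum_univ_two]
      linear_combination (- (p' - o')) * h1 + (p' - q') * h2
  by_cases hio : i = μ.o
  · refine ⟨(o - q) * (p - o) / ((o' - q') * (p' - o')),
      div_ne_zero (mul_ne_zero oq po) (mul_ne_zero oq' po'), ?_, ?_⟩
    · simp [hio, o, o']
    · rw [hio, div_mul_cancel₀ _ (mul_ne_zero oq' po')]
  by_cases hiq : i = μ.q
  · have qo : q - o ≠ 0 := ne μ.oq.symm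
    have qo' : q' - o' ≠ 0 := ne' μ.oq.symm
    refine ⟨(q - o) * (p - q) / ((q' - o') * (p' - q')),
      div_ne_zero (mul_ne_zero qo pq) (mul_ne_zero qo' pq'), ?_, ?_⟩
    · rw [hiq, div_mul_cancel₀ _ (mul_ne_zero qo' pq')]
    · simp [hiq, q, q']
  have iq := ne hiq
  have iq' := ne' hiq
  have hk : (α i - o) * (p - q) / ((α i - q) * (p - o)) =
      (α' i - o') * (p' - q') / ((α' i - q') * (p' - o')) := by
    by_cases hip : i = μ.p
    · subst hip
      rw [div_eq_one_iff_eq (mul_ne_zero pq po) |>.2 (mul_comm _ _),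
        div_eq_one_iff_eq (mul_ne_zero pq' po') |>.2 (mul_comm _ _)]
    · exact h i hio hip hiq
  refine ⟨(α i - q) * (p - o) / ((α' i - q') * (p' - o')),
    div_ne_zero (mul_ne_zero iq po) (mul_ne_zero iq' po'), ?_, ?_⟩
  · rw [div_eq_div_iff (mul_ne_zero iq po) (mul_ne_zero iq' po')] at hk
    rw [div_mul_eq_mul_div, eq_div_iff (mul_ne_zero iq' po')]
    linear_combination hk
  · rw [div_mul_cancel₀ _ (mul_ne_zero iq' po')]

/-- The determinant of the sum of three of the matrices `m`. -/
def detThree (m : Fin n → Mat₃) (i k l : Fin n) : ℂ := (m i + m k + m l).det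

/-- The rank one matrices with entries `cᵢ zᵢₐ zᵢᵦ`. -/
def rankOne (c : Fin n → ℂ) (z : Fin n → Fin 3 → ℂ) (i : Fin n) : Mat₃ :=
  Matrix.of fun a b => c i * (z i a * z i b)

lemma detThree_rankOne (c : Fin n → ℂ) (z : Fin n → Fin 3 → ℂ) (i k l : Fin n) :
    detThree (rankOne c z) i k l = c i * c k * c l * (Matrix.of ![z i, z k, z l]).det ^ 2 := by
  simp only [detThree, rankOne, Matrix.det_fin_three, Matrix.add_apply, Matrix.of_apply,
    Matrix.cons_val_zero, Matrix.cons_val_one, Matrix.cons_val]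
  ring

/-- The denominators of the invariants `wgt`. -/
def wgtDen (α : Fin n → ℂ) (m : Fin n → Mat₃) (i : Fin n) : ℂ :=
  detThree m μ.o (μ.k i) (μ.l i) * (α μ.o - α (μ.k i))

/-- Invariants of a marked pair `(Φ, P)` with degenerate elements `αᵢ` and rank one matrices
`mᵢ`. -/
noncomputable def wgt (α : Fin n → ℂ) (m : Fin n → Mat₃) (i : Fin n) : ℂ :=
  detThree m i (μ.k i) (μ.l i) * (α i - α (μ.k i)) / wgtDen μ α m i

lemma wgt_mob (α : Fin n → ℂ) (c : Fin n → ℂ) (z : Fin n → Fin 3 → ℂ)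
    {g : Mat₂} (hg : g.det ≠ 0) (hd : ∀ i, mobDen g (α i) ≠ 0)
    {h : Mat₃} (hh : h.det ≠ 0) (i : Fin n) :
    wgtDen μ (fun i => mob g (α i)) (rankOne (fun i => mobDen g (α i) * c i)
      fun i => h.mulVec (z i)) i = h.det ^ 2 * g.det * mobDen g (α (μ.l i)) *
        wgtDen μ α (rankOne c z) i ∧
    wgt μ (fun i => mob g (α i)) (rankOne (fun i => mobDen g (α i) * c i)
      fun i => h.mulVec (z i)) i = wgt μ α (rankOne c z) i := by
  have hz : ∀ i k l, (Matrix.of ![h.mulVec (z i), h.mulVec (z k), h.mulVec (z l)]).det =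
      h.det * (Matrix.of ![z i, z k, z l]).det := by
    intro i k l
    have : Matrix.of ![h.mulVec (z i), h.mulVec (z k), h.mulVec (z l)] =
        Matrix.of ![z i, z k, z l] * h.transpose := by
      ext a b
      fin_cases a <;> simp [Matrix.mul_apply, Matrix.mulVec, dotProduct, mul_comm]
    rw [this, Matrix.det_mul, Matrix.det_transpose, mul_comm]
  have hn : ∀ j, detThree (rankOne (fun i => mobDen g (α i) * c i) fun i => h.mulVec (z i)) j
      (μ.k i) (μ.l i) * (mob g (α j) - mob g (α (μ.k i))) =
      h.det ^ 2 * g.det * mobDen g (α (μ.l i)) *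
        (detThree (rankOne c z) j (μ.k i) (μ.l i) * (α j - α (μ.k i))) := by
    intro j
    rw [detThree_rankOne, detThree_rankOne, hz, mob_sub (hd _) (hd _)]
    have := hd j; have := hd (μ.k i)
    field_simp
  have h1 : wgtDen μ (fun i => mob g (α i)) (rankOne (fun i => mobDen g (α i) * c i)
      fun i => h.mulVec (z i)) i = h.det ^ 2 * g.det * mobDen g (α (μ.l i)) *
        wgtDen μ α (rankOne c z) i := hn _
  refine ⟨h1, ?_⟩
  rw [wgt, h1, hn, wgt, mul_div_mul_left]
  exact mul_ne_zero (mul_ne_zero (pow_ne_zero _ hh) hg) (hd _)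

/-- The vectors `(1, αᵢ, αᵢ²)`. -/
def vanVec (α : Fin n → ℂ) (i : Fin n) : Fin 3 → ℂ := fun a => α i ^ (a : ℕ)

/-- The value of the invariants `wgt` at a normal form with all weights equal to one. -/
noncomputable def wgtOne (α : Fin n → ℂ) (i : Fin n) : ℂ :=
  (α (μ.k i) - α i) ^ 2 * (α (μ.l i) - α i) ^ 2 * (α i - α (μ.k i)) /
    ((α (μ.k i) - α μ.o) ^ 2 * (α (μ.l i) - α μ.o) ^ 2 * (α μ.o - α (μ.k i)))

lemma det_vanVec (α : Fin n → ℂ) (i k l : Fin n) :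
    (Matrix.of ![vanVec α i, vanVec α k, vanVec α l]).det =
      (α k - α i) * (α l - α i) * (α l - α k) := by
  simp [Matrix.det_fin_three, vanVec]; ring

variable {α : Fin n → ℂ} (hα : Injective α)
include hα

lemma wgtOne_ne_zero (i : Fin n) : wgtOne μ α i ≠ 0 := by
  have ne : ∀ {i j}, i ≠ j → α i - α j ≠ 0 := fun hij => sub_ne_zero.2 fun e => hij (hα e)
  have h1 := ne (μ.ki i); have h2 := ne (μ.li i); have h3 := ne (μ.ki i).symm
  have h4 := ne (μ.ko i); have h5 := ne (μ.lo i); have h6 := ne (μ.ko i).symm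
  rw [wgtOne]
  positivity

lemma wgtDen_normal {c : Fin n → ℂ} (hc : ∀ i, c i ≠ 0) (i : Fin n) :
    wgtDen μ α (rankOne c (vanVec α)) i ≠ 0 := by
  have ne : ∀ {i j}, i ≠ j → α i - α j ≠ 0 := fun hij => sub_ne_zero.2 fun e => hij (hα e)
  have h4 := ne (μ.ko i); have h5 := ne (μ.lo i); have h6 := ne (μ.ko i).symm
  have h7 := ne (μ.kl i).symm
  have := hc (μ.k i); have := hc (μ.l i); have := hc μ.o
  rw [wgtDen, detThree_rankOne, det_vanVec]
  positivity

lemma wgt_normal {c : Fin n → ℂ} (hc : ∀ i, c i ≠ 0) (i : Fin n) :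
    wgt μ α (rankOne c (vanVec α)) i = c i / c μ.o * wgtOne μ α i := by
  have ne : ∀ {i j}, i ≠ j → α i - α j ≠ 0 := fun hij => sub_ne_zero.2 fun e => hij (hα e)
  have h4 := ne (μ.ko i); have h5 := ne (μ.lo i); have h6 := ne (μ.ko i).symm
  have h7 := ne (μ.kl i).symm
  have := hc (μ.k i); have := hc (μ.l i); have := hc μ.o
  rw [wgt, wgtDen, wgtOne, detThree_rankOne, detThree_rankOne, det_vanVec, det_vanVec]
  field_simp

lemma wgtOne_mob {g : Mat₂} (hg : g.det ≠ 0)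
    (hd : ∀ i, mobDen g (α i) ≠ 0) (i : Fin n) :
    wgtOne μ (fun i => mob g (α i)) i * mobDen g (α i) ^ 5 =
      wgtOne μ α i * mobDen g (α μ.o) ^ 5 := by
  have ne : ∀ {i j}, i ≠ j → α i - α j ≠ 0 := fun hij => sub_ne_zero.2 fun e => hij (hα e)
  have h4 := ne (μ.ko i); have h5 := ne (μ.lo i); have h6 := ne (μ.ko i).symm
  have e1 := hd i; have e2 := hd μ.o; have e3 := hd (μ.k i); have e4 := hd (μ.l i)
  simp only [wgtOne, mob_sub (hd _) (hd _)]
  field_simp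

end Moebius


section Labels

variable {W : Type*} [AddCommGroup W] [Module ℂ W] [Module.Finite ℂ W]

/-- `α` lists the degenerate elements of a pencil in the class `x`, in a suitable coordinate of the
pencil. -/
def IsLabM (x : Moduli W) (α : Fin (dim W) → ℂ) : Prop :=
  ∃ (a : PencilFrame W) (w : Basis (Fin (dim W)) ℂ W)
    (c : Fin (dim W) → ℂ),
    frameToModuli a = x ∧ IsDiag (a.1 0) (a.1 1) w α c

/-- `(α, m)` are the labelled data of a frame in the class `x`: the degenerate elements of the
pencil, and the restrictions to `P` of the corresponding squares of linear forms. -/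
def IsLab (x : RefinedModuli W) (α : Fin (dim W) → ℂ)
    (m : Fin (dim W) → Mat₃) : Prop :=
  ∃ (a : PairFrame W) (w : Basis (Fin (dim W)) ℂ W)
    (c : Fin (dim W) → ℂ), frameToRefined a = x ∧
    IsDiag (a.1.1 0) (a.1.1 1) w α c ∧ m = rankOne c fun i k => w.repr (a.1.2 k) i

lemma IsLab.isLabM {x : RefinedModuli W} {α m} (h : IsLab x α m) : IsLabM (forget x) α := by
  obtain ⟨a, w, c, rfl, hd, -⟩ := h
  exact ⟨⟨a.1.1, a.2.1⟩, w, c, rfl, hd⟩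

lemma IsLabM.inj {x : Moduli W} {α} (h : IsLabM x α) : Injective α := by
  obtain ⟨a, w, c, -, hd⟩ := h
  exact hd.inj

lemma pullback_refl_apply (φ : QuadraticForm ℂ W) : pullback (LinearEquiv.refl ℂ W) φ = φ := by
  rw [pullback_refl]; rfl

lemma isLabM_of_diag (hn : 2 ≤ dim W) (a : PencilFrame W)
    {g : Mat₂} (hg : g.det ≠ 0)
    {w : Basis (Fin (dim W)) ℂ W} {α c : Fin (dim W) → ℂ}
    (h : IsDiag (mix g a.1 0) (mix g a.1 1) w α c) : IsLabM (frameToModuli a) α := by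
  refine ⟨pencilFrameAct hn hg (LinearEquiv.refl ℂ W) a, w, c, frameToModuli_act _ _ _ _, ?_⟩
  simpa [pencilFrameAct, pencilAct_apply, pullback_refl_apply] using h

lemma isLab_of_diag (hn : 2 ≤ dim W) (a : PairFrame W)
    {g : Mat₂} (hg : g.det ≠ 0)
    {w : Basis (Fin (dim W)) ℂ W} {α c : Fin (dim W) → ℂ}
    (h : IsDiag (mix g a.1.1 0) (mix g a.1.1 1) w α c) :
    IsLab (frameToRefined a) α (rankOne c fun i k => w.repr (a.1.2 k) i) := by
  refine ⟨pairFrameAct hn hg (h := 1) (by simp) (LinearEquiv.refl ℂ W) a, w, c,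
    frameToRefined_act _ _ _ _ _, ?_, ?_⟩
  · simpa [pairFrameAct, pairAct, pencilAct_apply, pullback_refl_apply] using h
  · simp [pairFrameAct, pairAct, vecAct_apply, mix_one]

lemma IsLabM.unique (hn : 2 ≤ dim W) {x : Moduli W} {α α'}
    (h : IsLabM x α) (h' : IsLabM x α') :
    ∃ (π : Perm (Fin (dim W))) (g : Mat₂), g.det ≠ 0 ∧
      (∀ i, mobDen g (α (π i)) ≠ 0) ∧ α' = fun i => mob g (α (π i)) := by
  obtain ⟨a, w, c, rfl, hd⟩ := h
  obtain ⟨a', w', c', ha', hd'⟩ := h'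
  obtain ⟨g, hg, T, rfl⟩ := frameToModuli_eq hn ha'.symm
  have h1 := hd.pullback T
  have e : ∀ k, (pencilFrameAct hn hg T a).1 k =
      mix g ![pullback T (a.1 0), pullback T (a.1 1)] k := by
    intro k
    change pencilAct g T a.1 k = _
    rw [pencilAct_apply]
    simp [mix, Fin.sum_univ_two]
  rw [e, e] at hd'
  obtain ⟨hden, h2⟩ := h1.mix_diag hg hd'.not_isDegenerate
  obtain ⟨π, s, hs, hα, -⟩ := h2.unique hd'
  exact ⟨π, g, hg, fun i => hden _, funext hα⟩

lemma IsLab.unique (hn : 2 ≤ dim W) {x : RefinedModuli W} {α m α' m'}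
    (h : IsLab x α m) (h' : IsLab x α' m') :
    ∃ (π : Perm (Fin (dim W))) (g : Mat₂)
      (k : Mat₃) (c : Fin (dim W) → ℂ)
      (z : Fin (dim W) → Fin 3 → ℂ), g.det ≠ 0 ∧ k.det ≠ 0 ∧
      (∀ i, mobDen g (α (π i)) ≠ 0) ∧ (α' = fun i => mob g (α (π i))) ∧
      (fun i => m (π i)) = rankOne c z ∧
      m' = rankOne (fun i => mobDen g (α (π i)) * c i) fun i => k.mulVec (z i) := by
  obtain ⟨a, w, c, rfl, hd, rfl⟩ := h
  obtain ⟨a', w', c', ha', hd', rfl⟩ := h'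
  obtain ⟨g, k, hg, hk, T, rfl⟩ := frameToRefined_eq hn ha'.symm
  have h1 := hd.pullback T
  have e : ∀ r, (pairFrameAct hn hg hk T a).1.1 r =
      mix g ![pullback T (a.1.1 0), pullback T (a.1.1 1)] r := by
    intro r
    change pencilAct g T a.1.1 r = _
    rw [pencilAct_apply]
    simp [mix, Fin.sum_univ_two]
  rw [e, e] at hd'
  obtain ⟨hden, h2⟩ := h1.mix_diag hg hd'.not_isDegenerate
  obtain ⟨π, s, hs, hα, hc, hr⟩ := h2.unique hd'
  refine ⟨π, g, k, fun i => c (π i), fun i r => w.repr (a.1.2 r) (π i), hg, hk,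
    fun i => hden _, funext hα, rfl, ?_⟩
  have hv : ∀ r i, s i * w'.repr ((pairFrameAct hn hg hk T a).1.2 r) i =
      k.mulVec (fun r => w.repr (a.1.2 r) (π i)) r := by
    intro r i
    rw [← hr]
    change (w.map T.symm).repr (vecAct k T a.1.2 r) (π i) = _
    rw [vecAct_apply]
    simp [mix, Matrix.mulVec, dotProduct, Fin.sum_univ_three]
  funext i
  ext r r'
  simp only [rankOne, Matrix.of_apply, ← hv, hc]
  ring

lemma IsLab.unique_invariants (hn : 2 ≤ dim W) (μ : Marking (dim W))
    {x : RefinedModuli W} {α m α' m'} (h : IsLab x α m) (h' : IsLab x α' m') :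
    ∃ π : Perm (Fin (dim W)), kap μ α' = kap μ (fun i => α (π i)) ∧
      wgt μ α' m' = wgt μ (fun i => α (π i)) (fun i => m (π i)) ∧
      ∀ i, wgtDen μ α' m' i ≠ 0 ↔ wgtDen μ (fun i => α (π i)) (fun i => m (π i)) i ≠ 0 := by
  obtain ⟨π, g, k, c, z, hg, hk, hd, rfl, hm, rfl⟩ := h.unique hn h'
  have h1 := wgt_mob μ (fun i => α (π i)) c z hg hd hk
  refine ⟨π, kap_mob μ _ hg hd, ?_, fun i => ?_⟩
  · rw [hm]; exact funext fun i => (h1 i).2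
  · rw [hm, (h1 i).1]
    have := hd (μ.l i)
    simp [hg, hk, this]

lemma IsLab.perm {x : RefinedModuli W} {α m} (h : IsLab x α m)
    (π : Perm (Fin (dim W))) :
    IsLab x (fun i => α (π i)) fun i => m (π i) := by
  obtain ⟨a, w, c, rfl, hd, rfl⟩ := h
  refine ⟨a, w.reindex π.symm, fun i => c (π i), rfl, ⟨hd.inj.comp π.injective,
    fun i => hd.ne _, ?_, ?_⟩, ?_⟩
  · rw [hd.fst]; ext x
    simp only [sumSq_apply]
    rw [← Equiv.sum_comp π]
    simp
  · rw [hd.snd]; ext x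
    simp only [sumSq_apply]
    rw [← Equiv.sum_comp π]
    simp
  · funext i; ext r r'; simp [rankOne]

end Labels

section NormalForms

variable {W : Type*} [AddCommGroup W] [Module ℂ W] [Module.Finite ℂ W]

/-- The parameters `(α, c)` of normal forms. -/
abbrev NormalParam (n : ℕ) : Type :=
  {p : (Fin n → ℂ) × (Fin n → ℂ) // Injective p.1 ∧ ∀ i, p.2 i ≠ 0}

variable (W) in
/-- The frame `(∑ αᵢ cᵢ zᵢ², ∑ cᵢ zᵢ²; 1, α, α²)`. -/
noncomputable def secFrame
    (p : (Fin (dim W) → ℂ) × (Fin (dim W) → ℂ)) : PairAmb W :=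
  (![sumSq (fun i => p.1 i * p.2 i) (finBasis ℂ W).coord,
    sumSq p.2 (finBasis ℂ W).coord], powVec (finBasis ℂ W) p.1 1)

lemma isDiag_secFrame (p : NormalParam (dim W)) :
    IsDiag ((secFrame W p.1).1 0) ((secFrame W p.1).1 1) (finBasis ℂ W) p.1.1 p.1.2 :=
  ⟨p.2.1, p.2.2, rfl, rfl⟩

/-- The normal form as a frame of a pair. -/
noncomputable def normalFrame (hn : 4 ≤ dim W)
    (p : NormalParam (dim W)) : PairFrame W :=
  ⟨secFrame W p.1, (isDiag_secFrame p).isNonsingular_frame (by omega), by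
    have := finrank_span_eq_card (R := ℂ) (linearIndependent_powVec
      (w := finBasis ℂ W) p.2.1 hn (u := 1) fun _ => one_ne_zero)
    rw [Fintype.card_fin] at this
    exact this⟩

/-- The class of a normal form. -/
noncomputable def normalClass (hn : 4 ≤ dim W)
    (p : NormalParam (dim W)) : RefinedModuli W := frameToRefined (normalFrame hn p)

lemma isPoised_normalFrame (hn : 4 ≤ dim W)
    (p : NormalParam (dim W)) :
    IsPoised (span ℂ (range (normalFrame hn p).1.1))
      (span ℂ (range (normalFrame hn p).1.2)) := by
  rw [range_fin_two]
  exact (isPoised_iff (by omega) (isDiag_secFrame p)).2 ⟨1, fun _ => one_ne_zero, rfl⟩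

lemma isLab_normalClass (hn : 4 ≤ dim W)
    (p : NormalParam (dim W)) :
    IsLab (normalClass hn p) p.1.1 (rankOne p.1.2 (vanVec p.1.1)) := by
  refine ⟨normalFrame hn p, _, p.1.2, rfl, isDiag_secFrame p, ?_⟩
  congr 1
  funext i k
  change _ = (finBasis ℂ W).repr (powVec (finBasis ℂ W) p.1.1 1 k) i
  rw [repr_powVec]; simp [vanVec]

lemma frameToRefined_eq_normalClass (hn : 4 ≤ dim W) (a : PairFrame W)
    {g : Mat₂} (hg : g.det ≠ 0)
    {w : Basis (Fin (dim W)) ℂ W} {α c : Fin (dim W) → ℂ}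
    (h : IsDiag (mix g a.1.1 0) (mix g a.1.1 1) w α c) {u : Fin (dim W) → ℂ}
    (hu : ∀ i, u i ≠ 0)
    (hP : Span a.1.2 = Span (powVec w α u)) :
    frameToRefined a = normalClass hn ⟨(α, fun i => c i * u i ^ 2), h.inj,
      fun i => mul_ne_zero (h.ne i) (pow_ne_zero _ (hu i))⟩ := by
  set b := finBasis ℂ W
  set w' := w.unitsSMul fun i => Units.mk0 (u i) (hu i) with hw'
  have h1 := h.rescale fun i => Units.mk0 (u i) (hu i)
  set T : W ≃ₗ[ℂ] W := b.equiv w' (Equiv.refl _) with hT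
  have hb : w'.map T.symm = b := by
    refine Basis.eq_of_apply_eq fun i => ?_
    rw [Basis.map_apply, LinearEquiv.symm_apply_eq, hT, Basis.equiv_apply]
    rfl
  have h2 := h1.pullback T
  rw [← hw', hb] at h2
  refine Quotient.sound (s := pairSetoid W) ⟨T, ?_, ?_⟩
  · change span ℂ (range (secFrame W _).1) =
      (Span a.1.1).map (pullback T)
    rw [← span_mix hg a.1.1, ← span_pullback]
    congr 2
    funext k
    fin_cases k
    · exact h2.fst.symm
    · exact h2.snd.symm
  · change Span (powVec b α 1) =
      (Span a.1.2).map (T.symm : W →ₗ[ℂ] W)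
    rw [hP, ← span_symm_map]
    congr 2
    funext k
    refine b.ext_elem fun i => ?_
    have hr : ∀ x, b.repr (T.symm x) = w'.repr x := by
      intro x
      rw [← hb]
      simp
    rw [repr_powVec, hr, hw', Basis.repr_unitsSMul, repr_powVec]
    simp only [Pi.one_apply, mul_one, Units.smul_def, smul_eq_mul, Units.val_inv_eq_inv_val,
      Units.val_mk0]
    field_simp [hu i]

lemma exists_normalClass (hn : 4 ≤ dim W) (a : PairFrame W)
    (ha : IsPoised (Span a.1.1) (Span a.1.2)) :
    ∃ p, frameToRefined a = normalClass hn p := by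
  obtain ⟨g, hg, hnd⟩ := exists_nondegenerate_mix a.2.1
  obtain ⟨w, α, c, hd⟩ := exists_isDiag_frame (by omega)
    ((isNonsingular_frame_mix hg).2 a.2.1) hnd
  obtain ⟨u, hu, hP⟩ := (isPoised_frame_iff (by omega) hg hd).1 ha
  exact ⟨_, frameToRefined_eq_normalClass hn a hg hd hu hP⟩

lemma normalClass_mob (hn : 4 ≤ dim W) (p : NormalParam (dim W))
    {g : Mat₂} (hg : g.det ≠ 0) (hd : ∀ i, mobDen g (p.1.1 i) ≠ 0) :
    normalClass hn p = normalClass hn ⟨(fun i => mob g (p.1.1 i),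
      fun i => mobDen g (p.1.1 i) ^ 5 * p.1.2 i), mob_det_ne_zero_inj p.2.1 hg hd,
      fun i => mul_ne_zero (pow_ne_zero _ (hd i)) (p.2.2 i)⟩ := by
  have h1 := (isDiag_secFrame p).mobius hg hd
  have h2 : IsDiag (mix g (secFrame W p.1).1 0) (mix g (secFrame W p.1).1 1)
      (finBasis ℂ W) (fun i => mob g (p.1.1 i)) (fun i => mobDen g (p.1.1 i) * p.1.2 i) := by
    simpa [mix, Fin.sum_univ_two] using h1
  rw [normalClass, frameToRefined_eq_normalClass hn (normalFrame hn p) hg h2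
    (u := fun i => mobDen g (p.1.1 i) ^ 2 * 1)
    (fun i => mul_ne_zero (pow_ne_zero _ (hd i)) one_ne_zero)
    (span_powVec_mobius (finBasis ℂ W) p.1.1 1 hg hd).symm]
  congr 3
  funext i
  ring

lemma normalClass_perm (hn : 4 ≤ dim W) (p : NormalParam (dim W))
    (π : Perm (Fin (dim W))) :
    normalClass hn p = normalClass hn ⟨(fun i => p.1.1 (π i), fun i => p.1.2 (π i)),
      p.2.1.comp π.injective, fun i => p.2.2 (π i)⟩ := by
  set b := finBasis ℂ W
  have h1 : IsDiag (mix 1 (secFrame W p.1).1 0) (mix 1 (secFrame W p.1).1 1)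
      (b.reindex π.symm) (fun i => p.1.1 (π i)) (fun i => p.1.2 (π i)) := by
    rw [mix_one]
    refine ⟨p.2.1.comp π.injective, fun i => p.2.2 _, ?_, ?_⟩
    · ext x
      simp only [secFrame, sumSq_apply, Matrix.cons_val_zero]
      rw [← Equiv.sum_comp π]
      simp [b]
    · ext x
      change sumSq p.1.2 b.coord x = _
      rw [sumSq_apply, sumSq_apply, ← Equiv.sum_comp π]
      simp [b]
  rw [normalClass, frameToRefined_eq_normalClass hn (normalFrame hn p) (by simp) h1 (u := 1)
    (fun i => one_ne_zero) ?_]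
  · congr 3
    funext i
    simp
  · change Span (powVec b p.1.1 1) = _
    congr 2
    funext k
    refine (b.reindex π.symm).ext_elem fun i => ?_
    rw [repr_powVec]
    simp

lemma normalClass_smul (hn : 4 ≤ dim W) (p : NormalParam (dim W))
    {t : ℂ} (ht : t ≠ 0) :
    normalClass hn p = normalClass hn ⟨(p.1.1, fun i => t * p.1.2 i), p.2.1,
      fun i => mul_ne_zero ht (p.2.2 i)⟩ := by
  obtain ⟨s, hs⟩ := IsAlgClosed.exists_pow_nat_eq t (n := 5) (by norm_num)
  have hs0 : s ≠ 0 := by rintro rfl; apply ht; rw [← hs]; norm_num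
  have hden : ∀ x, mobDen !![s, 0; 0, s] x = s := by intro x; simp [mobDen]
  have hmob : ∀ x, mob !![s, 0; 0, s] x = x := by intro x; simp [mob, hs0]
  rw [normalClass_mob hn p (g := !![s, 0; 0, s]) (by simp [Matrix.det_fin_two, hs0])
    (fun i => by rw [hden]; exact hs0)]
  simp only [hden, hmob, hs]

/-- Two normal forms with the same degenerate elements are equivalent exactly if their weights
are related by a symmetry of the degenerate elements. -/
lemma normalClass_eq_iff (hn : 4 ≤ dim W) (p p' : NormalParam (dim W)) :
    normalClass hn p = normalClass hn p' ↔
    ∃ (π : Perm (Fin (dim W))) (g : Mat₂) (t : ℂ),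
      g.det ≠ 0 ∧ t ≠ 0 ∧ (∀ i, mobDen g (p.1.1 (π i)) ≠ 0) ∧
      (p'.1.1 = fun i => mob g (p.1.1 (π i))) ∧
      p'.1.2 = fun i => t * (mobDen g (p.1.1 (π i)) ^ 5 * p.1.2 (π i)) := by
  constructor
  · intro h
    obtain ⟨μ⟩ := exists_marking hn
    have hl := isLab_normalClass hn p
    have hl' := isLab_normalClass hn p'
    rw [← h] at hl'
    obtain ⟨π, g, k, c, z, hg, hk, hd, hα, hm, hm'⟩ := hl.unique (by omega) hl'
    have h1 := fun i => (wgt_mob μ (fun i => p.1.1 (π i)) c z hg hd hk i).2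
    rw [← hm, ← hm', ← hα] at h1
    set q : NormalParam (dim W) := ⟨(fun i => p.1.1 (π i), fun i => p.1.2 (π i)),
      p.2.1.comp π.injective, fun i => p.2.2 (π i)⟩
    have hq : (fun i => rankOne p.1.2 (vanVec p.1.1) (π i)) = rankOne q.1.2 (vanVec q.1.1) := by
      funext i; ext r s; simp [rankOne, vanVec, q]
    rw [hq] at h1
    have h2 : ∀ i, p'.1.2 i / p'.1.2 μ.o * wgtOne μ p'.1.1 i =
        q.1.2 i / q.1.2 μ.o * wgtOne μ q.1.1 i := fun i => by
      rw [← wgt_normal μ p'.2.1 p'.2.2, ← wgt_normal μ q.2.1 q.2.2]; exact h1 i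
    refine ⟨π, g, p'.1.2 μ.o / (q.1.2 μ.o * mobDen g (q.1.1 μ.o) ^ 5), hg,
      div_ne_zero (p'.2.2 _) (mul_ne_zero (q.2.2 _) (pow_ne_zero _ (hd _))), hd, hα, ?_⟩
    funext i
    have h3 := wgtOne_mob μ q.2.1 hg hd i
    have h4 := h2 i
    have hα' : (fun i => mob g (q.1.1 i)) = p'.1.1 := hα.symm
    rw [hα'] at h3
    have n1 := wgtOne_ne_zero μ p'.2.1 i
    have n2 := wgtOne_ne_zero μ q.2.1 i
    have n3 := p'.2.2 μ.o
    have n4 := q.2.2 μ.o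
    have n5 : mobDen g (q.1.1 i) ≠ 0 := hd i
    have n6 : mobDen g (q.1.1 μ.o) ≠ 0 := hd μ.o
    change p'.1.2 i = p'.1.2 μ.o / (q.1.2 μ.o * mobDen g (q.1.1 μ.o) ^ 5) *
      (mobDen g (q.1.1 i) ^ 5 * q.1.2 i)
    rw [div_mul_eq_mul_div, div_mul_eq_mul_div, div_eq_div_iff n3 n4] at h4
    rw [div_mul_eq_mul_div, eq_div_iff (mul_ne_zero n4 (pow_ne_zero _ n6))]
    refine mul_right_cancel₀ (mul_ne_zero n1 n2) ?_
    linear_combination (wgtOne μ q.1.1 i * mobDen g (q.1.1 μ.o) ^ 5) * h4 -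
      q.1.2 i * wgtOne μ q.1.1 i * p'.1.2 μ.o * h3
  · rintro ⟨π, g, t, hg, ht, hd, hα, hc⟩
    rw [normalClass_perm hn p π, normalClass_mob hn _ hg hd, normalClass_smul hn _ ht]
    congr 1
    exact Subtype.ext (Prod.ext hα.symm hc.symm)

lemma forget_normalClass_eq (hn : 4 ≤ dim W) {x : Moduli W}
    (p : NormalParam (dim W)) (h : IsLabM x p.1.1) :
    forget (normalClass hn p) = x := by
  obtain ⟨a, w, c, rfl, hd⟩ := h
  choose s hs using fun i => IsAlgClosed.exists_pow_nat_eq (p.1.2 i / c i) (n := 2) (by norm_num)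
  have hs0 : ∀ i, s i ≠ 0 := by
    intro i h0
    have := hs i
    rw [h0] at this
    exact div_ne_zero (p.2.2 i) (hd.ne i) (by rw [← this]; norm_num)
  have hr : Module.finrank ℂ (Span (powVec w p.1.1 s)) = 3 := by
    rw [finrank_span_eq_card (linearIndependent_powVec (w := w) p.2.1 hn hs0), Fintype.card_fin]
  have h1 := frameToRefined_eq_normalClass hn ⟨(a.1, powVec w p.1.1 s), a.2, hr⟩
    (g := 1) (by simp) (by simpa [mix_one] using hd) hs0 rfl
  have h2 : normalClass hn p = frameToRefined ⟨(a.1, powVec w p.1.1 s), a.2, hr⟩ := by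
    rw [h1]
    congr 1
    refine Subtype.ext (Prod.ext rfl (funext fun i => ?_))
    change p.1.2 i = c i * s i ^ 2
    rw [hs]
    field_simp [hd.ne i]
  rw [h2]; rfl

lemma exists_normalClass_of_forget (hn : 4 ≤ dim W) {α} (s : corr W)
    (h : IsLabM (p₁ s) α) : ∃ p : NormalParam (dim W), p.1.1 = α ∧
      p₂ s = normalClass hn p := by
  obtain ⟨a, rfl⟩ := frameToCorr_surjective s
  obtain ⟨p, hp⟩ := exists_normalClass hn a.1 a.2
  have h1 := (isLab_normalClass hn p).isLabM
  rw [← hp] at h1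
  obtain ⟨π, g, hg, hd, rfl⟩ := h1.unique (by omega) h
  refine ⟨_, ?_, hp.trans ((normalClass_perm hn p π).trans (normalClass_mob hn _ hg hd))⟩
  rfl

end NormalForms


namespace FunSpace

variable {X A B Q : Type*}

lemma Refines.of_isMorphism_restrict {𝒜 : FunSpace A} {ℬ : FunSpace B} {D : Set A} {F : D → B}
    (h : IsMorphism (𝒜.restrict D) ℬ F) {i : X → A} {k : X → B} (hi : ∀ x, i x ∈ D)
    (hk : ∀ x, F ⟨i x, hi x⟩ = k x) : Refines 𝒜 i ℬ k := by
  refine ⟨fun V hV x hx => ?_, fun x G hG => ?_⟩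
  · obtain ⟨O, hO, hOV⟩ := h.isOpen_preimage hV
    have hmem : ∀ x', i x' ∈ O ↔ k x' ∈ V := fun x' => by
      rw [← hk x']
      exact (Set.ext_iff.1 hOV ⟨i x', hi x'⟩)
    exact ⟨O, hO, (hmem x).2 hx, fun x' hx' => (hmem x').1 hx'⟩
  · obtain ⟨F', hF', O, hO, hxO, hFO⟩ := h.2 ⟨i x, hi x⟩ G (by rw [hk x]; exact hG)
    exact ⟨F', hF', O, hO, hxO, fun x' hx' => by rw [← hk x']; exact hFO ⟨i x', hi x'⟩ hx'⟩

lemma Refines.isMorphism {𝒜 : FunSpace A} {ℬ : FunSpace B} {f : A → B} (hA : 𝒜.IsLocal)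
    (h : Refines 𝒜 (fun x => x) ℬ f) : IsMorphism 𝒜 ℬ f := by
  refine IsMorphism.of_isOpen (fun U hU => ?_) fun x g hg => ?_
  · let _ := 𝒜.top
    rw [isOpen_iff_forall_mem_open]
    intro x hx
    obtain ⟨O, hO, hxO, hOU⟩ := h.1 U hU x hx
    exact ⟨O, hOU, hO, hxO⟩
  · obtain ⟨F, hF, O, hO, hxO, hgF⟩ := h.2 x g hg
    exact hA F _ x O hO hxO hgF hF

end FunSpace

lemma isChartOn_of_refines {X E : Type*} [AddCommGroup E] [Module ℂ E] [Module.Finite ℂ E]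
    {𝒳 : FunSpace X} {ψ : X → E} {U : Set X}
    (hU : IsOpen[𝒳.top] U) (hψ : Set.InjOn ψ U) (hD : IsOpen[(analytic E).top] (ψ '' U))
    (h₁ : Refines 𝒳 (fun u : U => u.1) (analytic E) (fun u : U => ψ u))
    (h₂ : Refines (analytic E) (fun u : U => ψ u) 𝒳 (fun u : U => u.1)) :
    IsChartOn 𝒳 ψ U := ⟨hU, hψ, hD, induced_eq h₁ h₂⟩

lemma IsChartOn.comp_equiv {X E F : Type*} [AddCommGroup E] [Module ℂ E] [Module.Finite ℂ E]
    [AddCommGroup F] [Module ℂ F] [Module.Finite ℂ F]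
    {𝒳 : FunSpace X} {ψ : X → E} {U : Set X} (h : IsChartOn 𝒳 ψ U) (e : E ≃ₗ[ℂ] F) :
    IsChartOn 𝒳 (fun x => e (ψ x)) U := by
  obtain ⟨h1, h2, h3, h4⟩ := h
  refine ⟨h1, fun x hx y hy hxy => h2 hx hy (e.injective hxy), ?_, ?_⟩
  · have : (fun x => e (ψ x)) '' U = e.symm ⁻¹' (ψ '' U) := by
      ext y
      simp only [Set.mem_image, Set.mem_preimage]
      exact exists_congr fun x => and_congr_right fun _ => e.eq_symm_apply.symm
    rw [this]
    exact (analytic_isMorphism_linear e.symm.toLinearMap).isOpen_preimage h3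
  · rw [h4]
    refine induced_eq ?_ ?_
    · exact Refines.of_isMorphism (analytic_isMorphism_linear e.toLinearMap) fun _ => rfl
    · exact Refines.of_isMorphism (analytic_isMorphism_linear e.symm.toLinearMap)
        fun u => e.symm_apply_apply _

section LocalLabels

variable {W : Type*} [AddCommGroup W] [Module ℂ W] [Module.Finite ℂ W]

lemma exists_local_labM (hn : 2 ≤ dim W) (a : PencilFrame W) :
    ∃ (A : PencilFrame W → Fin (dim W) → ℂ) (O : Set (PencilFrame W)),
      IsOpen[(pencilFrameAn W).top] O ∧ a ∈ O ∧ ∀ b ∈ O, IsLabM (frameToModuli b) (A b) ∧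
        (pencilFrameAn W).RegMapAt A b := by
  obtain ⟨g, hg, hnd⟩ := exists_nondegenerate_mix a.2
  obtain ⟨w, α, hd⟩ := exists_standard_diag (by omega) ((isNonsingular_frame_mix hg).2 a.2) hnd
  obtain ⟨A, L, N, hN, haN, -, -, h⟩ := exists_local_diag hd
  have hmor : IsMorphism (pencilFrameAn W) (analytic (PencilAmb W))
      fun b => mixLin g b.1 :=
    (analytic_isMorphism_linear (E := PencilAmb W) (E' := PencilAmb W) (mixLin g)).comp
      (isMorphism_induced _ _)
  refine ⟨fun b => A (mixLin g b.1), _, hmor.isOpen_preimage hN,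
    by rw [Set.mem_preimage, mixLin_apply]; exact haN, fun b hb => ⟨?_, fun l => ?_⟩⟩
  · obtain ⟨⟨w', -, hd'⟩, -⟩ := h _ hb
    simp only [mixLin_apply] at hd' ⊢
    exact isLabM_of_diag hn b hg hd'
  · exact hmor.2 b _ ((h _ hb).2.1 l)

lemma exists_local_lab (hn : 2 ≤ dim W) (a : PairFrame W) :
    ∃ (A : PairFrame W → Fin (dim W) → ℂ)
      (M : PairFrame W → Fin (dim W) → Mat₃)
      (O : Set (PairFrame W)),
      IsOpen[((analytic (PairAmb W)).induced (Subtype.val : PairFrame W → _)).top] O ∧ a ∈ O ∧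
      ∀ b ∈ O, IsLab (frameToRefined b) (A b) (M b) ∧
        (∀ i, ((analytic (PairAmb W)).induced (Subtype.val : PairFrame W → _)).RegAt
          (fun b => A b i) b) ∧
        ∀ i r s, ((analytic (PairAmb W)).induced (Subtype.val : PairFrame W → _)).RegAt
          (fun b => M b i r s) b := by
  obtain ⟨g, hg, hnd⟩ := exists_nondegenerate_mix a.2.1
  obtain ⟨w, α, hd⟩ := exists_standard_diag (by omega) ((isNonsingular_frame_mix hg).2 a.2.1) hnd
  obtain ⟨A, L, N, hN, haN, -, -, h⟩ := exists_local_diag hd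
  set 𝒬 := (analytic (PairAmb W)).induced (Subtype.val : PairFrame W → _)
  have hR : 𝒬.IsRinged := (analytic_isRinged _).induced _
  have hmor : IsMorphism 𝒬 (analytic (PencilAmb W)) fun b => mixLin g b.1.1 :=
    (analytic_isMorphism_linear (E := PairAmb W) (E' := PencilAmb W)
      ((mixLin g).comp (LinearMap.fst ℂ (PencilAmb W) (Fin 3 → W)))).comp
      (isMorphism_induced _ _)
  refine ⟨fun b => A (mixLin g b.1.1), fun b => rankOne 1 fun i k => L (mixLin g b.1.1) i (b.1.2 k),
    _, hmor.isOpen_preimage hN, by rw [Set.mem_preimage, mixLin_apply]; exact haN,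
    fun b hb => ⟨?_, fun i => ?_, fun i r s => ?_⟩⟩
  · obtain ⟨⟨w', hw', hd'⟩, -⟩ := h _ hb
    simp only [mixLin_apply] at hd' hw' ⊢
    rw [← hw']
    exact isLab_of_diag hn b hg hd'
  · exact hmor.2 b _ (((h _ hb).2.1.apply i).regAt)
  · have h0 : 𝒬.RegMapAt (fun b : PairFrame W => b.1) b :=
      (regMapAt_analytic (PairAmb W) b.1).induced (i := Subtype.val)
    have hv : ∀ i k, 𝒬.RegAt (fun b : PairFrame W => L (mixLin g b.1.1) i (b.1.2 k)) b := by
      intro i k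
      have e : (fun b : PairFrame W => L (mixLin g b.1.1) i (b.1.2 k)) = fun b => ∑ j,
          (finBasis ℂ W).repr (b.1.2 k) j *
            L (mixLin g b.1.1) i (finBasis ℂ W j) := by
        funext b
        conv_lhs => rw [← (finBasis ℂ W).sum_repr (b.1.2 k)]
        simp only [map_sum, map_smul, smul_eq_mul]
      rw [e]
      refine hR.sum _ _ _ fun j _ => hR.mul _ _ _ ?_ ?_
      · exact ((h0.map (LinearMap.snd ℂ _ _)).apply k) ((finBasis ℂ W).coord j)
      · exact hmor.2 b _ (((h _ hb).2.2.apply i) (Dual.eval ℂ W _))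
    simp only [rankOne, Matrix.of_apply, Pi.one_apply, one_mul]
    exact hR.mul _ _ _ (hv i r) (hv i s)

lemma IsLabM.mob (hn : 2 ≤ dim W) {x : Moduli W} {α} (h : IsLabM x α)
    {g : Mat₂} (hg : g.det ≠ 0) (hd : ∀ i, mobDen g (α i) ≠ 0) :
    IsLabM x fun i => PencilModuli.mob g (α i) := by
  obtain ⟨a, w, c, rfl, hdiag⟩ := h
  refine isLabM_of_diag hn a hg (c := fun i => mobDen g (α i) * c i) (w := w) ?_
  simpa [mix, Fin.sum_univ_two] using hdiag.mobius hg hd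

end LocalLabels

section CrossRatioCharts

variable {n : ℕ} (μ : Marking n)

/-- The labels different from the three reference labels. -/
abbrev Marking.J : Type := {i : Fin n // i ≠ μ.o ∧ i ≠ μ.p ∧ i ≠ μ.q}

/-- The independent cross ratios. -/
noncomputable def kapJ (α : Fin n → ℂ) : μ.J → ℂ := fun i => kap μ α i.1

lemma exists_mob_of_kapJ_eq {α α' : Fin n → ℂ} (hα : Injective α)
    (hα' : Injective α') (h : kapJ μ α = kapJ μ α') :
    ∃ g : Mat₂, g.det ≠ 0 ∧ ∀ i, mobDen g (α i) ≠ 0 ∧ mob g (α i) = α' i :=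
  exists_mob_of_kap_eq μ hα hα' fun i h1 h2 h3 => congrFun h ⟨i, h1, h2, h3⟩

lemma FunSpace.IsRinged.regAt_kap {X : Type*} {𝒳 : FunSpace X} (hX : 𝒳.IsRinged) {x : X}
    {A : X → Fin n → ℂ} (hA : ∀ i, 𝒳.RegAt (fun y => A y i) x) (hx : Injective (A x))
    {i : Fin n} (hi : i ≠ μ.q) : 𝒳.RegAt (fun y => kap μ (A y) i) x := by
  have ne : ∀ {i j}, i ≠ j → A x i - A x j ≠ 0 := fun hij => sub_ne_zero.2 fun e => hij (hx e)
  exact hX.div _ _ _ (hX.mul _ _ _ (hX.sub _ _ _ (hA _) (hA _)) (hX.sub _ _ _ (hA _) (hA _)))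
    (hX.mul _ _ _ (hX.sub _ _ _ (hA _) (hA _)) (hX.sub _ _ _ (hA _) (hA _)))
    (mul_ne_zero (ne hi) (ne μ.op.symm))

lemma FunSpace.IsRinged.regMapAt_kapJ {X : Type*} {𝒳 : FunSpace X} (hX : 𝒳.IsRinged) {x : X}
    {A : X → Fin n → ℂ} (hA : ∀ i, 𝒳.RegAt (fun y => A y i) x) (hx : Injective (A x)) :
    𝒳.RegMapAt (fun y => kapJ μ (A y)) x :=
  hX.regMapAt_pi fun i => hX.regMapAt (hX.regAt_kap μ hA hx i.2.2.2)

lemma FunSpace.IsRinged.regAt_detThree {X : Type*} {𝒳 : FunSpace X} (hX : 𝒳.IsRinged) {x : X}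
    {M : X → Fin n → Mat₃} (hM : ∀ i r s, 𝒳.RegAt (fun y => M y i r s) x)
    (i k l : Fin n) : 𝒳.RegAt (fun y => detThree (M y) i k l) x :=
  hX.det _ _ fun r s => hX.add _ _ _ (hX.add _ _ _ (hM _ _ _) (hM _ _ _)) (hM _ _ _)

lemma FunSpace.IsRinged.regAt_wgtDen {X : Type*} {𝒳 : FunSpace X} (hX : 𝒳.IsRinged) {x : X}
    {A : X → Fin n → ℂ} (hA : ∀ i, 𝒳.RegAt (fun y => A y i) x)
    {M : X → Fin n → Mat₃} (hM : ∀ i r s, 𝒳.RegAt (fun y => M y i r s) x)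
    (i : Fin n) : 𝒳.RegAt (fun y => wgtDen μ (A y) (M y) i) x :=
  hX.mul _ _ _ (hX.regAt_detThree hM _ _ _) (hX.sub _ _ _ (hA _) (hA _))

lemma FunSpace.IsRinged.regAt_wgt {X : Type*} {𝒳 : FunSpace X} (hX : 𝒳.IsRinged) {x : X}
    {A : X → Fin n → ℂ} (hA : ∀ i, 𝒳.RegAt (fun y => A y i) x)
    {M : X → Fin n → Mat₃} (hM : ∀ i r s, 𝒳.RegAt (fun y => M y i r s) x)
    (i : Fin n) (h : wgtDen μ (A x) (M x) i ≠ 0) : 𝒳.RegAt (fun y => wgt μ (A y) (M y) i) x :=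
  hX.div _ _ _ (hX.mul _ _ _ (hX.regAt_detThree hM _ _ _) (hX.sub _ _ _ (hA _) (hA _)))
    (hX.regAt_wgtDen μ hA hM i) h

lemma FunSpace.IsRinged.regAt_wgtOne {X : Type*} {𝒳 : FunSpace X} (hX : 𝒳.IsRinged) {x : X}
    {A : X → Fin n → ℂ} (hA : ∀ i, 𝒳.RegAt (fun y => A y i) x) (hx : Injective (A x))
    (i : Fin n) : 𝒳.RegAt (fun y => wgtOne μ (A y) i) x := by
  have ne : ∀ {i j}, i ≠ j → A x i - A x j ≠ 0 := fun hij => sub_ne_zero.2 fun e => hij (hx e)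
  have hs : ∀ i j, 𝒳.RegAt (fun y => A y i - A y j) x := fun i j => hX.sub _ _ _ (hA i) (hA j)
  refine hX.div _ _ _ (hX.mul _ _ _ (hX.mul _ _ _ (hX.pow _ _ (hs _ _) _)
    (hX.pow _ _ (hs _ _) _)) (hs _ _)) (hX.mul _ _ _ (hX.mul _ _ _ (hX.pow _ _ (hs _ _) _)
    (hX.pow _ _ (hs _ _) _)) (hs _ _)) ?_
  exact mul_ne_zero (mul_ne_zero (pow_ne_zero _ (ne (μ.ko i))) (pow_ne_zero _ (ne (μ.lo i))))
    (ne (μ.ko i).symm)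

/-- A domain of cross ratios on which the degenerate elements can be labelled in a unique way,
with a holomorphic choice of degenerate elements with given cross ratios. -/
structure KapDomain (α₀ : Fin n → ℂ) where
  D : Set (μ.J → ℂ)
  sec : (μ.J → ℂ) → Fin n → ℂ
  isOpen : IsOpen[(analytic (μ.J → ℂ)).top] D
  mem : kapJ μ α₀ ∈ D
  inj : ∀ κ ∈ D, Injective (sec κ)
  kap_sec : ∀ κ ∈ D, kapJ μ (sec κ) = κ
  regAt : ∀ κ ∈ D, ∀ i, (analytic (μ.J → ℂ)).RegAt (fun κ => sec κ i) κ
  sep : ∀ κ ∈ D, ∀ π : Perm (Fin n), kapJ μ (fun i => sec κ (π i)) ∈ D → π = 1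

lemma exists_kapDomain {α₀ : Fin n → ℂ} (hα : Injective α₀)
    (hgen : ∀ π : Perm (Fin n), kapJ μ (fun i => α₀ (π i)) = kapJ μ α₀ → π = 1) :
    Nonempty (KapDomain μ α₀) := by
  classical
  have ne : ∀ {i j}, i ≠ j → α₀ i - α₀ j ≠ 0 := fun hij => sub_ne_zero.2 fun e => hij (hα e)
  have po := ne μ.op.symm; have oq := ne μ.oq; have pq := ne μ.pq
  set o := α₀ μ.o; set p := α₀ μ.p; set q := α₀ μ.q
  have hri := analytic_isRinged (μ.J → ℂ)
  have hid := regMapAt_analytic (μ.J → ℂ)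
  have han := isAnalytic_analytic (μ.J → ℂ)
  set den : (μ.J → ℂ) → μ.J → ℂ := fun κ i => (p - q) - κ i * (p - o) with hden
  set sec : (μ.J → ℂ) → Fin n → ℂ := fun κ i =>
    if h : i ≠ μ.o ∧ i ≠ μ.p ∧ i ≠ μ.q then
      (o * (p - q) - κ ⟨i, h⟩ * q * (p - o)) / den κ ⟨i, h⟩ else α₀ i with hsec
  have so : ∀ κ, sec κ μ.o = o := fun κ => by simp [hsec, o]
  have sp : ∀ κ, sec κ μ.p = p := fun κ => by simp [hsec, p]
  have sq : ∀ κ, sec κ μ.q = q := fun κ => by simp [hsec, q]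
  have hregden : ∀ κ i, (analytic (μ.J → ℂ)).RegAt (fun κ => den κ i) κ := fun κ i =>
    hri.sub _ _ _ (hri.const _ _) (hri.mul _ _ _ ((hid κ).apply i).regAt (hri.const _ _))
  have hreg : ∀ κ, (∏ i, den κ i) ≠ 0 → ∀ i, (analytic (μ.J → ℂ)).RegAt (fun κ => sec κ i) κ := by
    intro κ hκ i
    by_cases h : i ≠ μ.o ∧ i ≠ μ.p ∧ i ≠ μ.q
    · simp only [hsec, dif_pos h]
      refine hri.div _ _ _ (hri.sub _ _ _ (hri.const _ _) (hri.mul _ _ _ (hri.mul _ _ _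
        ((hid κ).apply _).regAt (hri.const _ _)) (hri.const _ _))) (hregden _ _) ?_
      exact prod_ne_zero_iff.1 hκ _ (mem_univ _)
    · simp only [hsec, dif_neg h]; exact hri.const _ _
  have hkap : ∀ κ, (∏ i, den κ i) ≠ 0 → Injective (sec κ) → kapJ μ (sec κ) = κ := by
    intro κ hκ hinj
    funext i
    have h1 : den κ i ≠ 0 := prod_ne_zero_iff.1 hκ i (mem_univ _)
    have h2 : sec κ i.1 - q ≠ 0 := by
      rw [← sq κ]; exact sub_ne_zero.2 fun e => i.2.2.2 (hinj e)
    have h3 : sec κ i.1 = (o * (p - q) - κ i * q * (p - o)) / den κ i := by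
      simp only [hsec, dif_pos i.2]
    rw [kapJ, kap, so, sp, sq, div_eq_iff (mul_ne_zero h2 po)]
    rw [eq_div_iff h1] at h3
    simp only [hden] at h3
    linear_combination h3
  have hinv : ∀ i : μ.J, den (kapJ μ α₀) i ≠ 0 ∧ sec (kapJ μ α₀) i.1 = α₀ i.1 := by
    intro i
    have iq : α₀ i.1 - q ≠ 0 := ne i.2.2.2
    have e : kapJ μ α₀ i * ((α₀ i.1 - q) * (p - o)) = (α₀ i.1 - o) * (p - q) := by
      rw [kapJ, kap]; exact div_mul_cancel₀ _ (mul_ne_zero iq po)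
    have h1 : den (kapJ μ α₀) i * (α₀ i.1 - q) = (p - q) * (o - q) := by
      simp only [hden]; linear_combination -e
    have h2 : den (kapJ μ α₀) i ≠ 0 := left_ne_zero_of_mul (h1 ▸ mul_ne_zero pq oq)
    refine ⟨h2, ?_⟩
    simp only [hsec, dif_pos i.2]
    rw [div_eq_iff h2]
    simp only [hden]
    linear_combination e
  have hα₀ : sec (kapJ μ α₀) = α₀ := by
    funext i
    by_cases h : i ≠ μ.o ∧ i ≠ μ.p ∧ i ≠ μ.q
    · exact (hinv ⟨i, h⟩).2
    · simp only [hsec, dif_neg h]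
  set D₀ : Set (μ.J → ℂ) := {κ | (True ∧ (∏ i, den κ i) ≠ 0) ∧
    (Matrix.vandermonde (sec κ)).det ≠ 0} with hD₀
  have hD₀o : IsOpen[(analytic (μ.J → ℂ)).top] D₀ := by
    refine hri.isOpen_ne_zero (hri.isOpen_ne_zero (@isOpen_univ _ (analytic (μ.J → ℂ)).top)
      fun κ _ => hri.prod _ _ _ fun i _ => hregden κ i) fun κ hκ => hri.det _ _ fun i j =>
      hri.pow _ _ (hreg κ hκ.2 i) _
  have hmem₀ : kapJ μ α₀ ∈ D₀ := by
    refine ⟨⟨trivial, prod_ne_zero_iff.2 fun i _ => (hinv i).1⟩, ?_⟩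
    rw [hα₀]; exact Matrix.det_vandermonde_ne_zero_iff.2 hα
  have hinj : ∀ κ ∈ D₀, Injective (sec κ) := fun κ hκ =>
    Matrix.det_vandermonde_ne_zero_iff.1 hκ.2
  have hU : ∀ π : Perm (Fin n), ∃ U : Set (μ.J → ℂ), IsOpen[(analytic (μ.J → ℂ)).top] U ∧
      kapJ μ α₀ ∈ U ∧ (π ≠ 1 → ∀ κ ∈ U, kapJ μ (fun i => sec κ (π i)) ∉ U) := by
    intro π
    by_cases hπ : π = 1
    · exact ⟨D₀, hD₀o, hmem₀, fun h => absurd hπ h⟩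
    have hne : kapJ μ (fun i => α₀ (π i)) ≠ kapJ μ α₀ := fun h => hπ (hgen π h)
    obtain ⟨V, V', hV, hV', hxV, hxV', hdis⟩ := t2_separation hne
    have hr : (analytic (μ.J → ℂ)).RegMapAt (fun κ => kapJ μ (fun i => sec κ (π i)))
        (kapJ μ α₀) := hri.regMapAt_kapJ μ (fun i => hreg _ hmem₀.1.2 _)
          ((hinj _ hmem₀).comp π.injective)
    obtain ⟨O, hO, hxO, hOV⟩ := han.exists_isOpen hr (V := V) (by rw [analytic_top]; exact hV)
      (by simp only [hα₀]; exact hxV)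
    refine ⟨O ∩ V', isOpen_inter _ hO (by rw [analytic_top]; exact hV'), ⟨hxO, hxV'⟩,
      fun _ κ hκ hκ' => ?_⟩
    exact Set.disjoint_left.1 hdis (hOV κ hκ.1) hκ'.2
  choose U hUo hUm hUs using hU
  refine ⟨⟨D₀ ∩ ⋂ π, U π, sec, ?_, ⟨hmem₀, Set.mem_iInter.2 hUm⟩, fun κ hκ => hinj κ hκ.1,
    fun κ hκ => hkap κ hκ.1.1.2 (hinj κ hκ.1), fun κ hκ => hreg κ hκ.1.1.2, ?_⟩⟩
  · let _ := (analytic (μ.J → ℂ)).top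
    exact hD₀o.inter (isOpen_iInter_of_finite hUo)
  · intro κ hκ π h
    by_contra hπ
    exact hUs π hπ κ (Set.mem_iInter.1 hκ.2 π) (Set.mem_iInter.1 h.2 π)

lemma KapDomain.eq_one {μ : Marking n} {α₀ : Fin n → ℂ} (K : KapDomain μ α₀) {α : Fin n → ℂ}
    (hα : Injective α) (h : kapJ μ α ∈ K.D) {π : Perm (Fin n)}
    (hπ : kapJ μ (fun i => α (π i)) ∈ K.D) : π = 1 := by
  obtain ⟨g, hg, hgα⟩ := exists_mob_of_kapJ_eq μ hα (K.inj _ h) (K.kap_sec _ h).symm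
  refine K.sep _ h π ?_
  have : (fun i => K.sec (kapJ μ α) (π i)) = fun i => mob g (α (π i)) :=
    funext fun i => (hgα _).2.symm
  have e : kapJ μ (fun i => mob g (α (π i))) = kapJ μ fun i => α (π i) := funext fun i =>
    congrFun (kap_mob μ (fun i => α (π i)) hg fun i => (hgα _).1) i.1
  rw [this, e]
  exact hπ

end CrossRatioCharts


lemma FunSpace.quot_regMapAt_of_local {A Q E : Type*} [AddCommGroup E] [Module ℂ E]
    {𝒜 : FunSpace A} (hA : 𝒜.IsLocal) {q : A → Q} {S : Set Q} {f : Q → E}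
    (h : ∀ a, q a ∈ S → ∃ (O : Set A) (F : A → E), IsOpen[𝒜.top] O ∧ a ∈ O ∧ 𝒜.RegMapAt F a ∧
      ∀ b ∈ O, q b ∈ S ∧ f (q b) = F b) :
    IsOpen[(𝒜.quot q).top] S ∧ ∀ x ∈ S, (𝒜.quot q).RegMapAt f x := by
  have hS : IsOpen[(𝒜.quot q).top] S := by
    rw [isOpen_quot]
    let _ := 𝒜.top
    rw [isOpen_iff_forall_mem_open]
    intro a ha
    obtain ⟨O, F, hO, haO, -, h⟩ := h a ha
    exact ⟨O, fun b hb => (h b hb).1, hO, haO⟩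
  refine ⟨hS, fun x hx l => ⟨S, hS, hx, fun a ha => ?_⟩⟩
  obtain ⟨O, F, hO, haO, hF, h⟩ := h a ha
  exact hA _ _ a O hO haO (fun b hb => congrArg l (h b hb).2) (hF l)

section LabelledCharts

variable {W : Type*} [AddCommGroup W] [Module ℂ W] [Module.Finite ℂ W]

lemma IsLabM.perm {x : Moduli W} {α} (h : IsLabM x α)
    (π : Perm (Fin (dim W))) : IsLabM x fun i => α (π i) := by
  obtain ⟨a, w, c, rfl, hd⟩ := h
  refine ⟨a, w.reindex π.symm, fun i => c (π i), rfl, ⟨hd.inj.comp π.injective,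
    fun i => hd.ne _, ?_, ?_⟩⟩
  · rw [hd.fst]; ext x
    simp only [sumSq_apply]
    rw [← Equiv.sum_comp π]
    simp
  · rw [hd.snd]; ext x
    simp only [sumSq_apply]
    rw [← Equiv.sum_comp π]
    simp

lemma FunSpace.IsRinged.regMapAt_secFrame {X : Type*} {𝒳 : FunSpace X} (hX : 𝒳.IsRinged) {x : X}
    {p : X → (Fin (dim W) → ℂ) × (Fin (dim W) → ℂ)}
    (hp : 𝒳.RegMapAt p x) : 𝒳.RegMapAt (fun y => secFrame W (p y)) x := by
  have h1 := hp.map (LinearMap.fst ℂ _ _)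
  have h2 := hp.map (LinearMap.snd ℂ _ _)
  have hc : 𝒳.RegMapAt (fun _ => (finBasis ℂ W).coord) x := hX.regMapAt_const _
  refine hX.regMapAt_prod (hX.regMapAt_pi fun k => ?_) (hX.regMapAt_pi fun k =>
    hX.regMapAt_of_basis (finBasis ℂ W) fun i => ?_)
  · fin_cases k
    · exact hX.regMapAt_sumSq (hX.regMapAt_pi fun i => hX.regMapAt
        (hX.mul _ _ _ (h1.apply i).regAt (h2.apply i).regAt)) hc
    · exact hX.regMapAt_sumSq h2 hc
  · simp only [repr_powVec, Pi.one_apply, mul_one]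
    exact hX.pow _ _ (h1.apply i).regAt _

lemma isMorphism_normalClass (hn : 4 ≤ dim W) {X : Type*} {𝒳 : FunSpace X}
    (hX : 𝒳.IsLocal) {𝒜 : FunSpace (PairAmb W)} (p : X → NormalParam (dim W))
    (h : Refines 𝒳 (fun x => x) 𝒜 fun x => secFrame W (p x).1) :
    IsMorphism 𝒳 (refinedOf 𝒜) fun x => normalClass hn (p x) :=
  (isMorphism_mk _ frameToRefined).comp (Refines.isMorphism hX
    (Refines.to_induced (j := fun x => normalFrame hn (p x)) h))

variable (W) in
lemma isAnalytic_refinedAn : (refinedAn W).IsAnalytic :=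
  ((isAnalytic_analytic _).induced _).quot _

variable (W) in
lemma isAnalytic_moduliAn : (moduliAn W).IsAnalytic :=
  ((isAnalytic_analytic _).induced _).quot _

variable {μ : Marking (dim W)} {α₀ : Fin (dim W) → ℂ}
  (K : KapDomain μ α₀)

namespace KapDomain

/-- The classes of pencils with cross ratios in `K`. -/
def modSet : Set (Moduli W) := {x | ∃ α, IsLabM x α ∧ kapJ μ α ∈ K.D}

open Classical in
/-- The cross ratios as coordinates on `K.modSet`. -/
noncomputable def chi (x : Moduli W) : μ.J → ℂ :=
  if h : x ∈ K.modSet then kapJ μ h.choose else 0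

lemma chi_eq (hn : 4 ≤ dim W) {x : Moduli W} {α} (h : IsLabM x α)
    (hα : kapJ μ α ∈ K.D) : K.chi x = kapJ μ α := by
  have hx : x ∈ K.modSet := ⟨α, h, hα⟩
  rw [chi, dif_pos hx]
  obtain ⟨h1, h2⟩ := hx.choose_spec
  obtain ⟨π, g, hg, hd, e⟩ := h.unique (by omega) h1
  have e2 : kapJ μ hx.choose = kapJ μ fun i => α (π i) := by
    rw [e]; exact funext fun i => congrFun (kap_mob μ _ hg hd) i.1
  rw [e2] at h2 ⊢
  obtain rfl := K.eq_one h.inj hα h2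
  rfl

/-- The classes of pairs with cross ratios in `K` and nonvanishing denominators of the
invariants. -/
def refSet : Set (RefinedModuli W) :=
  {x | ∃ α m, IsLab x α m ∧ kapJ μ α ∈ K.D ∧ ∀ i, wgtDen μ α m i ≠ 0}

/-- The labels different from the first reference label. -/
abbrev _root_.PencilModuli.Marking.I {n : ℕ} (μ : Marking n) : Type := {i : Fin n // i ≠ μ.o}

open Classical in
/-- The cross ratios and weights as coordinates on `K.refSet`. -/
noncomputable def rho (x : RefinedModuli W) : (μ.J → ℂ) × (μ.I → ℂ) :=
  if h : x ∈ K.refSet then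
    (kapJ μ h.choose, fun i => wgt μ h.choose h.choose_spec.choose i.1) else 0

lemma rho_eq (hn : 4 ≤ dim W) {x : RefinedModuli W} {α m} (h : IsLab x α m)
    (hα : kapJ μ α ∈ K.D) (hm : ∀ i, wgtDen μ α m i ≠ 0) :
    K.rho x = (kapJ μ α, fun i => wgt μ α m i.1) := by
  have hx : x ∈ K.refSet := ⟨α, m, h, hα, hm⟩
  rw [rho, dif_pos hx]
  obtain ⟨h1, h2, -⟩ := hx.choose_spec.choose_spec
  obtain ⟨π, e1, e2, -⟩ := h.unique_invariants (by omega) μ h1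
  have e3 : kapJ μ hx.choose = kapJ μ fun i => α (π i) := funext fun i => congrFun e1 i.1
  rw [e3] at h2
  obtain rfl := K.eq_one h.isLabM.inj hα h2
  exact Prod.ext e3 (funext fun i => congrFun e2 i.1)

lemma chi_regMapAt (hn : 4 ≤ dim W) :
    IsOpen[(moduliAn W).top] K.modSet ∧ ∀ x ∈ K.modSet, (moduliAn W).RegMapAt K.chi x := by
  refine quot_regMapAt_of_local (isLocal_induced _ _) fun a ha => ?_
  obtain ⟨α, hα, hD⟩ := ha
  obtain ⟨A, O, hO, haO, h⟩ := exists_local_labM (by omega) a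
  obtain ⟨π, g, hg, hd, e⟩ := (h a haO).1.unique (by omega) hα
  have hR : (pencilFrameAn W).IsRinged := (analytic_isRinged _).induced _
  have hF : (pencilFrameAn W).RegMapAt (fun b => kapJ μ fun i => A b (π i)) a :=
    hR.regMapAt_kapJ μ (fun i => ((h a haO).2.apply _).regAt)
      ((h a haO).1.inj.comp π.injective)
  have e2 : kapJ μ α = kapJ μ fun i => A a (π i) := by
    rw [e]; exact funext fun i => congrFun (kap_mob μ _ hg hd) i.1
  obtain ⟨U, hU, haU, hUD⟩ := ((isAnalytic_analytic (PencilAmb W)).induced _).exists_isOpen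
    hF K.isOpen (e2 ▸ hD)
  refine ⟨O ∩ U, _, isOpen_inter _ hO hU, ⟨haO, haU⟩, hF, fun b hb => ?_⟩
  have hl := (h b hb.1).1.perm π
  exact ⟨⟨_, hl, hUD b hb.2⟩, K.chi_eq hn hl (hUD b hb.2)⟩

lemma rho_regMapAt (hn : 4 ≤ dim W) :
    IsOpen[(refinedAn W).top] K.refSet ∧ ∀ x ∈ K.refSet, (refinedAn W).RegMapAt K.rho x := by
  refine quot_regMapAt_of_local (isLocal_induced _ _) fun a ha => ?_
  obtain ⟨α, m, hα, hD, hm⟩ := ha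
  obtain ⟨A, M, O, hO, haO, h⟩ := exists_local_lab (by omega) a
  obtain ⟨π, e1, -, e3⟩ := (h a haO).1.unique_invariants (by omega) μ hα
  have hR := (analytic_isRinged (PairAmb W)).induced (Subtype.val : PairFrame W → _)
  have hinj := (h a haO).1.isLabM.inj.comp π.injective
  have hA := fun i => (h a haO).2.1 (π i)
  have hM := fun i => (h a haO).2.2 (π i)
  have hden := fun i => (e3 i).1 (hm i)
  have hF1 := hR.regMapAt_kapJ μ hA hinj
  have hF := hR.regMapAt_prod hF1 (hR.regMapAt_pi (R := fun (b : PairFrame W) (i : μ.I) =>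
    wgt μ (fun i => A b (π i)) (fun i => M b (π i)) i.1) fun i =>
      hR.regMapAt (hR.regAt_wgt μ hA hM i.1 (hden i.1)))
  have e2 : kapJ μ α = kapJ μ fun i => A a (π i) := funext fun i => congrFun e1 i.1
  obtain ⟨U, hU, haU, hUD⟩ := ((isAnalytic_analytic (PairAmb W)).induced _).exists_isOpen
    hF1 K.isOpen (e2 ▸ hD)
  obtain ⟨U', hU', haU', hne⟩ := hR.ne_zero _ a (hR.prod Finset.univ _ a fun i _ =>
    hR.regAt_wgtDen μ hA hM i) (prod_ne_zero_iff.2 fun i _ => hden i)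
  refine ⟨(O ∩ U) ∩ U', _, isOpen_inter _ (isOpen_inter _ hO hU) hU',
    ⟨⟨haO, haU⟩, haU'⟩, hF, fun b hb => ?_⟩
  have hl := (h b hb.1.1).1.perm π
  have hd := fun i => prod_ne_zero_iff.1 (hne b hb.2) i (mem_univ _)
  exact ⟨⟨_, _, hl, hUD b hb.1.2, hd⟩, K.rho_eq hn hl (hUD b hb.1.2) hd⟩

/-- The parameter of the normal form with given cross ratios and weights. -/
noncomputable def par (y : (μ.J → ℂ) × (μ.I → ℂ)) :
    (Fin (dim W) → ℂ) × (Fin (dim W) → ℂ) :=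
  (K.sec y.1, fun i => if h : i = μ.o then 1 else y.2 ⟨i, h⟩ / wgtOne μ (K.sec y.1) i)

/-- The domain of the coordinates `rho`. -/
def dom : Set ((μ.J → ℂ) × (μ.I → ℂ)) := {y | y.1 ∈ K.D ∧ ∏ i, y.2 i ≠ 0}

lemma par_mem {y} (hy : y ∈ K.dom) :
    Injective (K.par y).1 ∧ ∀ i, (K.par y).2 i ≠ 0 := by
  refine ⟨K.inj _ hy.1, fun i => ?_⟩
  simp only [par]
  split_ifs with h
  · exact one_ne_zero
  · exact div_ne_zero (prod_ne_zero_iff.1 hy.2 _ (mem_univ _))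
      (wgtOne_ne_zero μ (K.inj _ hy.1) i)

lemma par_regMapAt {y} (hy : y ∈ K.dom) :
    (analytic ((μ.J → ℂ) × (μ.I → ℂ))).RegMapAt K.par y := by
  have hri := analytic_isRinged ((μ.J → ℂ) × (μ.I → ℂ))
  have hid := regMapAt_analytic ((μ.J → ℂ) × (μ.I → ℂ)) y
  have h1 := hid.map (LinearMap.fst ℂ _ _)
  have h2 := hid.map (LinearMap.snd ℂ _ _)
  have hs : ∀ i, (analytic ((μ.J → ℂ) × (μ.I → ℂ))).RegAt (fun y => K.sec y.1 i) y := fun i =>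
    (isAnalytic_analytic _).regAt_comp h1 (K.regAt _ hy.1 i)
  refine hri.regMapAt_prod (hri.regMapAt_pi fun i => hri.regMapAt (hs i))
    (hri.regMapAt_pi fun i => hri.regMapAt ?_)
  by_cases h : i = μ.o
  · simp only [dif_pos h]; exact hri.const _ _
  · simp only [dif_neg h]
    exact hri.div _ _ _ (h2.apply _).regAt (hri.regAt_wgtOne μ hs (K.inj _ hy.1) i)
      (wgtOne_ne_zero μ (K.inj _ hy.1) i)

lemma isOpen_dom : IsOpen[(analytic ((μ.J → ℂ) × (μ.I → ℂ))).top] K.dom := by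
  have hri := analytic_isRinged ((μ.J → ℂ) × (μ.I → ℂ))
  have hid := regMapAt_analytic ((μ.J → ℂ) × (μ.I → ℂ))
  exact hri.isOpen_ne_zero ((analytic_isMorphism_linear
    (LinearMap.fst ℂ (μ.J → ℂ) (μ.I → ℂ))).isOpen_preimage K.isOpen) fun y _ =>
      hri.prod _ _ _ fun i _ => (((hid y).map (LinearMap.snd ℂ _ _)).apply i).regAt

lemma rho_normalClass (hn : 4 ≤ dim W) {p : NormalParam (dim W)}
    (hp : kapJ μ p.1.1 ∈ K.D) : normalClass hn p ∈ K.refSet ∧ K.rho (normalClass hn p) =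
      (kapJ μ p.1.1, fun i => p.1.2 i.1 / p.1.2 μ.o * wgtOne μ p.1.1 i.1) := by
  have hl := isLab_normalClass hn p
  have hd := wgtDen_normal μ p.2.1 p.2.2
  refine ⟨⟨_, _, hl, hp, hd⟩, ?_⟩
  rw [K.rho_eq hn hl hp hd]
  exact Prod.ext rfl (funext fun i => wgt_normal μ p.2.1 p.2.2 i.1)

lemma rho_par (hn : 4 ≤ dim W) {y} (hy : y ∈ K.dom) :
    normalClass hn ⟨K.par y, K.par_mem hy⟩ ∈ K.refSet ∧
      K.rho (normalClass hn ⟨K.par y, K.par_mem hy⟩) = y := by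
  have e : kapJ μ (K.par y).1 = y.1 := K.kap_sec _ hy.1
  obtain ⟨h1, h2⟩ := K.rho_normalClass hn (p := ⟨K.par y, K.par_mem hy⟩) (e ▸ hy.1)
  refine ⟨h1, h2.trans (Prod.ext e (funext fun i => ?_))⟩
  have := wgtOne_ne_zero μ (K.inj _ hy.1) i.1
  simp only [par, dif_neg i.2, dif_pos, div_one]
  exact div_mul_cancel₀ _ this

lemma exists_labM_sec (hn : 4 ≤ dim W) {x : Moduli W} {α} (h : IsLabM x α)
    (hα : kapJ μ α ∈ K.D) : IsLabM x (K.sec (kapJ μ α)) := by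
  obtain ⟨g, hg, hgα⟩ := exists_mob_of_kapJ_eq μ h.inj (K.inj _ hα) (K.kap_sec _ hα).symm
  have := h.mob (by omega) hg fun i => (hgα i).1
  rwa [show (fun i => mob g (α i)) = K.sec (kapJ μ α) from funext fun i => (hgα i).2] at this

lemma p₂_eq_par (hn : 4 ≤ dim W) {s : corr W} (hs : p₂ s ∈ K.refSet) :
    p₁ s ∈ K.modSet ∧ K.chi (p₁ s) = (K.rho (p₂ s)).1 ∧ ∃ hy : K.rho (p₂ s) ∈ K.dom,
      p₂ s = normalClass hn ⟨K.par (K.rho (p₂ s)), K.par_mem hy⟩ := by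
  obtain ⟨α, m, h, hα, hm⟩ := hs
  have h1 : IsLabM (p₁ s) α := by rw [← forget_p₂]; exact h.isLabM
  obtain ⟨p, hp, he⟩ := exists_normalClass_of_forget hn s (K.exists_labM_sec hn h1 hα)
  have hk : kapJ μ p.1.1 = kapJ μ α := by rw [hp]; exact K.kap_sec _ hα
  obtain ⟨-, h3⟩ := K.rho_normalClass hn (p := p) (hk ▸ hα)
  have hr : K.rho (p₂ s) = (kapJ μ α, fun i => p.1.2 i.1 / p.1.2 μ.o * wgtOne μ p.1.1 i.1) := by
    rw [he, h3, hk]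
  have hy : K.rho (p₂ s) ∈ K.dom := by
    rw [hr]
    exact ⟨hα, prod_ne_zero_iff.2 fun i _ => mul_ne_zero (div_ne_zero (p.2.2 _) (p.2.2 _))
      (wgtOne_ne_zero μ p.2.1 _)⟩
  refine ⟨⟨α, h1, hα⟩, by rw [K.chi_eq hn h1 hα, hr], hy, ?_⟩
  refine he.trans ((normalClass_smul hn p (inv_ne_zero (p.2.2 μ.o))).trans ?_)
  congr 1
  refine Subtype.ext (Prod.ext ?_ (funext fun i => ?_))
  · simp only [par, hr, hp]
  · simp only [par, hr]
    have := wgtOne_ne_zero μ p.2.1 i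
    split_ifs with h
    · rw [h]; exact inv_mul_cancel₀ (p.2.2 _)
    · rw [← hp, mul_div_assoc, div_self this, mul_one, inv_mul_eq_div]

lemma forget_par (hn : 4 ≤ dim W) {x : Moduli W} (hx : x ∈ K.modSet)
    {c} (hc : ∀ i, c i ≠ 0) (hD : K.chi x ∈ K.D) :
    forget (normalClass hn ⟨(K.sec (K.chi x), c), K.inj _ hD, hc⟩) = x := by
  obtain ⟨α, h, hα⟩ := hx
  refine forget_normalClass_eq hn _ ?_
  change IsLabM x (K.sec (K.chi x))
  rw [K.chi_eq hn h hα]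
  exact K.exists_labM_sec hn h hα

lemma chi_mem (hn : 4 ≤ dim W) {x : Moduli W} (hx : x ∈ K.modSet) :
    K.chi x ∈ K.D := by
  obtain ⟨α, h, hα⟩ := hx
  rwa [K.chi_eq hn h hα]

lemma isChartOn_chi (hn : 4 ≤ dim W) : IsChartOn (moduliAn W) K.chi K.modSet := by
  obtain ⟨ho, hreg⟩ := K.chi_regMapAt hn
  have h1 : ∀ i : Fin (dim W), (1 : Fin (dim W) → ℂ) i ≠ 0 :=
    fun _ => one_ne_zero
  have him : K.chi '' K.modSet = K.D := by
    refine Set.Subset.antisymm ?_ fun κ hκ => ?_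
    · rintro _ ⟨x, hx, rfl⟩; exact K.chi_mem hn hx
    · have hl := (isLab_normalClass hn ⟨(K.sec κ, 1), K.inj _ hκ, h1⟩).isLabM
      have e := K.kap_sec _ hκ
      exact ⟨_, ⟨_, hl, e.symm ▸ hκ⟩, (K.chi_eq hn hl (e.symm ▸ hκ)).trans e⟩
  refine isChartOn_of_refines ho (fun x hx y hy hxy => ?_) (him ▸ K.isOpen) ?_ ?_
  · rw [← K.forget_par hn hx h1 (K.chi_mem hn hx), ← K.forget_par hn hy h1 (K.chi_mem hn hy)]
    congr 5
  · exact Refines.analytic_of (isAnalytic_moduliAn W) K.chi (fun _ => rfl)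
      fun x => hreg x.1 x.2
  · have hmor := isMorphism_normalClass hn (𝒳 := (analytic (μ.J → ℂ)).restrict K.D)
      (isLocal_induced _ _) (𝒜 := analytic (PairAmb W))
      (fun κ => ⟨(K.sec κ.1, 1), K.inj _ κ.2, h1⟩) (Refines.analytic_of
        ((isAnalytic_analytic _).induced _) _ (fun _ => rfl) fun κ => ?_)
    · exact Refines.of_isMorphism_restrict ((isMorphism_forget
        (analytic_isMorphism_linear (LinearMap.fst ℂ (PencilAmb W) (Fin 3 → W)))).comp hmor)
        (fun x => K.chi_mem hn x.2) fun x => K.forget_par hn x.2 h1 (K.chi_mem hn x.2)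
    · have hri := analytic_isRinged (μ.J → ℂ)
      exact RegMapAt.induced (i := Subtype.val) (R := fun κ => secFrame W (K.sec κ, 1))
        (hri.regMapAt_secFrame (hri.regMapAt_prod (hri.regMapAt_pi fun i =>
          hri.regMapAt (K.regAt _ κ.2 i)) (hri.regMapAt_const _)))

lemma isChartOn_rho (hn : 4 ≤ dim W) :
    IsChartOn (corrAn W) (fun s => K.rho (p₂ s)) (p₂ ⁻¹' K.refSet) := by
  obtain ⟨ho, hreg⟩ := K.rho_regMapAt hn
  have him : (fun s => K.rho (p₂ s)) '' (p₂ ⁻¹' K.refSet) = K.dom := by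
    refine Set.Subset.antisymm ?_ fun y hy => ?_
    · rintro _ ⟨s, hs, rfl⟩; exact (K.p₂_eq_par hn hs).2.2.1
    · obtain ⟨h1, h2⟩ := K.rho_par hn hy
      exact ⟨frameToCorr ⟨_, isPoised_normalFrame hn ⟨K.par y, K.par_mem hy⟩⟩, h1, h2⟩
  rw [corrAn_eq]
  refine isChartOn_of ⟨_, ho, rfl⟩ (fun s hs t ht hst => p₂_injective ?_) (him ▸ K.isOpen_dom) ?_ ?_
  · obtain ⟨-, -, h1, h2⟩ := K.p₂_eq_par hn hs
    obtain ⟨-, -, h3, h4⟩ := K.p₂_eq_par hn ht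
    rw [h2, h4]
    congr 3
  · exact Refines.analytic_of (isAnalytic_refinedAn W) K.rho (fun _ => rfl)
      fun x => hreg _ x.2
  · have hmor := isMorphism_normalClass hn
      (𝒳 := (analytic ((μ.J → ℂ) × (μ.I → ℂ))).restrict K.dom)
      (isLocal_induced _ _) (𝒜 := analytic (PairAmb W))
      (fun y => ⟨K.par y.1, K.par_mem y.2⟩) (Refines.analytic_of
        ((isAnalytic_analytic _).induced _) _ (fun _ => rfl) fun y => ?_)
    · exact Refines.of_isMorphism_restrict hmor
        (fun s => (K.p₂_eq_par hn s.2).2.2.1) fun s => (K.p₂_eq_par hn s.2).2.2.2.symm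
    · exact RegMapAt.induced (i := Subtype.val) (R := fun y => secFrame W (K.par y))
        ((analytic_isRinged _).regMapAt_secFrame (K.par_regMapAt y.2))

include K in
lemma isSubmersionAt (hn : 4 ≤ dim W) {s : corr W} (h : IsLabM (p₁ s) α₀) :
    IsSubmersionAt (corrAn W) (moduliAn W) p₁ s := by
  classical
  have hs : p₂ s ∈ K.refSet := by
    obtain ⟨p, hp, he⟩ := exists_normalClass_of_forget hn s h
    rw [he]
    exact (K.rho_normalClass hn (by rw [hp]; exact K.mem)).1
  set e₁ : (μ.J → ℂ) ≃ₗ[ℂ] (Fin (Fintype.card μ.J) → ℂ) :=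
    LinearEquiv.funCongrLeft ℂ ℂ (Fintype.equivFin μ.J).symm
  set e₂ : (μ.I → ℂ) ≃ₗ[ℂ] (Fin (Fintype.card μ.I) → ℂ) :=
    LinearEquiv.funCongrLeft ℂ ℂ (Fintype.equivFin μ.I).symm
  refine ⟨_, _, fun s => (e₁.prodCongr e₂) (K.rho (p₂ s)), fun x => e₁ (K.chi x),
    p₂ ⁻¹' K.refSet, K.modSet, hs, (K.isChartOn_rho hn).comp_equiv (e₁.prodCongr e₂),
    (K.isChartOn_chi hn).comp_equiv e₁, fun t ht => (K.p₂_eq_par hn ht).1, fun t ht => ?_⟩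
  exact congrArg e₁ (K.p₂_eq_par hn ht).2.1

end KapDomain

lemma IsGeneral.eq_one {Φ : Submodule ℂ (QuadraticForm ℂ W)} (hΦ : IsGeneral Φ)
    (hn : 4 ≤ dim W) (μ : Marking (dim W)) {y : PencilAmb W}
    {w : Basis (Fin (dim W)) ℂ W} {α c : Fin (dim W) → ℂ}
    (h : IsDiag (y 0) (y 1) w α c) (hy : Span y = Φ)
    {π : Perm (Fin (dim W))} (hπ : kapJ μ (fun i => α (π i)) = kapJ μ α) :
    π = 1 := by
  subst hy
  obtain ⟨g, hg, hgα⟩ := exists_mob_of_kapJ_eq μ h.inj (h.inj.comp π.injective) hπ.symm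
  have hli : LinearIndependent ℂ y := by
    have := h.linearIndependent (by omega)
    rwa [show ![y 0, y 1] = y by funext k; fin_cases k <;> rfl] at this
  set b := Basis.span hli with hb
  have hb' : ∀ k, (b k : QuadraticForm ℂ W) = y k := fun k => congrArg Subtype.val (Basis.span_apply hli k)
  have hdet : IsUnit g.transpose.det := by rw [Matrix.det_transpose]; exact hg.isUnit
  have hG : ∀ φ, Matrix.toLinearEquiv b g.transpose hdet φ =
      (b.repr φ 0 * g 0 0 + b.repr φ 1 * g 1 0) • b 0 +
        (b.repr φ 0 * g 0 1 + b.repr φ 1 * g 1 1) • b 1 := by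
    intro φ
    conv_lhs => rw [← b.sum_repr φ]
    simp only [Matrix.toLinearEquiv_apply, map_add, map_smul, Matrix.toLin_self, Fin.sum_univ_two,
      Matrix.transpose_apply]
    module
  have hdeg : ∀ s t : ℂ, IsDegenerate ((s • b 0 + t • b 1 : Span y) :
      QuadraticForm ℂ W) ↔ ∃ i, s * α i + t = 0 := by
    intro s t
    rw [← h.isDegenerate_comb]
    simp only [Submodule.coe_add, Submodule.coe_smul, hb']
  obtain ⟨r, hr⟩ := hΦ (Matrix.toLinearEquiv b g.transpose hdet) fun φ => by
    rw [hG, hdeg]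
    conv_lhs => rw [← b.sum_repr φ, Fin.sum_univ_two, hdeg]
    set s := b.repr φ 0
    set t := b.repr φ 1
    have key : ∀ i, (s * g 0 0 + t * g 1 0) * α i + (s * g 0 1 + t * g 1 1) =
        mobDen g (α i) * (s * α (π i) + t) := by
      intro i
      have := mob_mul_mobDen (hgα i).1
      rw [show mob g (α i) = α (π i) from (hgα i).2] at this
      rw [mobDen] at this ⊢
      linear_combination -s * this
    simp only [key, mul_eq_zero, (hgα _).1, false_or]
    constructor
    · rintro ⟨i, hi⟩; exact ⟨π.symm i, by simpa using hi⟩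
    · rintro ⟨i, hi⟩; exact ⟨_, hi⟩
  have e : ∀ k l, b.repr (Matrix.toLinearEquiv b g.transpose hdet (b k)) l = g k l := by
    intro k l
    rw [hG]
    fin_cases k <;> fin_cases l <;> simp
  have e2 : ∀ k l, g k l = r * if k = l then 1 else 0 := by
    intro k l
    rw [← e, hr]
    simp [Finsupp.single_apply]
  refine Equiv.ext fun i => h.inj ?_
  have h1 := (hgα i).2
  have h2 := (hgα i).1
  simp only [mob, mobDen, e2] at h1 h2
  simp only [Fin.isValue, one_ne_zero, zero_ne_one, if_true, if_false, mul_one, mul_zero, zero_mul,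
    zero_add, add_zero] at h1 h2
  rw [mul_div_cancel_left₀ _ h2] at h1
  exact h1.symm

lemma isSubmersionAt_p₁ (hn : 4 ≤ dim W) (s : corr W) (Φ : NSPencil W)
    (hs : p₁ s = moduliMk Φ) (hΦ : IsGeneral Φ.1) :
    IsSubmersionAt (corrAn W) (moduliAn W) p₁ s := by
  obtain ⟨μ⟩ := exists_marking hn
  obtain ⟨x, hx⟩ := exists_frame two_pos Φ.1 Φ.2.1
  have hns : IsNonsingular (Span x) := by rw [hx]; exact Φ.2
  obtain ⟨g, hg, hnd⟩ := exists_nondegenerate_mix hns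
  obtain ⟨w, α, c, hd⟩ := exists_isDiag_frame (by omega) ((isNonsingular_frame_mix hg).2 hns) hnd
  have hspan : Span (mix g x) = Φ.1 := by rw [span_mix hg, hx]
  obtain ⟨K⟩ := exists_kapDomain μ hd.inj fun π hπ => hΦ.eq_one hn μ hd hspan hπ
  refine K.isSubmersionAt hn ?_
  have := isLabM_of_diag (by omega) ⟨x, hns⟩ hg hd
  rwa [hs, show moduliMk Φ = frameToModuli ⟨x, hns⟩ by
    rw [frameToModuli]; congr 1; exact Subtype.ext hx.symm]

end LabelledCharts


section Speiser

variable {G L Y : Type*} [Group G] [Finite G] [Field L] [AddCommGroup Y] [Module L Y]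

/-- Invariants of a faithful semilinear action of a finite group span every stable subspace. -/
lemma le_span_invariants {φ : G → L →* L} (hφ : Injective φ) {act : G → Y →+ Y}
    (hmul : ∀ g h y, act g (act h y) = act (g * h) y)
    (hone : ∀ y, act 1 y = y) (hsmul : ∀ g c y, act g (c • y) = φ g c • act g y)
    {X : Submodule L Y} (hX : ∀ g, ∀ y ∈ X, act g y ∈ X) :
    X ≤ span L {y | y ∈ X ∧ ∀ g, act g y = y} := by
  classical
  have := Fintype.ofFinite G
  intro y hy
  by_contra hne
  obtain ⟨f, hf, hker⟩ := Submodule.exists_le_ker_of_notMem hne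
  have h1 : ∀ c : L, ∑ g, f (act g y) • φ g c = 0 := by
    intro c
    have : ∑ g, act g (c • y) ∈ LinearMap.ker f := by
      refine hker (Submodule.subset_span ⟨Submodule.sum_mem _ fun g _ =>
        hX g _ (X.smul_mem c hy), fun g => ?_⟩)
      rw [map_sum, ← Equiv.sum_comp (Equiv.mulLeft g) fun h => act h (c • y)]
      simp [hmul]
    rw [LinearMap.mem_ker, map_sum] at this
    rw [← this]
    refine sum_congr rfl fun g _ => ?_
    rw [hsmul, map_smul, smul_eq_mul, smul_eq_mul, mul_comm]
  have h2 := (linearIndependent_monoidHom L L).comp φ hφ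
  have h3 := Fintype.linearIndependent_iff.1 h2 (fun g => f (act g y)) (by
    funext c
    simpa using h1 c) 1
  rw [hone] at h3
  exact hf h3

end Speiser

section Generators

variable {K : Type} [Field K] [Algebra ℂ K]

/-- The action of a group of automorphisms on a stable intermediate field. -/
def restrictAut {H : Subgroup (K ≃ₐ[ℂ] K)} (L : IntermediateField ℂ K)
    (hL : ∀ σ ∈ H, ∀ y ∈ L, σ y ∈ L) (σ : H) : L →* L where
  toFun y := ⟨σ.1 (y : K), hL σ.1 σ.2 y y.2⟩
  map_one' := Subtype.ext (map_one σ.1)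
  map_mul' y z := Subtype.ext (map_mul σ.1 (y : K) z)

lemma restrictAut_injective {H : Subgroup (K ≃ₐ[ℂ] K)} {L : IntermediateField ℂ K}
    (hL : ∀ σ ∈ H, ∀ y ∈ L, σ y ∈ L) (hf : ∀ σ ∈ H, (∀ y ∈ L, σ y = y) → σ = 1) :
    Injective (restrictAut L hL) := by
  intro σ τ h
  have h1 : ∀ y ∈ L, σ.1 y = τ.1 y := fun y hy =>
    congrArg Subtype.val (DFunLike.congr_fun h (⟨y, hy⟩ : L))
  have h2 := hf (τ.1⁻¹ * σ.1) (H.mul_mem (H.inv_mem τ.2) σ.2) fun y hy => by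
    rw [AlgEquiv.mul_apply, h1 y hy]
    exact τ.1.symm_apply_apply y
  exact Subtype.ext (inv_mul_eq_one.1 h2).symm

lemma exists_fin_enum {Y : Type*} [Zero Y] {s : Set Y} (hs : s.Finite) {r : ℕ}
    (hr : s.ncard ≤ r) : ∃ w : Fin r → Y, s ⊆ range w ∧ ∀ i, w i ∈ s ∨ w i = 0 := by
  classical
  have := hs.fintype
  have hc : Fintype.card s = s.ncard := by rw [Set.ncard_eq_toFinset_card', Set.toFinset_card]
  let e := Fintype.equivFinOfCardEq hc
  refine ⟨fun i => if h : i.1 < s.ncard then (e.symm ⟨i, h⟩).1 else 0, ?_, ?_⟩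
  · intro y hy
    refine ⟨⟨(e ⟨y, hy⟩).1, (e ⟨y, hy⟩).2.trans_le hr⟩, ?_⟩
    simp
  · intro i
    by_cases h : i.1 < s.ncard
    · left; simp [h]
    · right; simp [h]

/-- A stable space of dimension at most `r + 1` containing `1` is spanned by `1` and `r` further
invariants. -/
lemma exists_invariant_generators {H : Subgroup (K ≃ₐ[ℂ] K)} [Finite H]
    {L : IntermediateField ℂ K} (hL : ∀ σ ∈ H, ∀ y ∈ L, σ y ∈ L)
    (hf : ∀ σ ∈ H, (∀ y ∈ L, σ y = y) → σ = 1) {X : Submodule L K}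
    (hX : ∀ σ ∈ H, ∀ y ∈ X, σ y ∈ X) (h1 : (1 : K) ∈ X) [Module.Finite L X] {r : ℕ}
    (hr : Module.finrank L X ≤ r + 1) :
    ∃ w : Fin r → K, (∀ i, ∀ σ ∈ H, σ (w i) = w i) ∧
      X ≤ span L (insert 1 (range w)) := by
  have hspan := le_span_invariants (restrictAut_injective hL hf)
    (act := fun σ : H => (σ.1 : K ≃+ K).toAddMonoidHom) (fun _ _ _ => rfl) (fun _ => rfl)
    (fun σ c y => by
      change σ.1 (c • y) = (restrictAut L hL σ c) • σ.1 y
      rw [Algebra.smul_def, Algebra.smul_def, map_mul]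
      rfl) (X := X) (fun σ y hy => hX σ.1 σ.2 y hy)
  set I := {y : K | y ∈ X ∧ ∀ g : H, ((g.1 : K ≃+ K).toAddMonoidHom) y = y} with hI
  have hs1 : LinearIndepOn L id ({1} : Set K) := (linearIndepOn_singleton_iff L).2 one_ne_zero
  obtain ⟨b, hbI, h1b, hIb, hb⟩ := exists_linearIndepOn_extension hs1
    (t := I) (Set.singleton_subset_iff.2 ⟨h1, fun g => map_one g.1⟩)
  have hbX : ∀ y ∈ b, y ∈ X := fun y hy => (hbI hy).1
  have hb' : LinearIndependent L (fun y : b => (⟨y.1, hbX y.1 y.2⟩ : X)) :=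
    LinearIndependent.of_comp X.subtype hb
  have hfin : Finite b := hb'.finite
  have hbf : b.Finite := Set.toFinite b
  have := hbf.fintype
  have hcard : b.ncard ≤ r + 1 := by
    have := hb'.fintype_card_le_finrank
    rw [Set.ncard_eq_toFinset_card', Set.toFinset_card]
    omega
  obtain ⟨w, hw, hw'⟩ := exists_fin_enum (s := b \ {1}) (hbf.sdiff) (r := r) (by
    have := Set.ncard_sdiff_singleton_add_one (h1b rfl) hbf
    omega)
  refine ⟨w, fun i σ hσ => ?_, ?_⟩
  · rcases hw' i with h | h
    · exact (hbI h.1).2 ⟨σ, hσ⟩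
    · rw [h, map_zero]
  · refine hspan.trans (Submodule.span_le.2 fun y hy => ?_)
    refine Submodule.span_mono ?_ (by simpa using hIb (Set.mem_image_of_mem id hy))
    intro y hy
    by_cases h : y = 1
    · exact Or.inl h
    · exact Or.inr (hw ⟨hy, h⟩)

lemma isAlgebraic_adjoin_of_top {S : Set K} (h : adjoin ℂ S = ⊤) :
    Algebra.IsAlgebraic (Algebra.adjoin ℂ S) K := by
  rw [← IntermediateField.isAlgebraic_adjoin_iff_top, h]
  exact ⟨fun y => isAlgebraic_algebraMap (⟨y, trivial⟩ : (⊤ : IntermediateField ℂ K))⟩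

lemma trdeg_le_ncard {S : Set K} (hS : S.Finite) (h : adjoin ℂ S = ⊤) {d : ℕ}
    (hd : Algebra.trdeg ℂ K = d) : d ≤ S.ncard := by
  have := isAlgebraic_adjoin_of_top h
  have h1 := Algebra.IsAlgebraic.trdeg_le_cardinalMk ℂ S
  rw [hd, ← Set.cast_ncard hS] at h1
  exact_mod_cast h1

lemma algebraicIndependent_of_isAlgebraic {d : ℕ} (t : Fin d → K)
    (h : Algebra.IsAlgebraic (adjoin ℂ (range t)) K)
    (hd : Algebra.trdeg ℂ K = d) : AlgebraicIndependent ℂ t := by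
  have := IntermediateField.isAlgebraic_adjoin_iff_top.1 h
  exact (Algebra.IsAlgebraic.isTranscendenceBasis_of_lift_le_trdeg_of_finite ℂ t
    (by simp [hd])).1

lemma algebraicIndependent_of_adjoin {d : ℕ} (t : Fin d → K)
    (h : adjoin ℂ (range t) = ⊤)
    (hd : Algebra.trdeg ℂ K = d) : AlgebraicIndependent ℂ t := by
  refine algebraicIndependent_of_isAlgebraic t ?_ hd
  rw [IntermediateField.isAlgebraic_adjoin_iff_top]
  exact isAlgebraic_adjoin_of_top h

lemma transcendental_of_notMem_bot {s : K} (h : s ∉ (⊥ : IntermediateField ℂ K)) :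
    Transcendental ℂ s := by
  intro h1
  refine h (IntermediateField.mem_bot.2 ?_)
  have h2 : (minpoly ℂ s).degree = 1 := IsAlgClosed.degree_eq_one_of_irreducible ℂ
    (minpoly.irreducible h1.isIntegral)
  exact minpoly.mem_range_of_degree_eq_one ℂ s h2

lemma span_le_of_mem {L M : IntermediateField ℂ K} (h : L ≤ M) {S : Set K}
    (hS : ∀ y ∈ S, y ∈ M) {y : K} (hy : y ∈ span L S) : y ∈ M := by
  induction hy using Submodule.span_induction with
  | mem y hy => exact hS y hy
  | zero => exact zero_mem M
  | add y z _ _ h1 h2 => exact add_mem h1 h2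
  | smul c y _ h1 => rw [Algebra.smul_def]; exact mul_mem (h c.2) h1

end Generators


lemma mobDen_mul {g h : Mat₂} {t : ℂ} (ht : mobDen h t ≠ 0) :
    mobDen (g * h) t = mobDen g (mob h t) * mobDen h t := by
  have := mob_mul_mobDen ht
  simp only [mobDen, Matrix.mul_apply, Fin.sum_univ_two] at this ⊢
  linear_combination -(g 1 0) * this

lemma mob_mul {g h : Mat₂} {t : ℂ} (ht : mobDen h t ≠ 0)
    (hg : mobDen g (mob h t) ≠ 0) : mob (g * h) t = mob g (mob h t) := by
  have h0 : mobDen (g * h) t ≠ 0 := by rw [mobDen_mul ht]; exact mul_ne_zero hg ht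
  have h1 := mob_mul_mobDen ht
  have h2 := mob_mul_mobDen hg
  have h3 := mob_mul_mobDen h0
  refine mul_right_cancel₀ h0 (h3.trans ?_)
  rw [mobDen_mul ht, ← mul_assoc, h2]
  simp only [mobDen, Matrix.mul_apply, Fin.sum_univ_two] at *
  linear_combination -(g 0 0) * h1

/-- The automorphism `σ` permutes the `xᵢ`, up to the factors of a projective transformation `g`
of the line permuting the points `αᵢ`. -/
def IsTwist {A : Type*} [CommRing A] [Algebra ℂ A] {n : ℕ} (α : Fin n → ℂ) (x : Fin n → A)
    (σ : A ≃ₐ[ℂ] A) (g : Mat₂) (lam : A) : Prop :=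
  g.det ≠ 0 ∧ ∃ π : Perm (Fin n), ∀ i, mobDen g (α i) ≠ 0 ∧ mob g (α i) = α (π i) ∧
    σ (x (π i)) = lam * algebraMap ℂ A (mobDen g (α i) ^ 5) * x i

lemma IsTwist.mul {A : Type*} [CommRing A] [Algebra ℂ A] {n : ℕ} {α : Fin n → ℂ} {x : Fin n → A}
    {σ τ : A ≃ₐ[ℂ] A} {g h : Mat₂} {l k : A}
    (hσ : IsTwist α x σ g l) (hτ : IsTwist α x τ h k) :
    IsTwist α x (σ * τ) (h * g) (σ k * l) := by
  obtain ⟨hg, π, hπ⟩ := hσ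
  obtain ⟨hh, ϖ, hϖ⟩ := hτ
  refine ⟨by rw [Matrix.det_mul]; exact mul_ne_zero hh hg, π.trans ϖ, fun i => ?_⟩
  obtain ⟨d1, m1, e1⟩ := hπ i
  obtain ⟨d2, m2, e2⟩ := hϖ (π i)
  rw [← m1] at d2
  refine ⟨by rw [mobDen_mul d1]; exact mul_ne_zero d2 d1, by
    rw [mob_mul d1 d2, m1, m2, Equiv.trans_apply], ?_⟩
  rw [Equiv.trans_apply, AlgEquiv.mul_apply, e2, map_mul, map_mul, e1, AlgEquiv.commutes,
    mobDen_mul d1, m1, mul_pow, map_mul]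
  ring

/-- Coordinates `xᵢ` in a purely transcendental extension of `ℂ`, attached to points `αᵢ` of the
projective line, with a finite group of twists; the weights `θᵢ` change the twisting degree `5` into
a smaller degree `m`. -/
structure TwistedPoints (K : Type) [Field K] [Algebra ℂ K] (n : ℕ) where
  α : Fin n → ℂ
  inj : Injective α
  θ : Fin n → ℂ
  θ_ne : ∀ i, θ i ≠ 0
  m : ℕ
  one_le : 1 ≤ m
  le : m + 2 ≤ n
  twist : ∀ (g : Mat₂) (π : Perm (Fin n)), g.det ≠ 0 →
    (∀ i, mobDen g (α i) ≠ 0 ∧ mob g (α i) = α (π i)) →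
    ∃ κ : ℂ, κ ≠ 0 ∧ ∀ i, θ (π i) * mobDen g (α i) ^ 5 = κ * (θ i * mobDen g (α i) ^ m)
  x : Fin n → K
  sum_eq : ∑ i, algebraMap ℂ K (θ i) * x i = 1
  gen : adjoin ℂ (range x) = ⊤
  trdeg_eq : Algebra.trdeg ℂ K = ((n - 1 : ℕ) : Cardinal)
  H : Subgroup (K ≃ₐ[ℂ] K)
  finite : Finite H
  datum : ∀ σ ∈ H, ∃ g lam, IsTwist α x σ g lam

namespace TwistedPoints

open Polynomial

variable {K : Type} [Field K] [Algebra ℂ K] {n : ℕ} (T : TwistedPoints K n)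

/-- The linear form with values `θᵢ xᵢ`. -/
noncomputable def Q (F : Fin n → K) : K := ∑ i, algebraMap ℂ K (T.θ i) * T.x i * F i

lemma Q_mul (c : K) (F : Fin n → K) : T.Q (fun i => c * F i) = c * T.Q F := by
  rw [Q, Q, mul_sum]; exact sum_congr rfl fun i _ => by ring

lemma Q_one : T.Q (fun _ => 1) = 1 := by simp [Q, T.sum_eq]

/-- The value of `Q` on a polynomial function of the points. -/
noncomputable def qp : ℂ[X] →ₗ[ℂ] K where
  toFun p := T.Q fun i => algebraMap ℂ K (p.eval (T.α i))
  map_add' p p' := by simp [Q, mul_add, sum_add_distrib]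
  map_smul' c p := by
    simp only [eval_smul, smul_eq_mul, map_mul, Q_mul, RingHom.id_apply]
    rw [Algebra.smul_def]

lemma qp_apply (p : ℂ[X]) : T.qp p = T.Q fun i => algebraMap ℂ K (p.eval (T.α i)) := rfl

lemma qp_C (c : ℂ) : T.qp (C c) = algebraMap ℂ K c := by
  rw [qp_apply]
  simp only [eval_C]
  have := T.Q_mul (algebraMap ℂ K c) fun _ => 1
  simpa [Q_one] using this

/-- The moments. -/
noncomputable def q (k : ℕ) : K := T.qp (X ^ k)

lemma q_zero : T.q 0 = 1 := by
  rw [q, pow_zero, ← C_1, qp_C, map_one]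

lemma qp_eq_sum {p : ℂ[X]} {N : ℕ} (hp : p.natDegree ≤ N) :
    T.qp p = ∑ k ∈ Finset.range (N + 1), algebraMap ℂ K (p.coeff k) * T.q k := by
  conv_lhs => rw [p.as_sum_range' (N + 1) (by omega)]
  rw [map_sum]
  refine sum_congr rfl fun k _ => ?_
  rw [← smul_X_eq_monomial, map_smul, Algebra.smul_def, q]

lemma qp_mem {S : Submodule ℂ K} {p : ℂ[X]} {N : ℕ} (hp : p.natDegree ≤ N)
    (hS : ∀ k ≤ N, T.q k ∈ S) : T.qp p ∈ S := by
  rw [T.qp_eq_sum hp]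
  refine Submodule.sum_mem _ fun k hk => ?_
  rw [← Algebra.smul_def]
  exact S.smul_mem _ (hS k (by simpa [Nat.lt_succ_iff] using hk))

lemma x_eq_qp (i : Fin n) : algebraMap ℂ K (T.θ i) * T.x i =
    T.qp (Lagrange.basis Finset.univ T.α i) := by
  rw [qp_apply, Q, sum_eq_single i]
  · rw [Lagrange.eval_basis_self T.inj.injOn (mem_univ i), map_one, mul_one]
  · intro j _ hj
    rw [Lagrange.eval_basis_of_ne hj.symm (mem_univ j), map_zero, mul_zero]
  · simp

lemma x_mem {S : Submodule ℂ K} (hS : ∀ k < n, T.q k ∈ S) (i : Fin n) : T.x i ∈ S := by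
  have h0 := T.le
  have h1 : T.qp (Lagrange.basis Finset.univ T.α i) ∈ S :=
    T.qp_mem (N := n - 1) (natDegree_le_of_degree_le (by
      rw [Lagrange.degree_basis T.inj.injOn (mem_univ i)]; simp))
      fun k hk => hS k (by omega)
  rw [← x_eq_qp, ← Algebra.smul_def] at h1
  exact (S.smul_mem_iff (T.θ_ne i)).1 h1

lemma algebraicIndependent_q : AlgebraicIndependent ℂ fun i : Fin (n - 1) => T.q (i + 1) := by
  refine algebraicIndependent_of_adjoin _ ?_ T.trdeg_eq
  rw [eq_top_iff, ← T.gen, adjoin_le_iff]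
  rintro _ ⟨i, rfl⟩
  refine T.x_mem (S := (adjoin ℂ _).toSubalgebra.toSubmodule) (fun k hk => ?_) i
  rcases Nat.eq_zero_or_pos k with rfl | h
  · rw [q_zero]; exact one_mem (adjoin ℂ _)
  · refine subset_adjoin ℂ _ ⟨⟨k - 1, by omega⟩, ?_⟩
    simp [Nat.sub_add_cancel h]

lemma coeff_eq_zero_of_qp_mul {p p' : ℂ[X]} (hp : p.natDegree ≤ T.m) (hp' : p'.natDegree ≤ T.m)
    {e : ℂ} (he : e ≠ 0) (h : T.qp p * T.qp p' = algebraMap ℂ K e) : p.coeff T.m = 0 := by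
  have hm := T.le
  have hm1 := T.one_le
  by_contra hc
  set v : ℕ → MvPolynomial (Fin (n - 1)) ℂ :=
    fun k => if h : 1 ≤ k ∧ k < n then .X ⟨k - 1, by omega⟩ else 1 with hv
  have hv1 : ∀ k ≤ T.m, MvPolynomial.aeval (fun i : Fin (n - 1) => T.q (i + 1)) (v k) = T.q k := by
    intro k hk
    simp only [hv]
    split_ifs with h
    · simp [Nat.sub_add_cancel h.1]
    · have : k = 0 := by omega
      simp [this, q_zero]
  have hlift : ∀ {r : ℂ[X]}, r.natDegree ≤ T.m →
      MvPolynomial.aeval (fun i : Fin (n - 1) => T.q (i + 1))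
        (∑ k ∈ Finset.range (T.m + 1), MvPolynomial.C (r.coeff k) * v k) = T.qp r := by
    intro r hr
    rw [T.qp_eq_sum hr, map_sum]
    refine sum_congr rfl fun k hk => ?_
    rw [map_mul, hv1 k (by simpa [Nat.lt_succ_iff] using hk), MvPolynomial.aeval_C]
  have h1 := T.algebraicIndependent_q (a₁ :=
    (∑ k ∈ Finset.range (T.m + 1), MvPolynomial.C (p.coeff k) * v k) *
    (∑ k ∈ Finset.range (T.m + 1), MvPolynomial.C (p'.coeff k) * v k))
    (a₂ := MvPolynomial.C e) (by rw [map_mul, hlift hp, hlift hp', h, MvPolynomial.aeval_C])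
  have h2 := congrArg (MvPolynomial.eval fun j : Fin (n - 1) =>
    if j.1 = T.m - 1 then -p.coeff 0 / p.coeff T.m else 0) h1
  rw [map_mul, map_sum, MvPolynomial.eval_C] at h2
  refine he (h2.symm.trans (mul_eq_zero_of_left ?_ _))
  have h3 : ∀ k ≤ T.m, MvPolynomial.eval (fun j : Fin (n - 1) =>
      if j.1 = T.m - 1 then -p.coeff 0 / p.coeff T.m else 0) (MvPolynomial.C (p.coeff k) * v k) =
      if k = 0 then p.coeff 0 else if k = T.m then -p.coeff 0 else 0 := by
    intro k hk
    rw [map_mul, MvPolynomial.eval_C]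
    simp only [hv]
    by_cases h0 : k = 0
    · simp [h0]
    · rw [dif_pos ⟨by omega, by omega⟩, MvPolynomial.eval_X]
      by_cases h5 : k = T.m
      · rw [if_pos (by simp [h5]), if_neg h0, if_pos h5, h5, mul_div_cancel₀ _ hc]
      · rw [if_neg (by simp only; omega), if_neg h0, if_neg h5, mul_zero]
  rw [sum_congr rfl fun k hk => h3 k (by simpa [Nat.lt_succ_iff] using hk),
    Finset.sum_eq_add_of_mem (a := 0) (b := T.m) (by simp) (by simp) (by omega)]
  · rw [if_pos rfl, if_neg (by omega), if_pos rfl, add_neg_cancel]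
  · intro k _ hk
    rw [if_neg hk.1, if_neg hk.2]

variable {T}

lemma apply_Q {σ : K ≃ₐ[ℂ] K} {g lam} (h : IsTwist T.α T.x σ g lam) :
    ∃ (μ : K) (κ : ℂ) (π : Perm (Fin n)), κ ≠ 0 ∧ μ = lam * algebraMap ℂ K κ ∧
      (∀ i, mobDen g (T.α i) ≠ 0 ∧ mob g (T.α i) = T.α (π i)) ∧
      ∀ F : Fin n → K, σ (T.Q F) =
        μ * T.Q fun i => algebraMap ℂ K (mobDen g (T.α i) ^ T.m) * σ (F (π i)) := by
  obtain ⟨hg, π, hπ⟩ := h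
  obtain ⟨κ, hκ, e⟩ := T.twist g π hg fun i => ⟨(hπ i).1, (hπ i).2.1⟩
  refine ⟨_, κ, π, hκ, rfl, fun i => ⟨(hπ i).1, (hπ i).2.1⟩, fun F => ?_⟩
  rw [Q, Q, map_sum, ← Equiv.sum_comp π, mul_sum]
  refine sum_congr rfl fun i _ => ?_
  rw [map_mul, map_mul, (hπ i).2.2, AlgEquiv.commutes]
  have := congrArg (algebraMap ℂ K) (e i)
  simp only [map_mul] at this ⊢
  linear_combination lam * T.x i * σ (F (π i)) * this

/-- Numerator and denominator of a projective transformation. -/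
noncomputable def lin (g : Mat₂) (k : Fin 2) : ℂ[X] := C (g k 0) * X + C (g k 1)

lemma eval_lin_one (g : Mat₂) (t : ℂ) : (lin g 1).eval t = mobDen g t := by
  simp [lin, mobDen]

lemma eval_lin_zero {g : Mat₂} {t : ℂ} (h : mobDen g t ≠ 0) :
    (lin g 0).eval t = mob g t * mobDen g t := by
  rw [mob_mul_mobDen h]; simp [lin]

lemma natDegree_lin_le (g : Mat₂) (k : Fin 2) : (lin g k).natDegree ≤ 1 :=
  natDegree_linear_le

lemma apply_qp {σ : K ≃ₐ[ℂ] K} {g lam} (h : IsTwist T.α T.x σ g lam) :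
    ∃ (μ : K) (κ : ℂ), κ ≠ 0 ∧ μ = lam * algebraMap ℂ K κ ∧ ∀ p p' : ℂ[X],
      (∀ t, mobDen g t ≠ 0 → p'.eval t = mobDen g t ^ T.m * p.eval (mob g t)) →
      σ (T.qp p) = μ * T.qp p' := by
  obtain ⟨μ, κ, π, hκ, hμ, hπ, hQ⟩ := apply_Q h
  refine ⟨μ, κ, hκ, hμ, fun p p' hp => ?_⟩
  rw [qp_apply, hQ, qp_apply]
  congr 2
  funext i
  rw [AlgEquiv.commutes, ← map_mul, hp _ (hπ i).1, (hπ i).2]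

lemma eval_twist_pow {g : Mat₂} {m k : ℕ} (hk : k ≤ m) {t : ℂ}
    (ht : mobDen g t ≠ 0) : (lin g 1 ^ (m - k) * lin g 0 ^ k).eval t =
      mobDen g t ^ m * (X ^ k : ℂ[X]).eval (mob g t) := by
  rw [eval_mul, eval_pow, eval_pow, eval_lin_one, eval_lin_zero ht, eval_pow, eval_X, mul_pow,
    ← mul_assoc, mul_right_comm, ← pow_add, Nat.sub_add_cancel hk]

lemma natDegree_twist_pow_le (g : Mat₂) {m k : ℕ} (hk : k ≤ m) :
    (lin g 1 ^ (m - k) * lin g 0 ^ k).natDegree ≤ m := by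
  refine natDegree_mul_le.trans ?_
  have h1 := natDegree_pow_le_of_le (m - k) (natDegree_lin_le g 1)
  have h2 := natDegree_pow_le_of_le k (natDegree_lin_le g 0)
  omega

lemma scalar_of_fix {σ : K ≃ₐ[ℂ] K} {g lam} (h : IsTwist T.α T.x σ g lam)
    (hfix : ∀ k ≤ T.m, σ (T.q k) = T.q k) : g = Matrix.scalar (Fin 2) (g 1 1) := by
  have hm := T.one_le
  have hm2 := T.le
  obtain ⟨μ, κ, -, -, hq⟩ := apply_qp h
  have hdet := h.1
  have hfix' : ∀ p : ℂ[X], p.natDegree ≤ T.m → σ (T.qp p) = T.qp p := by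
    intro p hp
    rw [T.qp_eq_sum hp, map_sum]
    refine sum_congr rfl fun k hk => ?_
    rw [map_mul, AlgEquiv.commutes, hfix k (by simpa [Nat.lt_succ_iff] using hk)]
  have hone : 1 = μ * T.qp (lin g 1 ^ T.m) := by
    have := hq 1 (lin g 1 ^ T.m) fun t _ => by simp [eval_lin_one]
    rwa [show T.qp 1 = 1 by rw [← C_1, qp_C, map_one], map_one] at this
  set p : ℂ[X] := (C (g 1 0) * X + C (-g 0 0)) ^ T.m with hp
  have hpd : p.natDegree ≤ T.m := by
    have := natDegree_pow_le_of_le T.m (natDegree_linear_le (a := g 1 0) (b := -g 0 0))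
    rwa [mul_one] at this
  have h1 : T.qp p = μ * algebraMap ℂ K ((-g.det) ^ T.m) := by
    rw [← hfix' p hpd, hq p (C ((-g.det) ^ T.m)), qp_C]
    intro t ht
    have := mob_mul_mobDen ht
    rw [eval_C, hp, eval_pow, ← mul_pow]
    congr 1
    simp only [eval_add, eval_mul, eval_C, eval_X, Matrix.det_fin_two]
    unfold mobDen at *
    linear_combination -(g 1 0) * this
  have hc : g 1 0 = 0 := by
    have h2 : T.qp p * T.qp (lin g 1 ^ T.m) = algebraMap ℂ K ((-g.det) ^ T.m) := by
      rw [h1]; linear_combination -(algebraMap ℂ K ((-g.det) ^ T.m)) * hone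
    have h3 := T.coeff_eq_zero_of_qp_mul hpd (by
      simpa using natDegree_pow_le_of_le T.m (natDegree_lin_le g 1)) (by simp [hdet]) h2
    have h4 := coeff_pow_of_natDegree_le (natDegree_linear_le (a := g 1 0) (b := -g 0 0)) (m := T.m)
    rw [mul_one, ← hp, h3] at h4
    simpa using (pow_eq_zero_iff (by omega)).1 h4.symm
  have hl : lin g 1 = C (g 1 1) := by simp [lin, hc]
  rw [hl, ← C_pow, qp_C] at hone
  have h5 : algebraMap ℂ K (g 1 1) * T.q 1 =
      algebraMap ℂ K (g 0 0) * T.q 1 + algebraMap ℂ K (g 0 1) := by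
    have h6 := hq (X ^ 1) _ fun t ht => eval_twist_pow hm ht
    have h7 : T.qp (lin g 0) = algebraMap ℂ K (g 0 0) * T.q 1 + algebraMap ℂ K (g 0 1) := by
      rw [lin, map_add, qp_C, ← smul_eq_C_mul, map_smul, Algebra.smul_def, q, pow_one]
    have h8 : T.qp (C (g 1 1) ^ (T.m - 1) * lin g 0) =
        algebraMap ℂ K (g 1 1 ^ (T.m - 1)) * T.qp (lin g 0) := by
      rw [← C_pow, ← smul_eq_C_mul, map_smul, Algebra.smul_def]
    rw [hl, pow_one (lin g 0), h8] at h6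
    change σ (T.q 1) = _ at h6
    rw [hfix 1 hm] at h6
    rw [← h7]
    conv_lhs => rw [h6]
    have h9 : algebraMap ℂ K (g 1 1) * algebraMap ℂ K (g 1 1 ^ (T.m - 1)) =
        algebraMap ℂ K (g 1 1 ^ T.m) := by
      rw [← map_mul, ← pow_succ', Nat.sub_add_cancel hm]
    linear_combination (μ * T.qp (lin g 0)) * h9 - T.qp (lin g 0) * hone
  have htr : Transcendental ℂ (T.q 1) := by
    have := T.algebraicIndependent_q.transcendental ⟨0, by omega⟩
    simpa using this
  have h10 : g 1 1 = g 0 0 := by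
    by_contra hne
    refine htr ?_
    have : T.q 1 = algebraMap ℂ K (g 0 1 / (g 1 1 - g 0 0)) := by
      rw [map_div₀, map_sub, eq_div_iff (by rw [← map_sub]; simpa [sub_eq_zero] using hne)]
      linear_combination h5
    rw [this]
    exact isAlgebraic_algebraMap _
  have h11 : g 0 1 = 0 := by
    rw [h10, left_eq_add] at h5
    simpa using h5
  ext i j
  fin_cases i <;> fin_cases j <;> simp [hc, h10, h11]

lemma eq_one_of_scalar {σ : K ≃ₐ[ℂ] K} {c : ℂ} {lam}
    (h : IsTwist T.α T.x σ (Matrix.scalar (Fin 2) c) lam) :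
    σ = 1 ∧ lam * algebraMap ℂ K (c ^ 5) = 1 := by
  obtain ⟨hg, π, hπ⟩ := h
  have hd : ∀ t, mobDen (Matrix.scalar (Fin 2) c) t = c := by intro t; simp [mobDen]
  have hc : c ≠ 0 := by
    rintro rfl
    simp at hg
  have h1 : ∀ i, σ (T.x i) = lam * algebraMap ℂ K (c ^ 5) * T.x i := by
    intro i
    obtain ⟨-, h2, h3⟩ := hπ i
    have h4 : mob (Matrix.scalar (Fin 2) c) (T.α i) = T.α i := by
      simp [mob, hd, hc]
    rw [← T.inj (h4.symm.trans h2), hd] at h3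
    exact h3
  have h2 : lam * algebraMap ℂ K (c ^ 5) = 1 := by
    have := congrArg σ T.sum_eq
    rw [map_sum, map_one] at this
    simp only [map_mul, AlgEquiv.commutes, h1] at this
    refine Eq.trans ?_ this
    refine (mul_one _).symm.trans ?_
    rw [← T.sum_eq, mul_sum]
    exact sum_congr rfl fun i _ => by ring
  refine ⟨AlgEquiv.ext fun y => ?_, h2⟩
  have hy : y ∈ adjoin ℂ (range T.x) := by rw [T.gen]; trivial
  rw [AlgEquiv.one_apply]
  induction hy using IntermediateField.adjoin_induction with
  | mem y hy => obtain ⟨i, rfl⟩ := hy; rw [h1, h2, one_mul]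
  | algebraMap c => exact σ.commutes c
  | add y z _ _ h1 h2 => rw [map_add, h1, h2]
  | inv y _ h1 => rw [map_inv₀, h1]
  | mul y z _ _ h1 h2 => rw [map_mul, h1, h2]

lemma twist_unique {σ : K ≃ₐ[ℂ] K} (hσ : σ ∈ T.H) {g g' lam lam'}
    (h : IsTwist T.α T.x σ g lam) (h' : IsTwist T.α T.x σ g' lam') :
    ∃ e : ℂ, e ≠ 0 ∧ g' = e • g ∧ lam' * algebraMap ℂ K (e ^ 5) = lam := by
  obtain ⟨k, ν, hk⟩ := T.datum _ (T.H.inv_mem hσ)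
  have key : ∀ {g lam}, IsTwist T.α T.x σ g lam → ∃ c : ℂ, c ≠ 0 ∧ g * k = c • 1 ∧
      lam * σ ν * algebraMap ℂ K (c ^ 5) = 1 := by
    intro g lam h
    have h1 := hk.mul h
    rw [inv_mul_cancel] at h1
    have h2 := scalar_of_fix h1 fun k _ => rfl
    set c := (g * k) 1 1
    rw [h2] at h1
    have h3 := congrArg σ (eq_one_of_scalar h1).2
    have h4 : σ (σ⁻¹ lam) = lam := σ.apply_symm_apply lam
    rw [map_mul, map_mul, h4, map_one, AlgEquiv.commutes] at h3
    refine ⟨c, ?_, by rw [h2]; ext i j; fin_cases i <;> fin_cases j <;> simp, h3⟩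
    rintro h5
    exact h1.1 (by rw [h5]; simp)
  obtain ⟨c, hc, e1, e2⟩ := key h
  obtain ⟨c', hc', e1', e2'⟩ := key h'
  refine ⟨c' / c, div_ne_zero hc' hc, ?_, ?_⟩
  · have hu : IsUnit k := (Matrix.isUnit_iff_isUnit_det k).2 hk.1.isUnit
    refine hu.mul_left_injective ?_
    change g' * k = (c' / c) • g * k
    rw [Matrix.smul_mul, e1, e1', smul_smul, div_mul_cancel₀ _ hc]
  · have hc5 : algebraMap ℂ K (c ^ 5) ≠ 0 := by simpa using hc
    have hne : σ ν ≠ 0 := by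
      intro h0; rw [h0] at e2; simp at e2
    rw [div_pow, map_div₀]
    field_simp
    refine mul_left_cancel₀ hne ?_
    linear_combination e2' - e2

end TwistedPoints


section Stable

variable {K : Type} [Field K] [Algebra ℂ K]

lemma apply_mem_of_adjoin {S : Set K} {M : IntermediateField ℂ K} {σ : K ≃ₐ[ℂ] K}
    (h : ∀ y ∈ S, σ y ∈ M) {y : K} (hy : y ∈ adjoin ℂ S) : σ y ∈ M := by
  induction hy using IntermediateField.adjoin_induction with
  | mem y hy => exact h y hy
  | algebraMap c => rw [σ.commutes]; exact M.algebraMap_mem c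
  | add y z _ _ h1 h2 => rw [map_add]; exact add_mem h1 h2
  | inv y _ h1 => rw [map_inv₀]; exact inv_mem h1
  | mul y z _ _ h1 h2 => rw [map_mul]; exact mul_mem h1 h2

lemma apply_mem_of_span {L : IntermediateField ℂ K} {σ : K ≃ₐ[ℂ] K} (hL : ∀ y ∈ L, σ y ∈ L)
    {S : Set K} (h : ∀ y ∈ S, σ y ∈ span L S) {y : K} (hy : y ∈ span L S) :
    σ y ∈ span L S := by
  induction hy using Submodule.span_induction with
  | mem y hy => exact h y hy
  | zero => rw [map_zero]; exact zero_mem _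
  | add y z _ _ h1 h2 => rw [map_add]; exact add_mem h1 h2
  | smul c y _ h1 =>
    rw [Algebra.smul_def, map_mul]
    exact Submodule.smul_mem _ (⟨_, hL c c.2⟩ : L) h1

open Polynomial in
lemma mob_fixed_of_transcendental {s : K} (hs : Transcendental ℂ s) {a b c d : ℂ}
    (h : s * (algebraMap ℂ K c * s + algebraMap ℂ K d) = algebraMap ℂ K a * s + algebraMap ℂ K b) :
    c = 0 ∧ b = 0 ∧ a = d := by
  have h1 : C c * X ^ 2 + C (d - a) * X + C (-b) = 0 := by
    refine (transcendental_iff.1 hs) _ ?_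
    simp only [map_add, map_mul, aeval_C, map_pow, aeval_X, map_sub, map_neg]
    linear_combination h
  have h2 := congrArg (fun p => coeff p 2) h1
  have h3 := congrArg (fun p => coeff p 1) h1
  have h4 := congrArg (fun p => coeff p 0) h1
  simp [coeff_X, coeff_C] at h2 h3 h4
  exact ⟨h2, h4, (sub_eq_zero.1 h3).symm⟩

end Stable

namespace TwistedPoints

open Polynomial

variable {K : Type} [Field K] [Algebra ℂ K] {n : ℕ} (T : TwistedPoints K n)

/-- The field generated by the first moments. -/
noncomputable def base : IntermediateField ℂ K := adjoin ℂ (T.q '' Set.Icc 1 T.m)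

variable {T}

lemma q_mem_of_image {M : IntermediateField ℂ K} {r k : ℕ} (hM : T.q '' Set.Icc 1 r ⊆ M)
    (hk : k ≤ r) : T.q k ∈ M := by
  rcases Nat.eq_zero_or_pos k with rfl | h
  · rw [q_zero]; exact one_mem _
  · exact hM ⟨k, ⟨h, hk⟩, rfl⟩

lemma q_mem_base {k : ℕ} (hk : k ≤ T.m) : T.q k ∈ T.base :=
  q_mem_of_image (subset_adjoin ℂ _) hk

lemma qp_mem_base {p : ℂ[X]} (hp : p.natDegree ≤ T.m) : T.qp p ∈ T.base :=
  T.qp_mem (S := T.base.toSubalgebra.toSubmodule) hp fun _ hk => q_mem_base hk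

lemma lam_mem_base {σ : K ≃ₐ[ℂ] K} {g lam} (h : IsTwist T.α T.x σ g lam) :
    lam ∈ T.base ∧ lam ≠ 0 := by
  obtain ⟨μ, κ, -, hμ, hq⟩ := apply_qp h
  have h1 := hq 1 (lin g 1 ^ T.m) fun t _ => by simp [eval_lin_one]
  rw [show T.qp 1 = 1 by rw [← C_1, qp_C, map_one], map_one, hμ, mul_assoc] at h1
  rw [eq_inv_of_mul_eq_one_left h1.symm]
  refine ⟨inv_mem (mul_mem (T.base.algebraMap_mem κ) (qp_mem_base ?_)), fun h0 => ?_⟩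
  · simpa using natDegree_pow_le_of_le T.m (natDegree_lin_le g 1)
  · rw [inv_eq_zero.1 h0] at h1
    simp at h1

lemma apply_mem_base {σ : K ≃ₐ[ℂ] K} {g lam} (h : IsTwist T.α T.x σ g lam) {y : K}
    (hy : y ∈ T.base) : σ y ∈ T.base := by
  obtain ⟨μ, κ, -, hμ, hq⟩ := apply_qp h
  refine apply_mem_of_adjoin ?_ hy
  rintro _ ⟨k, hk, rfl⟩
  rw [q, hq _ _ fun t ht => eval_twist_pow hk.2 ht, hμ]
  exact mul_mem (mul_mem (lam_mem_base h).1 (T.base.algebraMap_mem _))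
    (qp_mem_base (natDegree_twist_pow_le g hk.2))

lemma base_stable : ∀ σ ∈ T.H, ∀ y ∈ T.base, σ y ∈ T.base := by
  intro σ hσ y hy
  obtain ⟨g, lam, h⟩ := T.datum σ hσ
  exact apply_mem_base h hy

lemma base_faithful : ∀ σ ∈ T.H, (∀ y ∈ T.base, σ y = y) → σ = 1 := by
  intro σ hσ hf
  obtain ⟨g, lam, h⟩ := T.datum σ hσ
  have h1 := scalar_of_fix h fun k hk => hf _ (q_mem_base hk)
  rw [h1] at h
  exact (eq_one_of_scalar h).1

variable (T) in
lemma exists_cocycle : ∃ (g : T.H → Mat₂) (ν : T.H → K),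
    (∀ σ : T.H, ∃ lam, IsTwist T.α T.x σ.1 (g σ) lam) ∧ (∀ σ, ν σ ∈ T.base) ∧ (∀ σ, ν σ ≠ 0) ∧
    (∀ i j, ν 1 * algebraMap ℂ K (g 1 i j) = if i = j then 1 else 0) ∧
    ∀ σ τ i j, ν (σ * τ) * algebraMap ℂ K (g (σ * τ) i j) =
      σ.1 (ν τ) * ν σ * algebraMap ℂ K ((g τ * g σ) i j) := by
  choose g lam h using fun σ : T.H => T.datum σ.1 σ.2
  refine ⟨g, fun σ => lam σ * algebraMap ℂ K ((g σ).det ^ 2), fun σ => ⟨_, h σ⟩,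
    fun σ => mul_mem (lam_mem_base (h σ)).1 (T.base.algebraMap_mem _),
    fun σ => mul_ne_zero (lam_mem_base (h σ)).2 (by simpa using (h σ).1), fun i j => ?_,
    fun σ τ i j => ?_⟩
  · have h1 := h 1
    have h2 := scalar_of_fix h1 fun k _ => rfl
    rw [h2] at h1
    have h3 := (eq_one_of_scalar h1).2
    simp only
    rw [h2, ← h3]
    fin_cases i <;> fin_cases j <;> simp [pow_succ, mul_assoc]
  · obtain ⟨e, he, h1, h2⟩ := twist_unique (σ * τ).2 ((h σ).mul (h τ)) (h (σ * τ))
    simp only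
    rw [h1, Matrix.det_smul, Fintype.card_fin, Matrix.det_mul, Matrix.smul_apply, smul_eq_mul]
    simp only [map_mul, map_pow, AlgEquiv.commutes] at h2 ⊢
    linear_combination (algebraMap ℂ K (g τ).det ^ 2 * algebraMap ℂ K (g σ).det ^ 2 *
      algebraMap ℂ K ((g τ * g σ) i j)) * h2

lemma exists_frame {g : T.H → Mat₂} {ν : T.H → K}
    (hν : ∀ σ, ν σ ∈ T.base)
    (hone : ∀ i j, ν 1 * algebraMap ℂ K (g 1 i j) = if i = j then 1 else 0)
    (hmul : ∀ σ τ i j, ν (σ * τ) * algebraMap ℂ K (g (σ * τ) i j) =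
      σ.1 (ν τ) * ν σ * algebraMap ℂ K ((g τ * g σ) i j)) :
    ∃ v : Fin 2 → Fin 2 → K, (∀ k i, v k i ∈ T.base) ∧ v 0 0 * v 1 1 - v 0 1 * v 1 0 ≠ 0 ∧
      ∀ k (σ : T.H) i, σ.1 (v k i) = ν σ * ∑ j, algebraMap ℂ K (g σ i j) * v k j := by
  have := T.finite
  let act : T.H → (Fin 2 → K) →+ (Fin 2 → K) := fun σ =>
    AddMonoidHom.mk' (fun v i => ∑ j, σ.1 (ν σ⁻¹ * algebraMap ℂ K (g σ⁻¹ i j) * v j)) (by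
      intro v w; funext i
      simp only [Pi.add_apply, mul_add, map_add, sum_add_distrib])
  have hact : ∀ σ v i, act σ v i =
      ∑ j, σ.1 (ν σ⁻¹ * algebraMap ℂ K (g σ⁻¹ i j) * v j) := fun _ _ _ => rfl
  let X : Submodule T.base (Fin 2 → K) :=
    { carrier := {v | ∀ i, v i ∈ T.base}
      add_mem' := fun h1 h2 i => add_mem (h1 i) (h2 i)
      zero_mem' := fun i => zero_mem _
      smul_mem' := fun c v hv i => mul_mem c.2 (hv i) }
  have hspan := le_span_invariants (restrictAut_injective base_stable base_faithful) (act := act)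
    (X := X) ?_ ?_ ?_ ?_
  · set I := {v : Fin 2 → K | v ∈ X ∧ ∀ σ, act σ v = v} with hI
    have key : ∀ w : Fin 2 → K, w ∈ X → w ≠ 0 → ∃ v ∈ I, w 0 * v 1 - w 1 * v 0 ≠ 0 := by
      intro w hw hw0
      by_contra! hcon
      let f : (Fin 2 → K) →ₗ[T.base] K :=
        { toFun := fun v => w 0 * v 1 - w 1 * v 0
          map_add' := fun v v' => by simp only [Pi.add_apply]; ring
          map_smul' := fun c v => by
            simp only [Pi.smul_apply, Algebra.smul_def, RingHom.id_apply]; ring }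
      have h1 : ∀ v ∈ X, f v = 0 := fun v hv =>
        (Submodule.span_le (p := LinearMap.ker f)).2 (fun v hv => hcon v hv) (hspan hv)
      have h2 := h1 ![0, 1] (by intro i; fin_cases i; exacts [zero_mem _, one_mem _])
      have h3 := h1 ![1, 0] (by intro i; fin_cases i; exacts [one_mem _, zero_mem _])
      simp [f] at h2 h3
      exact hw0 (by funext i; fin_cases i; exacts [h2, h3])
    obtain ⟨v, hv, hv0⟩ := key ![1, 0] (by intro i; fin_cases i; exacts [one_mem _, zero_mem _])
      (fun h => one_ne_zero (congrFun h 0))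
    obtain ⟨w, hw, hw0⟩ := key v hv.1 (by rintro rfl; simp at hv0)
    have hinv : ∀ v ∈ I, ∀ (σ : T.H) i,
        σ.1 (v i) = ν σ * ∑ j, algebraMap ℂ K (g σ i j) * v j := by
      intro v hv σ i
      have h1 := congrArg σ.1 (congrFun (hv.2 σ⁻¹) i)
      rw [← h1, hact, inv_inv, map_sum, mul_sum]
      refine sum_congr rfl fun j _ => ?_
      rw [← mul_assoc]
      exact σ.1.apply_symm_apply _
    refine ⟨![v, w], ?_, hw0, ?_⟩
    · intro k; fin_cases k; exacts [hv.1, hw.1]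
    · intro k; fin_cases k; exacts [hinv v hv, hinv w hw]
  · intro σ τ v
    funext i
    have h1 : ∀ i j, (σ.1 * τ.1) (ν (σ * τ)⁻¹ * algebraMap ℂ K (g (σ * τ)⁻¹ i j)) =
        σ.1 (ν σ⁻¹) * σ.1 (τ.1 (ν τ⁻¹)) * algebraMap ℂ K ((g σ⁻¹ * g τ⁻¹) i j) := by
      intro i j
      rw [mul_inv_rev, hmul, map_mul, map_mul, AlgEquiv.commutes, AlgEquiv.mul_apply,
        AlgEquiv.mul_apply]
      congr 3
      exact τ.1.apply_symm_apply _
    have h2 : ∀ i, act (σ * τ) v i =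
        ∑ j, (σ.1 * τ.1) (ν (σ * τ)⁻¹ * algebraMap ℂ K (g (σ * τ)⁻¹ i j)) * σ.1 (τ.1 (v j)) := by
      intro i; rw [hact]
      refine sum_congr rfl fun j _ => ?_
      rw [map_mul (σ * τ).1]; rfl
    rw [h2]
    simp only [hact, h1, Fin.sum_univ_two, map_mul, map_add, AlgEquiv.commutes, Matrix.mul_apply]
    ring
  · intro v
    funext i
    rw [hact]
    simp only [inv_one, hone]
    simp
  · intro σ c v
    funext i
    have h1 : ∀ j, (c • v) j = (c : K) * v j := fun _ => rfl
    change _ = σ.1 c * act σ v i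
    simp only [hact, h1, map_mul, Fin.sum_univ_two]
    ring
  · intro σ v hv i
    rw [hact]
    exact sum_mem fun j _ => base_stable _ σ.2 _
      (mul_mem (mul_mem (hν _) (T.base.algebraMap_mem _)) (hv j))

end TwistedPoints


namespace TwistedPoints

open Polynomial

variable {K : Type} [Field K] [Algebra ℂ K] {n : ℕ} {T : TwistedPoints K n}

variable (T) in
include T in
lemma adjoin_ne_top {S : Set K} (hS : S.Finite) (h : S.ncard < n - 1) :
    adjoin ℂ S ≠ ⊤ := fun h1 =>
  (trdeg_le_ncard hS h1 T.trdeg_eq).not_gt h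

lemma ncard_image_union_range_le (f : ℕ → K) {r N : ℕ} (u : Fin N → K) :
    (f '' Set.Icc 1 r ∪ range u).ncard ≤ r + N := by
  refine (Set.ncard_union_le _ _).trans (add_le_add ?_ ?_)
  · refine (Set.ncard_image_le (Set.finite_Icc 1 r)).trans ?_
    rw [← Nat.card_coe_set_eq]; simp
  · rw [← Set.image_univ]
    refine (Set.ncard_image_le Set.finite_univ).trans ?_
    simp [Set.ncard_univ]

lemma finite_image_union_range (f : ℕ → K) {r N : ℕ} (u : Fin N → K) :
    (f '' Set.Icc 1 r ∪ range u).Finite :=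
  ((Set.finite_Icc 1 r).image f).union (Set.finite_range u)

lemma adjoin_eq_top {M : IntermediateField ℂ K} (h : ∀ k < n, T.q k ∈ M) : M = ⊤ := by
  rw [eq_top_iff, ← T.gen, adjoin_le_iff]
  rintro _ ⟨i, rfl⟩
  exact T.x_mem (S := M.toSubalgebra.toSubmodule) h i

lemma finrank_span_image_le {L : IntermediateField ℂ K} (s : Finset K) :
    Module.finrank L (span L (s : Set K)) ≤ s.card :=
  finrank_span_finset_le_card s

variable (T) in
/-- Invariants generating the field over the field of the first moments. -/
lemma exists_invariants_over_base {N : ℕ} (hN : n = T.m + 2 + N) :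
    ∃ z : Fin (N + 1) → K, (∀ i, ∀ σ ∈ T.H, σ (z i) = z i) ∧
      adjoin ℂ (T.q '' Set.Icc 1 T.m ∪ range z) = ⊤ := by
  classical
  have := T.finite
  set X : Submodule T.base K := span T.base (range T.x) with hX
  have : Module.Finite T.base X := Module.Finite.span_of_finite _ (Set.finite_range _)
  have hx : ∀ i, T.x i ∈ X := fun i => Submodule.subset_span ⟨i, rfl⟩
  have hq : ∀ k, T.q k ∈ X := fun k => by
    rw [q, qp_apply, Q]
    refine Submodule.sum_mem X fun i _ => ?_
    rw [mul_right_comm, ← map_mul]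
    exact X.smul_mem (⟨_, T.base.algebraMap_mem _⟩ : T.base) (hx i)
  set s : Finset K := (insert 0 (Finset.Ioo T.m n)).image T.q with hs
  have hle : X ≤ span T.base (s : Set K) := by
    refine Submodule.span_le.2 ?_
    rintro _ ⟨i, rfl⟩
    refine T.x_mem (S := (span T.base (s : Set K)).restrictScalars ℂ) (fun k hk => ?_) i
    have hmem : ∀ k ∈ insert 0 (Finset.Ioo T.m n), T.q k ∈ span T.base (s : Set K) :=
      fun k hk => Submodule.subset_span (Finset.mem_image_of_mem _ hk)
    by_cases h : k ≤ T.m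
    · have := Submodule.smul_mem _ (⟨_, q_mem_base h⟩ : T.base) (hmem 0 (by simp))
      rw [Algebra.smul_def, q_zero, mul_one] at this
      exact this
    · exact hmem k (by simp; omega)
  have hcard : Module.finrank T.base X ≤ (N + 1) + 1 := by
    refine (Submodule.finrank_mono hle).trans ((finrank_span_image_le s).trans ?_)
    refine Finset.card_image_le.trans ((Finset.card_insert_le _ _).trans ?_)
    rw [Nat.card_Ioo]
    omega
  obtain ⟨z, hz, hzX⟩ := exists_invariant_generators base_stable base_faithful (X := X) (r := N + 1)
    (by
      intro σ hσ y hy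
      refine apply_mem_of_span (base_stable σ hσ) ?_ hy
      rintro _ ⟨i, rfl⟩
      obtain ⟨g, lam, h⟩ := T.datum σ hσ
      obtain ⟨-, π, hπ⟩ := id h
      have h2 := (hπ (π.symm i)).2.2
      rw [Equiv.apply_symm_apply] at h2
      rw [h2]
      exact X.smul_mem (⟨_, mul_mem (lam_mem_base h).1 (T.base.algebraMap_mem _)⟩ : T.base) (hx _))
    (by rw [← q_zero]; exact hq 0) hcard
  refine ⟨z, hz, adjoin_eq_top (T := T) fun k _ => ?_⟩
  refine span_le_of_mem (L := T.base)
    (adjoin.mono ℂ _ _ Set.subset_union_left) ?_ (hzX (hq k))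
  rintro y (rfl | hy)
  · exact one_mem _
  · exact subset_adjoin ℂ _ (Or.inr hy)

variable (T) in
/-- One of the generators can be chosen to transform by the projective transformations of the
line. -/
lemma exists_equivariant_generator {N : ℕ} (hN : n = T.m + 2 + N) :
    ∃ (g : T.H → Mat₂) (s : K) (z : Fin N → K),
      (∀ σ : T.H, ∃ lam, IsTwist T.α T.x σ.1 (g σ) lam) ∧
      (∀ σ : T.H, algebraMap ℂ K (g σ 1 0) * s + algebraMap ℂ K (g σ 1 1) ≠ 0 ∧
        σ.1 s * (algebraMap ℂ K (g σ 1 0) * s + algebraMap ℂ K (g σ 1 1)) =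
          algebraMap ℂ K (g σ 0 0) * s + algebraMap ℂ K (g σ 0 1)) ∧
      (∀ i, ∀ σ ∈ T.H, σ (z i) = z i) ∧
      adjoin ℂ (T.q '' Set.Icc 1 T.m ∪ range (Fin.cons s z : Fin (N + 1) → K))
        = ⊤ := by
  obtain ⟨z, hz, htop⟩ := T.exists_invariants_over_base hN
  obtain ⟨g, ν, htw, hν, hν0, hone, hmul⟩ := T.exists_cocycle
  obtain ⟨v, hv, hdet, hvσ⟩ := exists_frame hν hone hmul
  have hadj : ∀ {M : IntermediateField ℂ K}, (T.base : Set K) ⊆ M → z 0 ∈ M →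
      (∀ i : Fin N, z i.succ ∈ M) → M = ⊤ := by
    intro M h1 h2 h3
    rw [eq_top_iff, ← htop, adjoin_le_iff]
    rintro y (hy | ⟨i, rfl⟩)
    · exact h1 (subset_adjoin ℂ _ hy)
    · exact Fin.cases h2 h3 i
  have hz0 : z 0 ∉ T.base := by
    intro h
    refine T.adjoin_ne_top (S := T.q '' Set.Icc 1 T.m ∪ range fun i : Fin N => z i.succ)
      (finite_image_union_range _ _) ?_ (hadj ?_ ?_ ?_)
    · have := ncard_image_union_range_le T.q (r := T.m) fun i : Fin N => z i.succ
      omega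
    · exact adjoin.mono ℂ _ _ Set.subset_union_left
    · exact adjoin.mono ℂ _ _ Set.subset_union_left h
    · exact fun i => subset_adjoin ℂ _ (Or.inr ⟨i, rfl⟩)
  have hD : v 0 1 * z 0 + v 1 1 ≠ 0 := by
    intro h
    by_cases h1 : v 0 1 = 0
    · rw [h1, zero_mul, zero_add] at h
      exact hdet (by rw [h1, h]; ring)
    · refine hz0 ?_
      rw [show z 0 = -v 1 1 / v 0 1 by rw [eq_div_iff h1]; linear_combination h]
      exact div_mem (neg_mem (hv 1 1)) (hv 0 1)
  set s := (v 0 0 * z 0 + v 1 0) / (v 0 1 * z 0 + v 1 1) with hs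
  have hsD : s * (v 0 1 * z 0 + v 1 1) = v 0 0 * z 0 + v 1 0 := div_mul_cancel₀ _ hD
  refine ⟨g, s, fun i => z i.succ, htw, fun σ => ?_, fun i => hz _, hadj ?_ ?_ ?_⟩
  · have h1 : ∀ i, σ.1 (v 0 i * z 0 + v 1 i) = ν σ * (algebraMap ℂ K (g σ i 0) * s +
        algebraMap ℂ K (g σ i 1)) * (v 0 1 * z 0 + v 1 1) := by
      intro i
      rw [map_add, map_mul, hz 0 σ.1 σ.2, hvσ, hvσ, Fin.sum_univ_two, Fin.sum_univ_two]
      linear_combination -(ν σ * algebraMap ℂ K (g σ i 0)) * hsD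
    have h2 : σ.1 (v 0 1 * z 0 + v 1 1) ≠ 0 := (map_ne_zero σ.1).2 hD
    rw [h1] at h2
    have h3 := congrArg σ.1 hsD
    rw [map_mul, h1, h1] at h3
    refine ⟨fun h0 => h2 (by rw [h0]; ring), ?_⟩
    refine mul_left_cancel₀ (mul_ne_zero (hν0 σ) hD) ?_
    linear_combination h3
  · exact adjoin.mono ℂ _ _ Set.subset_union_left
  · set M := adjoin ℂ (T.q '' Set.Icc 1 T.m ∪
      range (Fin.cons s (fun i => z i.succ) : Fin (N + 1) → K)) with hM
    have hsM : s ∈ M := subset_adjoin ℂ _ (Or.inr ⟨0, rfl⟩)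
    have hvM : ∀ k i, v k i ∈ M := fun k i =>
      adjoin.mono ℂ _ _ Set.subset_union_left (hv k i)
    have h0 : v 0 0 - s * v 0 1 ≠ 0 := by
      intro h
      refine hdet ?_
      linear_combination (v 1 1) * h + v 0 1 * (hsD + z 0 * h)
    rw [show z 0 = (s * v 1 1 - v 1 0) / (v 0 0 - s * v 0 1) by
      rw [eq_div_iff h0]; linear_combination -hsD]
    exact div_mem (sub_mem (mul_mem hsM (hvM _ _)) (hvM _ _))
      (sub_mem (hvM _ _) (mul_mem hsM (hvM _ _)))
  · exact fun i => subset_adjoin ℂ _ (Or.inr ⟨i.succ, rfl⟩)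

end TwistedPoints


open Polynomial in
/-- A generator on which a finite group acts by projective transformations can be replaced by an
invariant. -/
lemma exists_invariant_of_mob {K : Type} [Field K] [Algebra ℂ K] {H : Subgroup (K ≃ₐ[ℂ] K)}
    [Finite H] {g : H → Mat₂} (hg : ∀ σ, (g σ).det ≠ 0) {s : K}
    (hs : Transcendental ℂ s)
    (hgs : ∀ σ : H, algebraMap ℂ K (g σ 1 0) * s + algebraMap ℂ K (g σ 1 1) ≠ 0 ∧
        σ.1 s * (algebraMap ℂ K (g σ 1 0) * s + algebraMap ℂ K (g σ 1 1)) =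
          algebraMap ℂ K (g σ 0 0) * s + algebraMap ℂ K (g σ 0 1))
    {S : Set K} (hS : ∀ y ∈ S, ∀ σ ∈ H, σ y = y)
    (htop : adjoin ℂ (insert s S) = ⊤) :
    ∃ t : K, adjoin ℂ (insert t S) = fixedField H := by
  classical
  have := Fintype.ofFinite H
  obtain ⟨τ, hτ⟩ : ∃ τ : ℂ, (∏ σ : H, TwistedPoints.lin (g σ) 1).eval τ ≠ 0 := by
    by_contra! hcon
    have h0 := Polynomial.funext (p := ∏ σ : H, TwistedPoints.lin (g σ) 1) (q := 0)
      (by simpa using hcon)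
    obtain ⟨σ, -, hσ⟩ := Finset.prod_eq_zero_iff.1 h0
    have e0 := congrArg (fun p => coeff p 0) hσ
    have e1 := congrArg (fun p => coeff p 1) hσ
    simp [TwistedPoints.lin, coeff_X, coeff_C] at e0 e1
    exact hg σ (by rw [Matrix.det_fin_two, e0, e1]; ring)
  set D : ℂ[X] := ∏ σ : H, TwistedPoints.lin (g σ) 1 with hD
  set N : ℂ[X] := ∏ σ : H, (C τ * TwistedPoints.lin (g σ) 1 - TwistedPoints.lin (g σ) 0) with hN
  set t : K := ∏ σ : H, (algebraMap ℂ K τ - σ.1 s) with ht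
  have htD : t * aeval s D = aeval s N := by
    rw [hD, hN, ht, map_prod, map_prod, ← Finset.prod_mul_distrib]
    refine prod_congr rfl fun σ _ => ?_
    simp only [TwistedPoints.lin, map_sub, map_mul, map_add, aeval_C, aeval_X]
    linear_combination -(hgs σ).2
  have ht0 : t ≠ 0 := by
    refine prod_ne_zero_iff.2 fun σ _ h => ?_
    have h1 : σ.1 s = σ.1 (algebraMap ℂ K τ) := by
      rw [σ.1.commutes]; exact (sub_eq_zero.1 h).symm
    exact hs (σ.1.injective h1 ▸ isAlgebraic_algebraMap τ)
  have hNτ : N.eval τ = 0 := by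
    have h1 := (hgs 1).2
    obtain ⟨e1, e2, e3⟩ := mob_fixed_of_transcendental hs h1
    rw [hN, eval_prod]
    refine prod_eq_zero (mem_univ 1) ?_
    simp only [TwistedPoints.lin, e1, e2, e3, eval_sub, eval_mul, eval_add, eval_C, eval_X]
    ring
  have htH : ∀ σ ∈ H, σ t = t := by
    intro σ hσ
    rw [ht, map_prod, ← Equiv.prod_comp (Equiv.mulLeft (⟨σ, hσ⟩ : H)) fun ρ : H =>
      algebraMap ℂ K τ - ρ.1 s]
    refine prod_congr rfl fun ρ _ => ?_
    rw [map_sub, σ.commutes]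
    rfl
  set F := adjoin ℂ (insert t S) with hF
  have hle : F ≤ fixedField H := by
    rw [adjoin_le_iff]
    rintro y (rfl | hy)
    · exact (IntermediateField.mem_fixedField_iff H _).2 htH
    · exact (IntermediateField.mem_fixedField_iff H _).2 (hS y hy)
  have htF : t ∈ F := subset_adjoin ℂ _ (Or.inl rfl)
  set R : F[X] := N.map (algebraMap ℂ F) - C (⟨t, htF⟩ : F) * D.map (algebraMap ℂ F) with hR
  have hRs : aeval s R = 0 := by
    rw [hR, map_sub, map_mul, aeval_C, aeval_map_algebraMap, aeval_map_algebraMap, ← htD]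
    exact sub_self _
  have hR0 : R ≠ 0 := by
    intro h
    have h1 := congrArg (eval (algebraMap ℂ F τ)) h
    rw [hR, eval_sub, eval_mul, eval_C, eval_map_algebraMap, eval_map_algebraMap,
      aeval_algebraMap_apply, aeval_algebraMap_apply, coe_aeval_eq_eval, hNτ, map_zero, zero_sub,
      eval_zero, neg_eq_zero, mul_eq_zero] at h1
    rcases h1 with h1 | h1
    · exact ht0 (congrArg Subtype.val h1)
    · exact hτ (by simpa using h1)
  have hNd : N.natDegree ≤ Fintype.card H := by
    refine (natDegree_prod_le _ _).trans ?_
    refine (Finset.sum_le_card_nsmul _ _ 1 fun σ _ => ?_).trans (by simp)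
    refine (natDegree_sub_le _ _).trans (max_le ?_ (TwistedPoints.natDegree_lin_le _ _))
    exact (natDegree_C_mul_le _ _).trans (TwistedPoints.natDegree_lin_le _ _)
  have hDd : D.natDegree ≤ Fintype.card H := by
    refine (natDegree_prod_le _ _).trans ?_
    exact (Finset.sum_le_card_nsmul _ _ 1 fun σ _ => TwistedPoints.natDegree_lin_le _ _).trans
      (by simp)
  have hRd : R.natDegree ≤ Fintype.card H := by
    refine (natDegree_sub_le _ _).trans (max_le (natDegree_map_le.trans hNd) ?_)
    exact (natDegree_C_mul_le _ _).trans (natDegree_map_le.trans hDd)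
  have hint : IsIntegral F s := (show IsAlgebraic F s from ⟨R, hR0, hRs⟩).isIntegral
  have htop' : adjoin F {s} = ⊤ := by
    have h1 : adjoin ℂ (insert s S) ≤
        (adjoin F {s}).restrictScalars ℂ := by
      rw [adjoin_le_iff]
      rintro y (rfl | hy)
      · exact subset_adjoin F _ rfl
      · exact (adjoin F {s}).algebraMap_mem
          (⟨y, subset_adjoin ℂ _ (Or.inr hy)⟩ : F)
    rw [htop] at h1
    exact eq_top_iff.2 fun y _ => h1 trivial
  have hfin := adjoin.finrank hint
  rw [htop', IntermediateField.finrank_top'] at hfin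
  have : FiniteDimensional F K :=
    FiniteDimensional.of_finrank_pos (by rw [hfin]; exact minpoly.natDegree_pos hint)
  refine ⟨t, IntermediateField.eq_of_le_of_finrank_le' hle ?_⟩
  have h1 : Module.finrank (fixedField H) K = Fintype.card H :=
    FixedPoints.finrank_eq_card H K
  rw [h1, hfin]
  exact (natDegree_le_natDegree (minpoly.degree_le_of_ne_zero F s hR0 hRs)).trans hRd

namespace TwistedPoints

open Polynomial

variable {K : Type} [Field K] [Algebra ℂ K] {n : ℕ} {T : TwistedPoints K n}

lemma Q_sub_pow (s : K) : T.Q (fun i => (algebraMap ℂ K (T.α i) - s) ^ T.m) =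
    ∑ k ∈ Finset.range (T.m + 1), (-s) ^ (T.m - k) * (T.m.choose k : K) * T.q k := by
  simp only [sub_eq_add_neg, add_pow, Q, q, qp_apply, mul_sum]
  rw [sum_comm]
  refine sum_congr rfl fun k _ => sum_congr rfl fun i _ => ?_
  rw [eval_pow, eval_X, map_pow]
  ring

lemma apply_Q_sub_pow {σ : K ≃ₐ[ℂ] K} {g lam} (h : IsTwist T.α T.x σ g lam) {s : K}
    (hs0 : algebraMap ℂ K (g 1 0) * s + algebraMap ℂ K (g 1 1) ≠ 0)
    (hs : σ s * (algebraMap ℂ K (g 1 0) * s + algebraMap ℂ K (g 1 1)) =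
      algebraMap ℂ K (g 0 0) * s + algebraMap ℂ K (g 0 1)) :
    ∃ μ : K, μ ≠ 0 ∧ (∀ k ≤ T.m, σ (T.q k) = μ * T.qp (lin g 1 ^ (T.m - k) * lin g 0 ^ k)) ∧
      σ (T.Q fun i => (algebraMap ℂ K (T.α i) - s) ^ T.m) * (algebraMap ℂ K (g 1 0) * s +
        algebraMap ℂ K (g 1 1)) ^ T.m = μ * algebraMap ℂ K (g.det ^ T.m) *
          T.Q fun i => (algebraMap ℂ K (T.α i) - s) ^ T.m := by
  obtain ⟨μ, κ, π, hκ, hμ, hπ, hQ⟩ := apply_Q h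
  refine ⟨μ, ?_, fun k hk => ?_, ?_⟩
  · rw [hμ]; exact mul_ne_zero (lam_mem_base h).2 (by simpa using hκ)
  · rw [q, qp_apply, hQ, qp_apply]
    congr 2
    funext i
    rw [AlgEquiv.commutes, ← map_mul, eval_twist_pow hk (hπ i).1, (hπ i).2]
  · rw [hQ, mul_assoc, mul_assoc, ← Q_mul, mul_comm (T.Q _), ← Q_mul]
    congr 2
    funext i
    rw [map_pow, map_pow, map_pow, map_sub, AlgEquiv.commutes, ← mul_pow, ← mul_pow, ← mul_pow]
    congr 1
    have h1 := congrArg (algebraMap ℂ K) (mob_mul_mobDen (hπ i).1)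
    rw [(hπ i).2] at h1
    simp only [mobDen, map_mul, map_add, Matrix.det_fin_two, map_sub] at h1 ⊢
    linear_combination (algebraMap ℂ K (g 1 0) * s + algebraMap ℂ K (g 1 1)) * h1 -
      (algebraMap ℂ K (g 1 0) * algebraMap ℂ K (T.α i) + algebraMap ℂ K (g 1 1)) * hs

variable (T) in
lemma exists_generators : ∃ S : Set K, S.Finite ∧ S.ncard ≤ n - 1 ∧
    adjoin ℂ S = fixedField T.H := by
  classical
  have := T.finite
  have hm := T.one_le
  obtain ⟨N, hN⟩ := Nat.exists_eq_add_of_le T.le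
  obtain ⟨g, s, z, htw, hgs, hz, htop⟩ := T.exists_equivariant_generator hN
  choose lam htw using htw
  have hcount : ∀ r < T.m, adjoin ℂ
      (T.q '' Set.Icc 1 r ∪ range (Fin.cons s z : Fin (N + 1) → K)) ≠ ⊤ := by
    intro r hr
    refine T.adjoin_ne_top (finite_image_union_range _ _) ?_
    have := ncard_image_union_range_le T.q (r := r) (Fin.cons s z : Fin (N + 1) → K)
    omega
  have hstr : Transcendental ℂ s := by
    refine transcendental_of_notMem_bot fun h => T.adjoin_ne_top
      (S := T.q '' Set.Icc 1 T.m ∪ range z) (finite_image_union_range _ _) ?_ ?_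
    · have := ncard_image_union_range_le T.q (r := T.m) z
      omega
    · rw [eq_top_iff, ← htop, adjoin_le_iff]
      rintro y (hy | ⟨i, rfl⟩)
      · exact subset_adjoin ℂ _ (Or.inl hy)
      · refine Fin.cases ?_ (fun i => ?_) i
        · exact bot_le (a := adjoin ℂ _) h
        · exact subset_adjoin ℂ _ (Or.inr ⟨i, rfl⟩)
  set ω := T.Q fun i => (algebraMap ℂ K (T.α i) - s) ^ T.m with hω
  have hωsum := Q_sub_pow (T := T) s
  rw [← hω] at hωsum
  have hω0 : ω ≠ 0 := by
    intro h0
    rw [h0, Finset.sum_range_succ, Nat.sub_self, pow_zero, Nat.choose_self, Nat.cast_one, one_mul,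
      one_mul] at hωsum
    set M := adjoin ℂ
      (T.q '' Set.Icc 1 (T.m - 1) ∪ range (Fin.cons s z : Fin (N + 1) → K)) with hM
    have hsM : s ∈ M := subset_adjoin ℂ _ (Or.inr ⟨0, rfl⟩)
    have hqM : ∀ k ≤ T.m - 1, T.q k ∈ M := fun k hk => q_mem_of_image
      (Set.subset_union_left.trans (subset_adjoin ℂ _)) hk
    have hqm : T.q T.m ∈ M := by
      rw [eq_neg_of_add_eq_zero_right hωsum.symm]
      refine neg_mem (sum_mem fun k hk => mul_mem (mul_mem (pow_mem (neg_mem hsM) _)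
        (natCast_mem _ _)) (hqM k ?_))
      have := Finset.mem_range.1 hk
      omega
    refine hcount (T.m - 1) (by omega) ?_
    rw [eq_top_iff, ← htop, adjoin_le_iff]
    rintro y (⟨k, hk, rfl⟩ | hy)
    · rcases hk.2.lt_or_eq with h | h
      · exact hqM k (by omega)
      · rw [h]; exact hqm
    · exact subset_adjoin ℂ _ (Or.inr hy)
  set L := adjoin ℂ {s} with hL
  have hsL : s ∈ L := subset_adjoin ℂ _ rfl
  have hden : ∀ σ : T.H, algebraMap ℂ K (g σ 1 0) * s + algebraMap ℂ K (g σ 1 1) ∈ L := fun σ =>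
    add_mem (mul_mem (L.algebraMap_mem _) hsL) (L.algebraMap_mem _)
  have hLst : ∀ σ ∈ T.H, ∀ y ∈ L, σ y ∈ L := by
    intro σ hσ y hy
    refine apply_mem_of_adjoin ?_ hy
    intro y hy
    rw [Set.mem_singleton_iff.1 hy]
    have h1 := hgs ⟨σ, hσ⟩
    rw [show σ s = _ from eq_div_of_mul_eq h1.1 h1.2]
    exact div_mem (add_mem (mul_mem (L.algebraMap_mem _) hsL) (L.algebraMap_mem _)) (hden _)
  have hLf : ∀ σ ∈ T.H, (∀ y ∈ L, σ y = y) → σ = 1 := by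
    intro σ hσ hf
    have h1 := (hgs ⟨σ, hσ⟩).2
    rw [hf s hsL] at h1
    obtain ⟨e1, e2, e3⟩ := mob_fixed_of_transcendental hstr h1
    have h2 := htw ⟨σ, hσ⟩
    rw [show g ⟨σ, hσ⟩ = Matrix.scalar (Fin 2) (g ⟨σ, hσ⟩ 1 1) by
      ext i j; fin_cases i <;> fin_cases j <;> simp [e1, e2, e3]] at h2
    exact (eq_one_of_scalar h2).1
  set B : Finset K := (Finset.range (T.m + 1)).image (fun k => T.q k / ω) ∪
    Finset.univ.image z with hB
  have hqB : ∀ k ≤ T.m, T.q k / ω ∈ span L (B : Set K) := fun k hk =>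
    Submodule.subset_span (Finset.mem_union_left _
      (Finset.mem_image_of_mem (fun k => T.q k / ω) (by simpa [Nat.lt_succ_iff] using hk)))
  have hzB : ∀ i, z i ∈ span L (B : Set K) := fun i =>
    Submodule.subset_span (Finset.mem_union_right _ (Finset.mem_image_of_mem z (mem_univ i)))
  have hqpB : ∀ p : ℂ[X], p.natDegree ≤ T.m → T.qp p / ω ∈ span L (B : Set K) := by
    intro p hp
    rw [T.qp_eq_sum hp, Finset.sum_div]
    refine Submodule.sum_mem _ fun k hk => ?_
    rw [mul_div_assoc]
    exact Submodule.smul_mem _ (⟨_, L.algebraMap_mem _⟩ : L)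
      (hqB k (by simpa [Nat.lt_succ_iff] using hk))
  have : Module.Finite L (span L (B : Set K)) :=
    Module.Finite.span_of_finite _ B.finite_toSet
  obtain ⟨w, hw, hwX⟩ := exists_invariant_generators hLst hLf (X := span L (B : Set K))
    (r := T.m + N) (by
      intro σ hσ y hy
      refine apply_mem_of_span (hLst σ hσ) ?_ hy
      intro y hy
      obtain ⟨μ, hμ, h1, h2⟩ := apply_Q_sub_pow (htw ⟨σ, hσ⟩) (hgs ⟨σ, hσ⟩).1 (hgs ⟨σ, hσ⟩).2
      rcases Finset.mem_union.1 hy with hy | hy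
      · obtain ⟨k, hk, rfl⟩ := Finset.mem_image.1 hy
        have hk' : k ≤ T.m := by simpa [Nat.lt_succ_iff] using hk
        set δ := algebraMap ℂ K (g ⟨σ, hσ⟩ 1 0) * s + algebraMap ℂ K (g ⟨σ, hσ⟩ 1 1)
        have hd0 : algebraMap ℂ K ((g ⟨σ, hσ⟩).det ^ T.m) ≠ 0 := by
          simpa using fun h => ((htw ⟨σ, hσ⟩).1 h).elim
        have h3 : σ (T.q k / ω) = δ ^ T.m / algebraMap ℂ K ((g ⟨σ, hσ⟩).det ^ T.m) *
            (T.qp (lin (g ⟨σ, hσ⟩) 1 ^ (T.m - k) * lin (g ⟨σ, hσ⟩) 0 ^ k) / ω) := by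
          have h4 : σ ω ≠ 0 := (map_ne_zero σ).2 hω0
          rw [map_div₀, h1 k hk', div_mul_div_comm, div_eq_div_iff h4 (mul_ne_zero hd0 hω0)]
          linear_combination -(T.qp (lin (g ⟨σ, hσ⟩) 1 ^ (T.m - k) * lin (g ⟨σ, hσ⟩) 0 ^ k)) * h2
        rw [h3]
        exact Submodule.smul_mem _ (⟨_, div_mem (pow_mem (hden ⟨σ, hσ⟩) _)
          (L.algebraMap_mem _)⟩ : L) (hqpB _ (natDegree_twist_pow_le _ hk'))
      · obtain ⟨i, -, rfl⟩ := Finset.mem_image.1 hy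
        rw [hz i σ hσ]
        exact hzB i)
    (by
      have h1 : (1 : K) = ∑ k ∈ Finset.range (T.m + 1),
          (-s) ^ (T.m - k) * (T.m.choose k : K) * (T.q k / ω) := by
        rw [← div_self hω0]
        conv_lhs => rw [hωsum]
        rw [Finset.sum_div, ← hωsum]
        exact sum_congr rfl fun k _ => mul_div_assoc _ _ _
      rw [h1]
      refine Submodule.sum_mem _ fun k hk => ?_
      exact Submodule.smul_mem _ (⟨_, mul_mem (pow_mem (neg_mem hsL) _) (natCast_mem _ _)⟩ : L)
        (hqB k (by simpa [Nat.lt_succ_iff] using hk)))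
    (by
      refine (finrank_span_image_le B).trans ((Finset.card_union_le _ _).trans ?_)
      have h1 : ((Finset.range (T.m + 1)).image fun k => T.q k / ω).card ≤ T.m + 1 :=
        Finset.card_image_le.trans (by simp)
      have h2 : (Finset.univ.image z).card ≤ N := Finset.card_image_le.trans (by simp)
      omega)
  have hgen : adjoin ℂ (insert s (range w)) = ⊤ := by
    set M := adjoin ℂ (insert s (range w)) with hM
    have hsM : s ∈ M := subset_adjoin ℂ _ (Or.inl rfl)
    have hLM : L ≤ M := by
      rw [hL, adjoin_le_iff]
      exact Set.singleton_subset_iff.2 hsM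
    have hBM : ∀ y ∈ span L (B : Set K), y ∈ M := fun y hy => by
      refine span_le_of_mem hLM ?_ (hwX hy)
      rintro y (rfl | hy)
      · exact one_mem _
      · exact subset_adjoin ℂ _ (Or.inr hy)
    have hωM : ω ∈ M := by
      have h1 := hBM _ (hqB 0 (Nat.zero_le _))
      rw [q_zero, one_div] at h1
      simpa using inv_mem h1
    rw [eq_top_iff, ← htop, adjoin_le_iff]
    rintro y (⟨k, hk, rfl⟩ | ⟨i, rfl⟩)
    · have := mul_mem (hBM _ (hqB k hk.2)) hωM
      rwa [div_mul_cancel₀ _ hω0] at this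
    · exact Fin.cases hsM (fun i => hBM _ (hzB i)) i
  obtain ⟨t, ht⟩ := exists_invariant_of_mob (fun σ => (htw σ).1) hstr hgs
    (S := range w) (by rintro _ ⟨i, rfl⟩; exact hw i) hgen
  refine ⟨_, (Set.finite_range w).insert t, ?_, ht⟩
  refine (Set.ncard_insert_le _ _).trans ?_
  have : (range w).ncard ≤ T.m + N := by
    rw [← Set.image_univ]
    refine (Set.ncard_image_le Set.finite_univ).trans ?_
    simp [Set.ncard_univ]
  omega

variable (T) in
/-- The field of invariants of a finite group of twists is purely transcendental. -/
lemma exists_rational_invariants : ∃ t : Fin (n - 1) → K, AlgebraicIndependent ℂ t ∧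
    Algebra.IsAlgebraic (adjoin ℂ (range t)) K ∧
    adjoin ℂ (range t) = fixedField T.H := by
  have := T.finite
  have := Fintype.ofFinite T.H
  obtain ⟨S, hS, hc, h⟩ := T.exists_generators
  obtain ⟨t, ht, ht'⟩ := exists_fin_enum hS hc
  have h1 : adjoin ℂ (range t) = fixedField T.H := by
    rw [← h]
    refine le_antisymm (adjoin_le_iff.2 ?_) (adjoin.mono ℂ _ _ ht)
    rintro _ ⟨i, rfl⟩
    rcases ht' i with h | h
    · exact subset_adjoin ℂ _ h
    · rw [h]; exact zero_mem (adjoin ℂ S)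
  have h2 : Algebra.IsAlgebraic (adjoin ℂ (range t)) K := by
    rw [h1]
    have : FiniteDimensional (fixedField T.H) K :=
      FiniteDimensional.of_finrank_pos (by
        rw [show Module.finrank (fixedField T.H) K = Fintype.card T.H from
          FixedPoints.finrank_eq_card T.H K]
        exact Fintype.card_pos)
    infer_instance
  exact ⟨t, algebraicIndependent_of_isAlgebraic t h2 T.trdeg_eq, h2, h1⟩

end TwistedPoints


section Invariants

variable {S : Type} [CommRing S] [Algebra ℂ S] (G : Subgroup (S ≃ₐ[ℂ] S))

/-- The ring of invariants. -/
abbrev Inv : Subalgebra ℂ S := FixedPoints.subalgebra ℂ S G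

instance : Algebra.IsInvariant (Inv G) S G := ⟨fun b hb => ⟨⟨b, hb⟩, rfl⟩⟩

variable {G}

lemma mem_inv {s : S} : s ∈ Inv G ↔ ∀ σ ∈ G, σ s = s :=
  ⟨fun h σ hσ => h ⟨σ, hσ⟩, fun h σ => h σ.1 σ.2⟩

variable [Finite G]

/-- Two points with the same invariants lie in one orbit. -/
lemma exists_comp_of_eq_on_inv {φ φ' : S →ₐ[ℂ] ℂ} (h : ∀ s ∈ Inv G, φ s = φ' s) :
    ∃ σ ∈ G, ∀ s, φ' s = φ (σ s) := by
  have hp : ∀ φ : S →ₐ[ℂ] ℂ, (RingHom.ker φ.toRingHom).IsPrime := fun φ => RingHom.ker_isPrime _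
  have := hp φ
  have := hp φ'
  obtain ⟨σ, hσ⟩ := Algebra.IsInvariant.exists_smul_of_under_eq (Inv G) S G
    (RingHom.ker φ.toRingHom) (RingHom.ker φ'.toRingHom) (by
      ext a
      change φ a = 0 ↔ φ' a = 0
      rw [h a a.2])
  refine ⟨σ⁻¹.1, σ⁻¹.2, fun s => ?_⟩
  have h1 : s - algebraMap ℂ S (φ' s) ∈ RingHom.ker φ'.toRingHom := by
    change φ' _ = 0
    rw [map_sub, AlgHom.commutes]
    exact sub_self _
  rw [hσ, Ideal.mem_pointwise_smul_iff_inv_smul_mem] at h1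
  change φ (σ⁻¹.1 _) = 0 at h1
  rw [map_sub, map_sub, AlgEquiv.commutes, AlgHom.commutes] at h1
  exact (sub_eq_zero.1 h1).symm

/-- Every point of the ring of invariants comes from a point. -/
lemma exists_extends_inv (ψ : Inv G →ₐ[ℂ] ℂ) : ∃ φ : S →ₐ[ℂ] ℂ, ∀ a : Inv G, φ a = ψ a := by
  have hint : Algebra.IsIntegral (Inv G) S := Algebra.IsInvariant.isIntegral (Inv G) S G
  have hmax : (RingHom.ker ψ.toRingHom).IsMaximal :=
    RingHom.ker_isMaximal_of_surjective _ fun c => ⟨algebraMap ℂ _ c, ψ.commutes c⟩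
  obtain ⟨Q, hQ, hQP⟩ := Ideal.exists_ideal_over_maximal_of_isIntegral (S := S)
    (RingHom.ker ψ.toRingHom) (fun a ha => by
      have h0 : a = 0 := Subtype.ext ha
      rw [h0]; exact zero_mem _)
  have : IsDomain (S ⧸ Q) := Ideal.Quotient.isDomain Q
  have key : ∀ a : Inv G, Ideal.Quotient.mk Q a = algebraMap ℂ (S ⧸ Q) (ψ a) := by
    intro a
    have h1 : a - algebraMap ℂ (Inv G) (ψ a) ∈ RingHom.ker ψ.toRingHom := by
      change ψ _ = 0
      rw [map_sub, AlgHom.commutes]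
      exact sub_self _
    rw [← hQP] at h1
    exact Ideal.Quotient.eq.2 h1
  have hint' : Algebra.IsIntegral ℂ (S ⧸ Q) := by
    refine ⟨fun y => ?_⟩
    obtain ⟨s, rfl⟩ := Ideal.Quotient.mk_surjective y
    obtain ⟨p, hp, hps⟩ := hint.isIntegral s
    refine ⟨p.map ψ.toRingHom, hp.map _, ?_⟩
    have h1 := congrArg (Ideal.Quotient.mk Q) hps
    rw [Polynomial.hom_eval₂, map_zero] at h1
    rw [Polynomial.eval₂_map, ← h1]
    congr 1
    exact RingHom.ext fun a => (key a).symm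
  have hb := IsAlgClosed.algebraMap_bijective_of_isIntegral (k := ℂ) (K := S ⧸ Q)
  let e := AlgEquiv.ofBijective (Algebra.ofId ℂ (S ⧸ Q)) hb
  refine ⟨e.symm.toAlgHom.comp (Ideal.Quotient.mkₐ ℂ Q), fun a => ?_⟩
  change e.symm (Ideal.Quotient.mk Q a) = ψ a
  rw [AlgEquiv.symm_apply_eq, key]
  rfl

end Invariants

section RationalQuotient

variable {S K : Type} [CommRing S] [IsDomain S] [Algebra ℂ S] [Field K] [Algebra S K]
  [IsFractionRing S K] [Algebra ℂ K] [IsScalarTower ℂ S K] {G : Subgroup (S ≃ₐ[ℂ] S)} [Finite G]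

lemma exists_common_denominator {ι : Type} [Finite ι] {y : ι → K}
    (hy : ∀ i, ∀ σ ∈ G, IsFractionRing.fieldEquivOfAlgEquiv ℂ K K σ (y i) = y i) :
    ∃ (E : Inv G) (N : ι → Inv G), E ≠ 0 ∧
      ∀ i, algebraMap S K E * y i = algebraMap S K (N i) := by
  classical
  have := Fintype.ofFinite G
  have hinj := IsFractionRing.injective S K
  obtain ⟨b, hb⟩ := IsLocalization.exist_integer_multiples_of_finite (nonZeroDivisors S) y
  have hE : (∏ σ : G, σ.1 b.1) ∈ Inv G := fun σ => by
    change σ.1 (∏ ρ : G, ρ.1 b.1) = _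
    rw [map_prod]
    exact Equiv.prod_comp (Equiv.mulLeft σ) fun ρ : G => ρ.1 b.1
  set E : Inv G := ⟨_, hE⟩ with hEdef
  have h1 : ∀ i, ∃ N : Inv G, algebraMap S K E * y i = algebraMap S K N := by
    intro i
    obtain ⟨c, hc⟩ := hb i
    have h2 : algebraMap S K ((∏ σ ∈ Finset.univ.erase (1 : G), σ.1 b.1) * c) =
        algebraMap S K E * y i := by
      rw [hEdef, map_mul, hc, Algebra.smul_def, ← mul_assoc, ← map_mul]
      congr 2
      exact Finset.prod_erase_mul _ (fun σ : G => σ.1 b.1) (mem_univ 1)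
    refine ⟨⟨_, mem_inv.2 fun σ hσ => hinj ?_⟩, h2.symm⟩
    rw [← IsFractionRing.fieldEquivOfAlgEquiv_algebraMap ℂ K K σ, h2, map_mul, hy i σ hσ,
      IsFractionRing.fieldEquivOfAlgEquiv_algebraMap, mem_inv.1 E.2 σ hσ]
  choose N hN using h1
  refine ⟨E, N, fun h => ?_, hN⟩
  have h3 : (∏ σ : G, σ.1 b.1) = 0 := congrArg Subtype.val h
  obtain ⟨σ, -, hσ⟩ := Finset.prod_eq_zero_iff.1 h3
  exact nonZeroDivisors.coe_ne_zero b ((map_eq_zero_iff σ.1 σ.1.injective).1 hσ)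

open IntermediateField.algebraAdjoinAdjoin in
lemma exists_denominator [Algebra.FiniteType ℂ S] {d : ℕ} {t : Fin d → K}
    (ht : AlgebraicIndependent ℂ t)
    (halg : Algebra.IsAlgebraic (adjoin ℂ (range t)) K)
    (hG : ∀ s ∈ Inv G, algebraMap S K s ∈ adjoin ℂ (range t)) :
    ∃ b : MvPolynomial (Fin d) ℂ, b ≠ 0 ∧ ∀ s ∈ Inv G, ∃ (ν : MvPolynomial (Fin d) ℂ) (k : ℕ),
      algebraMap S K s * MvPolynomial.aeval t (b ^ k) = MvPolynomial.aeval t ν := by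
  classical
  set R := Algebra.adjoin ℂ (range t) with hR
  have halg' : Algebra.IsAlgebraic R K := IntermediateField.isAlgebraic_adjoin_iff_top.1 halg
  have hcl : IsIntegrallyClosed R := IsIntegrallyClosed.of_equiv ht.aevalEquiv.toRingEquiv
  obtain ⟨s, hs⟩ := (‹Algebra.FiniteType ℂ S›).out
  obtain ⟨r, hr0, hr⟩ := Algebra.IsAlgebraic.exists_integral_multiples R
    (s.image (algebraMap S K))
  have key : ∀ y : S, ∃ k : ℕ, IsIntegral R (r ^ k • algebraMap S K y) := by
    intro y
    have hy : y ∈ Algebra.adjoin ℂ (s : Set S) := by rw [hs]; trivial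
    have hup : ∀ {z : K} {k l : ℕ}, IsIntegral R (r ^ k • z) → IsIntegral R (r ^ (l + k) • z) := by
      intro z k l h
      rw [pow_add, mul_smul]
      exact h.smul _
    induction hy using Algebra.adjoin_induction with
    | mem y hy => exact ⟨1, by rw [pow_one]; exact hr _ (Finset.mem_image_of_mem _ hy)⟩
    | algebraMap c =>
      refine ⟨0, ?_⟩
      rw [pow_zero, one_smul, ← IsScalarTower.algebraMap_apply ℂ S K,
        IsScalarTower.algebraMap_apply ℂ R K]
      exact isIntegral_algebraMap
    | add y z _ _ h1 h2 =>
      obtain ⟨k, h1⟩ := h1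
      obtain ⟨l, h2⟩ := h2
      refine ⟨l + k, ?_⟩
      rw [map_add, smul_add]
      exact (hup h1).add (by rw [add_comm]; exact hup h2)
    | mul y z _ _ h1 h2 =>
      obtain ⟨k, h1⟩ := h1
      obtain ⟨l, h2⟩ := h2
      refine ⟨k + l, ?_⟩
      rw [map_mul, pow_add, ← smul_mul_smul_comm]
      exact h1.mul h2
  refine ⟨ht.aevalEquiv.symm r, by simpa using hr0, fun y hy => ?_⟩
  obtain ⟨k, hk⟩ := key y
  have hmem : r ^ k • algebraMap S K y ∈ adjoin ℂ (range t) := by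
    rw [Algebra.smul_def]
    exact mul_mem (IntermediateField.algebra_adjoin_le_adjoin ℂ _ (r ^ k).2) (hG y hy)
  have h1 : IsIntegral R (⟨_, hmem⟩ : adjoin ℂ (range t)) :=
    (isIntegral_algebraMap_iff (A := adjoin ℂ (range t)) (B := K)
      Subtype.val_injective).1 hk
  obtain ⟨v, hv⟩ := IsIntegrallyClosed.isIntegral_iff.1 h1
  refine ⟨ht.aevalEquiv.symm v, k, ?_⟩
  have h2 : ∀ w : R, MvPolynomial.aeval t (ht.aevalEquiv.symm w) = (w : K) := by
    intro w
    rw [← ht.algebraMap_aevalEquiv, AlgEquiv.apply_symm_apply]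
    rfl
  rw [map_pow, h2, h2, mul_comm]
  have h3 := congrArg Subtype.val hv
  simp only [Algebra.smul_def] at h3
  rw [map_pow] at h3
  exact h3.symm

/-- If the field of invariants is purely transcendental, then the invariants identify an open set of
orbits with a basic open subset of an affine space. -/
lemma exists_rational_quotient [Algebra.FiniteType ℂ S] {d : ℕ} {t : Fin d → K}
    (ht : AlgebraicIndependent ℂ t)
    (halg : Algebra.IsAlgebraic (adjoin ℂ (range t)) K)
    (hG : ∀ s ∈ Inv G, algebraMap S K s ∈ adjoin ℂ (range t))
    (hfix : ∀ i, ∀ σ ∈ G, IsFractionRing.fieldEquivOfAlgEquiv ℂ K K σ (t i) = t i) :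
    ∃ (E : Inv G) (N : Fin d → Inv G) (B : MvPolynomial (Fin d) ℂ), E ≠ 0 ∧ B ≠ 0 ∧
      (∀ ψ : Inv G →ₐ[ℂ] ℂ, ψ E ≠ 0 → MvPolynomial.eval (fun i => ψ (N i) / ψ E) B ≠ 0) ∧
      (∀ s : Inv G, ∃ (ν : MvPolynomial (Fin d) ℂ) (k : ℕ), ∀ ψ : Inv G →ₐ[ℂ] ℂ, ψ E ≠ 0 →
        ψ s * MvPolynomial.eval (fun i => ψ (N i) / ψ E) B ^ k =
          MvPolynomial.eval (fun i => ψ (N i) / ψ E) ν) ∧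
      ∀ z : Fin d → ℂ, MvPolynomial.eval z B ≠ 0 → ∃ ψ : Inv G →ₐ[ℂ] ℂ, ψ E ≠ 0 ∧
        ∀ i, ψ (N i) / ψ E = z i := by
  obtain ⟨b, hb0, hb⟩ := exists_denominator ht halg hG
  have hβ : Injective (MvPolynomial.aeval (R := ℂ) t) := ht
  have hβb : MvPolynomial.aeval t b ≠ 0 := (map_ne_zero_iff _ hβ).2 hb0
  set ι : Inv G →ₐ[ℂ] K := (IsScalarTower.toAlgHom ℂ S K).comp (Inv G).val with hι
  have hιinj : Injective ι := (IsFractionRing.injective S K).comp Subtype.val_injective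
  have hpol : ∀ p : MvPolynomial (Fin d) ℂ, ∀ σ ∈ G, IsFractionRing.fieldEquivOfAlgEquiv ℂ K K σ
      (MvPolynomial.aeval t p) = MvPolynomial.aeval t p := by
    intro p σ hσ
    change (IsFractionRing.fieldEquivOfAlgEquiv ℂ K K σ).toAlgHom _ = _
    rw [← AlgHom.comp_apply]
    refine DFunLike.congr_fun (MvPolynomial.algHom_ext fun i => ?_) p
    rw [AlgHom.comp_apply, MvPolynomial.aeval_X]
    exact hfix i σ hσ
  obtain ⟨E, N', hE0, hN'⟩ := exists_common_denominator (K := K) (G := G)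
    (y := fun i : Option (Fin d) => i.elim (MvPolynomial.aeval t b)⁻¹ t) (by
      rintro (_ | i) σ hσ
      · simp only [Option.elim_none, map_inv₀, hpol b σ hσ]
      · exact hfix i σ hσ)
  set N := fun i => N' (some i) with hN
  have hιN : ∀ i, ι E * t i = ι (N i) := fun i => hN' (some i)
  have hEb : ι E = ι (N' none) * MvPolynomial.aeval t b := by
    have h1 : ι E * (MvPolynomial.aeval t b)⁻¹ = ι (N' none) := hN' none
    rw [← h1, inv_mul_cancel_right₀ hβb]
  have hb' : ∀ s : Inv G, ∃ (ν : MvPolynomial (Fin d) ℂ) (k : ℕ),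
      ι s * MvPolynomial.aeval t (b ^ k) = MvPolynomial.aeval t ν := fun s => hb s s.2
  obtain ⟨e, kE, he⟩ := hb' E
  have he0 : e ≠ 0 := by
    rintro rfl
    rw [map_zero, mul_eq_zero, map_eq_zero_iff _ hιinj, map_pow] at he
    exact he.elim hE0 (pow_ne_zero _ hβb)
  have hev : ∀ ψ : Inv G →ₐ[ℂ] ℂ, ∀ p : MvPolynomial (Fin d) ℂ, ψ E ≠ 0 →
      ∃ (D : ℕ) (P : Inv G), ι P = ι E ^ D * MvPolynomial.aeval t p ∧
        ψ P = ψ E ^ D * MvPolynomial.eval (fun i => ψ (N i) / ψ E) p := by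
    intro ψ p hψ
    induction p using MvPolynomial.induction_on with
    | C c => exact ⟨0, algebraMap ℂ _ c, by simp, by simp⟩
    | add p q h1 h2 =>
      obtain ⟨D, P, h1, h1'⟩ := h1
      obtain ⟨D', P', h2, h2'⟩ := h2
      refine ⟨D + D', E ^ D' * P + E ^ D * P', ?_, ?_⟩ <;>
        simp only [map_add, map_mul, map_pow, h1, h2, h1', h2'] <;> ring
    | mul_X p i h1 =>
      obtain ⟨D, P, h1, h1'⟩ := h1
      refine ⟨D + 1, P * N i, ?_, ?_⟩
      · rw [map_mul, map_mul, MvPolynomial.aeval_X, h1, ← hιN]; ring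
      · rw [map_mul, map_mul, MvPolynomial.eval_X, h1']
        rw [pow_succ]
        linear_combination -(ψ E ^ D * MvPolynomial.eval (fun i => ψ (N i) / ψ E) p) *
          mul_div_cancel₀ (ψ (N i)) hψ
  have hrel : ∀ ψ : Inv G →ₐ[ℂ] ℂ, ψ E ≠ 0 → ∀ (s s' : Inv G)
      (p q : MvPolynomial (Fin d) ℂ),
      ι s * MvPolynomial.aeval t p = ι s' * MvPolynomial.aeval t q →
      ψ s * MvPolynomial.eval (fun i => ψ (N i) / ψ E) p =
        ψ s' * MvPolynomial.eval (fun i => ψ (N i) / ψ E) q := by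
    intro ψ hψ s s' p q h
    obtain ⟨D, P, h1, h1'⟩ := hev ψ p hψ
    obtain ⟨D', P', h2, h2'⟩ := hev ψ q hψ
    have h3 : s * P * E ^ D' = E ^ D * (s' * P') := hιinj (by
      simp only [map_mul, map_pow, h1, h2]
      linear_combination (ι E ^ D * ι E ^ D') * h)
    have h4 := congrArg ψ h3
    simp only [map_mul, map_pow, h1', h2'] at h4
    refine mul_left_cancel₀ (mul_ne_zero (pow_ne_zero D hψ) (pow_ne_zero D' hψ)) ?_
    linear_combination h4
  refine ⟨E, N, b * e, hE0, mul_ne_zero hb0 he0, fun ψ hψ => ?_, fun s => ?_, fun z hz => ?_⟩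
  · have h1 := hrel ψ hψ E 1 _ _ (by rw [map_one ι, one_mul]; exact he)
    rw [map_one ψ, one_mul] at h1
    have h2 : MvPolynomial.eval (fun i => ψ (N i) / ψ E) b ≠ 0 := by
      have h3 := hrel ψ hψ (N' none) E b 1 (by rw [map_one, mul_one, hEb])
      rw [map_one, mul_one] at h3
      exact right_ne_zero_of_mul (h3 ▸ hψ)
    rw [map_mul]
    refine mul_ne_zero h2 ?_
    rw [← h1, map_pow]
    exact mul_ne_zero hψ (pow_ne_zero _ h2)
  · obtain ⟨ν, k, hν⟩ := hb' s
    refine ⟨ν * e ^ k, k, fun ψ hψ => ?_⟩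
    have h1 := hrel ψ hψ s 1 _ _ (by rw [map_one ι, one_mul]; exact hν)
    rw [map_one ψ, one_mul, map_pow] at h1
    rw [map_mul, map_mul, map_pow, mul_pow, ← h1, mul_assoc]
  · rw [map_mul] at hz
    have hzb := left_ne_zero_of_mul hz
    have hwd : ∀ {s : Inv G} {ν ν' : MvPolynomial (Fin d) ℂ} {k k' : ℕ},
        ι s * MvPolynomial.aeval t (b ^ k) = MvPolynomial.aeval t ν →
        ι s * MvPolynomial.aeval t (b ^ k') = MvPolynomial.aeval t ν' →
        MvPolynomial.eval z ν / MvPolynomial.eval z b ^ k =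
          MvPolynomial.eval z ν' / MvPolynomial.eval z b ^ k' := by
      intro s ν ν' k k' h h'
      have h1 : ν * b ^ k' = ν' * b ^ k := hβ (by
        rw [map_mul, map_mul, ← h, ← h']; ring)
      have h2 := congrArg (MvPolynomial.eval z) h1
      simp only [map_mul, map_pow] at h2
      rw [div_eq_div_iff (pow_ne_zero _ hzb) (pow_ne_zero _ hzb), h2]
    choose ν k hν using hb'
    have hc : ∀ c : ℂ, ι (algebraMap ℂ _ c) * MvPolynomial.aeval t (b ^ 0) =
        MvPolynomial.aeval t (MvPolynomial.C c) := fun c => by simp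
    let ψ : Inv G →ₐ[ℂ] ℂ :=
      { toFun := fun s => MvPolynomial.eval z (ν s) / MvPolynomial.eval z b ^ k s
        map_one' := by
          have := hwd (hν 1) (ν' := 1) (k' := 0) (by simp)
          rw [this]; simp
        map_zero' := by
          have := hwd (hν 0) (ν' := 0) (k' := 0) (by simp)
          rw [this]; simp
        map_mul' := fun s s' => by
          rw [hwd (hν (s * s')) (ν' := ν s * ν s') (k' := k s + k s') (by
            rw [map_mul, map_mul, ← hν, ← hν, pow_add, map_mul]; ring), map_mul, pow_add,
            div_mul_div_comm]
        map_add' := fun s s' => by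
          rw [hwd (hν (s + s')) (ν' := ν s * b ^ k s' + ν s' * b ^ k s) (k' := k s + k s') (by
            simp only [map_mul, map_add, ← hν, pow_add]; ring), div_add_div _ _
            (pow_ne_zero _ hzb) (pow_ne_zero _ hzb), pow_add]
          simp only [map_add, map_mul, map_pow]
          congr 1; ring
        commutes' := fun c => by
          change MvPolynomial.eval z (ν (algebraMap ℂ _ c)) / _ = _
          rw [hwd (hν (algebraMap ℂ _ c)) (hc c)]; simp }
    have hψ : ∀ s, ψ s = MvPolynomial.eval z (ν s) / MvPolynomial.eval z b ^ k s := fun _ => rfl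
    have hψE : ψ E = MvPolynomial.eval z e / MvPolynomial.eval z b ^ kE := hwd (hν E) he
    have hψE0 : ψ E ≠ 0 := by
      rw [hψE]; exact div_ne_zero (right_ne_zero_of_mul hz) (pow_ne_zero _ hzb)
    refine ⟨ψ, hψE0, fun i => ?_⟩
    have h1 : ψ (N i) = MvPolynomial.eval z (.X i * e) / MvPolynomial.eval z b ^ kE :=
      hwd (hν (N i)) (by rw [← hιN, map_mul (MvPolynomial.aeval t), MvPolynomial.aeval_X, ← he]; ring)
    rw [div_eq_iff hψE0, h1, hψE, map_mul, MvPolynomial.eval_X, mul_div_assoc]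

end RationalQuotient


open MvPolynomial (eval aeval)

section Torus

variable {n : ℕ} (o : Fin n)

/-- The torus of projective points with nonzero coordinates. -/
abbrev Torus : Type := {c : Fin n → ℂ // (∀ i, c i ≠ 0) ∧ c o = 1}

/-- The ring of regular functions on the torus. -/
noncomputable def torusRing : Subalgebra ℂ (Torus o → ℂ) :=
  Algebra.adjoin ℂ (range (fun i c => c.1 i) ∪ range fun i c => (c.1 i)⁻¹)

/-- The coordinates on the torus. -/
noncomputable def torusX (i : Fin n) : torusRing o :=
  ⟨fun c => c.1 i, Algebra.subset_adjoin (Or.inl ⟨i, rfl⟩)⟩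

/-- The inverses of the coordinates on the torus. -/
noncomputable def torusXInv (i : Fin n) : torusRing o :=
  ⟨fun c => (c.1 i)⁻¹, Algebra.subset_adjoin (Or.inr ⟨i, rfl⟩)⟩

variable {o}

lemma torusX_mul_inv (i : Fin n) : torusX o i * torusXInv o i = 1 :=
  Subtype.ext (funext fun c => mul_inv_cancel₀ (c.2.1 i))

lemma torusX_o : torusX o o = 1 := Subtype.ext (funext fun c => c.2.2)

/-- Evaluation at a point of the torus. -/
noncomputable def torusEv (c : Torus o) : torusRing o →ₐ[ℂ] ℂ :=
  (Pi.evalAlgHom ℂ (fun _ : Torus o => ℂ) c).comp (torusRing o).val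

lemma torusRing_induction {M : torusRing o → Prop} (hx : ∀ i, M (torusX o i))
    (hi : ∀ i, M (torusXInv o i)) (hc : ∀ c, M (algebraMap ℂ _ c))
    (ha : ∀ s t, M s → M t → M (s + t)) (hm : ∀ s t, M s → M t → M (s * t)) (s : torusRing o) :
    M s := by
  obtain ⟨s, hs⟩ := s
  induction hs using Algebra.adjoin_induction with
  | mem s hs =>
    rcases hs with ⟨i, rfl⟩ | ⟨i, rfl⟩
    · exact hx i
    · exact hi i
  | algebraMap c => exact hc c
  | add s t h h' e e' => exact ha _ _ e e'
  | mul s t h h' e e' => exact hm _ _ e e'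

lemma torusRing_hom_ext {A : Type*} [CommRing A] [Algebra ℂ A] {φ ψ : torusRing o →ₐ[ℂ] A}
    (h : ∀ i, φ (torusX o i) = ψ (torusX o i)) : φ = ψ := by
  refine AlgHom.ext fun s => ?_
  induction s using torusRing_induction with
  | hx i => exact h i
  | hi i =>
    have h1 := congrArg φ (torusX_mul_inv (o := o) i)
    have h2 := congrArg ψ (torusX_mul_inv (o := o) i)
    rw [map_mul, map_one] at h1 h2
    rw [← h] at h2
    linear_combination ψ (torusXInv o i) * h1 - φ (torusXInv o i) * h2
  | hc c => rw [AlgHom.commutes, AlgHom.commutes]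
  | ha s t e e' => rw [map_add, map_add, e, e']
  | hm s t e e' => rw [map_mul, map_mul, e, e']

lemma exists_torusEv (φ : torusRing o →ₐ[ℂ] ℂ) : ∃ c, φ = torusEv c := by
  refine ⟨⟨fun i => φ (torusX o i), fun i h => ?_, by
    dsimp only; rw [torusX_o, map_one]⟩, torusRing_hom_ext fun i => rfl⟩
  have h1 := congrArg φ (torusX_mul_inv (o := o) i)
  rw [map_mul, map_one] at h1
  exact left_ne_zero_of_mul (h1 ▸ one_ne_zero) h

lemma torusRing_finiteType : Algebra.FiniteType ℂ (torusRing o) := by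
  refine (Subalgebra.fg_iff_finiteType _).1 ?_
  obtain ⟨T, hT⟩ := ((Set.finite_range (fun (i : Fin n) (c : Torus o) => c.1 i)).union
    (Set.finite_range fun (i : Fin n) (c : Torus o) => (c.1 i)⁻¹)).exists_finset_coe
  exact ⟨T, by rw [hT]; rfl⟩

lemma torusRing_repr (s : torusRing o) : ∃ (P : MvPolynomial {i // i ≠ o} ℂ) (k : ℕ),
    ∀ c : Torus o, s.1 c * (∏ i, c.1 i) ^ k = eval (fun i => c.1 i.1) P := by
  classical
  have hX : ∀ i, ∃ P : MvPolynomial {i // i ≠ o} ℂ, ∀ c : Torus o,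
      c.1 i = eval (fun i => c.1 i.1) P := by
    intro i
    by_cases h : i = o
    · exact ⟨1, fun c => by rw [h, c.2.2, map_one]⟩
    · exact ⟨.X ⟨i, h⟩, fun c => by rw [MvPolynomial.eval_X]⟩
  choose X hX using hX
  have hprod : ∀ (T : Finset (Fin n)) (c : Torus o), ∏ i ∈ T, c.1 i =
      eval (fun i => c.1 i.1) (∏ i ∈ T, X i) := fun T c => by
    rw [map_prod]; exact prod_congr rfl fun i _ => hX i c
  induction s using torusRing_induction with
  | hx i => exact ⟨X i, 0, fun c => by rw [pow_zero, mul_one, ← hX]; rfl⟩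
  | hi i =>
    refine ⟨∏ j ∈ Finset.univ.erase i, X j, 1, fun c => ?_⟩
    rw [← hprod, pow_one, ← Finset.mul_prod_erase _ _ (mem_univ i), ← mul_assoc]
    change (c.1 i)⁻¹ * c.1 i * _ = _
    rw [inv_mul_cancel₀ (c.2.1 i), one_mul]
  | hc c => exact ⟨.C c, 0, fun x => by rw [pow_zero, mul_one, MvPolynomial.eval_C]; rfl⟩
  | ha s t e e' =>
    obtain ⟨P, k, e⟩ := e
    obtain ⟨Q, l, e'⟩ := e'
    refine ⟨P * (∏ i, X i) ^ l + Q * (∏ i, X i) ^ k, k + l, fun c => ?_⟩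
    rw [map_add, map_mul, map_mul, map_pow, map_pow, ← hprod, ← e, ← e']
    change (s.1 c + t.1 c) * _ = _
    ring
  | hm s t e e' =>
    obtain ⟨P, k, e⟩ := e
    obtain ⟨Q, l, e'⟩ := e'
    refine ⟨P * Q, k + l, fun c => ?_⟩
    rw [map_mul, ← e, ← e']
    change s.1 c * t.1 c * _ = _
    ring

lemma eq_zero_of_torus {P : MvPolynomial {i // i ≠ o} ℂ}
    (h : ∀ c : Torus o, eval (fun i => c.1 i.1) P = 0) : P = 0 := by
  classical
  refine MvPolynomial.funext_set (s := fun _ => {0}ᶜ)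
    (fun _ => (Set.finite_singleton (0 : ℂ)).infinite_compl) fun x hx => ?_
  rw [map_zero]
  have h1 := h ⟨fun i => if h : i = o then 1 else x ⟨i, h⟩, fun i => by
    dsimp only
    split_ifs with h
    · exact one_ne_zero
    · exact hx ⟨i, h⟩ trivial, by simp⟩
  rw [← h1]
  congr 2
  funext i
  simp [i.2]

instance : IsDomain (torusRing o) := by
  have : Nontrivial (torusRing o) := ⟨0, 1, fun h => zero_ne_one
    (congrFun (congrArg Subtype.val h) ⟨1, fun _ => one_ne_zero, rfl⟩)⟩
  have : NoZeroDivisors (torusRing o) := ⟨fun {s t} hst => by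
    obtain ⟨P, k, hP⟩ := torusRing_repr s
    obtain ⟨Q, l, hQ⟩ := torusRing_repr t
    have h0 : ∀ {s : torusRing o} {P k}, (∀ c : Torus o, s.1 c * (∏ i, c.1 i) ^ k =
        eval (fun i : {i // i ≠ o} => c.1 i.1) P) → P = 0 → s = 0 := by
      rintro s P k h rfl
      refine Subtype.ext (funext fun c => ?_)
      have := h c
      rw [map_zero] at this
      exact (mul_eq_zero.1 this).resolve_right
        (pow_ne_zero _ (prod_ne_zero_iff.2 fun i _ => c.2.1 i))
    have h1 : P * Q = 0 := eq_zero_of_torus fun c => by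
      have := congrFun (congrArg Subtype.val hst) c
      change s.1 c * t.1 c = 0 at this
      rw [map_mul, ← hP, ← hQ]
      linear_combination (∏ i, c.1 i) ^ k * (∏ i, c.1 i) ^ l * this
    exact (mul_eq_zero.1 h1).imp (h0 hP) (h0 hQ)⟩
  exact NoZeroDivisors.to_isDomain _

lemma exists_torusHom {u : Fin n → ℂ} (hu : ∀ i, u i ≠ 0) (π : Perm (Fin n)) :
    ∃ σ : torusRing o →ₐ[ℂ] torusRing o, ∀ i, σ (torusX o i) *
      (algebraMap ℂ _ (u o) * torusX o (π o)) = algebraMap ℂ _ (u i) * torusX o (π i) := by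
  have hne : ∀ (c : Torus o) i, u i * c.1 (π i) ≠ 0 := fun c i => mul_ne_zero (hu i) (c.2.1 _)
  let γ : Torus o → Torus o := fun c => ⟨fun i => u i * c.1 (π i) / (u o * c.1 (π o)),
    fun i => div_ne_zero (hne c i) (hne c o), div_self (hne c o)⟩
  have hx : ∀ i (c : Torus o), (γ c).1 i = (algebraMap ℂ (torusRing o) (u i * (u o)⁻¹) *
      torusX o (π i) * torusXInv o (π o)).1 c := by
    intro i c
    change u i * c.1 (π i) / (u o * c.1 (π o)) = u i * (u o)⁻¹ * c.1 (π i) * (c.1 (π o))⁻¹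
    rw [div_eq_mul_inv, mul_inv]; ring
  have hi : ∀ i (c : Torus o), ((γ c).1 i)⁻¹ = (algebraMap ℂ (torusRing o) (u o * (u i)⁻¹) *
      torusX o (π o) * torusXInv o (π i)).1 c := by
    intro i c
    change (u i * c.1 (π i) / (u o * c.1 (π o)))⁻¹ = u o * (u i)⁻¹ * c.1 (π o) * (c.1 (π i))⁻¹
    rw [inv_div, div_eq_mul_inv, mul_inv]; ring
  have hmem : ∀ s : torusRing o, s.1 ∘ γ ∈ torusRing o := by
    intro s
    induction s using torusRing_induction with
    | hx i => rw [show (torusX o i).1 ∘ γ = _ from funext (hx i)]; exact Subtype.property _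
    | hi i => rw [show (torusXInv o i).1 ∘ γ = _ from funext (hi i)]; exact Subtype.property _
    | hc c => exact (algebraMap ℂ (torusRing o) c).2
    | ha s t e e' => exact add_mem e e'
    | hm s t e e' => exact mul_mem e e'
  refine ⟨{ toFun := fun s => ⟨s.1 ∘ γ, hmem s⟩, map_one' := rfl, map_mul' := fun _ _ => rfl,
            map_zero' := rfl, map_add' := fun _ _ => rfl, commutes' := fun _ => rfl }, fun i => ?_⟩
  refine Subtype.ext (funext fun c => ?_)
  change u i * c.1 (π i) / (u o * c.1 (π o)) * (u o * c.1 (π o)) = u i * c.1 (π i)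
  exact div_mul_cancel₀ _ (hne c o)

lemma exists_torusAut {u : Fin n → ℂ} (hu : ∀ i, u i ≠ 0) (π : Perm (Fin n)) :
    ∃ σ : torusRing o ≃ₐ[ℂ] torusRing o, ∀ i, σ (torusX o i) *
      (algebraMap ℂ _ (u o) * torusX o (π o)) = algebraMap ℂ _ (u i) * torusX o (π i) := by
  have key : ∀ {u u' : Fin n → ℂ} {π π' : Perm (Fin n)} {σ τ : torusRing o →ₐ[ℂ] torusRing o},
      (∀ i, u i ≠ 0) → (∀ i, u' i * u (π' i) = 1) → (∀ i, π (π' i) = i) →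
      (∀ i, σ (torusX o i) * (algebraMap ℂ _ (u o) * torusX o (π o)) =
        algebraMap ℂ _ (u i) * torusX o (π i)) →
      (∀ i, τ (torusX o i) * (algebraMap ℂ _ (u' o) * torusX o (π' o)) =
        algebraMap ℂ _ (u' i) * torusX o (π' i)) → σ.comp τ = AlgHom.id ℂ _ := by
    intro u u' π π' σ τ hu h1 h2 hσ hτ
    refine torusRing_hom_ext fun i => ?_
    have e := congrArg σ (hτ i)
    simp only [map_mul, AlgHom.commutes] at e
    have e1 := hσ (π' o)
    have e2 := hσ (π' i)
    rw [h2, torusX_o, mul_one] at e1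
    rw [h2] at e2
    have a1 := congrArg (algebraMap ℂ (torusRing o)) (h1 o)
    have a2 := congrArg (algebraMap ℂ (torusRing o)) (h1 i)
    rw [map_mul, map_one] at a1 a2
    change σ (τ _) = torusX o i
    linear_combination (algebraMap ℂ (torusRing o) (u o) * torusX o (π o)) * e -
      σ (τ (torusX o i)) * algebraMap ℂ (torusRing o) (u' o) * e1 +
      algebraMap ℂ (torusRing o) (u' i) * e2 - σ (τ (torusX o i)) * a1 + torusX o i * a2
  have hu' : ∀ i, (u (π.symm i))⁻¹ ≠ 0 := fun i => inv_ne_zero (hu _)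
  obtain ⟨σ, hσ⟩ := exists_torusHom (o := o) hu π
  obtain ⟨τ, hτ⟩ := exists_torusHom (o := o) hu' π.symm
  exact ⟨AlgEquiv.ofAlgHom σ τ
    (key hu (fun i => inv_mul_cancel₀ (hu _)) (fun i => π.apply_symm_apply i) hσ hτ)
    (key hu' (fun i => by rw [π.symm_apply_apply, mul_inv_cancel₀ (hu _)])
      (fun i => π.symm_apply_apply i) hτ hσ), hσ⟩

lemma IsTwist.inv {α : Fin n → ℂ} {σ : torusRing o ≃ₐ[ℂ] torusRing o} {g lam}
    (h : IsTwist α (torusX o) σ g lam) :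
    ∃ lam', IsTwist α (torusX o) σ⁻¹ g.adjugate lam' := by
  obtain ⟨hg, π, hπ⟩ := h
  obtain ⟨L, hL⟩ : ∃ L, lam * L = 1 := by
    refine ⟨algebraMap ℂ _ (mobDen g (α o) ^ 5) * σ (torusXInv o (π o)), ?_⟩
    have h1 := congrArg σ (torusX_mul_inv (o := o) (π o))
    rw [map_mul, map_one, (hπ o).2.2, torusX_o, mul_one] at h1
    linear_combination h1
  have hadj : g.adjugate * g = Matrix.scalar (Fin 2) g.det := by
    rw [Matrix.adjugate_mul, Matrix.scalar_apply, Matrix.smul_one_eq_diagonal]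
  have hden : ∀ i, mobDen g.adjugate (α (π i)) * mobDen g (α i) = g.det := fun i => by
    rw [← (hπ i).2.1, ← mobDen_mul (hπ i).1, hadj]; simp [mobDen]
  have hne : ∀ i, mobDen g.adjugate (α (π i)) ≠ 0 := fun i =>
    left_ne_zero_of_mul (by rw [hden]; exact hg)
  refine ⟨σ⁻¹ L * algebraMap ℂ _ (g.det⁻¹ ^ 5), by
    rw [Matrix.det_adjugate]; simpa using hg, π.symm, fun j => ?_⟩
  obtain ⟨i, rfl⟩ := π.surjective j
  rw [π.symm_apply_apply]
  refine ⟨hne i, ?_, ?_⟩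
  · conv_lhs => rw [← (hπ i).2.1]
    rw [← mob_mul (hπ i).1 (by rw [(hπ i).2.1]; exact hne i), hadj]
    simp [mob, mobDen, hg]
  · refine σ.injective ?_
    have e : algebraMap ℂ (torusRing o) (g.det⁻¹ ^ 5) *
        algebraMap ℂ _ (mobDen g.adjugate (α (π i)) ^ 5) *
        algebraMap ℂ _ (mobDen g (α i) ^ 5) = 1 := by
      rw [← map_mul, ← map_mul, ← mul_pow, ← mul_pow, mul_assoc, hden, inv_mul_cancel₀ hg, one_pow,
        map_one]
    have hs : ∀ y, σ (σ⁻¹ y) = y := σ.apply_symm_apply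
    rw [hs, map_mul, map_mul, map_mul, hs, AlgEquiv.commutes, AlgEquiv.commutes, (hπ i).2.2]
    linear_combination -(lam * L * torusX o i) * e - torusX o i * hL

/-- The group of twists by the projective transformations permuting the points `αᵢ`. -/
def twistGroup (o : Fin n) (α : Fin n → ℂ) : Subgroup (torusRing o ≃ₐ[ℂ] torusRing o) where
  carrier := {σ | ∃ g lam, IsTwist α (torusX o) σ g lam}
  mul_mem' := by
    rintro σ τ ⟨g, l, h⟩ ⟨g', l', h'⟩
    exact ⟨_, _, h.mul h'⟩
  one_mem' := ⟨1, 1, by simp, 1, fun i => by simp [mobDen, mob]⟩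
  inv_mem' := by
    rintro σ ⟨g, l, h⟩
    exact ⟨_, h.inv⟩

lemma twistGroup_finite (μ : Marking n) {α : Fin n → ℂ} (hα : Injective α) :
    Finite (twistGroup μ.o α) := by
  have h0 : ∀ σ : twistGroup μ.o α, ∃ π : Perm (Fin n), ∃ c : torusRing μ.o, ∀ i,
      σ.1 (torusX μ.o (π i)) = c * algebraMap ℂ _ (wgtOne μ α i / wgtOne μ (fun i => α (π i)) i) *
        torusX μ.o i := by
    rintro ⟨σ, g, l, hg, π, h⟩
    refine ⟨π, l * algebraMap ℂ _ (mobDen g (α μ.o) ^ 5), fun i => ?_⟩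
    have h1 := wgtOne_mob μ hα hg (fun i => (h i).1) i
    rw [show (fun i => mob g (α i)) = fun i => α (π i) from funext fun i => (h i).2.1] at h1
    have h2 : wgtOne μ (fun i => α (π i)) i ≠ 0 := wgtOne_ne_zero μ (hα.comp π.injective) i
    rw [(h i).2.2, mul_assoc l (algebraMap _ _ _) (algebraMap _ _ _), ← map_mul]
    congr 3
    rw [mul_div_assoc', eq_div_iff h2]
    linear_combination h1
  choose π c h using h0
  refine Finite.of_injective π fun σ τ hστ => Subtype.ext (AlgEquiv.ext fun s => ?_)
  have hc : c σ = c τ := by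
    have h1 := h σ ((π σ).symm μ.o)
    have h2 := h τ ((π σ).symm μ.o)
    rw [← hστ] at h2
    rw [Equiv.apply_symm_apply, torusX_o, map_one] at h1 h2
    rw [mul_assoc] at h1 h2
    refine mul_right_cancel₀ (b := algebraMap ℂ _ (wgtOne μ α ((π σ).symm μ.o) /
      wgtOne μ (fun i => α (π σ i)) ((π σ).symm μ.o)) * torusX μ.o ((π σ).symm μ.o)) ?_
      (h1.symm.trans h2)
    intro h3
    rw [h3, mul_zero] at h1
    exact one_ne_zero h1
  refine DFunLike.congr_fun (torusRing_hom_ext (φ := σ.1.toAlgHom) (ψ := τ.1.toAlgHom)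
    fun i => ?_) s
  obtain ⟨i, rfl⟩ := (π σ).surjective i
  change σ.1 _ = τ.1 _
  rw [h σ, hc]
  conv_rhs => rw [hστ, h τ, ← hστ]

end Torus


section Quotient

variable {n : ℕ} (μ : Marking n)

lemma weight_twist (hn : 2 ≤ n) {α : Fin n → ℂ} (j : ℕ) {g : Mat₂}
    {π : Perm (Fin n)} (h : ∀ i, mobDen g (α i) ≠ 0 ∧ mob g (α i) = α (π i)) (i : Fin n) :
    (∏ l ∈ Finset.univ.erase (π i), (α (π i) - α l)) ^ j * mobDen g (α i) ^ ((n - 2) * j) *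
      (∏ l, mobDen g (α l)) ^ j = (g.det ^ (n - 1)) ^ j *
        (∏ l ∈ Finset.univ.erase i, (α i - α l)) ^ j := by
  have h1 : ∏ l ∈ Finset.univ.erase (π i), (α (π i) - α l) =
      ∏ l ∈ Finset.univ.erase i, (α (π i) - α (π l)) := by
    rw [show Finset.univ.erase (π i) = (Finset.univ.erase i).map π.toEmbedding by
      ext l; simp [Finset.mem_map_equiv, Equiv.symm_apply_eq], Finset.prod_map]
    rfl
  have h2 : ∀ l ∈ Finset.univ.erase i, (α (π i) - α (π l)) * (mobDen g (α i) * mobDen g (α l)) =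
      g.det * (α i - α l) := fun l _ => by
    rw [← (h i).2, ← (h l).2, mob_sub (h i).1 (h l).1,
      div_mul_cancel₀ _ (mul_ne_zero (h i).1 (h l).1)]
  have h3 := prod_congr rfl h2
  simp only [Finset.prod_mul_distrib, Finset.prod_const, Finset.card_erase_of_mem
    (mem_univ i), Finset.card_univ, Fintype.card_fin] at h3
  rw [h1, ← Finset.mul_prod_erase _ _ (mem_univ i), pow_mul, ← mul_pow, ← mul_pow, ← mul_pow,
    ← h3]
  congr 1
  rw [show n - 1 = n - 2 + 1 by omega, pow_succ]; ring

lemma torusEv_aeval {ι : Type*} {o : Fin n} (c : Torus o) (x : ι → torusRing o)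
    (P : MvPolynomial ι ℂ) :
    torusEv c (aeval x P) = eval (fun i => torusEv c (x i)) P := by
  rw [MvPolynomial.comp_aeval_apply, ← MvPolynomial.coe_aeval_eq_eval]
  rfl

/-- The sum of the coordinates with nonzero weights does not vanish. -/
lemma weighted_sum_ne_zero {θ : Fin n → ℂ} (hθ : ∀ i, θ i ≠ 0) :
    ∑ i, algebraMap ℂ (torusRing μ.o) (θ i) * torusX μ.o i ≠ 0 := by
  classical
  intro h
  have h1 : ∀ c : Torus μ.o, ∑ i, θ i * c.1 i = 0 := fun c => by
    have := congrArg (torusEv c) h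
    rw [map_sum, map_zero (torusEv c)] at this
    refine Eq.trans ?_ this
    refine sum_congr rfl fun i _ => ?_
    rw [map_mul, AlgHom.commutes]; rfl
  have h2 := h1 ⟨fun _ => 1, fun _ => one_ne_zero, rfl⟩
  have h3 := h1 ⟨Function.update (fun _ => 1) μ.p 2, fun i => by
    by_cases hi : i = μ.p <;> simp [Function.update_apply, hi], by
    simp [Function.update_apply, μ.op]⟩
  have h4 := congrArg₂ (· - ·) h3 h2
  dsimp only at h4
  rw [← sum_sub_distrib, sum_eq_single μ.p (fun i _ hi => by
    simp [Function.update_apply, hi]) (by simp)] at h4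
  refine hθ μ.p ?_
  simp only [Function.update_self] at h4
  linear_combination h4

lemma algebraicIndependent_torusX {o : Fin n} :
    AlgebraicIndependent ℂ fun i : {i // i ≠ o} => torusX o i.1 := by
  rw [algebraicIndependent_iff]
  intro P hP
  refine eq_zero_of_torus fun c => ?_
  have h1 := torusEv_aeval c (fun i : {i // i ≠ o} => torusX o i.1) P
  rw [hP] at h1
  exact h1.symm.trans (map_zero (torusEv c))

section FunctionField

variable {o : Fin n} {K : Type} [Field K] [Algebra (torusRing o) K]
  [IsFractionRing (torusRing o) K] [Algebra ℂ K] [IsScalarTower ℂ (torusRing o) K]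

lemma algebraMap_torus (c : ℂ) :
    algebraMap (torusRing o) K (algebraMap ℂ (torusRing o) c) = algebraMap ℂ K c :=
  (IsScalarTower.algebraMap_apply ℂ (torusRing o) K c).symm

lemma eq_top_of_torusX_mem {L : IntermediateField ℂ K}
    (hx : ∀ i, algebraMap (torusRing o) K (torusX o i) ∈ L) : L = ⊤ := by
  have hL : ∀ s, algebraMap (torusRing o) K s ∈ L := fun s => by
    induction s using torusRing_induction with
    | hx i => exact hx i
    | hi i =>
      have h1 := congrArg (algebraMap (torusRing o) K) (torusX_mul_inv (o := o) i)
      rw [map_mul, map_one] at h1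
      rw [eq_inv_of_mul_eq_one_right h1]
      exact inv_mem (hx i)
    | hc c => rw [algebraMap_torus]; exact L.algebraMap_mem c
    | ha s t e e' => rw [map_add]; exact add_mem e e'
    | hm s t e e' => rw [map_mul]; exact mul_mem e e'
  refine eq_top_iff.2 fun z _ => ?_
  obtain ⟨a, b, -, rfl⟩ := IsFractionRing.div_surjective (A := torusRing o) z
  exact div_mem (hL a) (hL b)

variable (K) in
include o in
lemma trdeg_torus : Algebra.trdeg ℂ K = ((n - 1 : ℕ) : Cardinal) := by
  classical
  have hind : AlgebraicIndependent ℂ fun i : {i // i ≠ o} =>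
      algebraMap (torusRing o) K (torusX o i.1) :=
    algebraicIndependent_torusX.map' (f := IsScalarTower.toAlgHom ℂ (torusRing o) K)
      (IsFractionRing.injective _ K)
  have hbas := hind.isTranscendenceBasis_iff_isAlgebraic.2 (isAlgebraic_adjoin_of_top
    (eq_top_of_torusX_mem (o := o) fun i => by
      by_cases h : i = o
      · rw [h, torusX_o, map_one]; exact one_mem (adjoin ℂ _)
      · exact subset_adjoin ℂ _ ⟨⟨i, h⟩, rfl⟩))
  rw [← hbas.cardinalMk_eq_trdeg, Cardinal.mk_fintype]
  simp [Fintype.card_subtype_compl]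

lemma adjoin_torusX_div {y : torusRing o} (hy : algebraMap (torusRing o) K y ≠ 0) :
    adjoin ℂ (range fun i =>
      algebraMap (torusRing o) K (torusX o i) / algebraMap (torusRing o) K y) = ⊤ := by
  set L := adjoin ℂ (range fun i =>
    algebraMap (torusRing o) K (torusX o i) / algebraMap (torusRing o) K y)
  have hx : ∀ i, algebraMap (torusRing o) K (torusX o i) / algebraMap (torusRing o) K y ∈ L :=
    fun i => subset_adjoin ℂ _ ⟨i, rfl⟩
  refine eq_top_of_torusX_mem (o := o) fun i => ?_
  have h1 := inv_mem (hx o)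
  rw [torusX_o, map_one, one_div, inv_inv] at h1
  have h2 := mul_mem (hx i) h1
  rwa [div_mul_cancel₀ _ hy] at h2

end FunctionField

lemma exists_twistedPoints {K : Type} [Field K] [Algebra (torusRing μ.o) K]
    [IsFractionRing (torusRing μ.o) K] [Algebra ℂ K] [IsScalarTower ℂ (torusRing μ.o) K] (hn : 4 ≤ n)
    {α : Fin n → ℂ} (hα : Injective α) :
    ∃ T : TwistedPoints K n, T.H = (twistGroup μ.o α).map
      (IsFractionRing.fieldEquivOfAlgEquivHom ℂ K) := by
  classical
  obtain ⟨m, j, h1m, hm, h5⟩ : ∃ m j : ℕ, 1 ≤ m ∧ m + 2 ≤ n ∧ 5 = m + (n - 2) * j := by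
    rcases (by omega : n = 4 ∨ n = 5 ∨ n = 6 ∨ 7 ≤ n) with rfl | rfl | rfl | h
    · exact ⟨1, 2, by omega, by omega, rfl⟩
    · exact ⟨2, 1, by omega, by omega, rfl⟩
    · exact ⟨1, 1, by omega, by omega, rfl⟩
    · exact ⟨5, 0, by omega, by omega, by omega⟩
  let ι := algebraMap (torusRing μ.o) K
  have hι : Injective ι := IsFractionRing.injective _ K
  let θ : Fin n → ℂ := fun i => (∏ l ∈ Finset.univ.erase i, (α i - α l)) ^ j
  have hθ : ∀ i, θ i ≠ 0 := fun i => pow_ne_zero _ (prod_ne_zero_iff.2 fun l hl =>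
    sub_ne_zero.2 fun e => (mem_erase.1 hl).1 (hα e).symm)
  obtain ⟨y, hy⟩ : ∃ y, y = ∑ i, algebraMap ℂ (torusRing μ.o) (θ i) * torusX μ.o i := ⟨_, rfl⟩
  have hy0 : ι y ≠ 0 := (map_ne_zero_iff ι hι).2 (hy ▸ weighted_sum_ne_zero μ hθ)
  have := twistGroup_finite μ hα
  have hsum : ∑ i, algebraMap ℂ K (θ i) * (ι (torusX μ.o i) / ι y) = 1 := by
    simp only [mul_div_assoc']
    rw [← Finset.sum_div, div_eq_one_iff_eq hy0, hy, map_sum]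
    exact sum_congr rfl fun i _ => by rw [map_mul ι, ← algebraMap_torus (o := μ.o) (K := K)]
  have htw : ∀ (g : Mat₂) (π : Perm (Fin n)), g.det ≠ 0 →
      (∀ i, mobDen g (α i) ≠ 0 ∧ mob g (α i) = α (π i)) →
      ∃ κ : ℂ, κ ≠ 0 ∧ ∀ i, θ (π i) * mobDen g (α i) ^ 5 = κ * (θ i * mobDen g (α i) ^ m) := by
    intro g π hg h
    have hprod : (∏ l, mobDen g (α l)) ^ j ≠ 0 :=
      pow_ne_zero _ (prod_ne_zero_iff.2 fun l _ => (h l).1)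
    refine ⟨(g.det ^ (n - 1)) ^ j / (∏ l, mobDen g (α l)) ^ j,
      div_ne_zero (pow_ne_zero _ (pow_ne_zero _ hg)) hprod, fun i => ?_⟩
    rw [div_mul_eq_mul_div, eq_div_iff hprod]
    have h1 := weight_twist (by omega) j h i
    conv_lhs => rw [h5, pow_add]
    simp only [θ]
    linear_combination mobDen g (α i) ^ m * h1
  have hdat : ∀ σ ∈ (twistGroup μ.o α).map (IsFractionRing.fieldEquivOfAlgEquivHom ℂ K),
      ∃ g lam, IsTwist α (fun i => ι (torusX μ.o i) / ι y) σ g lam := by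
    rintro _ ⟨σ, ⟨g, l, hg, π, h⟩, rfl⟩
    have hτ : ∀ s, IsFractionRing.fieldEquivOfAlgEquivHom ℂ K σ (ι s) = ι (σ s) := fun s =>
      IsFractionRing.fieldEquivOfAlgEquiv_algebraMap ℂ K K σ s
    generalize IsFractionRing.fieldEquivOfAlgEquivHom ℂ K σ = τ at hτ
    have hy1 : ι (σ y) ≠ 0 := by rw [← hτ]; exact (map_ne_zero τ).2 hy0
    refine ⟨g, ι l * ι y / ι (σ y), hg, π, fun i => ⟨(h i).1, (h i).2.1, ?_⟩⟩
    rw [map_div₀, hτ, hτ, (h i).2.2, map_mul ι, map_mul ι,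
      ← algebraMap_torus (o := μ.o) (K := K)]
    change ι l * ι _ * ι _ / _ = ι l * ι y / ι (σ y) * ι _ * (ι _ / ι y)
    rw [div_eq_iff hy1]
    field_simp
  exact ⟨⟨α, hα, θ, hθ, m, h1m, hm, htw, fun i => ι (torusX μ.o i) / ι y, hsum,
    adjoin_torusX_div hy0, trdeg_torus (o := μ.o) K,
    (twistGroup μ.o α).map (IsFractionRing.fieldEquivOfAlgEquivHom ℂ K),
    (Set.Finite.image _ (Set.toFinite (twistGroup μ.o α).carrier)).to_subtype, hdat⟩, rfl⟩

/-- The orbits of the group of twists are identified with points of an affine space. -/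
lemma exists_torus_quotient (hn : 4 ≤ n) {α : Fin n → ℂ} (hα : Injective α) :
    ∃ (E : Inv (twistGroup μ.o α)) (N : Fin (n - 1) → Inv (twistGroup μ.o α))
      (B : MvPolynomial (Fin (n - 1)) ℂ), E ≠ 0 ∧ B ≠ 0 ∧
      (∀ ψ : Inv (twistGroup μ.o α) →ₐ[ℂ] ℂ, ψ E ≠ 0 →
        eval (fun i => ψ (N i) / ψ E) B ≠ 0) ∧
      (∀ s : Inv (twistGroup μ.o α), ∃ (ν : MvPolynomial (Fin (n - 1)) ℂ) (k : ℕ),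
        ∀ ψ : Inv (twistGroup μ.o α) →ₐ[ℂ] ℂ, ψ E ≠ 0 →
          ψ s * eval (fun i => ψ (N i) / ψ E) B ^ k =
            eval (fun i => ψ (N i) / ψ E) ν) ∧
      ∀ z : Fin (n - 1) → ℂ, eval z B ≠ 0 →
        ∃ ψ : Inv (twistGroup μ.o α) →ₐ[ℂ] ℂ, ψ E ≠ 0 ∧ ∀ i, ψ (N i) / ψ E = z i := by
  obtain ⟨T, hT⟩ := exists_twistedPoints (K := FractionRing (torusRing μ.o)) μ hn hα
  obtain ⟨t, ht, halg, hfix⟩ := T.exists_rational_invariants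
  have := twistGroup_finite μ hα
  have := torusRing_finiteType (o := μ.o)
  have hmem : ∀ y : FractionRing (torusRing μ.o), y ∈ adjoin ℂ (range t) ↔
      ∀ σ ∈ twistGroup μ.o α, IsFractionRing.fieldEquivOfAlgEquiv ℂ _ _ σ y = y := fun y => by
    rw [hfix, IntermediateField.mem_fixedField_iff, hT]
    exact ⟨fun h σ hσ => h _ ⟨σ, hσ, rfl⟩, by rintro h _ ⟨σ, hσ, rfl⟩; exact h σ hσ⟩
  refine exists_rational_quotient (K := FractionRing (torusRing μ.o)) ht halg (fun s hs => ?_)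
    fun i => (hmem _).1 (subset_adjoin ℂ _ ⟨i, rfl⟩)
  refine (hmem _).2 fun σ hσ => ?_
  rw [IsFractionRing.fieldEquivOfAlgEquiv_algebraMap, mem_inv.1 hs σ hσ]

end Quotient

section Classes

variable {W : Type*} [AddCommGroup W] [Module ℂ W] [Module.Finite ℂ W]

/-- The normal form with degenerate elements `αᵢ` and weights `cᵢ`. -/
def torusParam {n : ℕ} {o : Fin n} {α : Fin n → ℂ} (hα : Injective α) (c : Torus o) :
    NormalParam n := ⟨(α, c.1), hα, c.2.1⟩

lemma normalClass_torus_iff (hn : 4 ≤ dim W) {o : Fin (dim W)}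
    {α : Fin (dim W) → ℂ} (hα : Injective α) (c c' : Torus o) :
    normalClass hn (torusParam hα c) = normalClass hn (torusParam hα c') ↔
      ∃ σ ∈ twistGroup o α, ∀ s, torusEv c' s = torusEv c (σ s) := by
  rw [normalClass_eq_iff]
  constructor
  · rintro ⟨π, g, t, hg, ht, hd, hα', hc⟩
    have hα'' : ∀ i, α i = mob g (α (π i)) := congrFun hα'
    have hc' : ∀ i, c'.1 i = t * (mobDen g (α (π i)) ^ 5 * c.1 (π i)) := congrFun hc
    replace hd : ∀ i, mobDen g (α (π i)) ≠ 0 := hd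
    obtain ⟨σ, hσ⟩ := exists_torusAut (o := o) (fun i => pow_ne_zero 5 (hd i)) π
    have h1 : ∀ i, torusEv c (σ (torusX o i)) = c'.1 i := fun i => by
      have h2 := congrArg (torusEv c) (hσ i)
      simp only [map_mul, AlgHom.commutes] at h2
      change _ * (mobDen g (α (π o)) ^ 5 * c.1 (π o)) = mobDen g (α (π i)) ^ 5 * c.1 (π i) at h2
      have h3 := hc' o
      rw [c'.2.2] at h3
      rw [hc' i, ← h2]
      linear_combination torusEv c (σ (torusX o i)) * h3
    refine ⟨σ, ⟨g, algebraMap ℂ _ (mobDen g (α (π o)) ^ 5)⁻¹ * torusXInv o (π o), hg, π.symm,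
      fun j => ?_⟩, fun s => ?_⟩
    · obtain ⟨i, rfl⟩ := π.surjective j
      rw [Equiv.symm_apply_apply]
      refine ⟨hd i, (hα'' i).symm, ?_⟩
      have h2 : algebraMap ℂ (torusRing o) (mobDen g (α (π o)) ^ 5) *
          algebraMap ℂ (torusRing o) (mobDen g (α (π o)) ^ 5)⁻¹ = 1 := by
        rw [← map_mul, mul_inv_cancel₀ (pow_ne_zero 5 (hd o)), map_one]
      have h3 := torusX_mul_inv (o := o) (π o)
      linear_combination (algebraMap ℂ (torusRing o) (mobDen g (α (π o)) ^ 5)⁻¹ *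
        torusXInv o (π o)) * hσ i - σ (torusX o i) * torusX o (π o) * torusXInv o (π o) * h2 -
        σ (torusX o i) * h3
    · exact DFunLike.congr_fun (torusRing_hom_ext (φ := torusEv c')
        (ψ := (torusEv c).comp σ.toAlgHom) fun i => (h1 i).symm) s
  · rintro ⟨σ, ⟨g, l, hg, π, h⟩, hs⟩
    have h1 : ∀ i, c'.1 (π i) = torusEv c l * (mobDen g (α i) ^ 5 * c.1 i) := fun i => by
      have h2 := hs (torusX o (π i))
      rw [(h i).2.2, map_mul, map_mul, AlgHom.commutes] at h2
      rw [← mul_assoc]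
      exact h2
    refine ⟨π.symm, g, torusEv c l, hg, ?_, fun i => (h _).1, funext fun i => ?_, funext fun i => ?_⟩
    · have := c'.2.1 (π o)
      rw [h1] at this
      exact left_ne_zero_of_mul this
    · obtain ⟨i, rfl⟩ := π.surjective i
      change α (π i) = mob g (α (π.symm (π i)))
      rw [Equiv.symm_apply_apply, (h i).2.1]
    · obtain ⟨i, rfl⟩ := π.surjective i
      change c'.1 (π i) = torusEv c l * (mobDen g (α (π.symm (π i))) ^ 5 *
        c.1 (π.symm (π i)))
      rw [Equiv.symm_apply_apply, h1]

end Classes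


lemma exists_sum_pow_ne_zero {ι : Type*} [Fintype ι] {v : ι → ℂ} {i : ι} (hi : v i ≠ 0) :
    ∃ k : ℕ, ∑ j, v j ^ (k + 1) ≠ 0 := by
  classical
  by_contra! h
  set S := (Finset.univ.image v).erase 0
  set P : Polynomial ℂ := ∏ w ∈ S, (1 - Polynomial.C w⁻¹ * Polynomial.X) with hP
  have h0 : P.eval 0 = 1 := by
    rw [hP, Polynomial.eval_prod]
    simp
  have h1 : ∀ j, v j ≠ 0 → P.eval (v j) = 0 := fun j hj => by
    rw [hP, Polynomial.eval_prod]
    refine prod_eq_zero (i := v j) (mem_erase.2 ⟨hj, by simp⟩) ?_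
    simp [hj]
  have h2 : ∑ j, P.eval (v j) = ∑ _j : ι, (1 : ℂ) := by
    simp only [Polynomial.eval_eq_sum_range]
    rw [sum_comm, Finset.sum_range_succ']
    have e : P.coeff 0 = 1 := by rw [← h0, Polynomial.coeff_zero_eq_eval_zero]
    simp only [← mul_sum, h, mul_zero, Finset.sum_const_zero, zero_add, pow_zero, e]
    simp
  have h3 : ∑ j, P.eval (v j) = ((Finset.univ.filter fun j => v j = 0).card : ℂ) := by
    rw [Finset.card_eq_sum_ones, sum_filter, Nat.cast_sum]
    refine sum_congr rfl fun j _ => ?_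
    by_cases hj : v j = 0
    · simp [hj, h0]
    · simp [hj, h1]
  rw [h3, Finset.sum_const, nsmul_one] at h2
  have h4 : (Finset.univ.filter fun j => v j = 0).card = Fintype.card ι := by exact_mod_cast h2
  rw [Finset.card_eq_iff_eq_univ] at h4
  have h5 := mem_univ i
  rw [← h4, Finset.mem_filter] at h5
  exact hi h5.2

section Symmetric

variable {X : Type*} {𝒳 : FunSpace X} {n : ℕ} {τ : Type} [Fintype τ]

/-- Symmetrized polynomials in labelled data with distinct first entries are regular if the moments
are. -/
lemma FunSpace.IsRinged.exists_regAt_symmetric (hX : 𝒳.IsRinged) {x : X} {O : Set X}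
    (hx : x ∈ O) (L : X → Fin n × Option τ → ℂ)
    (hp : ∀ k : ℕ, ∃ P, 𝒳.RegAt P x ∧ ∀ y ∈ O, P y = ∑ i, L y (i, none) ^ k)
    (hm : ∀ (t : τ) (k : ℕ), ∃ P, 𝒳.RegAt P x ∧
      ∀ y ∈ O, P y = ∑ i, L y (i, some t) * L y (i, none) ^ k)
    (hinj : ∀ y ∈ O, Injective fun i => L y (i, none))
    (P : MvPolynomial (Fin n × Option τ) ℂ) : ∃ S, 𝒳.RegAt S x ∧ ∀ y ∈ O,
      S y = ∑ ι : Fin n → Fin n, eval (fun v => L y (ι v.1, v.2)) P := by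
  classical
  choose p hp hp' using hp
  choose m hm hm' using hm
  let Good : (X → Fin n → ℂ) → Prop := fun h => ∃ (J : Type) (_ : Fintype J) (e : J → ℕ)
    (q : J → X → ℂ), (∀ j, 𝒳.RegAt (q j) x) ∧
      ∀ y ∈ O, ∀ i, h y i = ∑ j, q j y * L y (i, none) ^ e j
  have hone : Good fun _ _ => 1 := ⟨Unit, inferInstance, fun _ => 0, fun _ _ => 1,
    fun _ => hX.const _ _, fun y _ i => by simp⟩
  have hmul : ∀ {h h'}, Good h → Good h' → Good fun y i => h y i * h' y i := by
    rintro h h' ⟨J, _, e, q, hq, hh⟩ ⟨J', _, e', q', hq', hh'⟩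
    refine ⟨J × J', inferInstance, fun j => e j.1 + e' j.2, fun j y => q j.1 y * q' j.2 y,
      fun j => hX.mul _ _ _ (hq _) (hq' _), fun y hy i => ?_⟩
    dsimp only
    rw [hh y hy, hh' y hy, Finset.sum_mul_sum, Fintype.sum_prod_type]
    exact sum_congr rfl fun j _ => sum_congr rfl fun j' _ => by rw [pow_add]; ring
  have hpow : ∀ {h}, Good h → ∀ k : ℕ, Good fun y i => h y i ^ k := by
    intro h hh k
    induction k with
    | zero => simpa using hone
    | succ k ih => simpa only [pow_succ] using hmul ih hh
  have hprod : ∀ {ι : Type} (s : Finset ι) (h : ι → X → Fin n → ℂ), (∀ j, Good (h j)) →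
      Good fun y i => ∏ j ∈ s, h j y i := by
    intro ι s h hh
    induction s using Finset.induction_on with
    | empty => simpa using hone
    | insert j s hj ih => simpa only [Finset.prod_insert hj] using hmul (hh j) ih
  have hsum : ∀ {h}, Good h → ∃ S, 𝒳.RegAt S x ∧ ∀ y ∈ O, S y = ∑ i, h y i := by
    rintro h ⟨J, _, e, q, hq, hh⟩
    refine ⟨fun y => ∑ j, q j y * p (e j) y,
      hX.sum _ _ _ fun j _ => hX.mul _ _ _ (hq j) (hp _), fun y hy => ?_⟩
    simp only [hh y hy, hp' _ y hy, mul_sum]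
    exact sum_comm
  have hL : ∀ o : Option τ, Good fun y i => L y (i, o) := by
    rintro (_ | t)
    · exact ⟨Unit, inferInstance, fun _ => 1, fun _ _ => 1, fun _ => hX.const _ _,
        fun y _ i => by simp⟩
    let H : X → Matrix (Fin n) (Fin n) ℂ := fun y => Matrix.of fun j k => p (j.1 + k.1) y
    have hH : ∀ y ∈ O, H y = (Matrix.vandermonde fun i => L y (i, none)).transpose *
        Matrix.vandermonde fun i => L y (i, none) := fun y hy => by
      ext j k
      simp only [H, Matrix.of_apply, hp' _ y hy, Matrix.mul_apply, Matrix.transpose_apply,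
        Matrix.vandermonde_apply, pow_add]
    have hdet : ∀ y ∈ O, IsUnit (Matrix.vandermonde fun i => L y (i, none)).det := fun y hy =>
      isUnit_iff_ne_zero.2 (Matrix.det_vandermonde_ne_zero_iff.2 (hinj y hy))
    refine ⟨Fin n, inferInstance, fun k => k, fun k y => ∑ j, (H y)⁻¹ k j * m t j y,
      fun k => hX.sum _ _ _ fun j _ => hX.mul _ _ _ (hX.inv_apply H x (fun _ _ => hp _) ?_ _ _)
        (hm _ _), fun y hy i => ?_⟩
    · rw [hH x hx, Matrix.det_mul, Matrix.det_transpose]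
      exact mul_ne_zero (hdet x hx).ne_zero (hdet x hx).ne_zero
    · set V := Matrix.vandermonde fun i => L y (i, none)
      have h1 : (fun j : Fin n => m t j y) = V.transpose.mulVec fun i => L y (i, some t) := by
        funext j
        rw [hm' t j y hy]
        exact sum_congr rfl fun i _ => mul_comm _ _
      have h2 : V.mulVec ((H y)⁻¹.mulVec fun j : Fin n => m t j y) = fun i => L y (i, some t) := by
        rw [h1, Matrix.mulVec_mulVec, Matrix.mulVec_mulVec, hH y hy, Matrix.mul_inv_rev,
          ← mul_assoc, Matrix.mul_nonsing_inv _ (hdet y hy), one_mul,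
          Matrix.nonsing_inv_mul _ (by rw [Matrix.det_transpose]; exact hdet y hy),
          Matrix.one_mulVec]
      refine (congrFun h2 i).symm.trans ?_
      rw [Matrix.mulVec, dotProduct]
      exact sum_congr rfl fun k _ => mul_comm _ _
  have hmon : ∀ (d : Fin n × Option τ →₀ ℕ) (j : Fin n), ∃ S, 𝒳.RegAt S x ∧
      ∀ y ∈ O, S y = ∑ i, ∏ o : Option τ, L y (i, o) ^ d (j, o) := fun d j =>
    hsum (hprod _ _ fun o => hpow (hL o) _)
  choose S hS hS' using hmon
  refine ⟨fun y => ∑ d ∈ P.support, P.coeff d * ∏ j, S d j y, hX.sum _ _ _ fun d _ =>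
    hX.mul _ _ _ (hX.const _ _) (hX.prod _ _ _ fun j _ => hS d j), fun y hy => ?_⟩
  simp only [MvPolynomial.eval_eq', hS' _ _ y hy, Finset.prod_univ_sum, Fintype.piFinset_univ,
    Fintype.prod_prod_type, mul_sum]
  exact sum_comm

lemma sum_maps_eq_sum_perm {g : (Fin n → Fin n) → ℂ} (h : ∀ ι, ¬ Injective ι → g ι = 0) :
    ∑ ι, g ι = ∑ π : Perm (Fin n), g π :=
  (Fintype.sum_of_injective (fun π : Perm (Fin n) => (π : Fin n → Fin n))
    DFunLike.coe_injective _ _ (fun ι hι => h ι fun hinj =>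
      hι ⟨Equiv.ofBijective ι (Finite.injective_iff_bijective.1 hinj), rfl⟩) fun _ => rfl).symm

/-- The product of the differences of the first entries. -/
noncomputable def discPoly (n : ℕ) (τ : Type) : MvPolynomial (Fin n × Option τ) ℂ :=
  ∏ j : Fin n, ∏ k ∈ Finset.univ.erase j, (.X (j, none) - .X (k, none))

lemma eval_discPoly (L : Fin n × Option τ → ℂ) : eval L (discPoly n τ) =
    ∏ j : Fin n, ∏ k ∈ Finset.univ.erase j, (L (j, none) - L (k, none)) := by
  simp [discPoly, map_prod]

lemma eval_discPoly_eq_zero {L : Fin n × Option τ → ℂ} {ι : Fin n → Fin n}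
    (h : ¬ Injective ι) :
    eval (fun v => L (ι v.1, v.2)) (discPoly n τ) = 0 := by
  simp only [Injective, not_forall] at h
  obtain ⟨j, k, h1, h2⟩ := h
  rw [eval_discPoly]
  refine prod_eq_zero (mem_univ j) (prod_eq_zero (i := k)
    (mem_erase.2 ⟨Ne.symm h2, mem_univ _⟩) ?_)
  rw [h1, sub_self]

lemma eval_discPoly_perm (L : Fin n × Option τ → ℂ) (π : Perm (Fin n)) :
    eval (fun v => L (π v.1, v.2)) (discPoly n τ) =
      eval L (discPoly n τ) := by
  rw [eval_discPoly, eval_discPoly]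
  refine Eq.trans ?_ (Equiv.prod_comp π _)
  refine prod_congr rfl fun j _ => ?_
  rw [show Finset.univ.erase (π j) = (Finset.univ.erase j).map π.toEmbedding by
    ext l; simp [Finset.mem_map_equiv, Equiv.symm_apply_eq], Finset.prod_map]
  rfl

lemma eval_discPoly_ne_zero {L : Fin n × Option τ → ℂ}
    (h : Injective fun i => L (i, none)) : eval L (discPoly n τ) ≠ 0 := by
  rw [eval_discPoly]
  exact prod_ne_zero_iff.2 fun j _ => prod_ne_zero_iff.2 fun k hk =>
    sub_ne_zero.2 fun e => (mem_erase.1 hk).1 (h e).symm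

end Symmetric

section Labels

variable {W : Type*} [AddCommGroup W] [Module ℂ W] [Module.Finite ℂ W]

/-- Labelled data as a vector. -/
def labVec {n : ℕ} (α : Fin n → ℂ) (m : Fin n → Mat₃) :
    Fin n × Option (Fin 3 × Fin 3) → ℂ := fun v => v.2.elim (α v.1) fun t => m v.1 t.1 t.2

lemma labVec_comp {n : ℕ} (α : Fin n → ℂ) (m : Fin n → Mat₃)
    (π : Fin n → Fin n) : labVec (fun i => α (π i)) (fun i => m (π i)) =
      fun v => labVec α m (π v.1, v.2) := by
  funext v
  obtain ⟨i, _ | t⟩ := v <;> rfl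

lemma IsDiag.trace_opMat_pow {φ₁ φ₂ : QuadraticForm ℂ W}
    {w : Basis (Fin (dim W)) ℂ W} {α c : Fin (dim W) → ℂ}
    (h : IsDiag φ₁ φ₂ w α c) (k : ℕ) : (opMat φ₁ φ₂ ^ k).trace = ∑ i, α i ^ k := by
  set b := finBasis ℂ W
  have h1 : LinearMap.trace ℂ W (Matrix.toLin b b (opMat φ₁ φ₂ ^ k)) = ∑ i, α i ^ k := by
    rw [LinearMap.trace_eq_matrix_trace ℂ w, Matrix.trace]
    refine sum_congr rfl fun i _ => ?_
    rw [Matrix.diag_apply, LinearMap.toMatrix_apply]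
    have h2 := h.repr_opMat_pow (w i) k i
    rw [Basis.repr_self, Finsupp.single_eq_same, mul_one] at h2
    rw [← h2]
    congr 2
  rw [← h1, LinearMap.trace_eq_matrix_trace ℂ b, LinearMap.toMatrix_toLin]

lemma IsDiag.polar_iterate_opVec {φ₁ φ₂ : QuadraticForm ℂ W} {n : ℕ}
    {w : Basis (Fin n) ℂ W} {α c : Fin n → ℂ}
    (h : IsDiag φ₁ φ₂ w α c) (v : Fin 3 → W) (r s : Fin 3) (k : ℕ) :
    polar φ₂ (v r) ((opVec φ₁ φ₂)^[k] (v s)) =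
      2 * ∑ i, rankOne c (fun i k => w.repr (v k) i) i r s * α i ^ k := by
  have hy : ∀ i, w.repr ((opVec φ₁ φ₂)^[k] (v s)) i = α i ^ k * w.repr (v s) i := fun i => by
    induction k with
    | zero => simp
    | succ k ih => rw [Function.iterate_succ_apply', h.repr_opVec, ih]; ring
  generalize (opVec φ₁ φ₂)^[k] (v s) = y at hy
  rw [h.snd, polar_sumSq]
  congr 1
  refine sum_congr rfl fun i _ => ?_
  rw [Basis.coord_apply, Basis.coord_apply, hy, rankOne, Matrix.of_apply]
  ring

/-- A function of the labels which does not depend on the labelling is regular on the refined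
moduli space where it is regular as a function of the labels. -/
lemma refined_regAt_of_labels (hn : 2 ≤ dim W)
    {F : (Fin (dim W) × Option (Fin 3 × Fin 3) → ℂ) → ℂ} {f : RefinedModuli W → ℂ}
    (hF : ∀ y α m, IsLab y α m → f y = F (labVec α m)) {y α m} (h : IsLab y α m)
    (hreg : (zariski _).RegAt F (labVec α m)) : (refinedVar W).RegAt f y := by
  classical
  set 𝒜 := (zariski (PairAmb W)).induced (Subtype.val : PairFrame W → _) with h𝒜
  have hX : 𝒜.IsRinged := (zariski_isRinged _).induced _
  have hid : ∀ a : PairFrame W, 𝒜.RegMapAt (fun b : PairFrame W => b.1) a := fun a =>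
    (regMapAt_zariski (PairAmb W) a.1).induced (i := Subtype.val)
  have hφ : ∀ (i : Fin 2) (a : PairFrame W), 𝒜.RegMapAt (fun b : PairFrame W => b.1.1 i) a :=
    fun i a => ((hid a).map (LinearMap.fst ℂ _ _)).apply i
  have hv : ∀ (i : Fin 3) (a : PairFrame W), 𝒜.RegMapAt (fun b : PairFrame W => b.1.2 i) a :=
    fun i a => ((hid a).map (LinearMap.snd ℂ _ _)).apply i
  have key : ∀ (a : PairFrame W) (w : Basis (Fin (dim W)) ℂ W) (α c),
      IsDiag (a.1.1 0) (a.1.1 1) w α c →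
      (zariski _).RegAt F (labVec α (rankOne c fun i k => w.repr (a.1.2 k) i)) →
      ∃ (O : Set (PairFrame W)) (G : PairFrame W → ℂ), IsOpen[𝒜.top] O ∧ a ∈ O ∧ 𝒜.RegAt G a ∧
        ∀ b ∈ O, (∃ α m, IsLab (frameToRefined b) α m ∧ (zariski _).RegAt F (labVec α m)) ∧
          f (frameToRefined b) = G b := by
    rintro a w α c hd ⟨p, hp, q, hq, hqa, hpq⟩
    obtain ⟨P, hP⟩ := mem_polyFun_pi.1 hp
    obtain ⟨Q, hQ⟩ := mem_polyFun_pi.1 hq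
    set O₁ := {b : PairFrame W | ¬ IsDegenerate (b.1.1 1)}
    have hO₁ : IsOpen[𝒜.top] O₁ := by
      have := hX.isOpen_ne_zero (@isOpen_univ _ 𝒜.top) fun b _ => hX.regAt_det_gram (hφ 1 b)
      simpa only [O₁, isDegenerate_iff_det_gram, Set.mem_univ, true_and] using this
    have haO : a ∈ O₁ := hd.not_isDegenerate
    have hlab : ∀ b : PairFrame W, ∃ α' m',
        (b = a → labVec α' m' = labVec α (rankOne c fun i k => w.repr (a.1.2 k) i)) ∧
        (b ∈ O₁ → ∃ w' c', IsDiag (b.1.1 0) (b.1.1 1) w' α' c' ∧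
          m' = rankOne c' fun i k => w'.repr (b.1.2 k) i) := fun b => by
      by_cases hb : b = a
      · subst hb
        exact ⟨_, _, fun _ => rfl, fun _ => ⟨w, c, hd, rfl⟩⟩
      · by_cases hbO : b ∈ O₁
        · obtain ⟨w', α', c', hd'⟩ := exists_isDiag_frame (by omega) b.2.1 hbO
          exact ⟨α', _, fun h => (hb h).elim, fun _ => ⟨w', c', hd', rfl⟩⟩
        · exact ⟨α, 0, fun h => (hb h).elim, fun h => (hbO h).elim⟩
    choose A M hA hL using hlab
    have hsym := hX.exists_regAt_symmetric haO (fun b => labVec (A b) (M b))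
      (fun k => ⟨fun b => (opMat (b.1.1 0) (b.1.1 1) ^ k).trace, hX.sum _ _ _ fun i _ =>
        hX.pow_apply _ _ (hX.regAt_opMat (hφ 0 a) (hφ 1 a) haO) k i i, fun b hb => by
          obtain ⟨w', c', hd', -⟩ := hL b hb
          exact hd'.trace_opMat_pow k⟩)
      (fun t k => ⟨fun b => 2⁻¹ * polar (b.1.1 1) (b.1.2 t.1)
          ((opVec (b.1.1 0) (b.1.1 1))^[k] (b.1.2 t.2)),
        hX.mul _ _ _ (hX.const _ _) (hX.regAt_polar (hφ 1 a) (hv t.1 a) (by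
          induction k with
          | zero => exact hv t.2 a
          | succ k ih =>
            simp only [Function.iterate_succ_apply']
            exact hX.regMapAt_opVec (hφ 0 a) (hφ 1 a) haO ih)), fun b hb => by
          obtain ⟨w', c', hd', hm⟩ := hL b hb
          dsimp only
          rw [hd'.polar_iterate_opVec b.1.2 t.1 t.2, inv_mul_cancel_left₀ two_ne_zero, ← hm]
          rfl⟩)
      (fun b hb => by obtain ⟨w', c', hd', -⟩ := hL b hb; exact hd'.inj)
    have hv1 : eval (fun v => labVec (A a) (M a)
        ((1 : Perm (Fin (dim W))) v.1, v.2)) Q ^ 2 ≠ 0 :=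
      pow_ne_zero _ (by rw [← hQ]; exact (congrArg q (hA a rfl)).trans_ne hqa)
    obtain ⟨k, hk⟩ := exists_sum_pow_ne_zero (ι := Perm (Fin (dim W)))
      (v := fun π => eval (fun v => labVec (A a) (M a) (π v.1, v.2)) Q ^ 2) hv1
    obtain ⟨S, hS, hS'⟩ := hsym (discPoly _ _ * (Q ^ 2) ^ (k + 1))
    obtain ⟨T, hT, hT'⟩ := hsym (discPoly _ _ * (P * Q * (Q ^ 2) ^ k))
    have hinj : ∀ b ∈ O₁, Injective (A b) := fun b hb => by
      obtain ⟨w', c', hd', -⟩ := hL b hb; exact hd'.inj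
    have hlab : ∀ b ∈ O₁, ∀ ι : Fin (dim W) → Fin (dim W),
        Injective ι →
          IsLab (frameToRefined b) (fun i => A b (ι i)) fun i => M b (ι i) := fun b hb ι hι => by
      obtain ⟨w', c', hd', hm⟩ := hL b hb
      exact IsLab.perm ⟨b, w', c', rfl, hd', hm⟩
        (Equiv.ofBijective ι (Finite.injective_iff_bijective.1 hι))
    have hSa : S a ≠ 0 := by
      rw [hS' a haO, sum_maps_eq_sum_perm fun ι hι => by
        rw [map_mul, eval_discPoly_eq_zero hι, zero_mul]]
      simp only [map_mul, eval_discPoly_perm, ← mul_sum, map_pow]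
      exact mul_ne_zero (eval_discPoly_ne_zero (hinj a haO)) hk
    obtain ⟨U, hU, haU, hUS⟩ := hX.ne_zero S a hS hSa
    refine ⟨O₁ ∩ U, fun b => T b / S b, 𝒜.isOpen_inter hO₁ hU, ⟨haO, haU⟩,
      hX.div _ _ _ hT hS hSa, fun b hb => ⟨?_, ?_⟩⟩
    · have h1 := hUS b hb.2
      rw [hS' b hb.1] at h1
      obtain ⟨ι, -, hι⟩ := exists_ne_zero_of_sum_ne_zero h1
      rw [map_mul] at hι
      have hi : Injective ι := by
        by_contra hi
        exact left_ne_zero_of_mul hι (eval_discPoly_eq_zero hi)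
      refine ⟨_, _, hlab b hb.1 ι hi, p, hp, q, hq, ?_, hpq⟩
      rw [labVec_comp, hQ]
      intro h0
      exact right_ne_zero_of_mul hι (by rw [map_pow, map_pow, h0]; simp)
    · rw [eq_div_iff (hUS b hb.2), hS' b hb.1, hT' b hb.1, mul_sum]
      refine sum_congr rfl fun ι _ => ?_
      by_cases hi : Injective ι
      · simp only [map_mul, map_pow]
        by_cases h0 : eval (fun v => labVec (A b) (M b) (ι v.1, v.2)) Q = 0
        · rw [h0]; simp
        · rw [hF _ _ _ (hlab b hb.1 ι hi), labVec_comp, hpq _ (by rwa [hQ]), hP, hQ]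
          field_simp
          ring
      · rw [map_mul, map_mul, eval_discPoly_eq_zero hi, zero_mul, zero_mul, mul_zero]
  refine ((quot_regMapAt_of_local (isLocal_induced _ _)
    (S := {y | ∃ α m, IsLab y α m ∧ (zariski _).RegAt F (labVec α m)}) (f := f)
    fun a ha => ?_).2 y ⟨α, m, h, hreg⟩).regAt
  obtain ⟨α, m, ⟨a', w, c, ha', hd, rfl⟩, hF'⟩ := ha
  obtain ⟨g, k, hg, hk, T, rfl⟩ := frameToRefined_eq hn ha'.symm
  obtain ⟨O, G, hO, haO, hG, h⟩ := key _ w α c hd hF'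
  have hact := (zariski_isMorphism_linear (pairAct (W := W) g k T)).induced
    (i := Subtype.val) (k := Subtype.val) (f := pairFrameAct hn hg hk T) fun _ => rfl
  refine ⟨_, _, hact.isOpen_preimage hO, haO, hX.regMapAt (hact.2 a G hG), fun b hb => ?_⟩
  have := h _ hb
  rwa [frameToRefined_act] at this

end Labels


lemma exists_indicator_polynomial {ι κ : Type*} [Finite κ] (v : κ → ι → ℂ) (v₀ : ι → ℂ) :
    ∃ D : MvPolynomial ι ℂ, eval v₀ D = 1 ∧
      ∀ k, v k ≠ v₀ → eval (v k) D = 0 := by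
  classical
  have := Fintype.ofFinite κ
  have h : ∀ k, ∃ D : MvPolynomial ι ℂ, eval v₀ D = 1 ∧
      (v k ≠ v₀ → eval (v k) D = 0) := fun k => by
    by_cases hk : v k = v₀
    · exact ⟨1, by simp, fun h => (h hk).elim⟩
    · obtain ⟨i, hi⟩ := Function.ne_iff.1 hk
      refine ⟨.C (v₀ i - v k i)⁻¹ * (.X i - .C (v k i)), ?_, fun _ => by simp⟩
      simp [inv_mul_cancel₀ (sub_ne_zero.2 hi.symm)]
  choose D hD hD' using h
  exact ⟨∏ k, D k, by simp [map_prod, hD], fun k hk => by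
    rw [map_prod]; exact prod_eq_zero (mem_univ k) (hD' k hk)⟩

section Extension

variable {W : Type*} [AddCommGroup W] [Module ℂ W] [Module.Finite ℂ W]

lemma exists_torus_of_kap_eq (hn : 4 ≤ dim W) (μ : Marking (dim W))
    {α : Fin (dim W) → ℂ} (hα : Injective α)
    {π : Perm (Fin (dim W))} (hπ : kap μ (fun i => α (π i)) = kap μ α)
    (c : Torus μ.o) : ∃ c' : Torus μ.o,
      normalClass hn (torusParam hα c) = normalClass hn (torusParam hα c') ∧
      ∀ i, wgt μ (fun i => α (π i)) (fun i => rankOne c.1 (vanVec α) (π i)) i / wgtOne μ α i =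
        c'.1 i := by
  obtain ⟨g, hg, h⟩ := exists_mob_of_kap_eq μ (hα.comp π.injective) hα fun i _ _ _ => congrFun hπ i
  have hd : ∀ i, mobDen g (α (π i)) ≠ 0 := fun i => (h i).1
  have hm : (fun i => mob g (α (π i))) = α := funext fun i => (h i).2
  have h0 : ∀ i, mobDen g (α (π i)) ^ 5 * c.1 (π i) ≠ 0 := fun i =>
    mul_ne_zero (pow_ne_zero _ (hd i)) (c.2.1 _)
  refine ⟨⟨fun i => (mobDen g (α (π μ.o)) ^ 5 * c.1 (π μ.o))⁻¹ *
    (mobDen g (α (π i)) ^ 5 * c.1 (π i)), fun i => mul_ne_zero (inv_ne_zero (h0 _)) (h0 i),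
      inv_mul_cancel₀ (h0 _)⟩, (normalClass_eq_iff hn _ _).2
        ⟨π, g, _, hg, inv_ne_zero (h0 μ.o), hd, hm.symm, rfl⟩, fun i => ?_⟩
  have h1 := wgt_normal μ (hα.comp π.injective) (fun i => c.2.1 (π i)) i
  have h2 := wgtOne_mob μ (hα.comp π.injective) hg hd i
  have h3 := wgtOne_ne_zero μ hα i
  have h4 := h0 μ.o
  have h5 := hd i
  rw [show (fun i => mob g ((α ∘ π) i)) = α from hm] at h2
  rw [show (fun i => rankOne c.1 (vanVec α) (π i)) =
    rankOne (fun i => c.1 (π i)) (vanVec (α ∘ π)) from rfl]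
  change wgt μ (α ∘ π) _ i / _ = _
  have h6 := hd μ.o
  have h7 := c.2.1 (π μ.o)
  rw [h1, div_eq_iff h3, div_mul_eq_mul_div, div_eq_iff h7]
  field_simp
  simp only [Function.comp] at h2 ⊢
  linear_combination -c.1 (π i) * h2

/-- Every invariant function on the torus extends to a function on the refined moduli space which
is regular along the normal forms. -/
lemma exists_extension (hn : 4 ≤ dim W) (μ : Marking (dim W))
    {α : Fin (dim W) → ℂ} (hα : Injective α)
    (s : Inv (twistGroup μ.o α)) : ∃ f : RefinedModuli W → ℂ, ∀ c : Torus μ.o,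
      f (normalClass hn (torusParam hα c)) = torusEv c s ∧
        (refinedVar W).RegAt f (normalClass hn (torusParam hα c)) := by
  classical
  obtain ⟨P, k, hP⟩ := torusRing_repr (s : torusRing μ.o)
  obtain ⟨D, hD, hD'⟩ := exists_indicator_polynomial
    (fun π : Perm (Fin (dim W)) => kap μ fun i => α (π i)) (kap μ α)
  set G : (Fin (dim W) → ℂ) → (Fin (dim W) → Mat₃) →
      ℂ := fun β m => eval (kap μ β) D *
    (eval (fun i : {i // i ≠ μ.o} => wgt μ β m i / wgtOne μ α i) P *
      ((∏ i, wgt μ β m i / wgtOne μ α i) ^ k)⁻¹) with hG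
  set N := (Finset.univ.filter fun π : Perm (Fin (dim W)) =>
    kap μ (fun i => α (π i)) = kap μ α).card with hN
  set F : (Fin (dim W) × Option (Fin 3 × Fin 3) → ℂ) → ℂ := fun L =>
    (N : ℂ)⁻¹ * ∑ π : Perm (Fin (dim W)),
      G (fun i => L (π i, none)) fun i => Matrix.of fun r t => L (π i, some (r, t)) with hF
  have hinv : ∀ (y : RefinedModuli W) (β m β' m'), IsLab y β m → IsLab y β' m' →
      F (labVec β m) = F (labVec β' m') := by
    intro y β m β' m' h h'
    obtain ⟨σ, g, l, c, z, hg, hl, hd, rfl, hm, rfl⟩ := h.unique (by omega) h'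
    rw [hF]
    dsimp only
    rw [← Equiv.sum_comp (Equiv.mulLeft σ)]
    congr 1
    refine sum_congr rfl fun π _ => ?_
    have h1 : (fun i => m (σ (π i))) = rankOne (fun i => c (π i)) fun i => z (π i) :=
      funext fun i => congrFun hm (π i)
    have h2 := kap_mob μ (fun i => β (σ (π i))) hg fun i => hd (π i)
    have h3 := fun i => (wgt_mob μ (fun i => β (σ (π i))) (fun i => c (π i)) (fun i => z (π i)) hg
      (fun i => hd (π i)) hl i).2
    change G (fun i => β (σ (π i))) (fun i => m (σ (π i))) =
      G (fun i => mob g (β (σ (π i)))) (rankOne (fun i => mobDen g (β (σ (π i))) * c (π i))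
        fun i => l.mulVec (z (π i)))
    rw [hG]
    dsimp only
    simp only [h1, h2, h3]
  set f : RefinedModuli W → ℂ := fun y =>
    if h : ∃ L, ∃ β m, IsLab y β m ∧ L = labVec β m then F h.choose else 0
  have hf : ∀ y β m, IsLab y β m → f y = F (labVec β m) := fun y β m h => by
    have h' : ∃ L, ∃ β m, IsLab y β m ∧ L = labVec β m := ⟨_, β, m, h, rfl⟩
    obtain ⟨β', m', h1, h2⟩ := h'.choose_spec
    simp only [f, dif_pos h', h2]
    exact hinv y _ _ _ _ h1 h
  refine ⟨f, fun c => ?_⟩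
  have hl := isLab_normalClass hn (torusParam hα c)
  constructor
  · rw [hf _ _ _ hl]
    have hN0 : (N : ℂ) ≠ 0 := Nat.cast_ne_zero.2
      (Finset.card_ne_zero_of_mem (Finset.mem_filter.2 ⟨mem_univ 1, rfl⟩))
    rw [hF]
    dsimp only
    rw [inv_mul_eq_iff_eq_mul₀ hN0, hN, Finset.card_eq_sum_ones, Nat.cast_sum, Finset.sum_mul,
      sum_filter]
    refine sum_congr rfl fun π _ => ?_
    change G (fun i => α (π i)) (fun i => rankOne c.1 (vanVec α) (π i)) = _
    rw [hG]
    dsimp only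
    split_ifs with h
    · obtain ⟨c', hc, hw⟩ := exists_torus_of_kap_eq hn μ hα h c
      obtain ⟨σ, hσ, hs⟩ := (normalClass_torus_iff hn hα c c').1 hc
      have h2 := hs s
      rw [mem_inv.1 s.2 σ hσ] at h2
      rw [h, hD, ← h2]
      simp only [hw, ← hP c']
      rw [mul_inv_cancel_right₀
        (pow_ne_zero _ (prod_ne_zero_iff.2 fun i _ => c'.2.1 i))]
      simp [torusEv]
    · rw [hD' π h, zero_mul]
  · refine refined_regAt_of_labels (by omega) hf hl ?_
    set 𝒵 := zariski (Fin (dim W) × Option (Fin 3 × Fin 3) → ℂ)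
    have hX : 𝒵.IsRinged := zariski_isRinged _
    have hL : ∀ v, 𝒵.RegAt (fun L => L v) (labVec α (rankOne c.1 (vanVec α))) := fun v =>
      ((regMapAt_zariski _ _).apply v).regAt
    refine hX.mul _ _ _ (hX.const _ _) (hX.sum _ _ _ fun π _ => ?_)
    have hi : Injective fun i => α (π i) := hα.comp π.injective
    have hA : ∀ i, 𝒵.RegAt (fun L => L (π i, none)) (labVec α (rankOne c.1 (vanVec α))) :=
      fun i => hL _
    have hw : ∀ i, 𝒵.RegAt (fun L => wgt μ (fun i => L (π i, none))
        (fun i => Matrix.of fun r t => L (π i, some (r, t))) i / wgtOne μ α i)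
        (labVec α (rankOne c.1 (vanVec α))) := fun i =>
      hX.div _ (fun _ => wgtOne μ α i) _ (hX.regAt_wgt μ hA (fun i r t => hL _) i
        (wgtDen_normal μ hi (fun i => c.2.1 (π i)) i)) (hX.const _ _) (wgtOne_ne_zero μ hα i)
    have hk : ∀ i, 𝒵.RegAt (fun L => kap μ (fun i => L (π i, none)) i)
        (labVec α (rankOne c.1 (vanVec α))) := fun i => by
      by_cases hq : i = μ.q
      · subst hq
        simpa [kap] using hX.const 0 _
      · exact hX.regAt_kap μ hA hi hq
    have hw0 : ∀ i, wgt μ (fun i => α (π i)) (rankOne (fun i => c.1 (π i))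
        (vanVec fun i => α (π i))) i / wgtOne μ α i ≠ 0 := fun i => by
      rw [wgt_normal μ hi (fun i => c.2.1 (π i)) i]
      exact div_ne_zero (mul_ne_zero (div_ne_zero (c.2.1 _) (c.2.1 _)) (wgtOne_ne_zero μ hi i))
        (wgtOne_ne_zero μ hα i)
    exact hX.mul _ _ _ (hX.mvPolynomial _ _ hk D) (hX.mul _ _ _
      (hX.mvPolynomial (ι := {i // i ≠ μ.o}) _ _ (fun i => hw i.1) P)
      (hX.inv _ _ (hX.pow _ _ (hX.prod Finset.univ _ _ fun i _ => hw i) k)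
        (pow_ne_zero _ (prod_ne_zero_iff.2 fun i _ => hw0 i))))

end Extension


lemma isLocal_zariski (E : Type*) [AddCommGroup E] [Module ℂ E] : (zariski E).IsLocal := by
  rintro f g x U hU hx hfg ⟨p, hp, q, hq, hqx, hf⟩
  obtain ⟨r, hr, hrx, hrU⟩ := zariski_basis hU hx
  refine ⟨p * r, mul_mem hp hr, q * r, mul_mem hq hr, mul_ne_zero hqx hrx, fun y hy => ?_⟩
  have h := right_ne_zero_of_mul hy
  rw [hfg y (hrU y h), hf y (left_ne_zero_of_mul hy)]
  exact (mul_div_mul_right _ _ h).symm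

section AffineChart

variable {d : ℕ}

lemma cons_one_ne_zero (v : Fin d → ℂ) : (Fin.cons 1 v : Fin (d + 1) → ℂ) ≠ 0 := fun h =>
  one_ne_zero (congrFun h 0)

/-- The standard affine chart of projective space. -/
noncomputable def affineChart (v : Fin d → ℂ) : Projectivization ℂ (Fin (d + 1) → ℂ) :=
  Projectivization.mk ℂ (Fin.cons 1 v) (cons_one_ne_zero v)

/-- The affine coordinates on projective space. -/
noncomputable def affineCoord (ℓ : Projectivization ℂ (Fin (d + 1) → ℂ)) : Fin d → ℂ :=
  fun i => ℓ.rep i.succ / ℓ.rep 0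

lemma affineCoord_mk {v : Fin (d + 1) → ℂ} (hv : v ≠ 0) (h0 : v 0 ≠ 0) :
    (Projectivization.mk ℂ v hv).rep 0 ≠ 0 ∧
      affineCoord (Projectivization.mk ℂ v hv) = fun i => v i.succ / v 0 := by
  obtain ⟨a, ha⟩ := Projectivization.exists_smul_eq_mk_rep ℂ v hv
  have ha0 : (a : ℂ) ≠ 0 := a.ne_zero
  refine ⟨by rw [← ha]; exact mul_ne_zero ha0 h0, funext fun i => ?_⟩
  rw [affineCoord, ← ha]
  exact mul_div_mul_left _ _ ha0

lemma affineCoord_affineChart (v : Fin d → ℂ) :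
    (affineChart v).rep 0 ≠ 0 ∧ affineCoord (affineChart v) = v := by
  obtain ⟨h1, h2⟩ := affineCoord_mk (cons_one_ne_zero v) one_ne_zero
  exact ⟨h1, h2.trans (funext fun i => div_one _)⟩

lemma affineChart_div {v : Fin (d + 1) → ℂ} (hv : v ≠ 0) (h0 : v 0 ≠ 0) :
    affineChart (fun i => v i.succ / v 0) = Projectivization.mk ℂ v hv := by
  refine (Projectivization.mk_eq_mk_iff' ℂ _ _ _ _).2 ⟨(v 0)⁻¹, funext fun i => ?_⟩
  refine Fin.cases ?_ (fun i => ?_) i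
  · exact inv_mul_cancel₀ h0
  · exact inv_mul_eq_div _ _

lemma affineCoord_regMapAt :
    IsOpen[(projVariety (d + 1)).top] {ℓ | ℓ.rep 0 ≠ 0} ∧ ∀ ℓ ∈ {ℓ | ℓ.rep 0 ≠ 0},
      (projVariety (d + 1)).RegMapAt affineCoord ℓ := by
  refine quot_regMapAt_of_local (isLocal_induced _ _) fun a ha => ?_
  set 𝒜 := (zariski (Fin (d + 1) → ℂ)).induced
    (Subtype.val : {v : Fin (d + 1) → ℂ // v ≠ 0} → _) with h𝒜
  have hX : 𝒜.IsRinged := (zariski_isRinged _).induced _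
  have hreg : ∀ (i : Fin (d + 1)) a, 𝒜.RegAt (fun b => b.1 i) a := fun i a =>
    (((regMapAt_zariski (Fin (d + 1) → ℂ) a.1).induced (i := Subtype.val)).apply i).regAt
  have h0 : a.1 0 ≠ 0 := by
    obtain ⟨r, hr⟩ := Projectivization.exists_smul_eq_mk_rep ℂ a.1 a.2
    change (Projectivization.mk ℂ a.1 a.2).rep 0 ≠ 0 at ha
    rw [← hr] at ha
    exact right_ne_zero_of_mul ha
  exact ⟨_, fun b i => b.1 i.succ / b.1 0,
    hX.isOpen_ne_zero (@isOpen_univ _ 𝒜.top) fun b _ => hreg 0 b, ⟨trivial, h0⟩,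
    hX.regMapAt_pi fun i => hX.regMapAt (hX.div _ _ _ (hreg i.succ a) (hreg 0 a) h0),
    fun b hb => affineCoord_mk b.2 hb.2⟩

lemma isMorphism_affineChart :
    IsMorphism (zariski (Fin d → ℂ)) (projVariety (d + 1)) affineChart := by
  have hX := zariski_isRinged (Fin d → ℂ)
  refine (isMorphism_mk _ _).comp (Refines.isMorphism (isLocal_zariski _)
    (Refines.to_induced (k := Subtype.val)
      (j := fun v : Fin d → ℂ => ⟨Fin.cons 1 v, cons_one_ne_zero v⟩)
      (Refines.zariski_of hX (fun v => Fin.cons 1 v) (fun _ => rfl) fun v =>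
        hX.regMapAt_pi fun i => hX.regMapAt ?_)))
  refine Fin.cases ?_ (fun i => ?_) i
  · exact hX.const 1 _
  · exact ((regMapAt_zariski _ v).apply i).regAt

lemma exists_eval_ne_zero {ι : Type*} {P : MvPolynomial ι ℂ} (hP : P ≠ 0) :
    ∃ v, eval v P ≠ 0 := by
  by_contra! h
  exact hP (MvPolynomial.funext fun v => by rw [h, map_zero])

lemma dense_affineCoord {B : MvPolynomial (Fin d) ℂ} (hB : B ≠ 0) :
    @Dense _ (projVariety (d + 1)).top
      {ℓ | ℓ.rep 0 ≠ 0 ∧ eval (affineCoord ℓ) B ≠ 0} := by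
  let _ := (projVariety (d + 1)).top
  rw [dense_iff_inter_open]
  rintro O ⟨O', hO', hOO'⟩ ⟨ℓ, hℓ⟩
  have hmem : ∀ v (hv : v ≠ 0), v ∈ O' ↔ Projectivization.mk ℂ v hv ∈ O := fun v hv =>
    Set.ext_iff.1 hOO' ⟨v, hv⟩
  rw [← ℓ.mk_rep, ← hmem] at hℓ
  obtain ⟨p, hp, hpx, hpO⟩ := zariski_basis hO' hℓ
  obtain ⟨P, hP⟩ := mem_polyFun_pi.1 hp
  have hP0 : P ≠ 0 := by rintro rfl; exact hpx (by rw [hP, map_zero])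
  obtain ⟨v, hv⟩ := exists_eval_ne_zero (mul_ne_zero hP0 (MvPolynomial.X_ne_zero (0 : Fin (d + 1))))
  rw [map_mul, MvPolynomial.eval_X] at hv
  have h0 := right_ne_zero_of_mul hv
  set Q : MvPolynomial (Fin d) ℂ := aeval (Fin.cons (.C (v 0))
    fun i => .C (v 0) * .X i : Fin (d + 1) → MvPolynomial (Fin d) ℂ) P
  have hQ : ∀ w, eval w Q =
      eval (Fin.cons (v 0) fun i => v 0 * w i) P := fun w => by
    rw [← MvPolynomial.coe_aeval_eq_eval w, RingHom.coe_coe, MvPolynomial.comp_aeval_apply,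
      ← MvPolynomial.coe_aeval_eq_eval, RingHom.coe_coe]
    congr 2
    funext i
    refine Fin.cases ?_ (fun i => ?_) i <;> simp
  have hQ0 : Q ≠ 0 := by
    intro h
    have := hQ fun i => v i.succ / v 0
    rw [h, map_zero] at this
    refine left_ne_zero_of_mul hv (Eq.trans ?_ this.symm)
    congr 2
    funext i
    refine Fin.cases rfl (fun i => ?_) i
    rw [Fin.cons_succ, mul_div_cancel₀ _ h0]
  obtain ⟨w, hw⟩ := exists_eval_ne_zero (mul_ne_zero hQ0 hB)
  rw [map_mul, hQ, ← hP] at hw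
  have hu : (Fin.cons (v 0) fun i => v 0 * w i : Fin (d + 1) → ℂ) ≠ 0 := fun h => h0 (congrFun h 0)
  obtain ⟨h1, h2⟩ := affineCoord_mk hu h0
  refine ⟨_, (hmem _ hu).1 (hpO _ (left_ne_zero_of_mul hw)), h1, ?_⟩
  rw [h2]
  simpa [mul_div_cancel_left₀ _ h0] using right_ne_zero_of_mul hw

/-- A space with a dense open subset isomorphic to a principal open subset of an affine space is
rational. -/
lemma FunSpace.birational_projVariety {Y : Type*} {𝒬 : FunSpace Y} {U : Set Y}
    (hU : IsOpen[𝒬.top] U) (hd : @Dense Y 𝒬.top U) {z : U → Fin d → ℂ}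
    (hz : Injective z) {B : MvPolynomial (Fin d) ℂ} (hB : B ≠ 0)
    (hr : ∀ v, v ∈ range z ↔ eval v B ≠ 0)
    (hs : 𝒬.restrict U = (zariski _).induced z) : 𝒬.Birational (projVariety (d + 1)) := by
  obtain ⟨hS, hR⟩ := affineCoord_regMapAt (d := d)
  have hP : (projVariety (d + 1)).IsRinged := ((zariski_isRinged _).induced _).quot _
  refine ⟨U, {ℓ | ℓ.rep 0 ≠ 0 ∧ eval (affineCoord ℓ) B ≠ 0}, hU, hd,
    hP.isOpen_ne_zero hS fun ℓ hℓ => hP.mvPolynomial (fun i ℓ => affineCoord ℓ i) _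
      (fun i => ((hR ℓ hℓ).apply i).regAt) B, dense_affineCoord hB, ?_⟩
  have hc : ∀ v : Fin d → ℂ, affineCoord (affineChart v) = v := fun v => (affineCoord_affineChart v).2
  refine ⟨Equiv.ofBijective (fun u => ⟨affineChart (z u), (affineCoord_affineChart _).1, ?_⟩)
    ⟨fun u u' h => hz ?_, ?_⟩, ?_⟩
  · rw [hc]; exact (hr _).1 ⟨u, rfl⟩
  · rw [← hc (z u), ← hc (z u')]
    exact congrArg affineCoord (congrArg Subtype.val h)
  · rintro ⟨ℓ, h0, hℓ⟩
    obtain ⟨u, hu⟩ := (hr _).2 hℓ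
    refine ⟨u, Subtype.ext ?_⟩
    change affineChart (z u) = ℓ
    rw [hu]
    exact (affineChart_div ℓ.rep_nonzero h0).trans ℓ.mk_rep
  · rw [hs, restrict, induced_induced]
    exact induced_eq (Refines.of_isMorphism isMorphism_affineChart fun _ => rfl)
      (Refines.zariski_of hP affineCoord (fun u => hc (z u))
        fun u => hR _ (affineCoord_affineChart _).1)

end AffineChart


section TorusQuotient

variable {n : ℕ} {o : Fin n} {G : Subgroup (torusRing o ≃ₐ[ℂ] torusRing o)} {Y : Type*}
  {q : Torus o → Y}

/-- A function on the quotient of the torus that pulls back to a fraction is a fraction of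
invariants. -/
lemma exists_invariant_fraction [Finite G]
    (hq : ∀ c c', q c = q c' ↔ ∃ σ ∈ G, ∀ s, torusEv c' s = torusEv c (σ s)) (g : Y → ℂ)
    {a b : torusRing o} (h : ∀ c, g (q c) * torusEv c b = torusEv c a) {c₀ : Torus o}
    (hc₀ : torusEv c₀ b ≠ 0) : ∃ t A : Inv G, torusEv c₀ t ≠ 0 ∧
      ∀ c, g (q c) * torusEv c t = torusEv c A ∧
        (torusEv c t ≠ 0 → ∃ c', q c' = q c ∧ torusEv c' b ≠ 0) := by
  have := Fintype.ofFinite G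
  obtain ⟨k, hk⟩ := exists_sum_pow_ne_zero (ι := G) (i := 1) (v := fun σ => torusEv c₀ (σ.1 b)) hc₀
  have hinv : ∀ F : (torusRing o ≃ₐ[ℂ] torusRing o) → torusRing o,
      (∀ σ τ : torusRing o ≃ₐ[ℂ] torusRing o, τ (F σ) = F (τ * σ)) →
      ∑ σ : G, F σ.1 ∈ Inv G := fun F hF => mem_inv.2 fun τ hτ => by
    rw [map_sum]
    exact Fintype.sum_equiv (Equiv.mulLeft ⟨τ, hτ⟩) _ _ fun σ => hF _ _
  have hσ : ∀ (c : Torus o) (σ : G), ∃ c', q c' = q c ∧ ∀ s, torusEv c' s = torusEv c (σ.1 s) :=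
    fun c σ => by
      obtain ⟨c', hc'⟩ := exists_torusEv ((torusEv c).comp σ.1.toAlgHom)
      have h1 : ∀ s, torusEv c' s = torusEv c (σ.1 s) := fun s => (DFunLike.congr_fun hc' s).symm
      exact ⟨c', ((hq c c').2 ⟨σ.1, σ.2, h1⟩).symm, h1⟩
  refine ⟨⟨_, hinv (fun σ => σ b ^ (k + 1)) fun σ τ => map_pow _ _ _⟩,
    ⟨_, hinv (fun σ => σ a * σ b ^ k) fun σ τ => by rw [map_mul, map_pow]; rfl⟩, ?_, fun c => ⟨?_,
      fun hc => ?_⟩⟩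
  · simpa only [map_sum, map_pow] using hk
  · simp only [map_sum, map_mul, map_pow, mul_sum]
    refine sum_congr rfl fun σ _ => ?_
    obtain ⟨c', hc', hs⟩ := hσ c σ
    rw [← hs, ← hs, ← h c', hc']
    ring
  · simp only [map_sum, map_pow] at hc
    obtain ⟨σ, -, h1⟩ := exists_ne_zero_of_sum_ne_zero hc
    obtain ⟨c', hc', hs⟩ := hσ c σ
    exact ⟨c', hc', by rw [hs]; exact pow_ne_zero_iff (Nat.succ_ne_zero k) |>.1 h1⟩

lemma exists_torusEv_ne_zero {s : torusRing o} (hs : s ≠ 0) : ∃ c, torusEv c s ≠ 0 := by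
  by_contra! h
  exact hs (Subtype.ext (funext h))

lemma exists_torusEv_eq_polyFun {p : (Fin n → ℂ) → ℂ} (hp : p ∈ polyFun (Fin n → ℂ)) :
    ∃ s : torusRing o, ∀ c, torusEv c s = p c.1 := by
  obtain ⟨P, hP⟩ := mem_polyFun_pi.1 hp
  exact ⟨aeval (torusX o) P, fun c => by rw [torusEv_aeval, hP]; rfl⟩

/-- The quotients of the torus by the group of twisted permutations are rational. -/
lemma birational_torus_quotient (μ : Marking n) (hn : 4 ≤ n)
    {α : Fin n → ℂ} (hα : Injective α) {𝒬 : FunSpace Y} (hX : 𝒬.IsRinged)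
    {q : Torus μ.o → Y} (hsurj : Function.Surjective q)
    (hq : ∀ c c', q c = q c' ↔ ∃ σ ∈ twistGroup μ.o α, ∀ s, torusEv c' s = torusEv c (σ s))
    (hext : ∀ s : Inv (twistGroup μ.o α), ∃ f : Y → ℂ, ∀ c,
      f (q c) = torusEv c s ∧ 𝒬.RegAt f (q c))
    (hmor : IsMorphism ((zariski (Fin n → ℂ)).induced
      (Subtype.val : Torus μ.o → _)) 𝒬 q) : 𝒬.Birational (projVariety n) := by
  obtain ⟨d, rfl⟩ : ∃ d, n = d + 1 := ⟨n - 1, by omega⟩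
  have := twistGroup_finite μ hα
  obtain ⟨E, N, B, hE, hB, hEB, hν, hψ⟩ := exists_torus_quotient μ hn hα
  choose f hf hreg using fun s => hext s
  replace hreg : ∀ s y, 𝒬.RegAt (f s) y := fun s y => by
    obtain ⟨c, rfl⟩ := hsurj y; exact hreg s c
  choose ν k hν using hν
  set ψ : Torus μ.o → Inv (twistGroup μ.o α) →ₐ[ℂ] ℂ := fun c => (torusEv c).comp (Subalgebra.val _)
  set U : Set Y := {y | y ∈ Set.univ ∧ f E y ≠ 0} with hU
  let z : Y → Fin d → ℂ := fun y i => f (N i) y / f E y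
  have hz : ∀ c, z (q c) = fun i => ψ c (N i) / ψ c E := fun c => funext fun i => by
    simp only [z, hf]; rfl
  have hUc : ∀ c, q c ∈ U → ψ c E ≠ 0 := fun c hc => (hf E c) ▸ hc.2
  have hBz : ∀ c, q c ∈ U → eval (z (q c)) B ≠ 0 := fun c hc => by
    rw [hz]; exact hEB _ (hUc c hc)
  have hνz : ∀ c, q c ∈ U → ∀ s : Inv (twistGroup μ.o α), torusEv c s * eval (z (q c)) B ^ k s =
      eval (z (q c)) (ν s) := fun c hc s => by
    rw [hz]; exact hν s _ (hUc c hc)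
  have hopen : ∀ V, IsOpen[𝒬.top] V → ∀ c₀, q c₀ ∈ V → ∃ s : torusRing μ.o, torusEv c₀ s ≠ 0 ∧
      ∀ c, torusEv c s ≠ 0 → q c ∈ V := fun V hV c₀ hc₀ => by
    obtain ⟨O, hO, hOV⟩ := hmor.isOpen_preimage hV
    obtain ⟨p, hp, hpc, hpO⟩ := zariski_basis hO (x := c₀.1)
      ((Set.ext_iff.1 hOV c₀).2 hc₀)
    obtain ⟨s, hs⟩ := exists_torusEv_eq_polyFun (o := μ.o) hp
    exact ⟨s, by rwa [hs], fun c hc => (Set.ext_iff.1 hOV c).1 (hpO _ (by rwa [← hs]))⟩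
  refine birational_projVariety (U := U) (z := fun u => z u) (B := B)
    (hX.isOpen_ne_zero (@isOpen_univ _ 𝒬.top) fun y _ => hreg E y) ?_ ?_ hB (fun v => ⟨?_, ?_⟩)
    (induced_eq (Refines.zariski_of hX z (fun _ => rfl) fun u =>
      hX.regMapAt_pi fun i => hX.regMapAt (hX.div _ _ _ (hreg _ _) (hreg _ _) u.2.2)) ⟨?_, ?_⟩)
  · let _ := 𝒬.top
    rw [dense_iff_inter_open]
    rintro V hV ⟨y, hy⟩
    obtain ⟨c₀, rfl⟩ := hsurj y
    obtain ⟨s, hs, hsV⟩ := hopen V hV c₀ hy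
    have hs0 : s ≠ 0 := by rintro rfl; exact hs (map_zero _)
    have hE0 : (E : torusRing μ.o) ≠ 0 := fun h => hE (Subtype.ext h)
    obtain ⟨c, hc⟩ := exists_torusEv_ne_zero (mul_ne_zero hs0 hE0)
    rw [map_mul] at hc
    exact ⟨q c, hsV c (left_ne_zero_of_mul hc), trivial, by
      rw [hf]; exact right_ne_zero_of_mul hc⟩
  · rintro ⟨y, hy⟩ ⟨y', hy'⟩ h
    obtain ⟨c, rfl⟩ := hsurj y
    obtain ⟨c', rfl⟩ := hsurj y'
    refine Subtype.ext ((hq c c').2 (exists_comp_of_eq_on_inv fun s hs => ?_))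
    have h1 := hνz c hy ⟨s, hs⟩
    have h2 := hνz c' hy' ⟨s, hs⟩
    have h3 : z (q c) = z (q c') := h
    rw [← h3, ← h1] at h2
    exact (mul_right_cancel₀ (pow_ne_zero _ (hBz c hy)) h2).symm
  · rintro ⟨⟨y, hy⟩, rfl⟩
    obtain ⟨c, rfl⟩ := hsurj y
    exact hBz c hy
  · intro hv
    obtain ⟨χ, hχ, hχN⟩ := hψ v hv
    obtain ⟨φ, hφ⟩ := exists_extends_inv χ
    obtain ⟨c, rfl⟩ := exists_torusEv φ
    refine ⟨⟨q c, trivial, by rw [hf, hφ]; exact hχ⟩, ?_⟩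
    refine (hz c).trans (funext fun i => Eq.trans ?_ (hχN i))
    rw [← hφ, ← hφ]; rfl
  · rintro V hV ⟨y, hy⟩ hyV
    obtain ⟨c₀, rfl⟩ := hsurj y
    obtain ⟨s, hs, hsV⟩ := hopen V hV c₀ hyV
    obtain ⟨t, A, ht, htA⟩ := exists_invariant_fraction hq (fun _ => 1) (a := s) (b := s)
      (fun c => one_mul _) hs
    refine ⟨_, isOpen_zariski_ne_zero (mem_polyFun_pi.2 ⟨ν t, fun _ => rfl⟩), ?_, ?_⟩
    · exact (hνz c₀ hy t).symm.trans_ne (mul_ne_zero ht (pow_ne_zero _ (hBz c₀ hy)))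
    · rintro ⟨y, hy⟩ hyO
      obtain ⟨c, rfl⟩ := hsurj y
      obtain ⟨c', hc', hs'⟩ := (htA c).2 (left_ne_zero_of_mul ((hνz c hy t).trans_ne hyO))
      have h1 := hsV c' hs'
      rwa [hc'] at h1
  · rintro ⟨y, hy⟩ g hg
    obtain ⟨c₀, rfl⟩ := hsurj y
    obtain ⟨F, ⟨p, hp, r, hr, hrc, hF⟩, O, hO, hcO, hgF⟩ := hmor.2 c₀ g hg
    obtain ⟨e, he, hec, heO⟩ := zariski_basis hO hcO
    obtain ⟨p, hp⟩ := exists_torusEv_eq_polyFun (o := μ.o) hp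
    obtain ⟨r, hr⟩ := exists_torusEv_eq_polyFun (o := μ.o) hr
    obtain ⟨e, he⟩ := exists_torusEv_eq_polyFun (o := μ.o) he
    have hgc : ∀ c, g (q c) * torusEv c ((r * e) * (r * e)) = torusEv c ((p * e) * (r * e)) :=
      fun c => by
        simp only [map_mul]
        by_cases h0 : torusEv c r * torusEv c e = 0
        · simp [h0]
        · have h1 := left_ne_zero_of_mul h0
          have h2 : g (q c) = _ := hgF c (heO _ (by rw [← he]; exact right_ne_zero_of_mul h0))
          rw [h2, hF _ (by rwa [← hr]), ← hp, ← hr]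
          field_simp
    obtain ⟨t, A, ht, htA⟩ := exists_invariant_fraction hq g hgc (c₀ := c₀) (by
      rw [map_mul, map_mul, hr, he]
      exact mul_ne_zero (mul_ne_zero hrc hec) (mul_ne_zero hrc hec))
    have h𝒵 := zariski_isRinged (Fin d → ℂ)
    have hP : ∀ P v, (zariski (Fin d → ℂ)).RegAt (fun v => eval v P) v := fun P v =>
      zariski_regAt_of_mem (mem_polyFun_pi.2 ⟨P, fun _ => rfl⟩) v
    have hνt : ∀ c, q c ∈ U → torusEv c t ≠ 0 →
        eval (z (q c)) (ν t * B ^ k A) ≠ 0 := fun c hc h => by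
      rw [map_mul, map_pow, ← hνz c hc t]
      exact mul_ne_zero (mul_ne_zero h (pow_ne_zero _ (hBz c hc))) (pow_ne_zero _ (hBz c hc))
    refine ⟨_, h𝒵.div _ _ _ (hP (ν A * B ^ k t) _) (hP (ν t * B ^ k A) _) (hνt c₀ hy ht), _,
      isOpen_zariski_ne_zero (mem_polyFun_pi.2 ⟨ν t * B ^ k A, fun _ => rfl⟩), hνt c₀ hy ht, ?_⟩
    rintro ⟨y, hy⟩ hyO
    obtain ⟨c, rfl⟩ := hsurj y
    refine (eq_div_iff hyO).2 ?_
    change g (q c) * eval (z (q c)) _ = eval (z (q c)) _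
    rw [map_mul, map_mul, map_pow, map_pow, ← hνz c hy t, ← hνz c hy A, ← (htA c).1]
    ring

end TorusQuotient


variable {W : Type*} [AddCommGroup W] [Module ℂ W] [Module.Finite ℂ W]

lemma exists_isLabM (hn : 2 ≤ dim W) (m : Moduli W) : ∃ α, IsLabM m α := by
  obtain ⟨a, rfl⟩ := frameToModuli_surjective m
  obtain ⟨g, hg, hnd⟩ := exists_nondegenerate_mix a.2
  obtain ⟨w, α, c, hd⟩ := exists_isDiag_frame (by omega) ((isNonsingular_frame_mix hg).2 a.2) hnd
  exact ⟨α, isLabM_of_diag hn a hg hd⟩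

lemma birational_fiber (hn : 4 ≤ dim W) (m : Moduli W) :
    Birational ((corrVar W).restrict (p₁ ⁻¹' {m})) (projVariety (dim W)) := by
  obtain ⟨α, hm⟩ := exists_isLabM (by omega) m
  obtain ⟨μ⟩ := exists_marking hn
  have hα := hm.inj
  have hpt : ∀ c : Torus μ.o, ∃ x : p₁ (W := W) ⁻¹' {m},
      p₂ x.1 = normalClass hn (torusParam hα c) := fun c =>
    ⟨⟨frameToCorr ⟨_, isPoised_normalFrame hn (torusParam hα c)⟩, by
      rw [Set.mem_preimage, ← forget_p₂]
      exact forget_normalClass_eq hn (torusParam hα c) hm⟩, rfl⟩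
  choose q hq using hpt
  have hsurj : Function.Surjective q := fun x => by
    obtain ⟨p, hp, he⟩ := exists_normalClass_of_forget hn x.1 (x.2.symm ▸ hm)
    refine ⟨⟨fun i => (p.1.2 μ.o)⁻¹ * p.1.2 i, fun i => mul_ne_zero (inv_ne_zero (p.2.2 _)) (p.2.2 i),
      inv_mul_cancel₀ (p.2.2 _)⟩, Subtype.ext (p₂_injective ?_)⟩
    rw [hq, he, normalClass_smul hn p (inv_ne_zero (p.2.2 μ.o))]
    congr 1
    exact Subtype.ext (Prod.ext hp.symm rfl)
  have hstr : (corrVar W).restrict (p₁ ⁻¹' {m}) =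
      (refinedVar W).induced fun x : p₁ (W := W) ⁻¹' {m} => p₂ x.1 := by
    rw [corrVar_eq, restrict, induced_induced]; rfl
  have hR : (refinedVar W).IsRinged := ((zariski_isRinged _).induced _).quot _
  have hmor : IsMorphism ((zariski (Fin (dim W) → ℂ)).induced
      (Subtype.val : Torus μ.o → _)) (refinedVar W)
      fun c => normalClass hn (torusParam hα c) := by
    have hX := (zariski_isRinged (Fin (dim W) → ℂ)).induced
      (Subtype.val : Torus μ.o → _)
    refine isMorphism_normalClass hn (isLocal_induced _ _) (torusParam hα)
      (Refines.zariski_of hX _ (fun _ => rfl) fun c => hX.regMapAt_secFrame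
        (hX.regMapAt_prod (hX.regMapAt_const _) ?_))
    exact (regMapAt_zariski (Fin (dim W) → ℂ) c.1).induced (i := Subtype.val)
  have hmor' : IsMorphism ((zariski (Fin (dim W) → ℂ)).induced
      (Subtype.val : Torus μ.o → _)) ((corrVar W).restrict (p₁ ⁻¹' {m})) q := by
    rw [hstr]
    exact Refines.isMorphism (isLocal_induced _ _) (Refines.to_induced
      (Refines.of_isMorphism hmor fun c => (hq c).symm))
  have hext : ∀ s : Inv (twistGroup μ.o α), ∃ f : p₁ (W := W) ⁻¹' {m} → ℂ, ∀ c,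
      f (q c) = torusEv c s ∧ ((corrVar W).restrict (p₁ ⁻¹' {m})).RegAt f (q c) := fun s => by
    obtain ⟨f, hf⟩ := exists_extension hn μ hα s
    refine ⟨fun x => f (p₂ x.1), fun c => ⟨(congrArg f (hq c)).trans (hf c).1, ?_⟩⟩
    rw [hstr]
    exact (isMorphism_induced _ _).2 _ f (by rw [hq]; exact (hf c).2)
  have hqq : ∀ c c', q c = q c' ↔
      ∃ σ ∈ twistGroup μ.o α, ∀ s, torusEv c' s = torusEv c (σ s) := fun c c' => by
    rw [← normalClass_torus_iff hn hα, ← hq, ← hq]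
    exact ⟨fun h => by rw [h], fun h => Subtype.ext (p₂_injective h)⟩
  exact birational_torus_quotient μ hn hα (hstr ▸ hR.induced _) hsurj hqq hext hmor'

end PencilModuli

theorem mainTheorem5 (W : Type*) [AddCommGroup W] [Module ℂ W] [Module.Finite ℂ W]
    (hn : 3 < Module.finrank ℂ W) :
    FunSpace.IsEmbedding (corrVar W) (refinedVar W) p₂ ∧
    FunSpace.IsMorphism (corrVar W) (moduliVar W) p₁ ∧
    IsOrbitSubmersion (poisedFrameAn W) (pencilFrameAn W) frameToCorr frameToModuli
      poisedFrameProj p₁ ∧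
    (∀ (s : corr W) (Φ : NSPencil W), p₁ s = moduliMk Φ → IsGeneral Φ.1 →
      IsSubmersionAt (corrAn W) (moduliAn W) p₁ s) ∧
    ∀ m : Moduli W, FunSpace.Birational ((corrVar W).restrict (p₁ ⁻¹' {m}))
      (projVariety (Module.finrank ℂ W)) := by
  have hn' : 4 ≤ Module.finrank ℂ W := hn
  exact ⟨isEmbedding_p₂ hn', isMorphism_p₁, isOrbitSubmersion_p₁ hn', isSubmersionAt_p₁ hn',
    birational_fiber hn'⟩
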